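/- Consider equations $u_t+C(t,x)uu_x=A^2(t,x)u_{xx}+A^1(t,x)u_x$ (superscripts of $A$ are indices) with smooth real coefficients, $A^2$ and $C$ nowhere zero, on a nonempty open domain of the form $\{(t,x): t\in I,\ a(t)<x<b(t)\}$, where $I$ is an interval. Consider the classes - $\mathcal L$: $A^1=0$, i.e. $u_t+Cuu_x=A^2u_{xx}$; - $\mathcal L_{0'}$: $A^1=0$, $C=1$; - $\mathcal L_1\subset\mathcal L$: $\left(\frac{C_t}{C}-C\left(A^2\frac{C_x}{C^2}\right)_x\right)_x\neq0$ at every point of the domain; - $\hat{\mathcal L}$: $C=1$, i.e. $u_t+uu_x=A^2u_{xx}+A^1u_x$; - $\hat{\mathcal L}_1\subset\hat{\mathcal L}$: $A^1_{xx}\neq0$ at every point of the domain. Point transformations are local diffeomorphisms of the $(t,x,u)$-space; one relates two equations if its second prolongation identifies the 2-jets satisfying them. The equivalence groupoid $\mathcal G^\sim$ (resp. $\mathcal G^\sim_1$) of $\mathcal L$ (resp. $\mathcal L_1$) consists of the triples (equation, point transformation, equation) of this kind within the class. The usual equivalence (pseudo)group $G^\sim_{0'}$ of $\mathcal L_{0'}$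 (resp. $\hat G^\sim_1$ of $\hat{\mathcal L}_1$) consists of the local diffeomorphisms of the space of $(t,x,u)$ and of the arbitrary elements $A^2$ (resp. $(A^1,A^2)$) that are projectable to $(t,x,u)$ and that, together with their inverses, map equations of the class to equations of the class. A class is normalized if its equivalence group generates (locally) its equivalence groupoid. Equivalence of two equations up to a groupoid or a group is understood locally, i.e. some restrictions of them to nonempty open subsets are related. The maximal Lie invariance algebra $\mathfrak g$ of an equation consists of the smooth vector fields $Q=\tau\partial_t+\xi\partial_x+\eta\partial_u$ in $(t,x,u)$, over its domain, that satisfy the infinitesimal invariance criterion. The equation admits a Lie-symmetry extension within a class if $\mathfrak g$ is strictly greater than the kernel algebra, which is the intersection of the maximal Lie invariance algebras of all equations of the class with the same domain. A complete list of inequivalent Lie-symmetry extensions within a class is a family of nonempty sets of equations of the class ("cases") such that (i) all listed equations admit Lie-symmetry extensions, and the maximal Lie invariance algebras of equations in the same case are similar, i.e. locally related by a point transformation; (ii) equations from different cases are nowhere locally equivalent; (iii) for every equation of the class admitting a Lie-symmetry extension and every nonempty open subset $V$ of its domain, the equation is locally equivalent, somewhere over $V$, to a listed equation. Let $\mathcal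 F$ be the family of point transformations $\hat t=t$, $\hat x=X(t,x):=\int\frac{\mathrm dx}{C(t,x)}$ (any smooth $X$ on the domain with $X_x=1/C$), $\hat u=u$, parameterized by the coefficient $C$ of the source equation. **Theorem.** The classes $\mathcal L_{0'}$ and $\hat{\mathcal L}_1$ are normalized in the usual sense, and: 1. Let $R_0$ be a family of subsets of $\mathcal L_{0'}$ and $R_1$ a family of subsets of $\mathcal L_1$. Then every member of $R_0$ is disjoint from every member of $R_1$, and the disjoint union of the families $R_0$ and $R_1$ is a complete list of $\mathcal G^\sim$-inequivalent Lie-symmetry extensions within $\mathcal L$ if and only if $R_0$ is a complete list of $G^\sim_{0'}$-inequivalent Lie-symmetry extensions within $\mathcal L_{0'}$ and $R_1$ is a complete list of $\mathcal G^\sim_1$-inequivalent Lie-symmetry extensions within $\mathcal L_1$. 2. Say that a family $R$ is the preimage by $\mathcal F$ of a family $\hat R$ with the same index set if, case by case, each equation of $R$ has an image by $\mathcal F$ in $\hat R$ and each equation of $\hat R$ is an image by $\mathcal F$ of an equation in $R$. Every complete list of $\mathcal G^\sim_1$-inequivalent Lie-symmetry extensions within $\mathcal L_1$ is the preimage by $\mathcal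 F$ of some complete list of $\hat G^\sim_1$-inequivalent Lie-symmetry extensions within $\hat{\mathcal L}_1$. Moreover, whenever a family $R$ of subsets of $\mathcal L_1$ is the preimage by $\mathcal F$ of a family $\hat R$, the family $R$ is such a complete list for $\mathcal L_1$ if and only if $\hat R$ is such a complete list for $\hat{\mathcal L}_1$. 3. The family $\mathcal F$ maps $\mathcal L$ onto $\hat{\mathcal L}$: every equation in $\mathcal L$ has an image by $\mathcal F$; all its images belong to $\hat{\mathcal L}$, and they belong to $\hat{\mathcal L}_1$ if and only if the equation belongs to $\mathcal L_1$; and every equation in $\hat{\mathcal L}$, restricted to a suitable neighbourhood of any given point of its domain, is the image by $\mathcal F$ of an equation in $\mathcal L$. -/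

import Mathlib

open scoped ContDiff Topology

noncomputable section

namespace VarBurgers

/-! ## Equations -/

/-- The space of the independent variables `p = (t, x)`. -/
abbrev Base : Type := ℝ × ℝ

/-- The space with coordinates `((t, x), u)`. -/
abbrev Space : Type := Base × ℝ

/-- Partial derivative with respect to `t`. -/
def pdt (f : Base → ℝ) (p : Base) : ℝ := fderiv ℝ f p (1, 0)

/-- Partial derivative with respect to `x`. -/
def pdx (f : Base → ℝ) (p : Base) : ℝ := fderiv ℝ f p (0, 1)

/-- An equation `u_t + C(t,x) u u_x = A2(t,x) u_xx + A1(t,x) u_x` whose coefficients are smooth on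
the domain `dom` in the `(t,x)`-plane, with `A2` and `C` nowhere zero there. The domain is
nonempty, open, and of the form `{(t,x) : t ∈ I, a(t) < x < b(t)}` with an interval `I` (where `a`,
`b` may be infinite), so that "function of `t` only" and "`∫ dx`" have their usual meaning on it.
The superscript of `A2` is an index: `A2` may have any sign. Values off `dom` are irrelevant. -/
structure Eqn where
  dom : Set Base
  A2 : Base → ℝ
  A1 : Base → ℝ
  C : Base → ℝ
  dom_open : IsOpen dom
  dom_nonempty : dom.Nonempty
  dom_time : (Prod.fst '' dom).OrdConnected
  dom_slice : ∀ t : ℝ, {x : ℝ | (t, x) ∈ dom}.OrdConnected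
  smooth_A2 : ContDiffOn ℝ ∞ A2 dom
  smooth_A1 : ContDiffOn ℝ ∞ A1 dom
  smooth_C : ContDiffOn ℝ ∞ C dom
  A2_ne : ∀ p ∈ dom, A2 p ≠ 0
  C_ne : ∀ p ∈ dom, C p ≠ 0

/-- The 2-jet of `f` at `p` satisfies the equation. -/
def Eqn.HoldsAt (E : Eqn) (f : Base → ℝ) (p : Base) : Prop :=
  pdt f p + E.C p * f p * pdx f p = E.A2 p * pdx (pdx f) p + E.A1 p * pdx f p

/-- `E` is obtained from `E'` by restricting the domain. -/
def Eqn.IsRestrictionOf (E E' : Eqn) : Prop :=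
  E.dom ⊆ E'.dom ∧ Set.EqOn E.A2 E'.A2 E.dom ∧ Set.EqOn E.A1 E'.A1 E.dom ∧
    Set.EqOn E.C E'.C E.dom

/-! ## The classes of equations -/

/-- `u_t + C u u_x = A2 u_xx`. -/
def classL : Set Eqn := {E | ∀ p ∈ E.dom, E.A1 p = 0}

/-- `u_t + u u_x = A2 u_xx`. -/
def classL0p : Set Eqn := {E | ∀ p ∈ E.dom, E.A1 p = 0 ∧ E.C p = 1}

/-- The expression `(C_t / C - C (A2 C_x / C^2)_x)_x`. -/
def splitting (E : Eqn) : Base → ℝ :=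
  pdx fun q => pdt E.C q / E.C q - E.C q * pdx (fun r => E.A2 r * pdx E.C r / E.C r ^ 2) q

/-- The regular subclass of `classL`. -/
def classL1 : Set Eqn := {E | E ∈ classL ∧ ∀ p ∈ E.dom, splitting E p ≠ 0}

/-- `u_t + u u_x = A2 u_xx + A1 u_x`. -/
def classLhat : Set Eqn := {E | ∀ p ∈ E.dom, E.C p = 1}

/-- The regular subclass of `classLhat`, singled out by `A1_xx ≠ 0`. -/
def classL1hat : Set Eqn := {E | E ∈ classLhat ∧ ∀ p ∈ E.dom, pdx (pdx E.A1) p ≠ 0}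

/-- The arbitrary element of the class `classL0p`. -/
def arbL0p (E : Eqn) (p : Base) : ℝ := E.A2 p

/-- The arbitrary-element tuple of the class `classL1hat`. -/
def arbL1hat (E : Eqn) (p : Base) : ℝ × ℝ := (E.A1 p, E.A2 p)

/-! ## Point transformations and the equivalence groupoid -/

/-- A (local) point transformation of `X`: a smooth diffeomorphism between open subsets. -/
structure PointTransformation (X : Type*) [NormedAddCommGroup X] [NormedSpace ℝ X] extends
    OpenPartialHomeomorph X X where
  smooth : ContDiffOn ℝ ∞ toOpenPartialHomeomorph toOpenPartialHomeomorph.source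
  smooth_symm : ContDiffOn ℝ ∞ toOpenPartialHomeomorph.symm toOpenPartialHomeomorph.target

instance (X : Type*) [NormedAddCommGroup X] [NormedSpace ℝ X] :
    CoeFun (PointTransformation X) (fun _ => X → X) :=
  ⟨fun φ => φ.toOpenPartialHomeomorph⟩

/-- The inverse point transformation. -/
def PointTransformation.inv {X : Type*} [NormedAddCommGroup X] [NormedSpace ℝ X]
    (φ : PointTransformation X) : PointTransformation X where
  toOpenPartialHomeomorph := φ.toOpenPartialHomeomorph.symm
  smooth := φ.smooth_symm
  smooth_symm := by simpa using φ.smooth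

/-- Over the point `z = (p, u)`, the second prolongation of `φ` identifies the 2-jets satisfying
`E` with the 2-jets satisfying `E'` (wherever the prolongation is defined). The 2-jets are
represented by functions: whenever the graph of `f` through `z` is mapped by `φ`, near `z` and
transversally, to the graph of `g`, the function `f` satisfies `E` at `p` if and only if `g`
satisfies `E'` at the corresponding point. -/
def CarriesAt (φ : PointTransformation Space) (E E' : Eqn) (z : Space) : Prop :=
  ∀ f g : Base → ℝ, ContDiffAt ℝ ∞ f z.1 → f z.1 = z.2 → ContDiffAt ℝ ∞ g (φ z).1 →
    (∀ᶠ q in 𝓝 z.1, (φ (q, f q)).2 = g (φ (q, f q)).1) →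
    (fderiv ℝ (fun q => (φ (q, f q)).1) z.1).det ≠ 0 →
    (E.HoldsAt f z.1 ↔ E'.HoldsAt g (φ z).1)

/-- `φ` relates the equations `E` and `E'`. -/
def Relates (φ : PointTransformation Space) (E E' : Eqn) : Prop :=
  φ.source ⊆ E.dom ×ˢ Set.univ ∧ φ.target ⊆ E'.dom ×ˢ Set.univ ∧ ∀ z ∈ φ.source, CarriesAt φ E E' z

/-- The equivalence groupoid of a class: the set of its admissible transformations. -/
def groupoid (K : Set Eqn) : Set (Eqn × PointTransformation Space × Eqn) :=
  {a | a.1 ∈ K ∧ a.2.2 ∈ K ∧ Relates a.2.1 a.1 a.2.2}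

/-- Somewhere over `V`, the equation `E` is related to `E'` by an admissible transformation of the
class `K`. -/
def GroupoidEquivOn (K : Set Eqn) (E : Eqn) (V : Set Base) (E' : Eqn) : Prop :=
  ∃ φ : PointTransformation Space, (E, φ, E') ∈ groupoid K ∧ φ.source.Nonempty ∧
    φ.source ⊆ V ×ˢ Set.univ

/-! ## The usual equivalence group -/

section EquivalenceGroup

variable {𝔸 : Type*} [NormedAddCommGroup 𝔸] [NormedSpace ℝ 𝔸]

/-- `Φ`, a point transformation of the space of the variables `((t,x),u)` and of the arbitrary
elements, is projectable to the space of the variables, and maps every equation of the class `K`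
(locally) to an equation of the class `K`, the new arbitrary elements being given by `Φ`. -/
def MapsClass (K : Set Eqn) (arb : Eqn → Base → 𝔸) (Φ : PointTransformation (Space × 𝔸)) : Prop :=
  ∃ φ : PointTransformation Space,
    (∀ w ∈ Φ.source, w.1 ∈ φ.source ∧ (Φ w).1 = φ w.1) ∧
    ∀ E ∈ K, ∀ z : Space, z.1 ∈ E.dom → (z, arb E z.1) ∈ Φ.source →
      ∃ E' ∈ K, ∀ᶠ y in 𝓝 z, (φ y).1 ∈ E'.dom ∧
        arb E' (φ y).1 = (Φ (y, arb E y.1)).2 ∧ CarriesAt φ E E' y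

/-- The usual equivalence (pseudo)group of the class `K` with arbitrary elements `arb`. -/
def equivGroup (K : Set Eqn) (arb : Eqn → Base → 𝔸) : Set (PointTransformation (Space × 𝔸)) :=
  {Φ | MapsClass K arb Φ ∧ MapsClass K arb Φ.inv}

/-- Somewhere over `V`, the equation `E` is mapped to `E'` by an element of the usual equivalence
group of the class `K`. -/
def GroupEquivOn (K : Set Eqn) (arb : Eqn → Base → 𝔸) (E : Eqn) (V : Set Base) (E' : Eqn) : Prop :=
  E ∈ K ∧ E' ∈ K ∧ ∃ Φ ∈ equivGroup K arb, ∃ z : Space, z.1 ∈ V ∧ z.1 ∈ E.dom ∧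
    (z, arb E z.1) ∈ Φ.source ∧
    ∀ᶠ y in 𝓝 z, (Φ (y, arb E y.1)).1.1 ∈ E'.dom ∧
      (Φ (y, arb E y.1)).2 = arb E' (Φ (y, arb E y.1)).1.1

/-- The class `K` is normalized in the usual sense: its usual equivalence group generates its
equivalence groupoid. -/
def IsNormalized (K : Set Eqn) (arb : Eqn → Base → 𝔸) : Prop :=
  ∀ (E : Eqn) (φ : PointTransformation Space) (E' : Eqn), (E, φ, E') ∈ groupoid K →
    ∀ z ∈ φ.source, ∃ Φ ∈ equivGroup K arb, (z, arb E z.1) ∈ Φ.source ∧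
      ∀ᶠ y in 𝓝 z, Φ (y, arb E y.1) = (φ y, arb E' (φ y).1)

end EquivalenceGroup

/-! ## Lie symmetries -/

/-- A vector field `Q = τ ∂_t + ξ ∂_x + η ∂_u`, with `Q z = ((τ, ξ), η)`. -/
abbrev VField : Type := Space → Space

/-- The characteristic `η - τ u_t - ξ u_x` of `Q`, evaluated along `u = f`. -/
def characteristic (Q : VField) (f : Base → ℝ) (q : Base) : ℝ :=
  (Q (q, f q)).2 - (Q (q, f q)).1.1 * pdt f q - (Q (q, f q)).1.2 * pdx f q

/-- The coefficient
`η^(i,j) = D_t^i D_x^j (η - τ u_t - ξ u_x) + τ u_(i+1,j) + ξ u_(i,j+1)` of the prolongation of `Q`,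
evaluated on the jet of `f` at `p`. -/
def prolong (Q : VField) (i j : ℕ) (f : Base → ℝ) (p : Base) : ℝ :=
  pdt^[i] (pdx^[j] (characteristic Q f)) p
    + (Q (p, f p)).1.1 * pdt^[i + 1] (pdx^[j] f) p
    + (Q (p, f p)).1.2 * pdt^[i] (pdx^[j + 1] f) p

/-- The derivative of a function of `(t,x)` along `Q`, at `((t,x),u) = z`. -/
def along (Q : VField) (a : Base → ℝ) (z : Space) : ℝ :=
  (Q z).1.1 * pdt a z.1 + (Q z).1.2 * pdx a z.1

/-- The maximal Lie invariance algebra of `E`: the smooth vector fields `Q` over the domain of `E`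
with `Q^(2) (u_t + C u u_x - A2 u_xx - A1 u_x) = 0` whenever `u_t + C u u_x = A2 u_xx + A1 u_x`. -/
def invAlgebra (E : Eqn) : Set VField :=
  {Q | ContDiffOn ℝ ∞ Q (E.dom ×ˢ Set.univ) ∧
    ∀ p ∈ E.dom, ∀ f : Base → ℝ, ContDiffAt ℝ ∞ f p → E.HoldsAt f p →
      prolong Q 1 0 f p
        + along Q E.C (p, f p) * f p * pdx f p
        + E.C p * (Q (p, f p)).2 * pdx f p
        + E.C p * f p * prolong Q 0 1 f p
        - along Q E.A2 (p, f p) * pdx (pdx f) p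
        - E.A2 p * prolong Q 0 2 f p
        - along Q E.A1 (p, f p) * pdx f p
        - E.A1 p * prolong Q 0 1 f p = 0}

/-- The kernel Lie invariance algebra of the equations of the class `K` with domain `Ω`. -/
def kernelAlgebra (K : Set Eqn) (Ω : Set Base) : Set VField :=
  {Q | ∀ E ∈ K, E.dom = Ω → Q ∈ invAlgebra E}

/-- Within the class `K`, the equation `E` admits a Lie-symmetry extension: its maximal Lie
invariance algebra is strictly greater than the kernel algebra. -/
def IsExtension (K : Set Eqn) (E : Eqn) : Prop :=
  E ∈ K ∧ ∃ Q ∈ invAlgebra E, Q ∉ kernelAlgebra K E.dom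

/-- The maximal Lie invariance algebras of `E` and `E'` are similar: (somewhere) one is the
pushforward of the other by a point transformation. -/
def SimilarAlgebras (E E' : Eqn) : Prop :=
  ∃ φ : PointTransformation Space, φ.source.Nonempty ∧
    φ.source ⊆ E.dom ×ˢ Set.univ ∧ φ.target ⊆ E'.dom ×ˢ Set.univ ∧
    (∀ Q ∈ invAlgebra E, ∃ Q' ∈ invAlgebra E', ∀ z ∈ φ.source, fderiv ℝ φ z (Q z) = Q' (φ z)) ∧
    (∀ Q' ∈ invAlgebra E', ∃ Q ∈ invAlgebra E, ∀ z ∈ φ.source, fderiv ℝ φ z (Q z) = Q' (φ z))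

/-! ## Classification lists -/

/-- A complete list of inequivalent Lie-symmetry extensions within the class `K`, where
`Equiv E V E'` means that `E` is equivalent to `E'` somewhere over `V`. The list consists of cases
`R i`; each case is a nonempty set of equations of the class admitting Lie-symmetry extensions
with the same algebra up to similarity (a one-element set, if parameters are completely gauged);
equations from distinct cases are nowhere equivalent; and every equation of the class with a
Lie-symmetry extension is, near generic points of its domain, equivalent to a listed one. -/
structure IsCompleteList {ι : Type*} (K : Set Eqn) (Equiv : Eqn → Set Base → Eqn → Prop)
    (R : ι → Set Eqn) : Prop where
  nonempty : ∀ i, (R i).Nonempty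
  extension : ∀ i, ∀ E ∈ R i, IsExtension K E
  similar : ∀ i, ∀ E ∈ R i, ∀ E' ∈ R i, SimilarAlgebras E E'
  inequivalent : ∀ i j, i ≠ j → ∀ E ∈ R i, ∀ E' ∈ R j, ¬ Equiv E Set.univ E'
  complete : ∀ E, IsExtension K E → ∀ V : Set Base, IsOpen V → (V ∩ E.dom).Nonempty →
    ∃ i, ∃ E' ∈ R i, Equiv E V E'

/-! ## The family of point transformations -/

/-- The equation `E'` is the image of `E` under a point transformation
`t' = t`, `x' = X(t,x) = ∫ (1 / C(t,x)) dx`, `u' = u`, where `C` is the coefficient of `E`. -/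
def IsFImage (E E' : Eqn) : Prop :=
  ∃ (X : Base → ℝ) (φ : PointTransformation Space),
    ContDiffOn ℝ ∞ X E.dom ∧ (∀ p ∈ E.dom, pdx X p = 1 / E.C p) ∧
    φ.source = E.dom ×ˢ Set.univ ∧ φ.target = E'.dom ×ˢ Set.univ ∧
    (∀ p ∈ E.dom, ∀ u : ℝ, φ (p, u) = ((p.1, X p), u)) ∧
    Relates φ E E'

/-- The list `R` is the preimage of the list `R'`, case by case. -/
def IsFPreimage {ι : Type*} (R R' : ι → Set Eqn) : Prop :=
  ∀ i, (∀ E ∈ R i, ∃ E' ∈ R' i, IsFImage E E') ∧ (∀ E' ∈ R' i, ∃ E ∈ R i, IsFImage E E')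

end VarBurgers

end

open VarBurgers

open scoped ContDiff Topology

noncomputable section

namespace VarBurgers

/-! ## Directional derivatives -/

section Calculus

variable {V : Type*} [NormedAddCommGroup V] [NormedSpace ℝ V]

/-! Everything rests on the shape of the point transformations between equations `u_t + C u u_x = A2
u_xx + A1 u_x`. Testing a transformation on quadratic polynomials, whose 2-jets on an equation are
prescribed by one linear relation, shows that `t' = T(t)`, `x' = X(t,x)` and `u' = U₁(t) u +
U₀(t,x)`, and that the coefficients satisfy a short system of determining equations
(`Relates.exists_intertwines`). This makes relatedness symmetric and transitive (`Relates.symm`,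
`Relates.trans`).

Normalization. If `C = 1` on both sides, the system gives `X_x = T_t U₁` and `U₁_t + U₀_x = 0`. For
`A1 = 0` the remaining conditions on `T`, `X`, `U₁`, `U₀` do not contain `A2`. For `A1_xx ≠ 0` they
force `U₁` and `U₀` to be locally constant. In both cases a transformation admissible for one
equation is admissible for all, and its action on the arbitrary elements is explicit, so it lifts to
the equivalence group (`isNormalized_classL0p`, `isNormalized_classL1hat`).

The family `F`. A change of `x` with `X_x = 1/C` makes `C = 1`, and for `A1 = 0` the new `A1` has
second `x`-derivative `C` times the splitting expression (`A1_xx_of_intertwines`). To go back, a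
coordinate `Y` with `Y_t = A2 Y_xx + A1 Y_x` and `Y_x ≠ 0` is needed. The coefficients being merely
smooth, this linear evolution equation is solved locally by reduction to a heat equation with a
potential, which is handled by a heat potential and a Volterra series (`exists_heat_solution`,
`exists_evolution_coordinate`, `exists_preimage`).

Lie symmetries. Each of the classes `classL`, `classL0p`, `classL1` and `classL1hat` contains enough
equations with exponential `A2` to make its kernel algebras vanish over the domain, so an extension
is just a nonzero symmetry (`isExtension_iff`). The determining equations of symmetries form a total
linear system once `η₁_t` is adjoined to the unknowns. Hence a symmetry that vanishes on an open set
vanishes on the connected domain (`invAlgebra_unique_continuation`), and extensions survive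
restriction. They are transported by `F` (`IsFImage.exists_conjugates`).

Splitting of the list. Over an open set, either the splitting expression is nonzero somewhere, and
the equation restricts to `classL1`, or it vanishes identically. In the latter case the image by `F`
has `A1` affine in `x`, which is removed by a change of `t` and `x`, leading to `classL0p`
(`exists_classL0p_of_splitting`). The two subclasses are never related, since `A1_xx ≠ 0` is
preserved among equations with `C = 1` (`LocallyRelated.notMem_classL0p`). -/

/-- The directional derivative. -/
def dir (v : V) (f : V → ℝ) (q : V) : ℝ := fderiv ℝ f q v

lemma pdt_eq_dir : pdt = dir ((1, 0) : Base) := rfl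

lemma pdx_eq_dir : pdx = dir ((0, 1) : Base) := rfl

variable {v w : V} {f g : V → ℝ} {q : V}

lemma contDiffAt_dir (hf : ContDiffAt ℝ ∞ f q) : ContDiffAt ℝ ∞ (dir v f) q :=
  (hf.fderiv_right (m := ∞) (by simp)).clm_apply contDiffAt_const

lemma diffAt_of_smooth {F : Type*} [NormedAddCommGroup F] [NormedSpace ℝ F] {f : V → F}
    (hf : ContDiffAt ℝ ∞ f q) : DifferentiableAt ℝ f q :=
  hf.differentiableAt (by simp)

lemma two_of_smooth {F : Type*} [NormedAddCommGroup F] [NormedSpace ℝ F] {f : V → F}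
    (hf : ContDiffAt ℝ ∞ f q) : ContDiffAt ℝ 2 f q :=
  hf.of_le ENat.LEInfty.out

lemma diffAt_dir_of_two (hf : ContDiffAt ℝ 2 f q) : DifferentiableAt ℝ (dir v f) q :=
  ((hf.fderiv_right (m := 1) (by norm_num)).clm_apply contDiffAt_const).differentiableAt
    (by simp)

lemma eventually_diffAt_of_two {F : Type*} [NormedAddCommGroup F] [NormedSpace ℝ F] {f : V → F}
    (hf : ContDiffAt ℝ 2 f q) : ∀ᶠ r in 𝓝 q, DifferentiableAt ℝ f r := by
  filter_upwards [hf.eventually (by simp)] with r hr using hr.differentiableAt (by simp)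

lemma eventually_diffAt {F : Type*} [NormedAddCommGroup F] [NormedSpace ℝ F] {f : V → F}
    (hf : ContDiffAt ℝ ∞ f q) : ∀ᶠ r in 𝓝 q, DifferentiableAt ℝ f r :=
  eventually_diffAt_of_two (two_of_smooth hf)

lemma dir_congr (h : f =ᶠ[𝓝 q] g) : dir v f q = dir v g q := by
  simp only [dir, h.fderiv_eq]

lemma dir_eventuallyEq (h : f =ᶠ[𝓝 q] g) : dir v f =ᶠ[𝓝 q] dir v g := by
  filter_upwards [h.eventuallyEq_nhds] with r hr using dir_congr hr

lemma dir_const (c : ℝ) : dir v (fun _ => c) q = 0 := by simp [dir]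

lemma dir_add (hf : DifferentiableAt ℝ f q) (hg : DifferentiableAt ℝ g q) :
    dir v (fun r => f r + g r) q = dir v f q + dir v g q := by
  simp only [dir]; rw [fderiv_fun_add hf hg]; rfl

lemma dir_sub (hf : DifferentiableAt ℝ f q) (hg : DifferentiableAt ℝ g q) :
    dir v (fun r => f r - g r) q = dir v f q - dir v g q := by
  simp only [dir]; rw [fderiv_fun_sub hf hg]; rfl

lemma dir_neg : dir v (fun r => - f r) q = - dir v f q := by
  simp only [dir]; rw [fderiv_fun_neg]; rfl

lemma dir_mul (hf : DifferentiableAt ℝ f q) (hg : DifferentiableAt ℝ g q) :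
    dir v (fun r => f r * g r) q = dir v f q * g q + f q * dir v g q := by
  simp only [dir]; rw [fderiv_fun_mul hf hg]; simp; ring

lemma dir_const_mul (c : ℝ) (hf : DifferentiableAt ℝ f q) :
    dir v (fun r => c * f r) q = c * dir v f q := by
  rw [dir_mul (differentiableAt_const c) hf, dir_const]; ring

lemma dir_inv (hf : DifferentiableAt ℝ f q) (h : f q ≠ 0) :
    dir v (fun r => (f r)⁻¹) q = - dir v f q / f q ^ 2 := by
  have : HasFDerivAt (fun r => (f r)⁻¹) (-(f q ^ 2)⁻¹ • fderiv ℝ f q) q :=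
    (hasDerivAt_inv h).comp_hasFDerivAt q hf.hasFDerivAt
  simp only [dir]; rw [this.fderiv]; simp; ring

/-- The chain rule with a function of one variable outside. -/
lemma dir_comp_real {k : ℝ → ℝ} (hk : DifferentiableAt ℝ k (f q)) (hf : DifferentiableAt ℝ f q) :
    dir v (fun r => k (f r)) q = deriv k (f q) * dir v f q := by
  have : HasFDerivAt (fun r => k (f r)) (deriv k (f q) • fderiv ℝ f q) q :=
    hk.hasDerivAt.comp_hasFDerivAt q hf.hasFDerivAt
  simp only [dir]; rw [this.fderiv]; simp

/-- Second directional derivatives commute. -/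
lemma dir_comm (hf : ContDiffAt ℝ ∞ f q) : dir v (dir w f) q = dir w (dir v f) q := by
  have h2 : ContDiffAt ℝ 2 f q := hf.of_le ENat.LEInfty.out
  have hd : DifferentiableAt ℝ (fderiv ℝ f) q :=
    diffAt_of_smooth (hf.fderiv_right (m := ∞) (by simp))
  have key : ∀ a b : V, dir a (dir b f) q = fderiv ℝ (fderiv ℝ f) q a b := by
    intro a b
    have : HasFDerivAt (fun r => fderiv ℝ f r b)
        ((ContinuousLinearMap.apply ℝ ℝ b).comp (fderiv ℝ (fderiv ℝ f) q)) q :=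
      (ContinuousLinearMap.apply ℝ ℝ b).hasFDerivAt.comp q hd.hasFDerivAt
    change fderiv ℝ (fun r => fderiv ℝ f r b) q a = _
    rw [this.fderiv]; rfl
  rw [key, key]
  exact (h2.isSymmSndFDerivAt (by simp)).eq v w

end Calculus

section Chain

variable {V : Type*} [NormedAddCommGroup V] [NormedSpace ℝ V]

lemma fderiv_base_apply (g : Base → ℝ) (p : Base) (a b : ℝ) :
    fderiv ℝ g p (a, b) = pdt g p * a + pdx g p * b := by
  have : ((a, b) : Base) = a • ((1, 0) : Base) + b • ((0, 1) : Base) := by ext <;> simp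
  rw [this, map_add, map_smul, map_smul]
  simp only [pdt, pdx, smul_eq_mul]; ring

/-- The chain rule for a function of `(t,x)`. -/
lemma dir_comp_base {v : V} {g : Base → ℝ} {T X : V → ℝ} {q : V}
    (hg : DifferentiableAt ℝ g (T q, X q)) (hT : DifferentiableAt ℝ T q)
    (hX : DifferentiableAt ℝ X q) :
    dir v (fun r => g (T r, X r)) q
      = pdt g (T q, X q) * dir v T q + pdx g (T q, X q) * dir v X q := by
  have h : HasFDerivAt (fun r => g (T r, X r))
      ((fderiv ℝ g (T q, X q)).comp ((fderiv ℝ T q).prod (fderiv ℝ X q))) q :=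
    HasFDerivAt.comp (f := fun r => (T r, X r)) q hg.hasFDerivAt
      (hT.hasFDerivAt.prodMk hX.hasFDerivAt)
  change fderiv ℝ (fun r => g (T r, X r)) q v = _
  rw [h.fderiv]
  exact fderiv_base_apply g _ _ _

/-- The total derivative of a function of `((t,x),u)` along the graph of `f`. -/
lemma dir_graph {v : V} {H : V × ℝ → ℝ} {f : V → ℝ} {q : V}
    (hH : DifferentiableAt ℝ H (q, f q)) (hf : DifferentiableAt ℝ f q) :
    dir v (fun r => H (r, f r)) q
      = dir (v, 0) H (q, f q) + dir (0, 1) H (q, f q) * dir v f q := by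
  have h : HasFDerivAt (fun r => H (r, f r))
      ((fderiv ℝ H (q, f q)).comp ((ContinuousLinearMap.id ℝ V).prod (fderiv ℝ f q))) q :=
    HasFDerivAt.comp (f := fun r => (r, f r)) q hH.hasFDerivAt
      ((hasFDerivAt_id q).prodMk hf.hasFDerivAt)
  change fderiv ℝ (fun r => H (r, f r)) q v = _
  rw [h.fderiv]
  have : ((v, fderiv ℝ f q v) : V × ℝ) = (v, 0) + (fderiv ℝ f q v) • ((0, 1) : V × ℝ) := by
    ext <;> simp
  change fderiv ℝ H (q, f q) (v, fderiv ℝ f q v) = _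
  rw [this, map_add, map_smul]
  simp only [dir, smul_eq_mul]; ring

lemma contDiffAt_graph {H : V × ℝ → ℝ} {f : V → ℝ} {q : V}
    (hH : ContDiffAt ℝ ∞ H (q, f q)) (hf : ContDiffAt ℝ ∞ f q) :
    ContDiffAt ℝ ∞ (fun r => H (r, f r)) q :=
  ContDiffAt.comp (f := fun r => (r, f r)) q hH (contDiffAt_id.prodMk hf)

/-- The total derivative along the graph of `f`, near a point. -/
lemma dir_graph_eventually {v : V} {H : V × ℝ → ℝ} {f : V → ℝ} {q : V}
    (hH : ContDiffAt ℝ ∞ H (q, f q)) (hf : ContDiffAt ℝ ∞ f q) :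
    dir v (fun r => H (r, f r)) =ᶠ[𝓝 q]
      fun r => dir (v, 0) H (r, f r) + dir (0, 1) H (r, f r) * dir v f r := by
  have hc : Filter.Tendsto (fun r => (r, f r)) (𝓝 q) (𝓝 (q, f q)) :=
    (continuousAt_id.prodMk hf.continuousAt)
  filter_upwards [hc.eventually (eventually_diffAt hH), eventually_diffAt hf]
    with r h1 h2 using dir_graph h1 h2

/-- The second total derivative along the graph of `f`. -/
lemma dir_dir_graph {v : V} {H : V × ℝ → ℝ} {f : V → ℝ} {q : V}
    (hH : ContDiffAt ℝ ∞ H (q, f q)) (hf : ContDiffAt ℝ ∞ f q) :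
    dir v (dir v (fun r => H (r, f r))) q
      = dir (v, 0) (dir (v, 0) H) (q, f q)
        + 2 * dir (v, 0) (dir (0, 1) H) (q, f q) * dir v f q
        + dir (0, 1) (dir (0, 1) H) (q, f q) * dir v f q ^ 2
        + dir (0, 1) H (q, f q) * dir v (dir v f) q := by
  rw [dir_congr (dir_graph_eventually hH hf)]
  have h1 : ContDiffAt ℝ ∞ (dir ((v, 0) : V × ℝ) H) (q, f q) := contDiffAt_dir hH
  have h2 : ContDiffAt ℝ ∞ (dir ((0, 1) : V × ℝ) H) (q, f q) := contDiffAt_dir hH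
  have h3 : ContDiffAt ℝ ∞ (dir v f) q := contDiffAt_dir hf
  have g1 := contDiffAt_graph h1 hf
  have g2 := contDiffAt_graph h2 hf
  have d1 := diffAt_of_smooth g1
  have d2 := diffAt_of_smooth g2
  have d3 := diffAt_of_smooth h3
  rw [dir_add d1 (d2.fun_mul d3), dir_mul d2 d3, dir_graph (diffAt_of_smooth h1)
    (diffAt_of_smooth hf), dir_graph (diffAt_of_smooth h2) (diffAt_of_smooth hf),
    dir_comm (v := (0, 1)) (w := (v, 0)) hH]
  ring

lemma contDiffAt_comp_base {g : Base → ℝ} {T X : V → ℝ} {q : V}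
    (hg : ContDiffAt ℝ ∞ g (T q, X q)) (hT : ContDiffAt ℝ ∞ T q) (hX : ContDiffAt ℝ ∞ X q) :
    ContDiffAt ℝ ∞ (fun r => g (T r, X r)) q :=
  ContDiffAt.comp (f := fun r => (T r, X r)) q hg (hT.prodMk hX)

/-- The chain rule for a function of `(t,x)`, near a point. -/
lemma dir_comp_base_eventually {v : V} {g : Base → ℝ} {T X : V → ℝ} {q : V}
    (hg : ContDiffAt ℝ 2 g (T q, X q)) (hT : ContDiffAt ℝ ∞ T q) (hX : ContDiffAt ℝ ∞ X q) :
    dir v (fun r => g (T r, X r)) =ᶠ[𝓝 q]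
      fun r => pdt g (T r, X r) * dir v T r + pdx g (T r, X r) * dir v X r := by
  have hc : Filter.Tendsto (fun r => (T r, X r)) (𝓝 q) (𝓝 (T q, X q)) :=
    (hT.continuousAt.prodMk hX.continuousAt)
  filter_upwards [hc.eventually (eventually_diffAt_of_two hg), eventually_diffAt hT,
    eventually_diffAt hX] with r h1 h2 h3 using dir_comp_base h1 h2 h3

/-- The second derivative of a composition in a direction in which the first component is
stationary. -/
lemma dir_dir_comp_base {v : V} {g : Base → ℝ} {T X : V → ℝ} {q : V}
    (hg : ContDiffAt ℝ 2 g (T q, X q)) (hT : ContDiffAt ℝ ∞ T q) (hX : ContDiffAt ℝ ∞ X q)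
    (h0 : dir v T q = 0) :
    dir v (dir v (fun r => g (T r, X r))) q
      = pdx (pdx g) (T q, X q) * dir v X q ^ 2 + pdt g (T q, X q) * dir v (dir v T) q
        + pdx g (T q, X q) * dir v (dir v X) q := by
  rw [dir_congr (dir_comp_base_eventually hg hT hX)]
  have h1 : DifferentiableAt ℝ (pdt g) (T q, X q) := diffAt_dir_of_two hg
  have h2 : DifferentiableAt ℝ (pdx g) (T q, X q) := diffAt_dir_of_two hg
  have hTX := (diffAt_of_smooth hT).prodMk (diffAt_of_smooth hX)
  have d1 : DifferentiableAt ℝ (fun r => pdt g (T r, X r)) q :=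
    DifferentiableAt.comp (f := fun r => (T r, X r)) q h1 hTX
  have d2 : DifferentiableAt ℝ (fun r => pdx g (T r, X r)) q :=
    DifferentiableAt.comp (f := fun r => (T r, X r)) q h2 hTX
  have dT := diffAt_of_smooth (contDiffAt_dir (v := v) hT)
  have dX := diffAt_of_smooth (contDiffAt_dir (v := v) hX)
  -- The stationarity `h0` kills the terms with `g_tt` and `g_tx`, so only derivatives that occur in
  -- the equations survive.
  rw [dir_add (d1.fun_mul dT) (d2.fun_mul dX), dir_mul d1 dT, dir_mul d2 dX,
    dir_comp_base h2 (diffAt_of_smooth hT)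
      (diffAt_of_smooth hX), h0]
  ring

end Chain

/-! ## Transformations that are affine in the dependent variable -/

lemma Eqn.contDiffAt_A2 (E : Eqn) {p : Base} (hp : p ∈ E.dom) : ContDiffAt ℝ ∞ E.A2 p :=
  E.smooth_A2.contDiffAt (E.dom_open.mem_nhds hp)

lemma Eqn.contDiffAt_A1 (E : Eqn) {p : Base} (hp : p ∈ E.dom) : ContDiffAt ℝ ∞ E.A1 p :=
  E.smooth_A1.contDiffAt (E.dom_open.mem_nhds hp)

lemma Eqn.contDiffAt_C (E : Eqn) {p : Base} (hp : p ∈ E.dom) : ContDiffAt ℝ ∞ E.C p :=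
  E.smooth_C.contDiffAt (E.dom_open.mem_nhds hp)

/-- The difference of the sides of the equation, evaluated on `f`. -/
def Eqn.op (E : Eqn) (f : Base → ℝ) (q : Base) : ℝ :=
  pdt f q + E.C q * f q * pdx f q - E.A2 q * pdx (pdx f) q - E.A1 q * pdx f q

lemma Eqn.holdsAt_iff (E : Eqn) (f : Base → ℝ) (q : Base) : E.HoldsAt f q ↔ E.op f q = 0 := by
  unfold Eqn.HoldsAt Eqn.op
  constructor <;> intro h <;> linear_combination h

/-- At `q`, the transformation `t' = T(t)`, `x' = X(t,x)`, `u' = U₁(t) u + U₀(t,x)` carries the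
coefficients of `E` to those of `E'`. -/
structure Intertwines (E E' : Eqn) (T X U₁ U₀ : Base → ℝ) (q : Base) : Prop where
  smooth_T : ContDiffAt ℝ ∞ T q
  smooth_X : ContDiffAt ℝ ∞ X q
  smooth_U₁ : ContDiffAt ℝ ∞ U₁ q
  smooth_U₀ : ContDiffAt ℝ ∞ U₀ q
  T_x : ∀ᶠ r in 𝓝 q, pdx T r = 0
  U₁_x : ∀ᶠ r in 𝓝 q, pdx U₁ r = 0
  T_t : pdt T q ≠ 0
  X_x : pdx X q ≠ 0
  U₁_ne : U₁ q ≠ 0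
  -- The five relations are the coefficients of `u_xx`, `u u_x`, `u_x`, `u` and `1` in the identity
  -- of operators `T_t (E'.op g) = U₁ (E.op f)`.
  eq_A2 : E'.A2 (T q, X q) * pdt T q = E.A2 q * pdx X q ^ 2
  eq_C : E.C q * pdx X q = pdt T q * E'.C (T q, X q) * U₁ q
  eq_A1 : pdt T q * E'.A1 (T q, X q) = pdx X q * E.A1 q + E.A2 q * pdx (pdx X) q - pdt X q
    + pdt T q * E'.C (T q, X q) * U₀ q
  eq_U₁ : pdt U₁ q + E.C q * pdx U₀ q = 0
  eq_U₀ : pdt U₀ q = E.A2 q * pdx (pdx U₀) q + E.A1 q * pdx U₀ q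

section

variable {E E' : Eqn} {T X U₁ U₀ : Base → ℝ} {q : Base}

lemma pdx_pdx_comp_base {g : Base → ℝ} (hg : ContDiffAt ℝ 2 g (T q, X q))
    (hT : ContDiffAt ℝ ∞ T q) (hX : ContDiffAt ℝ ∞ X q) (h0 : ∀ᶠ r in 𝓝 q, pdx T r = 0) :
    pdx (pdx (fun r => g (T r, X r))) q
      = pdx (pdx g) (T q, X q) * pdx X q ^ 2 + pdx g (T q, X q) * pdx (pdx X) q := by
  have h1 : pdx (pdx T) q = 0 :=
    (dir_congr (v := (0, 1)) (g := fun _ => (0 : ℝ)) h0).trans (dir_const 0)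
  have := dir_dir_comp_base (v := (0, 1)) hg hT hX h0.self_of_nhds
  change pdx (pdx _) q = _ at this
  rw [this]
  change _ + pdt g (T q, X q) * pdx (pdx T) q + _ = _
  rw [h1, mul_zero, add_zero]; rfl

lemma pdx_comp_base {g : Base → ℝ} (hg : DifferentiableAt ℝ g (T q, X q))
    (hT : DifferentiableAt ℝ T q) (hX : DifferentiableAt ℝ X q) (h0 : pdx T q = 0) :
    pdx (fun r => g (T r, X r)) q = pdx g (T q, X q) * pdx X q := by
  have := dir_comp_base (v := (0, 1)) hg hT hX
  change _ = _ * pdx T q + _ at this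
  rw [h0, mul_zero, zero_add] at this
  exact this

lemma pdt_comp_base {g : Base → ℝ} (hg : DifferentiableAt ℝ g (T q, X q))
    (hT : DifferentiableAt ℝ T q) (hX : DifferentiableAt ℝ X q) :
    pdt (fun r => g (T r, X r)) q = pdt g (T q, X q) * pdt T q + pdx g (T q, X q) * pdt X q :=
  dir_comp_base (v := (1, 0)) hg hT hX

/-- The intertwining identity of the operators. -/
lemma Intertwines.op_eq (h : Intertwines E E' T X U₁ U₀ q) {f g : Base → ℝ}
    (hf : ContDiffAt ℝ 2 f q) (hg : ContDiffAt ℝ 2 g (T q, X q))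
    (hfg : (fun r => g (T r, X r)) =ᶠ[𝓝 q] fun r => U₁ r * f r + U₀ r) :
    pdt T q * E'.op g (T q, X q) = U₁ q * E.op f q := by
  have dg := hg.differentiableAt (by simp)
  have df := hf.differentiableAt (by simp)
  have dT := diffAt_of_smooth h.smooth_T
  have dX := diffAt_of_smooth h.smooth_X
  have d1 := diffAt_of_smooth h.smooth_U₁
  have d0 := diffAt_of_smooth h.smooth_U₀
  have dfx : DifferentiableAt ℝ (pdx f) q := diffAt_dir_of_two hf
  have d0x : DifferentiableAt ℝ (pdx U₀) q := diffAt_of_smooth (contDiffAt_dir h.smooth_U₀)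
  have e0 := hfg.self_of_nhds
  have et := dir_congr (v := (1, 0)) hfg
  rw [dir_add (d1.fun_mul df) d0, dir_mul d1 df] at et
  have et' := pdt_comp_base dg dT dX
  have ex : pdx (fun r => g (T r, X r)) =ᶠ[𝓝 q] fun r => U₁ r * pdx f r + pdx U₀ r := by
    filter_upwards [hfg.eventuallyEq_nhds, eventually_diffAt_of_two hf, eventually_diffAt h.smooth_U₁,
      eventually_diffAt h.smooth_U₀, h.U₁_x] with r h1 h2 h3 h4 h5
    have := dir_congr (v := (0, 1)) h1
    rw [dir_add (h3.fun_mul h2) h4, dir_mul h3 h2] at this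
    change pdx _ r = pdx U₁ r * f r + _ + _ at this
    rw [this, h5, zero_mul, zero_add]; rfl
  have exx := dir_congr (v := (0, 1)) ex
  rw [dir_add (d1.fun_mul dfx) d0x, dir_mul d1 dfx] at exx
  have ex' := pdx_comp_base dg dT dX h.T_x.self_of_nhds
  have exx' := pdx_pdx_comp_base hg h.smooth_T h.smooth_X h.T_x
  have ex0 := ex.self_of_nhds
  simp only [← pdx_eq_dir, ← pdt_eq_dir] at et exx
  rw [h.U₁_x.self_of_nhds] at exx
  unfold Eqn.op
  have a1 := et'.symm.trans et
  have a2 := ex'.symm.trans ex0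
  have a3 := exx'.symm.trans exx
  have b1 := h.eq_A2
  have b2 := h.eq_C
  have b3 := h.eq_A1
  have b4 := h.eq_U₁
  have b5 := h.eq_U₀
  simp only at e0 a2
  rw [e0]
  -- The derivatives of `g` become atoms, tied to those of `f` only by `a1`, `a2` and `a3`.
  generalize pdt g (T q, X q) = gt at *
  generalize pdx g (T q, X q) = gx at *
  generalize pdx (pdx g) (T q, X q) = gxx at *
  linear_combination a1 - gxx * b1 - f q * gx * b2 - gx * b3 + (f q * E.C q - E.A1 q) * a2
    - E.A2 q * a3 + f q * b4 + b5

end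

/-- The local inverse of a map of the `(t,x)`-plane. -/
lemma exists_local_inverse {T X : Base → ℝ} {q : Base} (hT : ContDiffAt ℝ ∞ T q)
    (hX : ContDiffAt ℝ ∞ X q) (hTx : pdx T q = 0) (hTt : pdt T q ≠ 0) (hXx : pdx X q ≠ 0) :
    ∃ G : Base → Base, ContDiffAt ℝ ∞ G (T q, X q) ∧ G (T q, X q) = q ∧
      (∀ᶠ r in 𝓝 q, G (T r, X r) = r) ∧ ∀ᶠ r in 𝓝 (T q, X q), (T (G r), X (G r)) = r := by
  have hB : ContDiffAt ℝ ∞ (fun r => (T r, X r)) q := hT.prodMk hX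
  -- Since `T_x = 0`, the Jacobian matrix is triangular and its inverse can be written down.
  let L : Base ≃L[ℝ] Base := LinearEquiv.toContinuousLinearEquiv
    { toFun := fun v => (pdt T q * v.1, pdt X q * v.1 + pdx X q * v.2)
      map_add' := fun v w => by ext <;> simp <;> ring
      map_smul' := fun c v => by ext <;> simp <;> ring
      invFun := fun v => (v.1 / pdt T q, (v.2 - pdt X q * (v.1 / pdt T q)) / pdx X q)
      left_inv := fun v => by ext <;> simp <;> field_simp; ring
      right_inv := fun v => by ext <;> simp <;> field_simp; ring }
  have hL : HasFDerivAt (fun r => (T r, X r)) (L : Base →L[ℝ] Base) q := by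
    have := (diffAt_of_smooth hT).hasFDerivAt.prodMk (diffAt_of_smooth hX).hasFDerivAt
    have hLe : (L : Base →L[ℝ] Base) = (fderiv ℝ T q).prod (fderiv ℝ X q) := by
      refine ContinuousLinearMap.ext fun v => Prod.ext ?_ ?_
      · change pdt T q * v.1 = fderiv ℝ T q (v.1, v.2)
        rw [fderiv_base_apply, hTx, zero_mul, add_zero]
      · change pdt X q * v.1 + pdx X q * v.2 = fderiv ℝ X q (v.1, v.2)
        rw [fderiv_base_apply]
    rw [hLe]; exact this
  refine ⟨hB.localInverse hL (by simp), hB.to_localInverse hL (by simp), ?_, ?_, ?_⟩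
  · exact hB.localInverse_apply_image hL (by simp)
  · exact (hB.hasStrictFDerivAt' hL (by simp)).eventually_left_inverse
  · exact (hB.hasStrictFDerivAt' hL (by simp)).eventually_right_inverse

/-- The affine form of a point transformation near `z`. -/
def AffineForm (φ : Space → Space) (T X U₁ U₀ : Base → ℝ) (y : Space) : Prop :=
  φ y = ((T y.1, X y.1), U₁ y.1 * y.2 + U₀ y.1)

section

variable {φ : PointTransformation Space} {E E' : Eqn} {T X U₁ U₀ : Base → ℝ} {z : Space}

lemma tendsto_graph {f : Base → ℝ} (hf : ContinuousAt f z.1) (hz : f z.1 = z.2) :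
    Filter.Tendsto (fun q => (q, f q)) (𝓝 z.1) (𝓝 z) := by
  have := (continuousAt_id (x := z.1)).prodMk hf
  unfold ContinuousAt at this
  simp only [id, hz] at this
  exact this

/-- Transformations of the affine form that intertwine the operators relate the equations. -/
lemma Intertwines.carriesAt (h : Intertwines E E' T X U₁ U₀ z.1)
    (hφ : ∀ᶠ y in 𝓝 z, AffineForm φ T X U₁ U₀ y) : CarriesAt φ E E' z := by
  intro f g hf hz hg hfg _
  have hφz : φ z = _ := hφ.self_of_nhds
  rw [hφz] at hg ⊢
  have key := h.op_eq (two_of_smooth hf) (two_of_smooth hg) (by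
    filter_upwards [hfg, (tendsto_graph hf.continuousAt hz).eventually hφ] with q h1 h2
    change φ (q, f q) = _ at h2
    rw [h2] at h1
    exact h1.symm)
  rw [E.holdsAt_iff, E'.holdsAt_iff]
  constructor
  · intro h0
    rw [h0, mul_zero] at key
    exact (mul_eq_zero.1 key).resolve_left h.T_t
  · intro h0
    rw [h0, mul_zero] at key
    exact (mul_eq_zero.1 key.symm).resolve_left h.U₁_ne

lemma fderiv_base_det {T X : Base → ℝ} {q : Base} (hT : DifferentiableAt ℝ T q)
    (hX : DifferentiableAt ℝ X q) :
    (fderiv ℝ (fun r => (T r, X r)) q).det = pdt T q * pdx X q - pdx T q * pdt X q := by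
  rw [(hT.hasFDerivAt.prodMk hX.hasFDerivAt).fderiv, ContinuousLinearMap.det,
    ← LinearMap.det_toMatrix (Module.Basis.finTwoProd ℝ), Matrix.det_fin_two]
  simp [LinearMap.toMatrix_apply, pdt, pdx]

end

/-! ## Derivatives on the space of `((t,x),u)` -/

/-- Partial derivative with respect to `t` of a function of `((t,x),u)`. -/
def pt (H : Space → ℝ) : Space → ℝ := dir (((1, 0), 0) : Space) H

/-- Partial derivative with respect to `x` of a function of `((t,x),u)`. -/
def px (H : Space → ℝ) : Space → ℝ := dir (((0, 1), 0) : Space) H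

/-- Partial derivative with respect to `u` of a function of `((t,x),u)`. -/
def pu (H : Space → ℝ) : Space → ℝ := dir ((0, 1) : Space) H

lemma fderiv_space_apply (H : Space → ℝ) (z : Space) (a b c : ℝ) :
    fderiv ℝ H z ((a, b), c) = pt H z * a + px H z * b + pu H z * c := by
  have : (((a, b), c) : Space)
      = a • (((1, 0), 0) : Space) + b • (((0, 1), 0) : Space) + c • ((0, 1) : Space) := by
    ext <;> simp
  rw [this, map_add, map_add, map_smul, map_smul, map_smul]
  simp only [pt, px, pu, dir, smul_eq_mul]; ring

section Graph

variable {H : Space → ℝ} {f : Base → ℝ} {q : Base}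

lemma pdt_graph (hH : DifferentiableAt ℝ H (q, f q)) (hf : DifferentiableAt ℝ f q) :
    pdt (fun r => H (r, f r)) q = pt H (q, f q) + pu H (q, f q) * pdt f q :=
  dir_graph (v := (1, 0)) hH hf

lemma pdx_graph (hH : DifferentiableAt ℝ H (q, f q)) (hf : DifferentiableAt ℝ f q) :
    pdx (fun r => H (r, f r)) q = px H (q, f q) + pu H (q, f q) * pdx f q :=
  dir_graph (v := (0, 1)) hH hf

lemma pdx_pdx_graph (hH : ContDiffAt ℝ ∞ H (q, f q)) (hf : ContDiffAt ℝ ∞ f q) :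
    pdx (pdx (fun r => H (r, f r))) q
      = px (px H) (q, f q) + 2 * px (pu H) (q, f q) * pdx f q
        + pu (pu H) (q, f q) * pdx f q ^ 2 + pu H (q, f q) * pdx (pdx f) q :=
  dir_dir_graph (v := (0, 1)) hH hf

end Graph

/-! ## Quadratic test functions -/

lemma dir_fst_base (v q : Base) : dir v (fun r : Base => r.1) q = v.1 := by
  simp [dir, fderiv_fst]

lemma dir_snd_base (v q : Base) : dir v (fun r : Base => r.2) q = v.2 := by
  simp [dir, fderiv_snd]

/-- The affine function with the given value and gradient at `p`. -/
def lin (p : Base) (u a b : ℝ) (q : Base) : ℝ := u + a * (q.1 - p.1) + b * (q.2 - p.2)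

/-- The quadratic polynomial with the given 2-jet at `p`. -/
def quad (p : Base) (u a b c d e : ℝ) (q : Base) : ℝ :=
  lin p u a b q + c / 2 * (q.1 - p.1) ^ 2 + d * (q.1 - p.1) * (q.2 - p.2)
    + e / 2 * (q.2 - p.2) ^ 2

lemma contDiff_lin (p : Base) (u a b : ℝ) : ContDiff ℝ ∞ (lin p u a b) := by
  unfold lin; fun_prop

lemma contDiff_quad (p : Base) (u a b c d e : ℝ) : ContDiff ℝ ∞ (quad p u a b c d e) := by
  have := contDiff_lin p u a b
  unfold quad; fun_prop

lemma quad_self (p : Base) (u a b c d e : ℝ) : quad p u a b c d e p = u := by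
  simp [quad, lin]

lemma dir_lin (p : Base) (u a b : ℝ) (v q : Base) : dir v (lin p u a b) q = a * v.1 + b * v.2 := by
  have : HasFDerivAt (lin p u a b)
      (a • ContinuousLinearMap.fst ℝ ℝ ℝ + b • ContinuousLinearMap.snd ℝ ℝ ℝ) q := by
    unfold lin
    refine HasFDerivAt.add (HasFDerivAt.const_add _ ?_) ?_
    · exact (hasFDerivAt_fst.sub_const _).const_mul a
    · exact (hasFDerivAt_snd.sub_const _).const_mul b
  simp only [dir]; rw [this.fderiv]; simp

lemma dir_quad (p : Base) (u a b c d e : ℝ) (v : Base) :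
    dir v (quad p u a b c d e)
      = lin p (a * v.1 + b * v.2) (c * v.1 + d * v.2) (d * v.1 + e * v.2) := by
  funext q
  have h1 : HasFDerivAt (fun r : Base => r.1 - p.1) (ContinuousLinearMap.fst ℝ ℝ ℝ) q :=
    hasFDerivAt_fst.sub_const _
  have h2 : HasFDerivAt (fun r : Base => r.2 - p.2) (ContinuousLinearMap.snd ℝ ℝ ℝ) q :=
    hasFDerivAt_snd.sub_const _
  have e1 := ((h1.pow 2).const_mul (c / 2))
  have e2 := ((h1.const_mul d).fun_mul h2)
  have e3 := ((h2.pow 2).const_mul (e / 2))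
  have e0 := ((contDiff_lin p u a b).differentiable (by simp) q).hasFDerivAt
  have := ((e0.fun_add e1).fun_add e2).fun_add e3
  change fderiv ℝ (fun r => lin p u a b r + c / 2 * (r.1 - p.1) ^ 2
    + d * (r.1 - p.1) * (r.2 - p.2) + e / 2 * (r.2 - p.2) ^ 2) q v = _
  rw [this.fderiv]
  have hl := dir_lin p u a b v q
  simp only [dir] at hl
  simp [hl, lin]
  ring

lemma pdt_quad (p : Base) (u a b c d e : ℝ) : pdt (quad p u a b c d e) p = a := by
  rw [pdt_eq_dir, dir_quad]; simp [lin]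

lemma pdx_quad (p : Base) (u a b c d e : ℝ) : pdx (quad p u a b c d e) p = b := by
  rw [pdx_eq_dir, dir_quad]; simp [lin]

lemma pdx_pdx_quad (p : Base) (u a b c d e : ℝ) : pdx (pdx (quad p u a b c d e)) p = e := by
  rw [pdx_eq_dir, dir_quad, dir_lin]; simp

lemma dir_dir_quad (p : Base) (u a b c d e : ℝ) (v : Base) :
    dir v (dir v (quad p u a b c d e)) p = c * v.1 ^ 2 + 2 * d * v.1 * v.2 + e * v.2 ^ 2 := by
  rw [dir_quad, dir_lin]; ring

/-- The equation is one relation between `a = u_t`, `b = u_x` and `e = u_xx`. The entries `c = u_tt`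
and `d = u_tx` stay free, which is what later forces projectability in `t`. -/
lemma Eqn.holdsAt_quad (E : Eqn) (p : Base) (u a b c d e : ℝ) :
    E.HoldsAt (quad p u a b c d e) p ↔ a + E.C p * u * b = E.A2 p * e + E.A1 p * b := by
  unfold Eqn.HoldsAt
  rw [pdt_quad, pdx_quad, pdx_pdx_quad, quad_self]

/-! ## Point transformations -/

namespace PointTransformation

variable (φ : PointTransformation Space)

/-- The `t`-component. -/
def T (y : Space) : ℝ := (φ y).1.1

/-- The `x`-component. -/
def X (y : Space) : ℝ := (φ y).1.2

/-- The `u`-component. -/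
def U (y : Space) : ℝ := (φ y).2

variable {φ} {z : Space}

lemma contDiffAt (hz : z ∈ φ.source) : ContDiffAt ℝ ∞ φ z :=
  φ.smooth.contDiffAt (φ.open_source.mem_nhds hz)

lemma contDiffAt_T (hz : z ∈ φ.source) : ContDiffAt ℝ ∞ φ.T z := (contDiffAt hz).fst.fst

lemma contDiffAt_X (hz : z ∈ φ.source) : ContDiffAt ℝ ∞ φ.X z := (contDiffAt hz).fst.snd

lemma contDiffAt_U (hz : z ∈ φ.source) : ContDiffAt ℝ ∞ φ.U z := (contDiffAt hz).snd

lemma contDiffAt_symm (hz : z ∈ φ.target) :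
    ContDiffAt ℝ ∞ φ.toOpenPartialHomeomorph.symm z :=
  φ.smooth_symm.contDiffAt (φ.open_target.mem_nhds hz)

/-- The differential of a point transformation is injective and surjective. -/
lemma fderiv_bijective (hz : z ∈ φ.source) :
    Function.Bijective (fderiv ℝ φ z) := by
  have hd := diffAt_of_smooth (contDiffAt hz)
  have hs := diffAt_of_smooth (contDiffAt_symm (φ.map_source hz))
  have hd' : HasFDerivAt φ (fderiv ℝ φ z) (φ.toOpenPartialHomeomorph.symm (φ z)) := by
    rw [φ.left_inv hz]; exact hd.hasFDerivAt
  have h1 := hs.hasFDerivAt.comp z hd.hasFDerivAt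
  have h2 := hd'.comp (φ z) hs.hasFDerivAt
  have e1 := (h1.congr_of_eventuallyEq (f₁ := id) (by
    filter_upwards [φ.open_source.mem_nhds hz] with y hy
    exact (φ.left_inv hy).symm)).unique (hasFDerivAt_id z)
  have e2 := (h2.congr_of_eventuallyEq (f₁ := id) (by
    filter_upwards [φ.open_target.mem_nhds (φ.map_source hz)] with y hy
    exact (φ.right_inv hy).symm)).unique (hasFDerivAt_id _)
  constructor
  · intro a b hab
    have := congrArg (fun w => fderiv ℝ φ.toOpenPartialHomeomorph.symm (φ z) w) hab
    have ea := DFunLike.congr_fun e1 a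
    have eb := DFunLike.congr_fun e1 b
    exact (ea.symm.trans this).trans eb
  · intro b
    exact ⟨_, DFunLike.congr_fun e2 b⟩

lemma fderiv_apply (hz : z ∈ φ.source) (a b c : ℝ) :
    fderiv ℝ φ z ((a, b), c) = ((pt φ.T z * a + px φ.T z * b + pu φ.T z * c,
      pt φ.X z * a + px φ.X z * b + pu φ.X z * c), pt φ.U z * a + px φ.U z * b + pu φ.U z * c) := by
  have h : HasFDerivAt φ (((fderiv ℝ φ.T z).prod (fderiv ℝ φ.X z)).prod (fderiv ℝ φ.U z)) z :=
    (((diffAt_of_smooth (contDiffAt_T hz)).hasFDerivAt.prodMk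
      (diffAt_of_smooth (contDiffAt_X hz)).hasFDerivAt).prodMk
      (diffAt_of_smooth (contDiffAt_U hz)).hasFDerivAt)
  rw [h.fderiv, ← fderiv_space_apply, ← fderiv_space_apply, ← fderiv_space_apply]
  rfl

end PointTransformation

/-! ## The structure of the transformations relating equations -/

section Structure

variable {φ : PointTransformation Space} {E E' : Eqn} {z : Space}

/-- The local image of the graph of a function under a point transformation. -/
lemma exists_graph_image (hz : z ∈ φ.source) {f : Base → ℝ} (hf : ContDiffAt ℝ ∞ f z.1)
    (hfz : f z.1 = z.2) (hdet : (fderiv ℝ (fun q => (φ (q, f q)).1) z.1).det ≠ 0) :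
    ∃ g : Base → ℝ, ContDiffAt ℝ ∞ g (φ z).1 ∧
      ∀ᶠ q in 𝓝 z.1, g (φ (q, f q)).1 = (φ (q, f q)).2 := by
  have hz' : (z.1, f z.1) = z := by rw [hfz]
  have hφ : ContDiffAt ℝ ∞ (fun q => φ (q, f q)) z.1 :=
    ContDiffAt.comp (f := fun q => (q, f q)) z.1 (by
      rw [hz']; exact PointTransformation.contDiffAt hz) (contDiffAt_id.prodMk hf)
  set B : Base → Base := fun q => (φ (q, f q)).1 with hB
  have hBs : ContDiffAt ℝ ∞ B z.1 := hφ.fst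
  let L := (fderiv ℝ B z.1).toContinuousLinearEquivOfDetNeZero hdet
  have hL : HasFDerivAt B (L : Base →L[ℝ] Base) z.1 := by
    rw [ContinuousLinearMap.coe_toContinuousLinearEquivOfDetNeZero]
    exact (diffAt_of_smooth hBs).hasFDerivAt
  have hBz : B z.1 = (φ z).1 := by simp only [hB, hz']
  let G := hBs.localInverse hL (by simp)
  have hGs : ContDiffAt ℝ ∞ G (φ z).1 := by
    rw [← hBz]; exact hBs.to_localInverse hL (by simp)
  have hGz : G (φ z).1 = z.1 := by
    rw [← hBz]; exact hBs.localInverse_apply_image hL (by simp)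
  have hG := (hBs.hasStrictFDerivAt' hL (by simp)).eventually_left_inverse
  refine ⟨fun r => (φ (G r, f (G r))).2, ?_, ?_⟩
  · exact ContDiffAt.comp (φ z).1 (g := fun q => (φ (q, f q)).2) (by rw [hGz]; exact hφ.snd) hGs
  · filter_upwards [hG] with q hq
    change (φ (G (B q), f (G (B q)))).2 = _
    rw [show G (B q) = q from hq]

lemma pdt_congr {f g : Base → ℝ} {q : Base} (h : f =ᶠ[𝓝 q] g) : pdt f q = pdt g q :=
  dir_congr h

lemma pdx_congr {f g : Base → ℝ} {q : Base} (h : f =ᶠ[𝓝 q] g) : pdx f q = pdx g q :=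
  dir_congr h

/-- The equations for the first derivatives of the transformed function. -/
lemma first_jet_image (hz : z ∈ φ.source) {f g : Base → ℝ} (hf : ContDiffAt ℝ ∞ f z.1)
    (hfz : f z.1 = z.2) (hg : ContDiffAt ℝ ∞ g (φ z).1)
    (hfg : ∀ᶠ q in 𝓝 z.1, g (φ (q, f q)).1 = (φ (q, f q)).2) (v : Base) :
    pdt g (φ z).1 * dir v (fun q => φ.T (q, f q)) z.1
      + pdx g (φ z).1 * dir v (fun q => φ.X (q, f q)) z.1 = dir v (fun q => φ.U (q, f q)) z.1 := by
  have hz' : (z.1, f z.1) = z := by rw [hfz]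
  have hT : ContDiffAt ℝ ∞ (fun q => φ.T (q, f q)) z.1 :=
    contDiffAt_graph (by rw [hz']; exact PointTransformation.contDiffAt_T hz) hf
  have hX : ContDiffAt ℝ ∞ (fun q => φ.X (q, f q)) z.1 :=
    contDiffAt_graph (by rw [hz']; exact PointTransformation.contDiffAt_X hz) hf
  have hp : (φ.T (z.1, f z.1), φ.X (z.1, f z.1)) = (φ z).1 := by rw [hz']; rfl
  have := dir_comp_base (v := v) (g := g) (by rw [hp]; exact diffAt_of_smooth hg)
    (diffAt_of_smooth hT) (diffAt_of_smooth hX)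
  rw [hp] at this
  rw [← this]
  exact dir_congr hfg

/-- The equation for the second derivative of the transformed function. -/
lemma second_jet_image (hz : z ∈ φ.source) {f g : Base → ℝ} (hf : ContDiffAt ℝ ∞ f z.1)
    (hfz : f z.1 = z.2) (hg : ContDiffAt ℝ ∞ g (φ z).1)
    (hfg : ∀ᶠ q in 𝓝 z.1, g (φ (q, f q)).1 = (φ (q, f q)).2) (v : Base)
    (hv : dir v (fun q => φ.T (q, f q)) z.1 = 0) :
    pdx (pdx g) (φ z).1 * dir v (fun q => φ.X (q, f q)) z.1 ^ 2
      + pdt g (φ z).1 * dir v (dir v (fun q => φ.T (q, f q))) z.1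
      + pdx g (φ z).1 * dir v (dir v (fun q => φ.X (q, f q))) z.1
      = dir v (dir v (fun q => φ.U (q, f q))) z.1 := by
  have hz' : (z.1, f z.1) = z := by rw [hfz]
  have hT : ContDiffAt ℝ ∞ (fun q => φ.T (q, f q)) z.1 :=
    contDiffAt_graph (by rw [hz']; exact PointTransformation.contDiffAt_T hz) hf
  have hX : ContDiffAt ℝ ∞ (fun q => φ.X (q, f q)) z.1 :=
    contDiffAt_graph (by rw [hz']; exact PointTransformation.contDiffAt_X hz) hf
  have hp : (φ.T (z.1, f z.1), φ.X (z.1, f z.1)) = (φ z).1 := by rw [hz']; rfl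
  have := dir_dir_comp_base (v := v) (g := g) (by rw [hp]; exact two_of_smooth hg)
    hT hX hv
  rw [hp] at this
  rw [← this]
  exact dir_congr (dir_eventuallyEq hfg)

lemma graph_det (hz : z ∈ φ.source) {f : Base → ℝ} (hf : ContDiffAt ℝ ∞ f z.1)
    (hfz : f z.1 = z.2) :
    (fderiv ℝ (fun q => (φ (q, f q)).1) z.1).det
      = (pt φ.T z + pu φ.T z * pdt f z.1) * (px φ.X z + pu φ.X z * pdx f z.1)
        - (px φ.T z + pu φ.T z * pdx f z.1) * (pt φ.X z + pu φ.X z * pdt f z.1) := by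
  have hz' : (z.1, f z.1) = z := by rw [hfz]
  have hT : DifferentiableAt ℝ φ.T (z.1, f z.1) := by
    rw [hz']; exact diffAt_of_smooth (PointTransformation.contDiffAt_T hz)
  have hX : DifferentiableAt ℝ φ.X (z.1, f z.1) := by
    rw [hz']; exact diffAt_of_smooth (PointTransformation.contDiffAt_X hz)
  have hf' := diffAt_of_smooth hf
  have hg : DifferentiableAt ℝ (fun q => (q, f q)) z.1 := differentiableAt_id.prodMk hf'
  have := fderiv_base_det (T := fun q => φ.T (q, f q)) (X := fun q => φ.X (q, f q)) (q := z.1)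
    (DifferentiableAt.comp (g := φ.T) (f := fun q => (q, f q)) z.1 hT hg)
    (DifferentiableAt.comp (g := φ.X) (f := fun q => (q, f q)) z.1 hX hg)
  rw [pdt_graph hT hf', pdx_graph hT hf', pdt_graph hX hf', pdx_graph hX hf', hz'] at this
  exact this

/-- The base components of a point transformation are independent. -/
lemma minors_ne (hz : z ∈ φ.source) :
    ¬ (pt φ.T z * px φ.X z - px φ.T z * pt φ.X z = 0 ∧
      pu φ.T z * px φ.X z - px φ.T z * pu φ.X z = 0 ∧
      pt φ.T z * pu φ.X z - pu φ.T z * pt φ.X z = 0) := by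
  rintro ⟨h1, h2, h3⟩
  obtain ⟨⟨⟨a, b⟩, c⟩, hw⟩ := (PointTransformation.fderiv_bijective hz).2 ((1, 0), 0)
  obtain ⟨⟨⟨a', b'⟩, c'⟩, hw'⟩ := (PointTransformation.fderiv_bijective hz).2 ((0, 1), 0)
  rw [PointTransformation.fderiv_apply hz] at hw hw'
  simp only [Prod.mk.injEq] at hw hw'
  obtain ⟨⟨e1, e2⟩, -⟩ := hw
  obtain ⟨⟨e3, e4⟩, -⟩ := hw'
  -- Cauchy–Binet: the identity matrix formed by the base components of the two images has
  -- determinant `1`, and this determinant is a combination of the three minors.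
  have : (1 : ℝ) = 0 := by
    linear_combination -(pt φ.X z * a' + px φ.X z * b' + pu φ.X z * c') * e1 - e4
      + (pt φ.T z * a' + px φ.T z * b' + pu φ.T z * c') * e2
      + (a * b' - b * a') * h1 + (c * b' - b * c') * h2 + (a * c' - c * a') * h3
  exact one_ne_zero this

/-- The Jacobian determinant is affine in `(a, b)`, with the three minors as coefficients, because
its `ab`-terms cancel. Its product with `Tx + Tu b` vanishes identically as a polynomial, and
polynomials form a domain, so the second factor is zero. -/
lemma coord_vanish {Tt Tx Tu Xt Xx Xu : ℝ}
    (hne : ¬ (Tt * Xx - Tx * Xt = 0 ∧ Tu * Xx - Tx * Xu = 0 ∧ Tt * Xu - Tu * Xt = 0))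
    (h : ∀ a b : ℝ, (Tt + Tu * a) * (Xx + Xu * b) - (Tx + Tu * b) * (Xt + Xu * a) ≠ 0 →
      Tx + Tu * b = 0) : Tx = 0 ∧ Tu = 0 := by
  have key : ∀ a b : ℝ, (Tx + Tu * b) * ((Tt * Xx - Tx * Xt) + a * (Tu * Xx - Tx * Xu)
      + b * (Tt * Xu - Tu * Xt)) = 0 := by
    intro a b
    by_cases h0 : (Tt + Tu * a) * (Xx + Xu * b) - (Tx + Tu * b) * (Xt + Xu * a) = 0
    · linear_combination (Tx + Tu * b) * h0
    · rw [h a b h0, zero_mul]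
  generalize Tt * Xx - Tx * Xt = m1 at *
  generalize Tu * Xx - Tx * Xu = m2 at *
  generalize Tt * Xu - Tu * Xt = m3 at *
  have k1 : Tx * m1 = 0 := by linear_combination key 0 0
  have k2 : Tx * m2 = 0 := by linear_combination key 1 0 - key 0 0
  have k3 : Tu * m3 = 0 := by linear_combination (key 0 1 + key 0 (-1)) / 2 - key 0 0
  have k4 : Tu * m1 + Tx * m3 = 0 := by linear_combination (key 0 1 - key 0 (-1)) / 2
  have k5 : Tu * m2 = 0 := by linear_combination key 1 1 - key 0 1 - k2
  by_cases hx : Tx = 0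
  · refine ⟨hx, ?_⟩
    by_contra hu
    refine hne ⟨?_, (mul_eq_zero.1 k5).resolve_left hu, (mul_eq_zero.1 k3).resolve_left hu⟩
    rw [hx, zero_mul, add_zero] at k4
    exact (mul_eq_zero.1 k4).resolve_left hu
  · exfalso
    have m1z := (mul_eq_zero.1 k1).resolve_left hx
    rw [m1z, mul_zero, zero_add] at k4
    exact hne ⟨m1z, (mul_eq_zero.1 k2).resolve_left hx, (mul_eq_zero.1 k4).resolve_left hx⟩

/-- The `u`-direction is transversal to the image of a graph. -/
lemma transversal_ne (hz : z ∈ φ.source) {a b gt gx : ℝ}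
    (hdet : (pt φ.T z + pu φ.T z * a) * (px φ.X z + pu φ.X z * b)
        - (px φ.T z + pu φ.T z * b) * (pt φ.X z + pu φ.X z * a) ≠ 0)
    (ht : gt * (pt φ.T z + pu φ.T z * a) + gx * (pt φ.X z + pu φ.X z * a)
      = pt φ.U z + pu φ.U z * a)
    (hx : gt * (px φ.T z + pu φ.T z * b) + gx * (px φ.X z + pu φ.X z * b)
      = px φ.U z + pu φ.U z * b) :
    pu φ.U z - gt * pu φ.T z - gx * pu φ.X z ≠ 0 := by
  intro h0
  set D := (pt φ.T z + pu φ.T z * a) * (px φ.X z + pu φ.X z * b)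
        - (px φ.T z + pu φ.T z * b) * (pt φ.X z + pu φ.X z * a) with hD
  set w1 := pu φ.T z * (px φ.X z + pu φ.X z * b) - pu φ.X z * (px φ.T z + pu φ.T z * b) with hw1
  set w2 := (pt φ.T z + pu φ.T z * a) * pu φ.X z - (pt φ.X z + pu φ.X z * a) * pu φ.T z with hw2
  -- By Cramer's rule, `(w1, w2)` is the displacement along the graph that has the same base image
  -- as `D` times the `u`-direction. If the transversal component vanishes, the difference of the
  -- two vectors lies in the kernel of the differential.
  have h1 : fderiv ℝ φ z ((w1, w2), a * w1 + b * w2 - D) = 0 := by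
    rw [PointTransformation.fderiv_apply hz]
    refine Prod.ext (Prod.ext ?_ ?_) ?_
    · change _ = (0 : ℝ)
      rw [hw1, hw2, hD]; ring
    · change _ = (0 : ℝ)
      rw [hw1, hw2, hD]; ring
    · change _ = (0 : ℝ)
      linear_combination -w1 * ht - w2 * hx - D * h0
  have h2 := (PointTransformation.fderiv_bijective hz).1 (h1.trans (map_zero _).symm)
  simp only [Prod.mk_eq_zero] at h2
  obtain ⟨⟨e1, e2⟩, e3⟩ := h2
  rw [e1, e2] at e3
  exact hdet (by linear_combination -e3)

/-- The new time depends on the old time only. -/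
lemma Relates.T_vanish (h : Relates φ E E') (hz : z ∈ φ.source) :
    px φ.T z = 0 ∧ pu φ.T z = 0 := by
  refine coord_vanish (minors_ne hz) fun a b hdet => ?_
  have hzE : z.1 ∈ E.dom := (h.1 hz).1
  have hzE' : (φ z).1 ∈ E'.dom := (h.2.1 (φ.map_source hz)).1
  -- This is `u_xx` solved from `E` for given `u_t = a` and `u_x = b`.
  set e := (a + E.C z.1 * z.2 * b - E.A1 z.1 * b) / E.A2 z.1 with he
  have hE : a + E.C z.1 * z.2 * b = E.A2 z.1 * e + E.A1 z.1 * b := by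
    rw [he]; field_simp [E.A2_ne z.1 hzE]; ring
  -- The direction along the graph in which the new time is stationary. The second derivative of the
  -- image function along it involves `g_xx` and first derivatives of `g` only.
  set v : Base := (-(px φ.T z + pu φ.T z * b), pt φ.T z + pu φ.T z * a) with hv
  let K : (Space → ℝ) → ℝ := fun H => dir (v, 0) (dir (v, 0) H) z
    + 2 * dir (v, 0) (dir (0, 1) H) z * (a * v.1 + b * v.2)
    + dir (0, 1) (dir (0, 1) H) z * (a * v.1 + b * v.2) ^ 2
  have first : ∀ (H : Space → ℝ), ContDiffAt ℝ ∞ H z → ∀ (w : Base) (c : ℝ),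
      dir w (fun q => H (q, quad z.1 z.2 a b c 0 e q)) z.1
        = (pt H z + pu H z * a) * w.1 + (px H z + pu H z * b) * w.2 := by
    intro H hH w c
    have hq := quad_self z.1 z.2 a b c 0 e
    rw [dir_graph (by rw [hq]; exact diffAt_of_smooth hH)
      (diffAt_of_smooth (contDiff_quad _ _ _ _ _ _ _).contDiffAt), hq, dir_quad]
    have : dir ((w, 0) : Space) H z = pt H z * w.1 + px H z * w.2 + pu H z * 0 :=
      fderiv_space_apply H z w.1 w.2 0
    change dir (w, 0) H z + pu H z * lin _ _ _ _ _ = _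
    rw [this]; simp only [lin]; ring
  have second : ∀ (H : Space → ℝ), ContDiffAt ℝ ∞ H z → ∀ c : ℝ,
      dir v (dir v (fun q => H (q, quad z.1 z.2 a b c 0 e q))) z.1
        = K H + pu H z * (c * v.1 ^ 2 + e * v.2 ^ 2) := by
    intro H hH c
    have hq := quad_self z.1 z.2 a b c 0 e
    rw [dir_dir_graph (by rw [hq]; exact hH) (contDiff_quad _ _ _ _ _ _ _).contDiffAt, hq,
      dir_dir_quad, dir_quad]
    simp only [K, lin, pu, Prod.mk.eta]
    ring
  have main : ∀ c : ℝ, ∃ gt gx gxx : ℝ,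
      gt * (pt φ.T z + pu φ.T z * a) + gx * (pt φ.X z + pu φ.X z * a)
        = pt φ.U z + pu φ.U z * a ∧
      gt * (px φ.T z + pu φ.T z * b) + gx * (px φ.X z + pu φ.X z * b)
        = px φ.U z + pu φ.U z * b ∧
      gt + E'.C (φ z).1 * (φ z).2 * gx = E'.A2 (φ z).1 * gxx + E'.A1 (φ z).1 * gx ∧
      gxx * ((pt φ.X z + pu φ.X z * a) * v.1 + (px φ.X z + pu φ.X z * b) * v.2) ^ 2
        + gt * (K φ.T + pu φ.T z * (c * v.1 ^ 2 + e * v.2 ^ 2))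
        + gx * (K φ.X + pu φ.X z * (c * v.1 ^ 2 + e * v.2 ^ 2))
        = K φ.U + pu φ.U z * (c * v.1 ^ 2 + e * v.2 ^ 2) := by
    intro c
    have hq := quad_self z.1 z.2 a b c 0 e
    have hf : ContDiffAt ℝ ∞ (quad z.1 z.2 a b c 0 e) z.1 :=
      (contDiff_quad _ _ _ _ _ _ _).contDiffAt
    have hd : (fderiv ℝ (fun q => (φ (q, quad z.1 z.2 a b c 0 e q)).1) z.1).det ≠ 0 := by
      rw [graph_det hz hf hq, pdt_quad, pdx_quad]; exact hdet
    obtain ⟨g, hg, hfg⟩ := exists_graph_image hz hf hq hd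
    have hgE := (h.2.2 z hz _ g hf hq hg (hfg.mono fun _ hr => hr.symm) hd).1
      ((E.holdsAt_quad _ _ _ _ _ _ _).2 hE)
    have hgz : g (φ z).1 = (φ z).2 := by
      have := hfg.self_of_nhds
      rwa [hq] at this
    have cT := PointTransformation.contDiffAt_T hz
    have cX := PointTransformation.contDiffAt_X hz
    have cU := PointTransformation.contDiffAt_U hz
    refine ⟨pdt g (φ z).1, pdx g (φ z).1, pdx (pdx g) (φ z).1, ?_, ?_, ?_, ?_⟩
    · have := first_jet_image hz hf hq hg hfg (1, 0)
      rw [first _ cT, first _ cX, first _ cU] at this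
      linear_combination this
    · have := first_jet_image hz hf hq hg hfg (0, 1)
      rw [first _ cT, first _ cX, first _ cU] at this
      linear_combination this
    · unfold Eqn.HoldsAt at hgE
      rwa [hgz] at hgE
    · have := second_jet_image hz hf hq hg hfg v (by rw [first _ cT]; simp only [hv]; ring)
      rwa [first _ cX, second _ cT, second _ cX, second _ cU] at this
  -- Changing `u_tt` from `0` to `1` keeps the jet on `E` and does not affect the first derivatives
  -- of the image; by `E'` it does not affect `g_xx` either. So `u_tt` must drop out of the last
  -- relation, where its coefficient is `v.1 ^ 2` times a transversal, hence nonzero, factor.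
  obtain ⟨gt, gx, gxx, e1, e2, e3, e4⟩ := main 0
  obtain ⟨gt', gx', gxx', e1', e2', e3', e4'⟩ := main 1
  have hne := transversal_ne hz hdet e1 e2
  have ht : gt' = gt := by
    refine mul_right_cancel₀ hdet ?_
    linear_combination (px φ.X z + pu φ.X z * b) * (e1' - e1)
      - (pt φ.X z + pu φ.X z * a) * (e2' - e2)
  have hx : gx' = gx := by
    refine mul_right_cancel₀ hdet ?_
    linear_combination (pt φ.T z + pu φ.T z * a) * (e2' - e2)
      - (px φ.T z + pu φ.T z * b) * (e1' - e1)
  have hxx : gxx' = gxx := by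
    refine mul_left_cancel₀ (E'.A2_ne _ hzE') ?_
    rw [ht, hx] at e3'
    linear_combination e3 - e3'
  rw [ht, hx, hxx] at e4'
  have hv1 : v.1 ^ 2 * (pu φ.U z - gt * pu φ.T z - gx * pu φ.X z) = 0 := by
    linear_combination e4 - e4'
  have := (pow_eq_zero_iff two_ne_zero).1 ((mul_eq_zero.1 hv1).resolve_right hne)
  simp only [hv] at this
  linear_combination -this

end Structure

section Structure

variable {φ : PointTransformation Space} {E E' : Eqn} {z : Space}

/-- The correspondence of 2-jets under a point transformation relating two equations. -/
lemma Relates.jet_image (h : Relates φ E E') (hz : z ∈ φ.source) (a b e : ℝ)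
    (hD : px φ.X z + pu φ.X z * b ≠ 0) :
    ∃ gt gx gxx : ℝ,
      gx * (px φ.X z + pu φ.X z * b) = px φ.U z + pu φ.U z * b ∧
      gt * pt φ.T z + gx * (pt φ.X z + pu φ.X z * a) = pt φ.U z + pu φ.U z * a ∧
      gxx * (px φ.X z + pu φ.X z * b) ^ 2 + gx * (px (px φ.X) z + 2 * px (pu φ.X) z * b
          + pu (pu φ.X) z * b ^ 2 + pu φ.X z * e)
        = px (px φ.U) z + 2 * px (pu φ.U) z * b + pu (pu φ.U) z * b ^ 2 + pu φ.U z * e ∧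
      (a + E.C z.1 * z.2 * b = E.A2 z.1 * e + E.A1 z.1 * b ↔
        gt + E'.C (φ z).1 * (φ z).2 * gx = E'.A2 (φ z).1 * gxx + E'.A1 (φ z).1 * gx) := by
  obtain ⟨hTx, hTu⟩ := h.T_vanish hz
  have hTt : pt φ.T z ≠ 0 := by
    intro h0
    exact minors_ne hz ⟨by rw [h0, hTx]; ring, by rw [hTu, hTx]; ring, by rw [h0, hTu]; ring⟩
  have hq := quad_self z.1 z.2 a b 0 0 e
  have hf : ContDiffAt ℝ ∞ (quad z.1 z.2 a b 0 0 e) z.1 :=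
    (contDiff_quad _ _ _ _ _ _ _).contDiffAt
  have hd : (fderiv ℝ (fun q => (φ (q, quad z.1 z.2 a b 0 0 e q)).1) z.1).det ≠ 0 := by
    rw [graph_det hz hf hq, pdt_quad, pdx_quad, hTx, hTu]
    simpa using ⟨hTt, hD⟩
  obtain ⟨g, hg, hfg⟩ := exists_graph_image hz hf hq hd
  have hgE := h.2.2 z hz _ g hf hq hg (hfg.mono fun _ hr => hr.symm) hd
  have hgz : g (φ z).1 = (φ z).2 := by
    have := hfg.self_of_nhds
    rwa [hq] at this
  have cT := PointTransformation.contDiffAt_T hz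
  have cX := PointTransformation.contDiffAt_X hz
  have cU := PointTransformation.contDiffAt_U hz
  have hfd := diffAt_of_smooth hf
  have jt : ∀ {H : Space → ℝ}, ContDiffAt ℝ ∞ H z →
      dir (1, 0) (fun q => H (q, quad z.1 z.2 a b 0 0 e q)) z.1 = pt H z + pu H z * a := by
    intro H hH
    have := pdt_graph (f := quad z.1 z.2 a b 0 0 e) (q := z.1) (H := H)
      (by rw [hq]; exact diffAt_of_smooth hH) hfd
    rwa [hq, pdt_quad] at this
  have jx : ∀ {H : Space → ℝ}, ContDiffAt ℝ ∞ H z →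
      dir (0, 1) (fun q => H (q, quad z.1 z.2 a b 0 0 e q)) z.1 = px H z + pu H z * b := by
    intro H hH
    have := pdx_graph (f := quad z.1 z.2 a b 0 0 e) (q := z.1) (H := H)
      (by rw [hq]; exact diffAt_of_smooth hH) hfd
    rwa [hq, pdx_quad] at this
  have jxx : ∀ {H : Space → ℝ}, ContDiffAt ℝ ∞ H z →
      dir (0, 1) (dir (0, 1) (fun q => H (q, quad z.1 z.2 a b 0 0 e q))) z.1
        = px (px H) z + 2 * px (pu H) z * b + pu (pu H) z * b ^ 2 + pu H z * e := by
    intro H hH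
    have := pdx_pdx_graph (f := quad z.1 z.2 a b 0 0 e) (q := z.1) (H := H)
      (by rw [hq]; exact hH) hf
    rwa [hq, pdx_quad, pdx_pdx_quad] at this
  have hTxx : dir (0, 1) (dir (0, 1) (fun q => φ.T (q, quad z.1 z.2 a b 0 0 e q))) z.1 = 0 := by
    have hev : dir (0, 1) (fun q => φ.T (q, quad z.1 z.2 a b 0 0 e q)) =ᶠ[𝓝 z.1]
        fun _ => 0 := by
      filter_upwards [(tendsto_graph hf.continuousAt hq).eventually
        (φ.open_source.mem_nhds hz)] with q hqs
      have := pdx_graph (f := quad z.1 z.2 a b 0 0 e) (q := q) (H := φ.T)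
        (diffAt_of_smooth (PointTransformation.contDiffAt_T hqs))
        ((contDiff_quad _ _ _ _ _ _ _).differentiable (by simp) q)
      rw [(h.T_vanish hqs).1, (h.T_vanish hqs).2, zero_mul, add_zero] at this
      exact this
    rw [dir_congr hev, dir_const]
  refine ⟨pdt g (φ z).1, pdx g (φ z).1, pdx (pdx g) (φ z).1, ?_, ?_, ?_, ?_⟩
  · have := first_jet_image hz hf hq hg hfg (0, 1)
    rw [jx cT, jx cX, jx cU, hTx, hTu] at this
    linear_combination this
  · have := first_jet_image hz hf hq hg hfg (1, 0)
    rw [jt cT, jt cX, jt cU, hTu] at this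
    linear_combination this
  · have := second_jet_image hz hf hq hg hfg (0, 1) (by rw [jx cT, hTx, hTu]; ring)
    rw [jx cX, hTxx, jxx cX, jxx cU] at this
    linear_combination this
  · rw [E.holdsAt_quad] at hgE
    unfold Eqn.HoldsAt at hgE
    rwa [hgz] at hgE

/-- As `T_x = T_u = 0`, the differential is block triangular, and its `(x,u)`-block inherits
injectivity. -/
lemma Relates.fiber_det_ne (h : Relates φ E E') (hz : z ∈ φ.source) :
    pu φ.U z * px φ.X z - pu φ.X z * px φ.U z ≠ 0 := by
  intro h0
  obtain ⟨hTx, hTu⟩ := h.T_vanish hz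
  have inj : ∀ b c : ℝ, px φ.X z * b + pu φ.X z * c = 0 → px φ.U z * b + pu φ.U z * c = 0 →
      b = 0 ∧ c = 0 := by
    intro b c h1 h2
    have h3 : fderiv ℝ φ z ((0, b), c) = 0 := by
      rw [PointTransformation.fderiv_apply hz, hTx, hTu]
      refine Prod.ext (Prod.ext ?_ ?_) ?_
      · change _ = (0 : ℝ)
        ring
      · change _ = (0 : ℝ)
        linear_combination h1
      · change _ = (0 : ℝ)
        linear_combination h2
    have := (PointTransformation.fderiv_bijective hz).1 (h3.trans (map_zero _).symm)
    simp only [Prod.mk_eq_zero] at this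
    exact ⟨this.1.2, this.2⟩
  obtain ⟨e1, e2⟩ := inj (pu φ.U z) (-px φ.U z) (by linear_combination h0) (by ring)
  obtain ⟨e3, e4⟩ := inj (pu φ.X z) (-px φ.X z) (by ring) (by linear_combination -h0)
  have e2' : px φ.U z = 0 := by linear_combination -e2
  have e4' : px φ.X z = 0 := by linear_combination -e4
  exact one_ne_zero (inj 1 0 (by rw [e4']; ring) (by rw [e2']; ring)).1

lemma Relates.T_t_ne (h : Relates φ E E') (hz : z ∈ φ.source) : pt φ.T z ≠ 0 := by
  obtain ⟨hTx, hTu⟩ := h.T_vanish hz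
  intro h0
  exact minors_ne hz ⟨by rw [h0, hTx]; ring, by rw [hTu, hTx]; ring, by rw [h0, hTu]; ring⟩

/-- Raising `u_xx` by `1` and `u_t` by `A2` stays on `E`, so the induced increments of `g_t` and
`g_xx` must balance in `E'`. Here `b` is an arbitrary value of `u_x`, which leaves room to show that
`X_u = 0`. -/
lemma Relates.A2_jet (h : Relates φ E E') (hz : z ∈ φ.source) (b : ℝ)
    (hD : px φ.X z + pu φ.X z * b ≠ 0) :
    E.A2 z.1 * (px φ.X z + pu φ.X z * b) ^ 2 = E'.A2 (φ z).1 * pt φ.T z := by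
  set a := E.A1 z.1 * b - E.C z.1 * z.2 * b with ha
  obtain ⟨gt, gx, gxx, e1, e2, e3, e4⟩ := h.jet_image hz a b 0 hD
  obtain ⟨gt', gx', gxx', e1', e2', e3', e4'⟩ := h.jet_image hz (a + E.A2 z.1) b 1 hD
  have f1 := e4.1 (by rw [ha]; ring)
  have f2 := e4'.1 (by rw [ha]; ring)
  have hx : gx' = gx := mul_right_cancel₀ hD (e1'.trans e1.symm)
  rw [hx] at e2' e3' f2
  -- Up to the factor `X_x + X_u b` this is the determinant of the `(x,u)`-block.
  have hκ : pu φ.U z - gx * pu φ.X z ≠ 0 := by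
    intro h0
    refine h.fiber_det_ne hz ?_
    linear_combination (px φ.X z + pu φ.X z * b) * h0 + pu φ.X z * e1
  refine mul_left_cancel₀ hκ ?_
  linear_combination pt φ.T z * (px φ.X z + pu φ.X z * b) ^ 2 * (f2 - f1)
    - (px φ.X z + pu φ.X z * b) ^ 2 * (e2' - e2) + E'.A2 (φ z).1 * pt φ.T z * (e3' - e3)

/-- The new space variable does not depend on `u`. -/
lemma Relates.X_vanish (h : Relates φ E E') (hz : z ∈ φ.source) : pu φ.X z = 0 := by
  by_contra h0
  -- The two slopes make `X_x + X_u b` equal to `1` and to `2`. The right side of `A2_jet` does not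
  -- depend on the slope, so `A2 = 4 A2`.
  have h1 := h.A2_jet hz ((1 - px φ.X z) / pu φ.X z) (by field_simp; simp)
  have h2 := h.A2_jet hz ((2 - px φ.X z) / pu φ.X z) (by field_simp; simp)
  have k : ∀ s : ℝ, px φ.X z + pu φ.X z * ((s - px φ.X z) / pu φ.X z) = s := by
    intro s; field_simp; ring
  rw [k] at h1 h2
  exact E.A2_ne z.1 (h.1 hz).1 (by linear_combination (h2 - h1) / 3)

lemma Relates.X_x_ne (h : Relates φ E E') (hz : z ∈ φ.source) : px φ.X z ≠ 0 := by
  intro h0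
  exact h.fiber_det_ne hz (by rw [h0, h.X_vanish hz]; ring)

lemma Relates.U_u_ne (h : Relates φ E E') (hz : z ∈ φ.source) : pu φ.U z ≠ 0 := by
  intro h0
  exact h.fiber_det_ne hz (by rw [h0, h.X_vanish hz]; ring)

lemma Relates.eq_A2 (h : Relates φ E E') (hz : z ∈ φ.source) :
    E.A2 z.1 * px φ.X z ^ 2 = E'.A2 (φ z).1 * pt φ.T z := by
  have := h.A2_jet hz 0 (by simpa using h.X_x_ne hz)
  simpa using this

lemma dir_vanish_of_eventually {V : Type*} [NormedAddCommGroup V] [NormedSpace ℝ V] {v : V}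
    {f : V → ℝ} {q : V} (h : ∀ᶠ r in 𝓝 q, f r = 0) : dir v f q = 0 :=
  (dir_congr (g := fun _ => 0) h).trans (dir_const 0)

/-- The determining equations of the point transformations relating two equations. -/
lemma Relates.determining (h : Relates φ E E') (hz : z ∈ φ.source) :
    pu (pu φ.U) z = 0 ∧
    pu φ.U z * (E.A1 z.1 - E.C z.1 * z.2) * px φ.X z - pu φ.U z * pt φ.X z
        + pt φ.T z * E'.C (φ z).1 * φ.U z * pu φ.U z
      = E.A2 z.1 * (2 * px (pu φ.U) z * px φ.X z - pu φ.U z * px (px φ.X) z)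
        + pt φ.T z * E'.A1 (φ z).1 * pu φ.U z ∧
    pt φ.U z * px φ.X z - px φ.U z * pt φ.X z
        + pt φ.T z * E'.C (φ z).1 * φ.U z * px φ.U z
      = E.A2 z.1 * (px (px φ.U) z * px φ.X z - px φ.U z * px (px φ.X) z)
        + pt φ.T z * E'.A1 (φ z).1 * px φ.U z := by
  have hX0 : ∀ᶠ y in 𝓝 z, pu φ.X y = 0 := by
    filter_upwards [φ.open_source.mem_nhds hz] with y hy using h.X_vanish hy
  have hXu := hX0.self_of_nhds
  have hXuu : pu (pu φ.X) z = 0 := dir_vanish_of_eventually hX0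
  have hXxu : px (pu φ.X) z = 0 := dir_vanish_of_eventually hX0
  have hXx := h.X_x_ne hz
  have hA := h.eq_A2 hz
  have hA2 := E.A2_ne z.1 (h.1 hz).1
  have hU : φ.U z = (φ z).2 := rfl
  -- On jets with `u_xx = 0`, where `u_t = (A1 - C u) b`, the equation `E'` becomes a quadratic
  -- polynomial in `b = u_x`. Its coefficients are the three claims, extracted from `b = 0, 1, -1`.
  have key : ∀ b : ℝ,
      (pt φ.U z + pu φ.U z * (E.A1 z.1 - E.C z.1 * z.2) * b) * px φ.X z
        - (px φ.U z + pu φ.U z * b) * pt φ.X z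
        + pt φ.T z * E'.C (φ z).1 * φ.U z * (px φ.U z + pu φ.U z * b)
      = E.A2 z.1 * ((px (px φ.U) z + 2 * px (pu φ.U) z * b + pu (pu φ.U) z * b ^ 2) * px φ.X z
          - (px φ.U z + pu φ.U z * b) * px (px φ.X) z)
        + pt φ.T z * E'.A1 (φ z).1 * (px φ.U z + pu φ.U z * b) := by
    intro b
    obtain ⟨gt, gx, gxx, e1, e2, e3, e4⟩ := h.jet_image hz ((E.A1 z.1 - E.C z.1 * z.2) * b) b 0
      (by rw [hXu, zero_mul, add_zero]; exact hXx)
    have f1 := e4.1 (by ring)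
    rw [hXu] at e1 e2 e3
    rw [hXuu, hXxu] at e3
    rw [hU, ← sub_eq_zero]
    linear_combination (-px φ.X z) * e2 + (pt φ.X z + pt φ.T z * (-E'.C (φ z).1 * (φ z).2 + E'.A1 (φ z).1) - E.A2 z.1 * px (px φ.X) z) * e1
      + pt φ.T z * px φ.X z * f1 + E.A2 z.1 * px φ.X z * e3 - px φ.X z * gxx * hA
  have k0 := key 0
  have k1 := key 1
  have k2 := key (-1)
  refine ⟨?_, ?_, ?_⟩
  · have : E.A2 z.1 * px φ.X z * pu (pu φ.U) z = 0 := by linear_combination k0 - (k1 + k2) / 2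
    exact (mul_eq_zero.1 this).resolve_left (mul_ne_zero hA2 hXx)
  · linear_combination (k1 - k2) / 2
  · linear_combination k0

end Structure

section Affine

variable {K : Space → ℝ} {k₁ k₀ : Base → ℝ} {y : Space}

lemma dir_affine (v : Base) (hk₁ : DifferentiableAt ℝ k₁ y.1) (hk₀ : DifferentiableAt ℝ k₀ y.1) :
    dir ((v, 0) : Space) (fun w : Space => k₁ w.1 * w.2 + k₀ w.1) y
      = dir v k₁ y.1 * y.2 + dir v k₀ y.1 := by
  have h1 : HasFDerivAt (fun w : Space => k₁ w.1)
      ((fderiv ℝ k₁ y.1).comp (ContinuousLinearMap.fst ℝ Base ℝ)) y :=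
    hk₁.hasFDerivAt.comp y hasFDerivAt_fst
  have h0 : HasFDerivAt (fun w : Space => k₀ w.1)
      ((fderiv ℝ k₀ y.1).comp (ContinuousLinearMap.fst ℝ Base ℝ)) y :=
    hk₀.hasFDerivAt.comp y hasFDerivAt_fst
  have h2 : HasFDerivAt (fun w : Space => w.2) (ContinuousLinearMap.snd ℝ Base ℝ) y :=
    hasFDerivAt_snd
  have := (h1.fun_mul h2).fun_add h0
  simp only [dir]
  rw [this.fderiv]
  simp; ring

lemma pu_affine (hk₁ : DifferentiableAt ℝ k₁ y.1) (hk₀ : DifferentiableAt ℝ k₀ y.1) :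
    pu (fun w : Space => k₁ w.1 * w.2 + k₀ w.1) y = k₁ y.1 := by
  have h1 : HasFDerivAt (fun w : Space => k₁ w.1)
      ((fderiv ℝ k₁ y.1).comp (ContinuousLinearMap.fst ℝ Base ℝ)) y :=
    hk₁.hasFDerivAt.comp y hasFDerivAt_fst
  have h0 : HasFDerivAt (fun w : Space => k₀ w.1)
      ((fderiv ℝ k₀ y.1).comp (ContinuousLinearMap.fst ℝ Base ℝ)) y :=
    hk₀.hasFDerivAt.comp y hasFDerivAt_fst
  have h2 : HasFDerivAt (fun w : Space => w.2) (ContinuousLinearMap.snd ℝ Base ℝ) y :=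
    hasFDerivAt_snd
  have := (h1.fun_mul h2).fun_add h0
  simp only [pu, dir]
  rw [this.fderiv]
  simp

lemma dir_affine_eventually (v : Base) (hK : K =ᶠ[𝓝 y] fun w => k₁ w.1 * w.2 + k₀ w.1)
    (hk₁ : ContDiffAt ℝ ∞ k₁ y.1) (hk₀ : ContDiffAt ℝ ∞ k₀ y.1) :
    dir ((v, 0) : Space) K =ᶠ[𝓝 y] fun w => dir v k₁ w.1 * w.2 + dir v k₀ w.1 := by
  have hc : Filter.Tendsto Prod.fst (𝓝 y) (𝓝 y.1) := continuousAt_fst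
  filter_upwards [hK.eventuallyEq_nhds, hc.eventually (eventually_diffAt hk₁),
    hc.eventually (eventually_diffAt hk₀)] with w h1 h2 h3
  rw [dir_congr h1, dir_affine v h2 h3]

lemma pu_affine_eventually (hK : K =ᶠ[𝓝 y] fun w => k₁ w.1 * w.2 + k₀ w.1)
    (hk₁ : ContDiffAt ℝ ∞ k₁ y.1) (hk₀ : ContDiffAt ℝ ∞ k₀ y.1) :
    pu K =ᶠ[𝓝 y] fun w => 0 * w.2 + k₁ w.1 := by
  have hc : Filter.Tendsto Prod.fst (𝓝 y) (𝓝 y.1) := continuousAt_fst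
  filter_upwards [hK.eventuallyEq_nhds, hc.eventually (eventually_diffAt hk₁),
    hc.eventually (eventually_diffAt hk₀)] with w h1 h2 h3
  have := (dir_congr (v := (0, 1)) h1).trans (pu_affine h2 h3)
  rw [zero_mul, zero_add]
  exact this

end Affine

/-- A function with vanishing `u`-derivative on an interval does not depend on `u`. -/
lemma eq_of_pu_eq_zero {H : Space → ℝ} {q : Base} {u₀ ε : ℝ} (hε : 0 < ε)
    (hd : ∀ s ∈ Metric.ball u₀ ε, DifferentiableAt ℝ H (q, s))
    (h0 : ∀ s ∈ Metric.ball u₀ ε, pu H (q, s) = 0) :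
    ∀ s ∈ Metric.ball u₀ ε, H (q, s) = H (q, u₀) := by
  have hder : ∀ s ∈ Metric.ball u₀ ε, HasDerivAt (fun s => H (q, s)) 0 s := by
    intro s hs
    have h1 : HasDerivAt (fun s : ℝ => ((q, s) : Space)) ((0, 1) : Space) s :=
      (hasDerivAt_const s q).prodMk (hasDerivAt_id s)
    have := (hd s hs).hasFDerivAt.comp_hasDerivAt s h1
    rw [← h0 s hs]
    exact this
  intro s hs
  exact Metric.isOpen_ball.is_const_of_deriv_eq_zero
    (convex_ball u₀ ε).isPreconnected
    (fun r hr => (hder r hr).differentiableAt.differentiableWithinAt)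
    (fun r hr => (hder r hr).deriv) hs (Metric.mem_ball_self hε)

/-- Point transformations relating two equations are, locally, affine in `u`, projectable to the
`(t,x)`-plane and to the `t`-line, and intertwine the operators. -/
theorem Relates.exists_intertwines {φ : PointTransformation Space} {E E' : Eqn} {z : Space}
    (h : Relates φ E E') (hz : z ∈ φ.source) :
    ∃ T X U₁ U₀ : Base → ℝ, (∀ᶠ q in 𝓝 z.1, Intertwines E E' T X U₁ U₀ q) ∧
      ∀ᶠ y in 𝓝 z, AffineForm φ T X U₁ U₀ y := by
  -- On a product ball, vanishing `u`-derivatives mean independence of `u`, and everything can be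
  -- read off at the height `u₀`.
  obtain ⟨ε, hε, hball⟩ := Metric.isOpen_iff.1 φ.open_source z hz
  rw [← ball_prod_same] at hball
  set u₀ := z.2 with hu₀
  have hsrc : ∀ q ∈ Metric.ball z.1 ε, ∀ s ∈ Metric.ball u₀ ε, (q, s) ∈ φ.source :=
    fun q hq s hs => hball ⟨hq, hs⟩
  have hu : u₀ ∈ Metric.ball u₀ ε := Metric.mem_ball_self hε
  set T : Base → ℝ := fun q => φ.T (q, u₀) with hT
  set X : Base → ℝ := fun q => φ.X (q, u₀) with hX
  set U₁ : Base → ℝ := fun q => pu φ.U (q, u₀) with hU₁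
  set U₀ : Base → ℝ := fun q => φ.U (q, u₀) - u₀ * pu φ.U (q, u₀) with hU₀
  have hin : ∀ q, ContDiffAt ℝ ∞ (fun q : Base => (q, u₀)) q :=
    fun q => contDiffAt_id.prodMk contDiffAt_const
  have cT : ∀ q ∈ Metric.ball z.1 ε, ContDiffAt ℝ ∞ T q := fun q hq =>
    ContDiffAt.comp (f := fun q : Base => (q, u₀)) q
      (PointTransformation.contDiffAt_T (hsrc q hq u₀ hu)) (hin q)
  have cX : ∀ q ∈ Metric.ball z.1 ε, ContDiffAt ℝ ∞ X q := fun q hq =>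
    ContDiffAt.comp (f := fun q : Base => (q, u₀)) q
      (PointTransformation.contDiffAt_X (hsrc q hq u₀ hu)) (hin q)
  have cU₁ : ∀ q ∈ Metric.ball z.1 ε, ContDiffAt ℝ ∞ U₁ q := fun q hq =>
    ContDiffAt.comp (f := fun q : Base => (q, u₀)) q
      (contDiffAt_dir (PointTransformation.contDiffAt_U (hsrc q hq u₀ hu))) (hin q)
  have cU₀ : ∀ q ∈ Metric.ball z.1 ε, ContDiffAt ℝ ∞ U₀ q := fun q hq =>
    (ContDiffAt.comp (f := fun q : Base => (q, u₀)) q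
      (PointTransformation.contDiffAt_U (hsrc q hq u₀ hu)) (hin q)).sub
      (contDiffAt_const.mul (cU₁ q hq))
  have eT : ∀ q ∈ Metric.ball z.1 ε, ∀ s ∈ Metric.ball u₀ ε, φ.T (q, s) = T q := fun q hq =>
    eq_of_pu_eq_zero hε
      (fun s hs => diffAt_of_smooth (PointTransformation.contDiffAt_T (hsrc q hq s hs)))
      (fun s hs => (h.T_vanish (hsrc q hq s hs)).2)
  have eX : ∀ q ∈ Metric.ball z.1 ε, ∀ s ∈ Metric.ball u₀ ε, φ.X (q, s) = X q := fun q hq =>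
    eq_of_pu_eq_zero hε
      (fun s hs => diffAt_of_smooth (PointTransformation.contDiffAt_X (hsrc q hq s hs)))
      (fun s hs => h.X_vanish (hsrc q hq s hs))
  have eU₁ : ∀ q ∈ Metric.ball z.1 ε, ∀ s ∈ Metric.ball u₀ ε, pu φ.U (q, s) = U₁ q := fun q hq =>
    eq_of_pu_eq_zero hε
      (fun s hs => diffAt_of_smooth
        (contDiffAt_dir (PointTransformation.contDiffAt_U (hsrc q hq s hs))))
      (fun s hs => (h.determining (hsrc q hq s hs)).1)
  have eU : ∀ q ∈ Metric.ball z.1 ε, ∀ s ∈ Metric.ball u₀ ε,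
      φ.U (q, s) = U₁ q * s + U₀ q := by
    intro q hq s hs
    have hd2 : ∀ y : Space, DifferentiableAt ℝ (fun y : Space => y.2) y := fun y =>
      differentiableAt_snd
    have := eq_of_pu_eq_zero (H := fun y => φ.U y - y.2 * U₁ q) (q := q) hε
      (fun s hs => (diffAt_of_smooth (PointTransformation.contDiffAt_U (hsrc q hq s hs))).sub
        ((hd2 _).mul_const _))
      (fun s hs => by
        have e1 : pu (fun y : Space => y.2 * U₁ q) (q, s) = U₁ q := by
          simp only [pu, dir]
          rw [((hasFDerivAt_snd (𝕜 := ℝ) (p := ((q, s) : Space))).mul_const (U₁ q)).fderiv]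
          simp
        have e2 := dir_sub (v := ((0, 1) : Space))
          (diffAt_of_smooth (PointTransformation.contDiffAt_U (hsrc q hq s hs)))
          ((hd2 (q, s)).mul_const (U₁ q))
        change pu _ _ = pu φ.U (q, s) - pu _ _ at e2
        rw [e2, e1, eU₁ q hq s hs, sub_self]) s hs
    simp only at this
    simp only [hU₀]
    linear_combination this
  have hform : ∀ q ∈ Metric.ball z.1 ε, ∀ s ∈ Metric.ball u₀ ε,
      ∀ᶠ y in 𝓝 (q, s), AffineForm φ T X U₁ U₀ y := by
    intro q hq s hs
    filter_upwards [(Metric.isOpen_ball.prod Metric.isOpen_ball).mem_nhds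
      (show (q, s) ∈ Metric.ball z.1 ε ×ˢ Metric.ball u₀ ε from ⟨hq, hs⟩)] with y hy
    refine Prod.ext (Prod.ext ?_ ?_) ?_
    · exact eT y.1 hy.1 y.2 hy.2
    · exact eX y.1 hy.1 y.2 hy.2
    · exact eU y.1 hy.1 y.2 hy.2
  have slice : ∀ {H : Space → ℝ} (v : Base) {q : Base}, DifferentiableAt ℝ H (q, u₀) →
      dir v (fun r => H (r, u₀)) q = dir (v, 0) H (q, u₀) := by
    intro H v q hH
    have := dir_graph (v := v) (f := fun _ => u₀) hH (differentiableAt_const _)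
    rw [this, dir_const, mul_zero, add_zero]
  have hTx : ∀ q ∈ Metric.ball z.1 ε, pdx T q = 0 := fun q hq =>
    (slice (0, 1) (diffAt_of_smooth (PointTransformation.contDiffAt_T (hsrc q hq u₀ hu)))).trans
      (h.T_vanish (hsrc q hq u₀ hu)).1
  have hTt : ∀ q ∈ Metric.ball z.1 ε, pdt T q ≠ 0 := fun q hq => by
    have e : pdt T q = pt φ.T (q, u₀) :=
      slice (1, 0) (diffAt_of_smooth (PointTransformation.contDiffAt_T (hsrc q hq u₀ hu)))
    rw [e]; exact h.T_t_ne (hsrc q hq u₀ hu)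
  have hXx : ∀ q ∈ Metric.ball z.1 ε, pdx X q ≠ 0 := fun q hq => by
    have e : pdx X q = px φ.X (q, u₀) :=
      slice (0, 1) (diffAt_of_smooth (PointTransformation.contDiffAt_X (hsrc q hq u₀ hu)))
    rw [e]; exact h.X_x_ne (hsrc q hq u₀ hu)
  have hU₁ne : ∀ q ∈ Metric.ball z.1 ε, U₁ q ≠ 0 := fun q hq => h.U_u_ne (hsrc q hq u₀ hu)
  have hall : ∀ q ∈ Metric.ball z.1 ε,
      E'.A2 (T q, X q) * pdt T q = E.A2 q * pdx X q ^ 2 ∧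
      E.C q * pdx X q = pdt T q * E'.C (T q, X q) * U₁ q ∧
      pdx U₁ q = 0 ∧
      pdt T q * E'.A1 (T q, X q) = pdx X q * E.A1 q + E.A2 q * pdx (pdx X) q - pdt X q
        + pdt T q * E'.C (T q, X q) * U₀ q ∧
      pdt U₁ q + E.C q * pdx U₀ q = E.A2 q * pdx (pdx U₁) q ∧
      pdt U₀ q = E.A2 q * pdx (pdx U₀) q + E.A1 q * pdx U₀ q := by
    intro q hq
    have hq0 := hsrc q hq u₀ hu
    have c0 : ContDiffAt ℝ ∞ (fun _ : Base => (0 : ℝ)) q := contDiffAt_const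
    have d0 : ∀ v : Base, dir v (fun _ : Base => (0 : ℝ)) = fun _ => 0 := fun v => by
      funext r; exact dir_const 0
    have kT : ∀ s ∈ Metric.ball u₀ ε, φ.T =ᶠ[𝓝 (q, s)] fun w => (fun _ => 0) w.1 * w.2 + T w.1 :=
      fun s hs => by
        filter_upwards [hform q hq s hs] with w hw
        simp only [zero_mul, zero_add]
        exact congrArg (fun a => a.1.1) hw
    have kX : ∀ s ∈ Metric.ball u₀ ε, φ.X =ᶠ[𝓝 (q, s)] fun w => (fun _ => 0) w.1 * w.2 + X w.1 :=
      fun s hs => by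
        filter_upwards [hform q hq s hs] with w hw
        simp only [zero_mul, zero_add]
        exact congrArg (fun a => a.1.2) hw
    have kU : ∀ s ∈ Metric.ball u₀ ε, φ.U =ᶠ[𝓝 (q, s)] fun w => U₁ w.1 * w.2 + U₀ w.1 :=
      fun s hs => by
        filter_upwards [hform q hq s hs] with w hw
        exact congrArg (fun a => a.2) hw
    have pT : ∀ v : Base, ∀ s ∈ Metric.ball u₀ ε, dir (v, 0) φ.T (q, s) = dir v T q := by
      intro v s hs
      have := (dir_affine_eventually v (y := (q, s)) (kT s hs) c0 (cT q hq)).self_of_nhds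
      rw [this, d0]; simp
    have pX : ∀ v : Base, ∀ s ∈ Metric.ball u₀ ε, dir (v, 0) φ.X (q, s) = dir v X q := by
      intro v s hs
      have := (dir_affine_eventually v (y := (q, s)) (kX s hs) c0 (cX q hq)).self_of_nhds
      rw [this, d0]; simp
    have pXxx : ∀ s ∈ Metric.ball u₀ ε, px (px φ.X) (q, s) = pdx (pdx X) q := by
      intro s hs
      have h1 := dir_affine_eventually (0, 1) (y := (q, s)) (kX s hs) c0 (cX q hq)
      rw [d0] at h1
      have := (dir_affine_eventually (y := (q, s)) (0, 1) h1 c0 (contDiffAt_dir (cX q hq))).self_of_nhds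
      rw [d0] at this
      change dir _ (dir _ _) _ = _
      rw [this]; simp [pdx_eq_dir]
    have pU : ∀ v : Base, ∀ s ∈ Metric.ball u₀ ε,
        dir (v, 0) φ.U (q, s) = dir v U₁ q * s + dir v U₀ q := fun v s hs =>
      (dir_affine_eventually v (kU s hs) (cU₁ q hq) (cU₀ q hq)).self_of_nhds
    have pUxx : ∀ s ∈ Metric.ball u₀ ε,
        px (px φ.U) (q, s) = pdx (pdx U₁) q * s + pdx (pdx U₀) q := by
      intro s hs
      have h1 := dir_affine_eventually (0, 1) (kU s hs) (cU₁ q hq) (cU₀ q hq)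
      exact (dir_affine_eventually (y := (q, s)) (0, 1) h1 (contDiffAt_dir (cU₁ q hq))
        (contDiffAt_dir (cU₀ q hq))).self_of_nhds
    have pUu : ∀ s ∈ Metric.ball u₀ ε, px (pu φ.U) (q, s) = pdx U₁ q := by
      intro s hs
      have h1 := pu_affine_eventually (kU s hs) (cU₁ q hq) (cU₀ q hq)
      have := (dir_affine_eventually (y := (q, s)) (k₁ := fun _ => 0) (0, 1) h1 c0 (cU₁ q hq)).self_of_nhds
      rw [d0] at this
      change dir _ (pu _) _ = _
      rw [this]; simp [pdx_eq_dir]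
    have hB : ∀ s ∈ Metric.ball u₀ ε, (φ (q, s)).1 = (T q, X q) := fun s hs => by
      have : φ (q, s) = _ := (hform q hq s hs).self_of_nhds
      rw [this]
    have b1 : ∀ s ∈ Metric.ball u₀ ε,
        U₁ q * (E.A1 q - E.C q * s) * pdx X q - U₁ q * pdt X q
          + pdt T q * E'.C (T q, X q) * (U₁ q * s + U₀ q) * U₁ q
        = E.A2 q * (2 * pdx U₁ q * pdx X q - U₁ q * pdx (pdx X) q)
          + pdt T q * E'.A1 (T q, X q) * U₁ q := by
      intro s hs
      have := (h.determining (hsrc q hq s hs)).2.1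
      rwa [hB s hs, show px φ.X (q, s) = pdx X q from pX (0, 1) s hs,
        show pt φ.X (q, s) = pdt X q from pX (1, 0) s hs,
        show pt φ.T (q, s) = pdt T q from pT (1, 0) s hs, pXxx s hs, pUu s hs, eU q hq s hs,
        eU₁ q hq s hs] at this
    have b0 : ∀ s ∈ Metric.ball u₀ ε,
        (pdt U₁ q * s + pdt U₀ q) * pdx X q - (pdx U₁ q * s + pdx U₀ q) * pdt X q
          + pdt T q * E'.C (T q, X q) * (U₁ q * s + U₀ q) * (pdx U₁ q * s + pdx U₀ q)
        = E.A2 q * ((pdx (pdx U₁) q * s + pdx (pdx U₀) q) * pdx X q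
            - (pdx U₁ q * s + pdx U₀ q) * pdx (pdx X) q)
          + pdt T q * E'.A1 (T q, X q) * (pdx U₁ q * s + pdx U₀ q) := by
      intro s hs
      have := (h.determining (hsrc q hq s hs)).2.2
      rwa [hB s hs, show px φ.X (q, s) = pdx X q from pX (0, 1) s hs,
        show pt φ.X (q, s) = pdt X q from pX (1, 0) s hs,
        show px φ.U (q, s) = pdx U₁ q * s + pdx U₀ q from pU (0, 1) s hs,
        show pt φ.U (q, s) = pdt U₁ q * s + pdt U₀ q from pU (1, 0) s hs,
        show pt φ.T (q, s) = pdt T q from pT (1, 0) s hs, pXxx s hs, pUxx s hs,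
        eU q hq s hs] at this
    have eqA2 := h.eq_A2 hq0
    rw [hB _ hu, show px φ.X (q, u₀) = pdx X q from pX (0, 1) u₀ hu,
      show pt φ.T (q, u₀) = pdt T q from pT (1, 0) u₀ hu] at eqA2
    -- The relations `b1` and `b0` are polynomials in `s` of degree at most one and two. The three
    -- heights `u₀` and `u₀ ± ε / 2` separate their coefficients.
    have hp : u₀ + ε / 2 ∈ Metric.ball u₀ ε := by
      rw [Metric.mem_ball, Real.dist_eq, add_sub_cancel_left, abs_of_pos (by positivity)]
      linarith
    have hm : u₀ - ε / 2 ∈ Metric.ball u₀ ε := by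
      rw [Metric.mem_ball, Real.dist_eq, sub_sub_cancel_left, abs_neg, abs_of_pos (by positivity)]
      linarith
    have hX' := hXx q hq
    have hU' := hU₁ne q hq
    have hE : E.C q ≠ 0 := E.C_ne q (h.1 hq0).1
    have eqC : E.C q * pdx X q = pdt T q * E'.C (T q, X q) * U₁ q := by
      have := b1 _ hp
      have h2 := b1 _ hu
      refine mul_left_cancel₀ (mul_ne_zero hε.ne' hU') ?_
      linear_combination 2 * h2 - 2 * this
    have eqA1 := b1 _ hu
    -- The second difference of `b0` isolates the coefficient of `s²`, which equals `C X_x U₁_x` in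
    -- view of `eqC`.
    have hU₁x : pdx U₁ q = 0 := by
      have e : ε ^ 2 * (E.C q * pdx X q) * pdx U₁ q = 0 := by
        linear_combination 2 * (b0 _ hp + b0 _ hm - 2 * b0 _ hu) + ε ^ 2 * pdx U₁ q * eqC
      exact (mul_eq_zero.1 e).resolve_left
        (mul_ne_zero (pow_ne_zero 2 hε.ne') (mul_ne_zero hE hX'))
    have c1 := b0 _ hp
    have c2 := b0 _ hu
    rw [hU₁x] at eqA1 c1 c2
    have eqA1' : pdt T q * E'.A1 (T q, X q) = pdx X q * E.A1 q + E.A2 q * pdx (pdx X) q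
        - pdt X q + pdt T q * E'.C (T q, X q) * U₀ q := by
      refine mul_left_cancel₀ hU' ?_
      linear_combination -eqA1 - U₁ q * u₀ * eqC
    have eqU₁ : pdt U₁ q + E.C q * pdx U₀ q = E.A2 q * pdx (pdx U₁) q := by
      refine mul_left_cancel₀ (mul_ne_zero hε.ne' hX') ?_
      linear_combination 2 * c1 - 2 * c2 + ε * pdx U₀ q * eqC
    refine ⟨eqA2.symm, eqC, hU₁x, eqA1', eqU₁, ?_⟩
    refine mul_left_cancel₀ hX' ?_
    linear_combination c2 - u₀ * pdx X q * eqU₁ + u₀ * pdx U₀ q * eqC + pdx U₀ q * eqA1'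
  refine ⟨T, X, U₁, U₀, ?_, hform z.1 (Metric.mem_ball_self hε) u₀ hu⟩
  filter_upwards [Metric.ball_mem_nhds z.1 hε] with q hq
  have hnear : ∀ᶠ r in 𝓝 q, r ∈ Metric.ball z.1 ε := Metric.isOpen_ball.mem_nhds hq
  obtain ⟨h1, h2, h3, h4, h5, h6⟩ := hall q hq
  have hU₁x : ∀ᶠ r in 𝓝 q, pdx U₁ r = 0 := hnear.mono fun r hr => (hall r hr).2.2.1
  exact ⟨cT q hq, cX q hq, cU₁ q hq, cU₀ q hq, hnear.mono hTx, hU₁x, hTt q hq, hXx q hq,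
    hU₁ne q hq, h1, h2, h4, by
      rw [h5, show pdx (pdx U₁) q = 0 from dir_vanish_of_eventually hU₁x, mul_zero], h6⟩

/-! ## The groupoid operations -/

lemma Intertwines.holds_iff {E E' : Eqn} {T X U₁ U₀ : Base → ℝ} {q : Base}
    (h : Intertwines E E' T X U₁ U₀ q) {f g : Base → ℝ}
    (hf : ContDiffAt ℝ ∞ f q) (hg : ContDiffAt ℝ ∞ g (T q, X q))
    (hfg : (fun r => g (T r, X r)) =ᶠ[𝓝 q] fun r => U₁ r * f r + U₀ r) :
    E.HoldsAt f q ↔ E'.HoldsAt g (T q, X q) := by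
  have key := h.op_eq (two_of_smooth hf) (two_of_smooth hg) hfg
  rw [E.holdsAt_iff, E'.holdsAt_iff]
  constructor
  · intro h0
    rw [h0, mul_zero] at key
    exact (mul_eq_zero.1 key).resolve_left h.T_t
  · intro h0
    rw [h0, mul_zero] at key
    exact (mul_eq_zero.1 key.symm).resolve_left h.U₁_ne

lemma Intertwines.tendsto_base {E E' : Eqn} {T X U₁ U₀ : Base → ℝ} {q : Base}
    (h : Intertwines E E' T X U₁ U₀ q) :
    Filter.Tendsto (fun r => (T r, X r)) (𝓝 q) (𝓝 (T q, X q)) :=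
  h.smooth_T.continuousAt.prodMk h.smooth_X.continuousAt

lemma Intertwines.exists_inverse {E E' : Eqn} {T X U₁ U₀ : Base → ℝ} {q : Base}
    (h : Intertwines E E' T X U₁ U₀ q) :
    ∃ G : Base → Base, ContDiffAt ℝ ∞ G (T q, X q) ∧ G (T q, X q) = q ∧
      (∀ᶠ r in 𝓝 q, G (T r, X r) = r) ∧ ∀ᶠ r in 𝓝 (T q, X q), (T (G r), X (G r)) = r :=
  exists_local_inverse h.smooth_T h.smooth_X h.T_x.self_of_nhds h.T_t h.X_x

/-- The inverse transformation relates the equations in the opposite direction. -/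
lemma Intertwines.carriesAt_inv {φ : PointTransformation Space} {E E' : Eqn}
    {T X U₁ U₀ : Base → ℝ} {z : Space} (hz : z ∈ φ.source)
    (h : Intertwines E E' T X U₁ U₀ z.1) (hφ : ∀ᶠ y in 𝓝 z, AffineForm φ T X U₁ U₀ y) :
    CarriesAt φ.inv E' E (φ z) := by
  intro f g hf hfz hg hfg _
  have hinv : φ.inv (φ z) = z := φ.left_inv hz
  rw [hinv] at hg ⊢
  have hφz : φ z = _ := hφ.self_of_nhds
  have hφz1 : (φ z).1 = (T z.1, X z.1) := by rw [hφz]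
  obtain ⟨G, -, -, hG, -⟩ := h.exists_inverse
  rw [hφz1] at hf hfz hfg ⊢
  refine (h.holds_iff hg hf ?_).symm
  have hB := h.tendsto_base
  have hgr : Filter.Tendsto (fun r => (r, f r)) (𝓝 (T z.1, X z.1)) (𝓝 (φ z)) := by
    have := tendsto_graph (z := φ z) (f := f) (by rw [hφz1]; exact hf.continuousAt)
      (by rw [hφz1]; exact hfz)
    rwa [hφz1] at this
  have hs : Filter.Tendsto φ.inv (𝓝 (φ z)) (𝓝 z) := by
    have := (PointTransformation.contDiffAt (φ := φ.inv) (φ.map_source hz)).continuousAt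
    unfold ContinuousAt at this
    rwa [hinv] at this
  have hy := (hs.comp hgr).comp hB
  have h1 : Filter.Tendsto (fun y : Space => y.1) (𝓝 z) (𝓝 z.1) := continuousAt_fst
  filter_upwards [hB.eventually hfg, hy.eventually hφ, hG, (h1.comp hy).eventually hG,
    (hgr.comp hB).eventually (φ.open_target.mem_nhds (φ.map_source hz))]
    with q e1 e2 e3 e4 e5
  simp only [Function.comp] at e2 e4 e5
  set y := φ.inv ((T q, X q), f (T q, X q)) with hy'
  have e6 : φ y = ((T q, X q), f (T q, X q)) := φ.right_inv e5
  change φ y = _ at e2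
  rw [e6] at e2
  have e7 : (T q, X q) = (T y.1, X y.1) := congrArg Prod.fst e2
  have e8 : f (T q, X q) = U₁ y.1 * y.2 + U₀ y.1 := congrArg Prod.snd e2
  have e9 : y.1 = q := by rw [← e4, ← e7, e3]
  rw [e8, e1, e9]

/-- Reversing `CarriesAt` requires graphs to correspond to graphs in both directions; the affine
form supplies this. -/
lemma Relates.symm {φ : PointTransformation Space} {E E' : Eqn} (h : Relates φ E E') :
    Relates φ.inv E' E := by
  refine ⟨h.2.1, h.1, fun z hz => ?_⟩
  have hz' : φ.toOpenPartialHomeomorph.symm z ∈ φ.source := φ.map_target hz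
  obtain ⟨T, X, U₁, U₀, hI, hφ⟩ := h.exists_intertwines hz'
  have := hI.self_of_nhds.carriesAt_inv hz' hφ
  rwa [φ.right_inv hz] at this

/-- The composition of point transformations. -/
def PointTransformation.comp (φ ψ : PointTransformation Space) : PointTransformation Space where
  toOpenPartialHomeomorph := φ.toOpenPartialHomeomorph.trans ψ.toOpenPartialHomeomorph
  smooth := (ContDiffOn.comp_inter ψ.smooth φ.smooth).mono (by
    intro z hz
    rw [OpenPartialHomeomorph.trans_source] at hz
    exact hz)
  smooth_symm := (ContDiffOn.comp_inter φ.smooth_symm ψ.smooth_symm).mono (by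
    intro z hz
    rw [OpenPartialHomeomorph.trans_target] at hz
    exact hz)

lemma PointTransformation.mem_comp_source {φ ψ : PointTransformation Space} {z : Space} :
    z ∈ (φ.comp ψ).source ↔ z ∈ φ.source ∧ φ z ∈ ψ.source := by
  change z ∈ (φ.toOpenPartialHomeomorph.trans ψ.toOpenPartialHomeomorph).source ↔ _
  rw [OpenPartialHomeomorph.trans_source]; rfl

lemma PointTransformation.mem_comp_target {φ ψ : PointTransformation Space} {z : Space} :
    z ∈ (φ.comp ψ).target ↔ z ∈ ψ.target ∧ ψ.inv z ∈ φ.target := by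
  change z ∈ (φ.toOpenPartialHomeomorph.trans ψ.toOpenPartialHomeomorph).target ↔ _
  rw [OpenPartialHomeomorph.trans_target]; rfl

lemma Relates.trans {φ ψ : PointTransformation Space} {E E' E'' : Eqn} (h : Relates φ E E')
    (h' : Relates ψ E' E'') : Relates (φ.comp ψ) E E'' := by
  refine ⟨fun z hz => h.1 (PointTransformation.mem_comp_source.1 hz).1,
    fun z hz => h'.2.1 (PointTransformation.mem_comp_target.1 hz).1, fun z hz => ?_⟩
  obtain ⟨hz, hz'⟩ := PointTransformation.mem_comp_source.1 hz
  intro f g hf hfz hg hfg _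
  have hg : ContDiffAt ℝ ∞ g (ψ (φ z)).1 := hg
  change _ ↔ E''.HoldsAt g (ψ (φ z)).1
  obtain ⟨T, X, U₁, U₀, hI, hφ⟩ := h.exists_intertwines hz
  obtain ⟨T', X', U₁', U₀', hI', hψ⟩ := h'.exists_intertwines hz'
  have hI := hI.self_of_nhds
  have hI' := hI'.self_of_nhds
  have hφz : φ z = _ := hφ.self_of_nhds
  have hφz1 : (φ z).1 = (T z.1, X z.1) := by rw [hφz]
  have hψz : ψ (φ z) = _ := hψ.self_of_nhds
  have hψz1 : (ψ (φ z)).1 = (T' (φ z).1, X' (φ z).1) := by rw [hψz]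
  obtain ⟨G, hGs, hGz, hG, hG'⟩ := hI.exists_inverse
  -- The graph of `k ∘ G` is the image of the graph of `f` under `φ`. It is the intermediate
  -- function that links `E` to `E'` and `E'` to `E''`.
  set k : Base → ℝ := fun r => U₁ r * f r + U₀ r with hk
  have hks : ContDiffAt ℝ ∞ k z.1 := (hI.smooth_U₁.mul hf).add hI.smooth_U₀
  have hkG : ContDiffAt ℝ ∞ (fun r => k (G r)) (T z.1, X z.1) :=
    ContDiffAt.comp (T z.1, X z.1) (g := k) (by rw [hGz]; exact hks) hGs
  rw [hI.holds_iff hf hkG (hG.mono fun r hr => by simp only [hr, hk]), hψz1]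
  rw [← hφz1] at hkG ⊢ 
  refine hI'.holds_iff hkG (by rw [← hψz1]; exact hg) ?_
  have hGt : Filter.Tendsto G (𝓝 (φ z).1) (𝓝 z.1) := by
    have := hGs.continuousAt
    unfold ContinuousAt at this
    rwa [hGz, ← hφz1] at this
  have hgr := tendsto_graph hf.continuousAt hfz
  have hφc : Filter.Tendsto φ (𝓝 z) (𝓝 (φ z)) :=
    (PointTransformation.contDiffAt hz).continuousAt
  rw [← hφz1] at hG'
  filter_upwards [hG', hGt.eventually hfg, (hgr.comp hGt).eventually hφ,
    ((hφc.comp hgr).comp hGt).eventually hψ] with r e1 e2 e3 e4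
  simp only [Function.comp] at e3 e4
  have e3' : φ (G r, f (G r)) = (r, k (G r)) := by
    change φ _ = _ at e3
    rw [e3]
    simp only [e1, hk]
  rw [e3'] at e4
  change ψ _ = _ at e4
  change (ψ (φ (G r, f (G r)))).2 = g (ψ (φ (G r, f (G r)))).1 at e2
  rw [e3', e4] at e2
  exact e2.symm

/-- The restriction of a point transformation to an open set. -/
def PointTransformation.restrict {V : Type*} [NormedAddCommGroup V] [NormedSpace ℝ V]
    (φ : PointTransformation V) (s : Set V) (hs : IsOpen s) :
    PointTransformation V where
  toOpenPartialHomeomorph := φ.toOpenPartialHomeomorph.restrOpen s hs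
  smooth := φ.smooth.mono (by
    intro z hz
    rw [OpenPartialHomeomorph.restrOpen_source] at hz
    exact hz.1)
  smooth_symm := φ.smooth_symm.mono (by
    intro z hz
    exact hz.1)

lemma PointTransformation.restrict_source {V : Type*} [NormedAddCommGroup V] [NormedSpace ℝ V]
    (φ : PointTransformation V) (s : Set V) (hs : IsOpen s) :
    (φ.restrict s hs).source = φ.source ∩ s :=
  OpenPartialHomeomorph.restrOpen_source _ _ hs

/-! ## Equations on boxes -/

lemma ordConnected_time {s : Set Base} (hs : Convex ℝ s) : (Prod.fst '' s).OrdConnected :=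
  (hs.linear_image (LinearMap.fst ℝ ℝ ℝ)).ordConnected

lemma ordConnected_slice {s : Set Base} (hs : Convex ℝ s) (t : ℝ) :
    {x : ℝ | (t, x) ∈ s}.OrdConnected := by
  refine Convex.ordConnected (𝕜 := ℝ) fun x hx y hy a b ha hb hab => ?_
  have : ((t, a • x + b • y) : Base) = a • (t, x) + b • (t, y) := by
    ext
    · simp only [Prod.smul_mk, Prod.mk_add_mk, smul_eq_mul]; rw [← add_mul, hab, one_mul]
    · simp
  change (t, a • x + b • y) ∈ s
  rw [this]
  exact hs hx hy ha hb hab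

/-- An equation on a ball for the maximum norm. -/
def Eqn.onBall (p : Base) (r : ℝ) (hr : 0 < r) (A2 A1 C : Base → ℝ)
    (h2 : ContDiffOn ℝ ∞ A2 (Metric.ball p r)) (h1 : ContDiffOn ℝ ∞ A1 (Metric.ball p r))
    (hC : ContDiffOn ℝ ∞ C (Metric.ball p r)) (h2n : ∀ q ∈ Metric.ball p r, A2 q ≠ 0)
    (hCn : ∀ q ∈ Metric.ball p r, C q ≠ 0) : Eqn where
  dom := Metric.ball p r
  A2 := A2
  A1 := A1
  C := C
  dom_open := Metric.isOpen_ball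
  dom_nonempty := ⟨p, Metric.mem_ball_self hr⟩
  dom_time := ordConnected_time (convex_ball p r)
  dom_slice := ordConnected_slice (convex_ball p r)
  smooth_A2 := h2
  smooth_A1 := h1
  smooth_C := hC
  A2_ne := h2n
  C_ne := hCn

/-- The restriction of an equation to a ball. -/
def Eqn.restrictBall (E : Eqn) (p : Base) (r : ℝ) (hr : 0 < r) (h : Metric.ball p r ⊆ E.dom) :
    Eqn :=
  Eqn.onBall p r hr E.A2 E.A1 E.C (E.smooth_A2.mono h) (E.smooth_A1.mono h) (E.smooth_C.mono h)
    (fun q hq => E.A2_ne q (h hq)) (fun q hq => E.C_ne q (h hq))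

lemma exists_ball_of_eventually {p : Base} {P : Base → Prop} (h : ∀ᶠ q in 𝓝 p, P q) :
    ∃ r > 0, ∀ q ∈ Metric.ball p r, P q := by
  obtain ⟨r, hr, h⟩ := Metric.eventually_nhds_iff_ball.1 h
  exact ⟨r, hr, h⟩

/-- The local inverse of a smooth map of the `(t,x)`-plane is smooth. -/
lemma exists_smooth_inverse {T X : Base → ℝ} {q : Base}
    (h : ∀ᶠ r in 𝓝 q, ContDiffAt ℝ ∞ T r ∧ ContDiffAt ℝ ∞ X r ∧ pdx T r = 0 ∧ pdt T r ≠ 0 ∧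
      pdx X r ≠ 0) :
    ∃ G : Base → Base, (∀ᶠ r in 𝓝 (T q, X q), ContDiffAt ℝ ∞ G r) ∧ G (T q, X q) = q ∧
      (∀ᶠ r in 𝓝 q, G (T r, X r) = r) ∧ ∀ᶠ r in 𝓝 (T q, X q), (T (G r), X (G r)) = r := by
  obtain ⟨h1, h2, h3, h4, h5⟩ := h.self_of_nhds
  obtain ⟨G, hG, hGq, hl, hr⟩ := exists_local_inverse h1 h2 h3 h4 h5
  refine ⟨G, ?_, hGq, hl, hr⟩
  have hGt : Filter.Tendsto G (𝓝 (T q, X q)) (𝓝 q) := by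
    have := hG.continuousAt
    unfold ContinuousAt at this
    rwa [hGq] at this
  filter_upwards [hr, hGt.eventually h, hGt.eventually hl.eventually_nhds] with r' e1 e2 e3
  obtain ⟨k1, k2, k3, k4, k5⟩ := e2
  -- At a nearby point the inverse function theorem gives another, possibly different, inverse `G'`
  -- smooth there; `G` coincides with it near that point, being a left inverse.
  obtain ⟨G', hG', hGq', hl', hr'⟩ := exists_local_inverse k1 k2 k3 k4 k5
  rw [e1] at hG' hGq' hr'
  refine hG'.congr_of_eventuallyEq ?_
  have hGt' : Filter.Tendsto G' (𝓝 r') (𝓝 (G r')) := by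
    have := hG'.continuousAt
    unfold ContinuousAt at this
    rwa [hGq'] at this
  filter_upwards [hr', hGt'.eventually e3] with s f1 f2
  rw [← f2, f1]

/-! ## Elements of the equivalence groups -/

section Skew

variable {𝔸 : Type*} [NormedAddCommGroup 𝔸] [NormedSpace ℝ 𝔸]

/-- The extension of a point transformation of the space of variables to the arbitrary elements. -/
def PointTransformation.skew (φ : PointTransformation Space) (G G' : Base → 𝔸 → 𝔸)
    (hG : ContDiffOn ℝ ∞ (fun w : Space × 𝔸 => G w.1.1 w.2) (φ.source ×ˢ Set.univ))
    (hG' : ContDiffOn ℝ ∞ (fun w : Space × 𝔸 => G' w.1.1 w.2) (φ.source ×ˢ Set.univ))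
    (hl : ∀ y ∈ φ.source, ∀ a, G' y.1 (G y.1 a) = a)
    (hr : ∀ y ∈ φ.source, ∀ a, G y.1 (G' y.1 a) = a) : PointTransformation (Space × 𝔸) :=
  have s1 : ContDiffOn ℝ ∞ (fun w : Space × 𝔸 => (φ w.1, G w.1.1 w.2)) (φ.source ×ˢ Set.univ) :=
    (φ.smooth.comp contDiff_fst.contDiffOn fun _ hw => hw.1).prodMk hG
  have s2 : ContDiffOn ℝ ∞ (fun w : Space × 𝔸 => (φ.inv w.1, G' (φ.inv w.1).1 w.2))
      (φ.target ×ˢ Set.univ) := by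
    have h1 : ContDiffOn ℝ ∞ (fun w : Space × 𝔸 => φ.inv w.1) (φ.target ×ˢ Set.univ) :=
      φ.smooth_symm.comp contDiff_fst.contDiffOn fun _ hw => hw.1
    refine h1.prodMk ?_
    exact hG'.comp (f := fun w : Space × 𝔸 => (φ.inv w.1, w.2))
      (h1.prodMk contDiff_snd.contDiffOn) fun w hw => ⟨φ.map_target hw.1, trivial⟩
  { toFun := fun w => (φ w.1, G w.1.1 w.2)
    invFun := fun w => (φ.inv w.1, G' (φ.inv w.1).1 w.2)
    source := φ.source ×ˢ Set.univ
    target := φ.target ×ˢ Set.univ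
    map_source' := fun w hw => ⟨φ.map_source hw.1, trivial⟩
    map_target' := fun w hw => ⟨φ.map_target hw.1, trivial⟩
    left_inv' := fun w hw => by
      have : φ.inv (φ w.1) = w.1 := φ.left_inv hw.1
      simp only [this, hl w.1 hw.1]
    right_inv' := fun w hw => by
      have : φ (φ.inv w.1) = w.1 := φ.right_inv hw.1
      have hs : φ.inv w.1 ∈ φ.source := φ.map_target hw.1
      simp only [this, hr _ hs]
    open_source := φ.open_source.prod isOpen_univ
    open_target := φ.open_target.prod isOpen_univ
    continuousOn_toFun := s1.continuousOn
    continuousOn_invFun := s2.continuousOn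
    smooth := s1
    smooth_symm := s2 }

variable {φ : PointTransformation Space} {G G' : Base → 𝔸 → 𝔸}
    {hG : ContDiffOn ℝ ∞ (fun w : Space × 𝔸 => G w.1.1 w.2) (φ.source ×ˢ Set.univ)}
    {hG' : ContDiffOn ℝ ∞ (fun w : Space × 𝔸 => G' w.1.1 w.2) (φ.source ×ˢ Set.univ)}
    {hl : ∀ y ∈ φ.source, ∀ a, G' y.1 (G y.1 a) = a}
    {hr : ∀ y ∈ φ.source, ∀ a, G y.1 (G' y.1 a) = a}

/-- A criterion for belonging to the usual equivalence group. -/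
lemma skew_mem_equivGroup {K : Set Eqn} {arb : Eqn → Base → 𝔸} {T X U₁ U₀ : Base → ℝ}
    (hφ : ∀ y ∈ φ.source, AffineForm φ T X U₁ U₀ y)
    (hf : ∀ E ∈ K, ∀ y ∈ φ.source, y.1 ∈ E.dom → ∃ E' ∈ K, ∀ᶠ q in 𝓝 y.1,
      (T q, X q) ∈ E'.dom ∧ arb E' (T q, X q) = G q (arb E q) ∧ Intertwines E E' T X U₁ U₀ q)
    (hb : ∀ E' ∈ K, ∀ y ∈ φ.source, (T y.1, X y.1) ∈ E'.dom → ∃ E ∈ K, ∀ᶠ q in 𝓝 y.1,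
      q ∈ E.dom ∧ arb E' (T q, X q) = G q (arb E q) ∧ Intertwines E E' T X U₁ U₀ q) :
    φ.skew G G' hG hG' hl hr ∈ equivGroup K arb := by
  have hfst : ∀ y : Space, Filter.Tendsto (fun y : Space => y.1) (𝓝 y) (𝓝 y.1) :=
    fun y => continuousAt_fst
  constructor
  · refine ⟨φ, fun w hw => ⟨hw.1, rfl⟩, fun E hE z hz hzs => ?_⟩
    obtain ⟨E', hE', hev⟩ := hf E hE z hzs.1 hz
    refine ⟨E', hE', ?_⟩
    filter_upwards [(hfst z).eventually hev, φ.open_source.mem_nhds hzs.1] with y hy hys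
    have e : φ y = _ := hφ y hys
    have e1 : (φ y).1 = (T y.1, X y.1) := by rw [e]
    refine ⟨by rw [e1]; exact hy.1, by rw [e1]; exact hy.2.1, hy.2.2.carriesAt ?_⟩
    filter_upwards [φ.open_source.mem_nhds hys] with w hw using hφ w hw
  · refine ⟨φ.inv, fun w hw => ⟨hw.1, rfl⟩, fun E' hE' z' hz' hzs => ?_⟩
    have hz't : z' ∈ φ.target := hzs.1
    set z := φ.inv z' with hzdef
    have hzsrc : z ∈ φ.source := φ.map_target hz't
    have hφz : φ z = z' := φ.right_inv hz't
    have e : φ z = _ := hφ z hzsrc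
    have e1 : (T z.1, X z.1) = z'.1 := by rw [← hφz, e]
    obtain ⟨E, hE, hev⟩ := hb E' hE' z hzsrc (by rw [e1]; exact hz')
    refine ⟨E, hE, ?_⟩
    have hc : Filter.Tendsto φ.inv (𝓝 z') (𝓝 z) :=
      (PointTransformation.contDiffAt (φ := φ.inv) hz't).continuousAt
    filter_upwards [((hfst z).comp hc).eventually hev, φ.open_target.mem_nhds hz't] with y' hy hyt
    simp only [Function.comp] at hy
    set y := φ.inv y' with hydef
    have hys : y ∈ φ.source := φ.map_target hyt
    have hφy : φ y = y' := φ.right_inv hyt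
    have e : φ y = _ := hφ y hys
    have e2 : (T y.1, X y.1) = y'.1 := by rw [← hφy, e]
    refine ⟨hy.1, ?_, ?_⟩
    · change arb E y.1 = G' y.1 (arb E' y'.1)
      rw [← e2, hy.2.1, hl y hys]
    · have := hy.2.2.carriesAt_inv hys (by
        filter_upwards [φ.open_source.mem_nhds hys] with w hw using hφ w hw)
      rwa [hφy] at this

end Skew

/-! ## The equivalence group versus the equivalence groupoid -/

/-- `CarriesAt` sees the target equation only through the values of its coefficients at one point.
-/
lemma CarriesAt.congr_right {φ : PointTransformation Space} {E E' E'' : Eqn} {z : Space}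
    (h : CarriesAt φ E E' z) (h2 : E'.A2 (φ z).1 = E''.A2 (φ z).1)
    (h1 : E'.A1 (φ z).1 = E''.A1 (φ z).1) (hC : E'.C (φ z).1 = E''.C (φ z).1) :
    CarriesAt φ E E'' z := by
  intro f g hf hfz hg hfg hd
  rw [h f g hf hfz hg hfg hd]
  unfold Eqn.HoldsAt
  rw [h2, h1, hC]

section GroupGroupoid

variable {𝔸 : Type*} [NormedAddCommGroup 𝔸] [NormedSpace ℝ 𝔸] {K : Set Eqn}
  {arb : Eqn → Base → 𝔸}

/-- Equivalence up to the usual equivalence group implies equivalence up to the groupoid. -/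
lemma GroupEquivOn.groupoidEquivOn
    (hK : ∀ E ∈ K, ∀ E' ∈ K, ∀ p ∈ E.dom, p ∈ E'.dom → arb E p = arb E' p →
      E.A2 p = E'.A2 p ∧ E.A1 p = E'.A1 p ∧ E.C p = E'.C p)
    (harb : ∀ E ∈ K, ∀ p ∈ E.dom, ContinuousAt (arb E) p)
    {E E' : Eqn} {V : Set Base} (hV : IsOpen V) (h : GroupEquivOn K arb E V E') :
    GroupoidEquivOn K E V E' := by
  obtain ⟨hE, hE', Φ, hΦ, z, hzV, hzE, hzΦ, hev⟩ := h
  obtain ⟨⟨φ, hφ, hmap⟩, -⟩ := hΦ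
  obtain ⟨F, hF, hevF⟩ := hmap E hE z hzE hzΦ
  have hfst : Filter.Tendsto (fun y : Space => y.1) (𝓝 z) (𝓝 z.1) := continuousAt_fst
  have hc : Filter.Tendsto (fun y : Space => (y, arb E y.1)) (𝓝 z) (𝓝 (z, arb E z.1)) :=
    Filter.Tendsto.prodMk_nhds Filter.tendsto_id ((harb E hE z.1 hzE).tendsto.comp hfst)
  have hall : ∀ᶠ y in 𝓝 z, y.1 ∈ V ∧ y.1 ∈ E.dom ∧ (φ y).1 ∈ E'.dom ∧ CarriesAt φ E E' y := by
    filter_upwards [hev, hevF, hfst.eventually (hV.mem_nhds hzV),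
      hfst.eventually (E.dom_open.mem_nhds hzE), hc.eventually (Φ.open_source.mem_nhds hzΦ)]
      with y h1 h2 h3 h4 h5
    obtain ⟨-, e⟩ := hφ _ h5
    rw [e] at h1
    -- The group element yields some target `F` in the class. It has the same arbitrary elements as
    -- `E'` at the image point, so by `hK` the same coefficients there.
    obtain ⟨k2, k1, kC⟩ := hK F hF E' hE' _ h2.1 h1.1 (h2.2.1.trans h1.2)
    exact ⟨h3, h4, h1.1, h2.2.2.congr_right k2 k1 kC⟩
  obtain ⟨O, hO, hOo, hzO⟩ := eventually_nhds_iff.1 hall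
  have hz : z ∈ φ.source := (hφ _ hzΦ).1
  refine ⟨φ.restrict O hOo, ⟨hE, hE', ?_, ?_, ?_⟩, ⟨z, ?_⟩, ?_⟩
  · intro y hy
    rw [φ.restrict_source] at hy
    exact ⟨(hO y hy.2).2.1, trivial⟩
  · intro y' hy'
    have hs := (φ.restrict O hOo).map_target hy'
    have hr := (φ.restrict O hOo).right_inv hy'
    rw [φ.restrict_source] at hs
    rw [← hr]
    exact ⟨(hO _ hs.2).2.2.1, trivial⟩
  · intro y hy
    rw [φ.restrict_source] at hy
    exact (hO y hy.2).2.2.2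
  · rw [φ.restrict_source]; exact ⟨hz, hzO⟩
  · intro y hy
    rw [φ.restrict_source] at hy
    exact ⟨(hO y hy.2).1, trivial⟩

/-- In a normalized class, equivalence up to the groupoid implies equivalence up to the usual
equivalence group. -/
lemma GroupoidEquivOn.groupEquivOn (hK : IsNormalized K arb) {E E' : Eqn} {V : Set Base}
    (h : GroupoidEquivOn K E V E') : GroupEquivOn K arb E V E' := by
  obtain ⟨φ, hφ, ⟨z, hz⟩, hV⟩ := h
  obtain ⟨Φ, hΦ, hzΦ, hev⟩ := hK E φ E' hφ z hz
  refine ⟨hφ.1, hφ.2.1, Φ, hΦ, z, (hV hz).1, (hφ.2.2.1 hz).1, hzΦ, ?_⟩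
  filter_upwards [hev, φ.open_source.mem_nhds hz] with y hy hys
  rw [hy]
  exact ⟨(hφ.2.2.2.1 (φ.map_source hys)).1, rfl⟩

end GroupGroupoid

/-! ## Normalization -/

/-- The regularity conditions shared by the transformations within the two normalized classes. -/
structure Regular (T X U₁ U₀ : Base → ℝ) (q : Base) : Prop where
  smooth_T : ContDiffAt ℝ ∞ T q
  smooth_X : ContDiffAt ℝ ∞ X q
  smooth_U₁ : ContDiffAt ℝ ∞ U₁ q
  smooth_U₀ : ContDiffAt ℝ ∞ U₀ q
  T_x : pdx T q = 0
  U₁_x : pdx U₁ q = 0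
  T_t : pdt T q ≠ 0
  U₁_ne : U₁ q ≠ 0
  X_x : pdx X q = pdt T q * U₁ q

lemma pdx_pdt_vanish {f : Base → ℝ} {q : Base} (hf : ContDiffAt ℝ ∞ f q)
    (h : ∀ᶠ r in 𝓝 q, pdx f r = 0) : pdx (pdt f) q = 0 :=
  (dir_comm (v := (0, 1)) (w := (1, 0)) hf).trans (dir_vanish_of_eventually h)

/-- `X_x = T_t U₁` is a function of `t` only. -/
lemma Regular.X_xx {T X U₁ U₀ : Base → ℝ} {q : Base}
    (h : ∀ᶠ r in 𝓝 q, Regular T X U₁ U₀ r) : pdx (pdx X) q = 0 := by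
  have h0 := h.self_of_nhds
  have e : pdx X =ᶠ[𝓝 q] fun r => pdt T r * U₁ r := h.mono fun r hr => hr.X_x
  have h1 : DifferentiableAt ℝ (pdt T) q := diffAt_of_smooth (contDiffAt_dir h0.smooth_T)
  have := dir_mul (v := (0, 1)) h1 (diffAt_of_smooth h0.smooth_U₁)
  rw [pdx_congr e]
  change pdx _ q = pdx (pdt T) q * U₁ q + pdt T q * pdx U₁ q at this
  rw [this, pdx_pdt_vanish h0.smooth_T (h.mono fun r hr => hr.T_x), h0.U₁_x]
  ring

lemma Regular.exists_inverse {T X U₁ U₀ : Base → ℝ} {q : Base}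
    (h : ∀ᶠ r in 𝓝 q, Regular T X U₁ U₀ r) :
    ∃ G : Base → Base, (∀ᶠ r in 𝓝 (T q, X q), ContDiffAt ℝ ∞ G r) ∧ G (T q, X q) = q ∧
      (∀ᶠ r in 𝓝 q, G (T r, X r) = r) ∧ ∀ᶠ r in 𝓝 (T q, X q), (T (G r), X (G r)) = r :=
  exists_smooth_inverse (h.mono fun r hr => ⟨hr.smooth_T, hr.smooth_X, hr.T_x, hr.T_t, by
    rw [hr.X_x]; exact mul_ne_zero hr.T_t hr.U₁_ne⟩)

/-- The equations `C = 1` obtained from each other by a regular transformation. -/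
lemma Regular.intertwines {E E' : Eqn} {T X U₁ U₀ : Base → ℝ} {q : Base}
    (h : ∀ᶠ r in 𝓝 q, Regular T X U₁ U₀ r) (hC : E.C q = 1) (hC' : E'.C (T q, X q) = 1)
    (h1 : pdt U₁ q + pdx U₀ q = 0)
    (h2 : pdt U₀ q = E.A2 q * pdx (pdx U₀) q + E.A1 q * pdx U₀ q)
    (hA2 : E'.A2 (T q, X q) = pdx X q ^ 2 / pdt T q * E.A2 q)
    (hA1 : pdt T q * E'.A1 (T q, X q) = pdx X q * E.A1 q - pdt X q + pdt T q * U₀ q) :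
    Intertwines E E' T X U₁ U₀ q := by
  have h0 := h.self_of_nhds
  have hT := h0.T_t
  refine ⟨h0.smooth_T, h0.smooth_X, h0.smooth_U₁, h0.smooth_U₀, h.mono fun r hr => hr.T_x,
    h.mono fun r hr => hr.U₁_x, h0.T_t, ?_, h0.U₁_ne, ?_, ?_, ?_, ?_, h2⟩
  · rw [h0.X_x]; exact mul_ne_zero h0.T_t h0.U₁_ne
  · rw [hA2]; field_simp
  · rw [hC, hC', h0.X_x]; ring
  · rw [hC', Regular.X_xx h, hA1]; ring
  · rw [hC]; linear_combination h1

/-- The converse of `Regular.intertwines`. -/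
lemma Intertwines.regular {E E' : Eqn} {T X U₁ U₀ : Base → ℝ} {q : Base}
    (h : Intertwines E E' T X U₁ U₀ q) (hC : E.C q = 1) (hC' : E'.C (T q, X q) = 1) :
    Regular T X U₁ U₀ q :=
  ⟨h.smooth_T, h.smooth_X, h.smooth_U₁, h.smooth_U₀, h.T_x.self_of_nhds, h.U₁_x.self_of_nhds,
    h.T_t, h.U₁_ne, by
    have := h.eq_C
    rw [hC, hC'] at this
    linear_combination this⟩

/-- The construction of the target equation with prescribed coefficients. -/
lemma Regular.exists_target {T X U₁ U₀ : Base → ℝ} {q : Base}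
    (h : ∀ᶠ r in 𝓝 q, Regular T X U₁ U₀ r) {a2 a1 : Base → ℝ}
    (ha2 : ∀ᶠ r in 𝓝 q, ContDiffAt ℝ ∞ a2 r ∧ a2 r ≠ 0)
    (ha1 : ∀ᶠ r in 𝓝 q, ContDiffAt ℝ ∞ a1 r) {P : Base → Prop}
    (hP : ∀ᶠ r in 𝓝 q, P r) :
    ∃ E' : Eqn, (∀ r, E'.C r = 1) ∧ (T q, X q) ∈ E'.dom ∧
      (∀ᶠ r in 𝓝 q, E'.A2 (T r, X r) = a2 r ∧ E'.A1 (T r, X r) = a1 r) ∧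
      (∀ r' ∈ E'.dom, ∃ r, P r ∧ (T r, X r) = r' ∧
        ∀ᶠ s in 𝓝 r, E'.A2 (T s, X s) = a2 s ∧ E'.A1 (T s, X s) = a1 s) := by
  obtain ⟨G, hGs, hGq, hl, hr⟩ := Regular.exists_inverse h
  have hGt : Filter.Tendsto G (𝓝 (T q, X q)) (𝓝 q) := by
    have := hGs.self_of_nhds.continuousAt
    unfold ContinuousAt at this
    rwa [hGq] at this
  -- The ball is small enough for each of its points to come from a point with `P`. This lets
  -- pointwise inequalities of the source be transferred to the whole target domain.
  obtain ⟨ρ, hρ, hb⟩ := exists_ball_of_eventually (hGs.and ((hGt.eventually ha2).and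
    ((hGt.eventually ha1).and (hr.and ((hGt.eventually hl.eventually_nhds).and
      (hGt.eventually hP))))))
  refine ⟨Eqn.onBall (T q, X q) ρ hρ (fun r => a2 (G r)) (fun r => a1 (G r)) (fun _ => 1)
    (fun r hrb => ((hb r hrb).2.1.1.comp r (hb r hrb).1).contDiffWithinAt)
    (fun r hrb => ((hb r hrb).2.2.1.comp r (hb r hrb).1).contDiffWithinAt)
    contDiffOn_const (fun r hrb => (hb r hrb).2.1.2) (fun _ _ => one_ne_zero),
    fun _ => rfl, Metric.mem_ball_self hρ, ?_, ?_⟩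
  · filter_upwards [hl] with r e
    change a2 (G _) = _ ∧ a1 (G _) = _
    rw [e]; exact ⟨rfl, rfl⟩
  · intro r' hr'
    obtain ⟨-, -, -, e1, e2, e3⟩ := hb r' hr'
    refine ⟨G r', e3, e1, ?_⟩
    filter_upwards [e2] with s e
    change a2 (G _) = _ ∧ a1 (G _) = _
    rw [e]; exact ⟨rfl, rfl⟩

lemma pdx_pdx_mul {c f : Base → ℝ} {q : Base} (hc : ContDiffAt ℝ ∞ c q) (hf : ContDiffAt ℝ ∞ f q)
    (h0 : ∀ᶠ r in 𝓝 q, pdx c r = 0) :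
    pdx (pdx fun r => c r * f r) q = c q * pdx (pdx f) q := by
  have h1 : pdx (fun r => c r * f r) =ᶠ[𝓝 q] fun r => c r * pdx f r := by
    filter_upwards [h0, eventually_diffAt hc, eventually_diffAt hf] with r e1 e2 e3
    have := dir_mul (v := (0, 1)) e2 e3
    change pdx _ r = pdx c r * f r + c r * pdx f r at this
    rw [this, e1, zero_mul, zero_add]
  have hfx : DifferentiableAt ℝ (pdx f) q := diffAt_of_smooth (contDiffAt_dir hf)
  rw [pdx_congr h1]
  have := dir_mul (v := (0, 1)) (diffAt_of_smooth hc) hfx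
  change pdx _ q = pdx c q * pdx f q + c q * pdx (pdx f) q at this
  rw [this, h0.self_of_nhds, zero_mul, zero_add]

lemma pdx_pdx_add {f g : Base → ℝ} {q : Base} (hf : ContDiffAt ℝ ∞ f q)
    (hg : ContDiffAt ℝ ∞ g q) :
    pdx (pdx fun r => f r + g r) q = pdx (pdx f) q + pdx (pdx g) q := by
  have h1 : pdx (fun r => f r + g r) =ᶠ[𝓝 q] fun r => pdx f r + pdx g r := by
    filter_upwards [eventually_diffAt hf, eventually_diffAt hg] with r e2 e3
    exact dir_add e2 e3
  rw [pdx_congr h1]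
  exact dir_add (diffAt_of_smooth (contDiffAt_dir hf)) (diffAt_of_smooth (contDiffAt_dir hg))

lemma pdx_pdx_sub {f g : Base → ℝ} {q : Base} (hf : ContDiffAt ℝ ∞ f q)
    (hg : ContDiffAt ℝ ∞ g q) :
    pdx (pdx fun r => f r - g r) q = pdx (pdx f) q - pdx (pdx g) q := by
  have h1 : pdx (fun r => f r - g r) =ᶠ[𝓝 q] fun r => pdx f r - pdx g r := by
    filter_upwards [eventually_diffAt hf, eventually_diffAt hg] with r e2 e3
    exact dir_sub e2 e3
  rw [pdx_congr h1]
  exact dir_sub (diffAt_of_smooth (contDiffAt_dir hf)) (diffAt_of_smooth (contDiffAt_dir hg))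

/-- The transformation of `A1_xx`. -/
lemma Regular.A1_xx {T X U₁ U₀ : Base → ℝ} {q : Base}
    (h : ∀ᶠ r in 𝓝 q, Regular T X U₁ U₀ r) (hU : ∀ᶠ r in 𝓝 q, pdx U₀ r = 0) {a b : Base → ℝ}
    (ha : ContDiffAt ℝ ∞ a q) (hb : ContDiffAt ℝ ∞ b (T q, X q))
    (hab : ∀ᶠ r in 𝓝 q, pdt T r * b (T r, X r) = pdx X r * a r - pdt X r + pdt T r * U₀ r) :
    pdt T q * (pdx (pdx b) (T q, X q) * pdx X q ^ 2) = pdx X q * pdx (pdx a) q := by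
  have h0 := h.self_of_nhds
  have hTt : ContDiffAt ℝ ∞ (pdt T) q := contDiffAt_dir h0.smooth_T
  have hXx : ContDiffAt ℝ ∞ (pdx X) q := contDiffAt_dir h0.smooth_X
  have hXt : ContDiffAt ℝ ∞ (pdt X) q := contDiffAt_dir h0.smooth_X
  have hTx : ∀ᶠ r in 𝓝 q, pdx T r = 0 := h.mono fun r hr => hr.T_x
  have hXxx : ∀ᶠ r in 𝓝 q, pdx (pdx X) r = 0 := by
    filter_upwards [h.eventually_nhds] with r hr using Regular.X_xx hr
  have hTtx : ∀ᶠ r in 𝓝 q, pdx (pdt T) r = 0 := by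
    filter_upwards [h, hTx.eventually_nhds] with r hr hr' using pdx_pdt_vanish hr.smooth_T hr'
  have e1 := pdx_pdx_mul hTt (contDiffAt_comp_base hb h0.smooth_T h0.smooth_X) hTtx
  have e2 := pdx_pdx_mul hXx ha hXxx
  have e3 := pdx_pdx_mul hTt h0.smooth_U₀ hTtx
  have e4 : pdx (pdx U₀) q = 0 := dir_vanish_of_eventually hU
  have e5 : pdx (pdx (pdt X)) q = 0 := by
    have : pdx (pdt X) =ᶠ[𝓝 q] pdt (pdx X) := by
      filter_upwards [h] with r hr using dir_comm hr.smooth_X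
    rw [pdx_congr this]
    exact pdx_pdt_vanish hXx hXxx
  have e6 := pdx_pdx_comp_base (two_of_smooth hb) h0.smooth_T h0.smooth_X hTx
  rw [Regular.X_xx h, mul_zero, add_zero] at e6
  -- Two `x`-derivatives of `hab`: the factors `T_t` and `X_x` depend on `t` only, and the terms
  -- `X_t` and `T_t U₀` are annihilated.
  have e7 := (dir_congr (v := (0, 1)) (dir_eventuallyEq (v := (0, 1)) hab))
  change pdx (pdx _) q = pdx (pdx _) q at e7
  rw [pdx_pdx_add ((hXx.mul ha).sub hXt) (hTt.mul h0.smooth_U₀), pdx_pdx_sub (hXx.mul ha) hXt,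
    e1, e2, e3, e4, e5, e6] at e7
  linear_combination e7

/-- Generation of the groupoid by a family of regular transformations. -/
lemma exists_skew {𝔸 : Type*} [NormedAddCommGroup 𝔸] [NormedSpace ℝ 𝔸] {K : Set Eqn}
    {arb : Eqn → Base → 𝔸} {E E' : Eqn} {φ : PointTransformation Space} {z : Space}
    (hz : z ∈ φ.source) {T X U₁ U₀ : Base → ℝ} {P : Base → Prop} {G G' : Base → 𝔸 → 𝔸}
    (hφ : ∀ᶠ y in 𝓝 z, AffineForm φ T X U₁ U₀ y)
    (hP : ∀ᶠ q in 𝓝 z.1, P q)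
    (hG : ∀ q, P q → ∀ a, ContDiffAt ℝ ∞ (fun w : Base × 𝔸 => G w.1 w.2) (q, a))
    (hG' : ∀ q, P q → ∀ a, ContDiffAt ℝ ∞ (fun w : Base × 𝔸 => G' w.1 w.2) (q, a))
    (hl : ∀ q, P q → ∀ a, G' q (G q a) = a) (hr : ∀ q, P q → ∀ a, G q (G' q a) = a)
    (hf : ∀ E ∈ K, ∀ p, p ∈ E.dom → (∀ᶠ r in 𝓝 p, P r) → ∃ E' ∈ K, ∀ᶠ q in 𝓝 p,
      (T q, X q) ∈ E'.dom ∧ arb E' (T q, X q) = G q (arb E q) ∧ Intertwines E E' T X U₁ U₀ q)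
    (hb : ∀ E' ∈ K, ∀ p, (T p, X p) ∈ E'.dom → (∀ᶠ r in 𝓝 p, P r) → ∃ E ∈ K, ∀ᶠ q in 𝓝 p,
      q ∈ E.dom ∧ arb E' (T q, X q) = G q (arb E q) ∧ Intertwines E E' T X U₁ U₀ q)
    (harb : ∀ᶠ q in 𝓝 z.1, arb E' (T q, X q) = G q (arb E q)) :
    ∃ Φ ∈ equivGroup K arb, (z, arb E z.1) ∈ Φ.source ∧
      ∀ᶠ y in 𝓝 z, Φ (y, arb E y.1) = (φ y, arb E' (φ y).1) := by
  have hfst : Filter.Tendsto (fun y : Space => y.1) (𝓝 z) (𝓝 z.1) := continuousAt_fst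
  -- After restriction to `O`, the affine form and the condition `P` hold on the entire source, as
  -- an element of the equivalence group requires.
  obtain ⟨O, hO, hOo, hzO⟩ := eventually_nhds_iff.1 (hφ.and (hfst.eventually hP))
  have hsrc : ∀ y ∈ (φ.restrict O hOo).source, AffineForm φ T X U₁ U₀ y ∧ P y.1 := by
    intro y hy
    rw [φ.restrict_source] at hy
    exact hO y hy.2
  have hPn : ∀ y ∈ (φ.restrict O hOo).source, ∀ᶠ r in 𝓝 y.1, P r := by
    intro y hy
    rw [φ.restrict_source] at hy
    have : ∀ᶠ r in 𝓝 y.1, (r, y.2) ∈ O :=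
      (continuous_id.prodMk continuous_const).continuousAt.eventually (hOo.mem_nhds hy.2)
    filter_upwards [this] with r hr using (hO _ hr).2
  refine ⟨(φ.restrict O hOo).skew G G' ?_ ?_ (fun y hy => hl _ (hsrc y hy).2)
    (fun y hy => hr _ (hsrc y hy).2), skew_mem_equivGroup (T := T) (X := X) (U₁ := U₁) (U₀ := U₀)
      (fun y hy => (hsrc y hy).1)
      (fun E hE y hy hyE => hf E hE y.1 hyE (hPn y hy))
      (fun E' hE' y hy hyE => hb E' hE' y.1 hyE (hPn y hy)), ?_, ?_⟩
  · intro w hw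
    exact (ContDiffAt.comp (f := fun w : Space × 𝔸 => (w.1.1, w.2)) w
      (hG _ (hsrc _ hw.1).2 w.2) (contDiffAt_fst.fst.prodMk contDiffAt_snd)).contDiffWithinAt
  · intro w hw
    exact (ContDiffAt.comp (f := fun w : Space × 𝔸 => (w.1.1, w.2)) w
      (hG' _ (hsrc _ hw.1).2 w.2) (contDiffAt_fst.fst.prodMk contDiffAt_snd)).contDiffWithinAt
  · refine ⟨?_, trivial⟩
    change z ∈ (φ.restrict O hOo).source
    rw [φ.restrict_source]; exact ⟨hz, hzO⟩
  · filter_upwards [hφ, hfst.eventually harb] with y h1 h2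
    have e : φ y = _ := h1
    have e1 : (φ y).1 = (T y.1, X y.1) := by rw [e]
    rw [e1, h2]; rfl

lemma eventually_mem_doms {φ : PointTransformation Space} {E E' : Eqn} {z : Space}
    (h : Relates φ E E') (hz : z ∈ φ.source) {T X U₁ U₀ : Base → ℝ}
    (hI : ∀ᶠ q in 𝓝 z.1, Intertwines E E' T X U₁ U₀ q)
    (hφ : ∀ᶠ y in 𝓝 z, AffineForm φ T X U₁ U₀ y) :
    ∀ᶠ q in 𝓝 z.1, q ∈ E.dom ∧ (T q, X q) ∈ E'.dom := by
  have hφz : φ z = _ := hφ.self_of_nhds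
  have h1 : (T z.1, X z.1) ∈ E'.dom := by
    have := (h.2.1 (φ.map_source hz)).1
    rwa [hφz] at this
  exact Filter.Eventually.and (E.dom_open.mem_nhds (h.1 hz).1)
    (hI.self_of_nhds.tendsto_base.eventually (E'.dom_open.mem_nhds h1))

/-- From `U₁_t + U₀_x = 0` and `U₁ = U₁(t)` follows `U₀_xx = 0`; with `A1 = 0` on both sides, also
`U₀_t = 0` and `X_t = T_t U₀`. These conditions, collected in `P`, no longer contain `A2`, so the
transformation acts on all equations of the class, by `A2 ↦ (X_x² / T_t) A2`. -/
theorem isNormalized_classL0p : IsNormalized classL0p arbL0p := by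
  intro E φ E' ⟨hE, hE', hR⟩ z hz
  obtain ⟨T, X, U₁, U₀, hI, hφ⟩ := hR.exists_intertwines hz
  have hdoms := eventually_mem_doms hR hz hI hφ
  have hreg : ∀ᶠ q in 𝓝 z.1, Regular T X U₁ U₀ q := by
    filter_upwards [hI, hdoms] with q h1 h2 using h1.regular (hE q h2.1).2 (hE' _ h2.2).2
  set P : Base → Prop := fun q => Regular T X U₁ U₀ q ∧ pdt X q = pdt T q * U₀ q ∧
    pdt U₁ q + pdx U₀ q = 0 ∧ pdx (pdx U₀) q = 0 ∧ pdt U₀ q = 0 with hPdef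
  have hP : ∀ᶠ q in 𝓝 z.1, P q := by
    have hU : ∀ᶠ q in 𝓝 z.1, pdt U₁ q + pdx U₀ q = 0 := by
      filter_upwards [hI, hdoms] with q h1 h2
      have := h1.eq_U₁
      rwa [(hE q h2.1).2, one_mul] at this
    filter_upwards [hI, hdoms, hreg.eventually_nhds, hU.eventually_nhds, hI.eventually_nhds]
      with q h1 h2 h3 h4 h5
    have hU0xx : pdx (pdx U₀) q = 0 := by
      have e : pdx U₀ =ᶠ[𝓝 q] fun r => - pdt U₁ r := h4.mono fun r hr => by linarith
      have e2 : pdx (pdt U₁) q = 0 := pdx_pdt_vanish h1.smooth_U₁ h1.U₁_x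
      rw [pdx_congr e]
      exact dir_neg.trans (by rw [← pdx_eq_dir, e2, neg_zero])
    refine ⟨h3.self_of_nhds, ?_, h4.self_of_nhds, hU0xx, ?_⟩
    · have := h1.eq_A1
      rw [(hE q h2.1).1, (hE' _ h2.2).1, (hE' _ h2.2).2, Regular.X_xx h3] at this
      linear_combination this
    · have := h1.eq_U₀
      rw [hU0xx, (hE q h2.1).1] at this
      linear_combination this
  have hXx : ∀ {q}, P q → pdx X q ≠ 0 := fun {q} hq => by
    rw [hq.1.X_x]; exact mul_ne_zero hq.1.T_t hq.1.U₁_ne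
  have hk : ∀ q, P q → ContDiffAt ℝ ∞ (fun r => pdx X r ^ 2 / pdt T r) q := fun q hq => by
    have h1 : ContDiffAt ℝ ∞ (pdx X) q := contDiffAt_dir hq.1.smooth_X
    have h2 : ContDiffAt ℝ ∞ (pdt T) q := contDiffAt_dir hq.1.smooth_T
    exact (h1.pow 2).div h2 hq.1.T_t
  refine exists_skew (P := P) (G := fun q a => pdx X q ^ 2 / pdt T q * a)
    (G' := fun q a => (pdx X q ^ 2 / pdt T q)⁻¹ * a) hz hφ hP ?_ ?_ ?_ ?_ ?_ ?_ ?_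
  · intro q hq a
    exact (ContDiffAt.comp (f := Prod.fst) (q, a) (hk q hq) contDiffAt_fst).mul contDiffAt_snd
  · intro q hq a
    exact ((ContDiffAt.comp (f := Prod.fst) (q, a) (hk q hq) contDiffAt_fst).inv
      (div_ne_zero (pow_ne_zero 2 (hXx hq)) hq.1.T_t)).mul contDiffAt_snd
  · intro q hq a
    exact inv_mul_cancel_left₀ (div_ne_zero (pow_ne_zero 2 (hXx hq)) hq.1.T_t) a
  · intro q hq a
    exact mul_inv_cancel_left₀ (div_ne_zero (pow_ne_zero 2 (hXx hq)) hq.1.T_t) a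
  · intro F hF p hp hPp
    obtain ⟨F', hF'C, hF'dom, hF', hF'all⟩ := Regular.exists_target (q := p)
      (hPp.mono fun r hr => hr.1) (a2 := fun r => pdx X r ^ 2 / pdt T r * F.A2 r)
      (a1 := fun _ => 0) (by
        filter_upwards [hPp, F.dom_open.mem_nhds hp] with r h1 h2
        exact ⟨(hk r h1).mul (F.contDiffAt_A2 h2),
          mul_ne_zero (div_ne_zero (pow_ne_zero 2 (hXx h1)) h1.1.T_t) (F.A2_ne r h2)⟩)
      (Filter.Eventually.of_forall fun _ => contDiffAt_const) (P := fun _ => True)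
      (Filter.Eventually.of_forall fun _ => trivial)
    refine ⟨F', fun r' hr' => ⟨?_, hF'C r'⟩, ?_⟩
    · obtain ⟨r, -, hr, he⟩ := hF'all r' hr'
      rw [← hr]; exact he.self_of_nhds.2
    have hB : Filter.Tendsto (fun r => (T r, X r)) (𝓝 p) (𝓝 (T p, X p)) :=
      hPp.self_of_nhds.1.smooth_T.continuousAt.prodMk hPp.self_of_nhds.1.smooth_X.continuousAt
    filter_upwards [hPp, hF', hB.eventually (F'.dom_open.mem_nhds hF'dom),
      (hPp.mono fun r hr => hr.1).eventually_nhds, F.dom_open.mem_nhds hp] with r h1 h2 h3 h4 h5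
    refine ⟨h3, h2.1, Regular.intertwines h4 (hF r h5).2 (hF'C _) h1.2.2.1 ?_ h2.1 ?_⟩
    · rw [h1.2.2.2.1, h1.2.2.2.2, (hF r h5).1]; ring
    · rw [h2.2, (hF r h5).1, h1.2.1]; ring
  -- For the inverse the equation is pulled back: its `A2` is that of `F'` composed with the map and
  -- divided by the same factor.
  · intro F' hF' p hp hPp
    have hB : Filter.Tendsto (fun r => (T r, X r)) (𝓝 p) (𝓝 (T p, X p)) :=
      hPp.self_of_nhds.1.smooth_T.continuousAt.prodMk hPp.self_of_nhds.1.smooth_X.continuousAt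
    obtain ⟨ρ, hρ, hb⟩ := exists_ball_of_eventually
      (hPp.and (hB.eventually (F'.dom_open.mem_nhds hp)))
    have hne : ∀ r, P r → (pdx X r ^ 2 / pdt T r)⁻¹ ≠ 0 := fun r hr =>
      inv_ne_zero (div_ne_zero (pow_ne_zero 2 (hXx hr)) hr.1.T_t)
    refine ⟨Eqn.onBall p ρ hρ (fun r => (pdx X r ^ 2 / pdt T r)⁻¹ * F'.A2 (T r, X r))
      (fun _ => 0) (fun _ => 1)
      (fun r hr => (((hk r (hb r hr).1).inv (div_ne_zero (pow_ne_zero 2 (hXx (hb r hr).1))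
        (hb r hr).1.1.T_t)).mul (contDiffAt_comp_base (F'.contDiffAt_A2 (hb r hr).2)
          (hb r hr).1.1.smooth_T (hb r hr).1.1.smooth_X)).contDiffWithinAt)
      contDiffOn_const contDiffOn_const
      (fun r hr => mul_ne_zero (hne r (hb r hr).1) (F'.A2_ne _ (hb r hr).2))
      (fun _ _ => one_ne_zero), fun _ _ => ⟨rfl, rfl⟩, ?_⟩
    filter_upwards [Metric.ball_mem_nhds p hρ, (hPp.mono fun r hr => hr.1).eventually_nhds]
      with r hr h4
    obtain ⟨h1, h2⟩ := hb r hr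
    have e : F'.A2 (T r, X r) = pdx X r ^ 2 / pdt T r * ((pdx X r ^ 2 / pdt T r)⁻¹
        * F'.A2 (T r, X r)) :=
      (mul_inv_cancel_left₀ (div_ne_zero (pow_ne_zero 2 (hXx h1)) h1.1.T_t) _).symm
    refine ⟨hr, e, Regular.intertwines h4 rfl (hF' _ h2).2 h1.2.2.1 ?_ e ?_⟩
    · change _ = _ * pdx (pdx U₀) r + 0 * _
      rw [h1.2.2.2.1, h1.2.2.2.2]; ring
    · change _ = pdx X r * 0 - _ + _
      rw [(hF' _ h2).1, h1.2.1]; ring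
  · filter_upwards [hI, hP] with q h1 h2
    have := h1.eq_A2
    have hT := h2.1.T_t
    change E'.A2 _ = _ * E.A2 q
    field_simp
    linear_combination this

/-- The form of admissible transformations with sources in `classL1hat`. -/
lemma regular_of_classL1hat {φ : PointTransformation Space} {E E' : Eqn} (hE : E ∈ classL1hat)
    (hE' : E' ∈ classLhat) (hR : Relates φ E E') {z : Space} (hz : z ∈ φ.source)
    {T X U₁ U₀ : Base → ℝ} (hI : ∀ᶠ q in 𝓝 z.1, Intertwines E E' T X U₁ U₀ q)
    (hφ : ∀ᶠ y in 𝓝 z, AffineForm φ T X U₁ U₀ y) :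
    ∀ᶠ q in 𝓝 z.1, Regular T X U₁ U₀ q ∧ pdt U₁ q = 0 ∧ pdx U₀ q = 0 ∧ pdt U₀ q = 0 := by
  have hdoms := eventually_mem_doms hR hz hI hφ
  have hreg : ∀ᶠ q in 𝓝 z.1, Regular T X U₁ U₀ q := by
    filter_upwards [hI, hdoms] with q h1 h2 using h1.regular (hE.1 q h2.1) (hE' _ h2.2)
  have hU : ∀ᶠ q in 𝓝 z.1, pdt U₁ q + pdx U₀ q = 0 := by
    filter_upwards [hI, hdoms] with q h1 h2
    have := h1.eq_U₁
    rwa [hE.1 q h2.1, one_mul] at this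
  have hU0t : ∀ᶠ q in 𝓝 z.1, pdt U₀ q = - (pdt U₁ q * E.A1 q) := by
    filter_upwards [hI, hdoms, hU.eventually_nhds] with q h1 h2 h4
    have hU0xx : pdx (pdx U₀) q = 0 := by
      have e : pdx U₀ =ᶠ[𝓝 q] fun r => - pdt U₁ r := h4.mono fun r hr => by linarith
      have e2 : pdx (pdt U₁) q = 0 := pdx_pdt_vanish h1.smooth_U₁ h1.U₁_x
      rw [pdx_congr e]
      exact dir_neg.trans (by rw [← pdx_eq_dir, e2, neg_zero])
    have := h1.eq_U₀
    rw [hU0xx] at this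
    linear_combination this + E.A1 q * h4.self_of_nhds
  have hU1tx : ∀ᶠ q in 𝓝 z.1, pdx (pdt U₁) q = 0 := by
    filter_upwards [hI] with q h1 using pdx_pdt_vanish h1.smooth_U₁ h1.U₁_x
  filter_upwards [hI, hdoms, hreg, hU.eventually_nhds, hU0t.eventually_nhds,
    hU1tx.eventually_nhds, hI.eventually_nhds] with q h1 h2 h3 h4 h5 h6 h7
  have hU1t : ContDiffAt ℝ ∞ (pdt U₁) q := contDiffAt_dir h1.smooth_U₁
  -- Two `x`-derivatives of `U₀_t = -U₁_t A1`. On the left `U₀_tx = -U₁_tt` depends on `t` only, so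
  -- `0 = U₁_t A1_xx`.
  have hU1 : pdt U₁ q = 0 := by
    have e1 : pdx (pdx (pdt U₀)) q = 0 := by
      have e : pdx (pdt U₀) =ᶠ[𝓝 q] fun r => - pdt (pdt U₁) r := by
        filter_upwards [h7, h4.eventually_nhds] with r k1 k2
        have : pdx (pdt U₀) r = pdt (pdx U₀) r := dir_comm k1.smooth_U₀
        rw [this]
        have e' : pdx U₀ =ᶠ[𝓝 r] fun r => - pdt U₁ r := k2.mono fun r hr => by linarith
        rw [pdt_congr e']
        exact dir_neg
      rw [pdx_congr e]
      have := pdx_pdt_vanish hU1t h6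
      exact dir_neg.trans (by rw [← pdx_eq_dir, this, neg_zero])
    have e2 : pdx (pdx (pdt U₀)) q = - (pdt U₁ q * pdx (pdx E.A1) q) := by
      have e3 := dir_congr (v := (0, 1)) (dir_eventuallyEq (v := (0, 1)) h5)
      have e4 : pdx (fun r => - (pdt U₁ r * E.A1 r)) =ᶠ[𝓝 q]
          fun r => - pdx (fun r => pdt U₁ r * E.A1 r) r :=
        Filter.Eventually.of_forall fun r => dir_neg
      have e5 := pdx_pdx_mul hU1t (E.contDiffAt_A1 h2.1) h6
      rw [← e5]
      change pdx (pdx _) q = pdx (pdx _) q at e3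
      rw [e3, pdx_congr e4]
      exact dir_neg
    rw [e1] at e2
    have := mul_eq_zero.1 (neg_eq_zero.1 e2.symm)
    exact this.resolve_right (hE.2 q h2.1)
  refine ⟨h3, hU1, ?_, ?_⟩
  · have := h4.self_of_nhds
    rw [hU1] at this
    linear_combination this
  · rw [h5.self_of_nhds, hU1]; ring

/-- Admissible transformations preserve the condition singling out `classL1hat`. -/
lemma Relates.A1_xx_ne {φ : PointTransformation Space} {E E' : Eqn} (hE : E ∈ classL1hat)
    (hE' : E' ∈ classLhat) (hR : Relates φ E E') {z : Space} (hz : z ∈ φ.source) :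
    pdx (pdx E'.A1) (φ z).1 ≠ 0 := by
  obtain ⟨T, X, U₁, U₀, hI, hφ⟩ := hR.exists_intertwines hz
  have hdoms := eventually_mem_doms hR hz hI hφ
  have hP := regular_of_classL1hat hE hE' hR hz hI hφ
  have h0 := hP.self_of_nhds
  have e : φ z = _ := hφ.self_of_nhds
  rw [e]
  have key := Regular.A1_xx (hP.mono fun s hs => hs.1) (hP.mono fun s hs => hs.2.2.1)
    (E.contDiffAt_A1 hdoms.self_of_nhds.1) (E'.contDiffAt_A1 hdoms.self_of_nhds.2) (by
      filter_upwards [hI, hdoms, (hP.mono fun s hs => hs.1).eventually_nhds] with q h1 h2 h3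
      have := h1.eq_A1
      rw [Regular.X_xx h3, hE' _ h2.2] at this
      linear_combination this)
  intro h
  rw [h, zero_mul, mul_zero] at key
  have hX : pdx X z.1 ≠ 0 := by
    rw [h0.1.X_x]; exact mul_ne_zero h0.1.T_t h0.1.U₁_ne
  exact mul_ne_zero hX (hE.2 _ hdoms.self_of_nhds.1) key.symm

/-- By `regular_of_classL1hat` the functions `U₁` and `U₀` are locally constant, so `P` is free of
the arbitrary elements. The action on `A1` comes from solving `eq_A1` for the new coefficient, and
`Regular.A1_xx` keeps the result inside the class. -/
theorem isNormalized_classL1hat : IsNormalized classL1hat arbL1hat := by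
  intro E φ E' ⟨hE, hE', hR⟩ z hz
  obtain ⟨T, X, U₁, U₀, hI, hφ⟩ := hR.exists_intertwines hz
  have hdoms := eventually_mem_doms hR hz hI hφ
  have hreg : ∀ᶠ q in 𝓝 z.1, Regular T X U₁ U₀ q := by
    filter_upwards [hI, hdoms] with q h1 h2 using h1.regular (hE.1 q h2.1) (hE'.1 _ h2.2)
  set P : Base → Prop := fun q => Regular T X U₁ U₀ q ∧ pdt U₁ q = 0 ∧ pdx U₀ q = 0 ∧
    pdt U₀ q = 0 with hPdef
  have hP : ∀ᶠ q in 𝓝 z.1, P q := regular_of_classL1hat hE hE'.1 hR hz hI hφ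
  have hXx : ∀ {q}, P q → pdx X q ≠ 0 := fun {q} hq => by
    rw [hq.1.X_x]; exact mul_ne_zero hq.1.T_t hq.1.U₁_ne
  have sXx : ∀ {q}, P q → ContDiffAt ℝ ∞ (pdx X) q := fun hq => contDiffAt_dir hq.1.smooth_X
  have sXt : ∀ {q}, P q → ContDiffAt ℝ ∞ (pdt X) q := fun hq => contDiffAt_dir hq.1.smooth_X
  have sTt : ∀ {q}, P q → ContDiffAt ℝ ∞ (pdt T) q := fun hq => contDiffAt_dir hq.1.smooth_T
  have hlift : ∀ {k : Base → ℝ} {q : Base} {a : ℝ × ℝ}, ContDiffAt ℝ ∞ k q →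
      ContDiffAt ℝ ∞ (fun w : Base × (ℝ × ℝ) => k w.1) (q, a) := fun {k q a} hk =>
    ContDiffAt.comp (f := Prod.fst) (q, a) hk contDiffAt_fst
  have hU0x : ∀ {p}, (∀ᶠ r in 𝓝 p, P r) → pdx (pdx U₀) p = 0 := fun hp =>
    dir_vanish_of_eventually (hp.mono fun r hr => hr.2.2.1)
  refine exists_skew (P := P)
    (G := fun q a => ((pdx X q * a.1 - pdt X q) / pdt T q + U₀ q, pdx X q ^ 2 / pdt T q * a.2))
    (G' := fun q a => ((pdt T q * (a.1 - U₀ q) + pdt X q) / pdx X q,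
      (pdx X q ^ 2 / pdt T q)⁻¹ * a.2)) hz hφ hP ?_ ?_ ?_ ?_ ?_ ?_ ?_
  · intro q hq a
    exact ((((hlift (sXx hq)).mul contDiffAt_snd.fst).sub (hlift (sXt hq))).div
      (hlift (sTt hq)) hq.1.T_t).add (hlift hq.1.smooth_U₀) |>.prodMk
      ((((hlift (sXx hq)).pow 2).div (hlift (sTt hq)) hq.1.T_t).mul contDiffAt_snd.snd)
  · intro q hq a
    exact ((((hlift (sTt hq)).mul (contDiffAt_snd.fst.sub (hlift hq.1.smooth_U₀))).add
      (hlift (sXt hq))).div (hlift (sXx hq)) (hXx hq)).prodMk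
      (((((hlift (sXx hq)).pow 2).div (hlift (sTt hq)) hq.1.T_t).inv
        (div_ne_zero (pow_ne_zero 2 (hXx hq)) hq.1.T_t)).mul contDiffAt_snd.snd)
  · intro q hq a
    have h1 := hXx hq
    have h2 := hq.1.T_t
    refine Prod.ext ?_ ?_
    · simp only; field_simp; ring
    · exact inv_mul_cancel_left₀ (div_ne_zero (pow_ne_zero 2 (hXx hq)) hq.1.T_t) a.2
  · intro q hq a
    have h1 := hXx hq
    have h2 := hq.1.T_t
    refine Prod.ext ?_ ?_
    · simp only; field_simp; ring
    · exact mul_inv_cancel_left₀ (div_ne_zero (pow_ne_zero 2 (hXx hq)) hq.1.T_t) a.2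
  · intro F hF p hp hPp
    obtain ⟨F', hF'C, hF'dom, hF', hF'all⟩ := Regular.exists_target (q := p)
      (hPp.mono fun r hr => hr.1) (a2 := fun r => pdx X r ^ 2 / pdt T r * F.A2 r)
      (a1 := fun r => (pdx X r * F.A1 r - pdt X r) / pdt T r + U₀ r) (by
        filter_upwards [hPp, F.dom_open.mem_nhds hp] with r h1 h2
        exact ⟨(((sXx h1).pow 2).div (sTt h1) h1.1.T_t).mul (F.contDiffAt_A2 h2),
          mul_ne_zero (div_ne_zero (pow_ne_zero 2 (hXx h1)) h1.1.T_t) (F.A2_ne r h2)⟩)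
      (by
        filter_upwards [hPp, F.dom_open.mem_nhds hp] with r h1 h2
        exact ((((sXx h1).mul (F.contDiffAt_A1 h2)).sub (sXt h1)).div (sTt h1) h1.1.T_t).add
          h1.1.smooth_U₀) (P := fun r => (∀ᶠ s in 𝓝 r, P s) ∧ r ∈ F.dom)
      (hPp.eventually_nhds.and (F.dom_open.mem_nhds hp))
    refine ⟨F', ⟨fun r' _ => hF'C r', fun r' hr' => ?_⟩, ?_⟩
    · obtain ⟨r, ⟨hPr, hrF⟩, hr, he⟩ := hF'all r' hr'
      have key := Regular.A1_xx (hPr.mono fun s hs => hs.1) (hPr.mono fun s hs => hs.2.2.1)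
        (F.contDiffAt_A1 hrF) (b := F'.A1) (by rw [hr]; exact F'.contDiffAt_A1 hr') (by
          filter_upwards [he, hPr] with s h1 h2
          have := h2.1.T_t
          rw [h1.2]; field_simp)
      rw [hr] at key
      intro h0
      rw [h0, zero_mul, mul_zero] at key
      exact mul_ne_zero (hXx hPr.self_of_nhds) (hF.2 r hrF) key.symm
    have hB : Filter.Tendsto (fun r => (T r, X r)) (𝓝 p) (𝓝 (T p, X p)) :=
      hPp.self_of_nhds.1.smooth_T.continuousAt.prodMk hPp.self_of_nhds.1.smooth_X.continuousAt
    filter_upwards [hPp, hF', hB.eventually (F'.dom_open.mem_nhds hF'dom),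
      (hPp.mono fun r hr => hr.1).eventually_nhds, F.dom_open.mem_nhds hp,
      hPp.eventually_nhds] with r h1 h2 h3 h4 h5 h6
    refine ⟨h3, Prod.ext h2.2 h2.1, Regular.intertwines h4 (hF.1 r h5) (hF'C _)
      (by rw [h1.2.1, h1.2.2.1]; ring) ?_ h2.1 ?_⟩
    · rw [hU0x h6, h1.2.2.1, h1.2.2.2]; ring
    · have := h1.1.T_t
      rw [h2.2]; field_simp
  · intro F' hF' p hp hPp
    have hB : Filter.Tendsto (fun r => (T r, X r)) (𝓝 p) (𝓝 (T p, X p)) :=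
      hPp.self_of_nhds.1.smooth_T.continuousAt.prodMk hPp.self_of_nhds.1.smooth_X.continuousAt
    obtain ⟨ρ, hρ, hb⟩ := exists_ball_of_eventually
      (hPp.eventually_nhds.and (hB.eventually (F'.dom_open.mem_nhds hp)))
    have hb1 : ∀ r ∈ Metric.ball p ρ, P r := fun r hr => (hb r hr).1.self_of_nhds
    have hne : ∀ r, P r → (pdx X r ^ 2 / pdt T r)⁻¹ ≠ 0 := fun r hr =>
      inv_ne_zero (div_ne_zero (pow_ne_zero 2 (hXx hr)) hr.1.T_t)
    have sA1 : ∀ r ∈ Metric.ball p ρ, ContDiffAt ℝ ∞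
        (fun r => (pdt T r * (F'.A1 (T r, X r) - U₀ r) + pdt X r) / pdx X r) r := fun r hr =>
      (((sTt (hb1 r hr)).mul ((contDiffAt_comp_base (F'.contDiffAt_A1 (hb r hr).2)
        (hb1 r hr).1.smooth_T (hb1 r hr).1.smooth_X).sub (hb1 r hr).1.smooth_U₀)).add
        (sXt (hb1 r hr))).div (sXx (hb1 r hr)) (hXx (hb1 r hr))
    refine ⟨Eqn.onBall p ρ hρ (fun r => (pdx X r ^ 2 / pdt T r)⁻¹ * F'.A2 (T r, X r))
      (fun r => (pdt T r * (F'.A1 (T r, X r) - U₀ r) + pdt X r) / pdx X r) (fun _ => 1)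
      (fun r hr => (((((sXx (hb1 r hr)).pow 2).div (sTt (hb1 r hr)) (hb1 r hr).1.T_t).inv
        (div_ne_zero (pow_ne_zero 2 (hXx (hb1 r hr)))
        (hb1 r hr).1.T_t)).mul (contDiffAt_comp_base (F'.contDiffAt_A2 (hb r hr).2)
          (hb1 r hr).1.smooth_T (hb1 r hr).1.smooth_X)).contDiffWithinAt)
      (fun r hr => (sA1 r hr).contDiffWithinAt) contDiffOn_const
      (fun r hr => mul_ne_zero (hne r (hb1 r hr)) (F'.A2_ne _ (hb r hr).2))
      (fun _ _ => one_ne_zero), ⟨fun _ _ => rfl, fun r hr => ?_⟩, ?_⟩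
    · have hr : r ∈ Metric.ball p ρ := hr
      have hPr := (hb r hr).1
      have key := Regular.A1_xx (hPr.mono fun s hs => hs.1) (hPr.mono fun s hs => hs.2.2.1)
        (sA1 r hr) (b := F'.A1) (F'.contDiffAt_A1 (hb r hr).2) (by
          filter_upwards [hPr] with s h2
          have := hXx h2
          field_simp; ring)
      intro h0
      change pdx (pdx _) r = 0 at h0
      simp only [Eqn.onBall] at h0
      rw [h0, mul_zero] at key
      exact mul_ne_zero (hb1 r hr).1.T_t (mul_ne_zero (hF'.2 _ (hb r hr).2)
        (pow_ne_zero 2 (hXx (hb1 r hr)))) key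
    filter_upwards [Metric.ball_mem_nhds p hρ, (hPp.mono fun r hr => hr.1).eventually_nhds]
      with r hr h4
    obtain ⟨h1', h2⟩ := hb r hr
    have h1 := h1'.self_of_nhds
    have hX := hXx h1
    have hT := h1.1.T_t
    have e : F'.A2 (T r, X r) = pdx X r ^ 2 / pdt T r * ((pdx X r ^ 2 / pdt T r)⁻¹
        * F'.A2 (T r, X r)) :=
      (mul_inv_cancel_left₀ (div_ne_zero (pow_ne_zero 2 hX) hT) _).symm
    refine ⟨hr, Prod.ext ?_ e, Regular.intertwines h4 rfl (hF'.1 _ h2)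
      (by rw [h1.2.1, h1.2.2.1]; ring) ?_ e ?_⟩
    · change F'.A1 (T r, X r) = (pdx X r * ((pdt T r * (F'.A1 (T r, X r) - U₀ r) + pdt X r)
        / pdx X r) - pdt X r) / pdt T r + U₀ r
      field_simp; ring
    · rw [hU0x h1', h1.2.2.1, h1.2.2.2]; ring
    · change _ = pdx X r * ((pdt T r * (F'.A1 (T r, X r) - U₀ r) + pdt X r) / pdx X r) - _ + _
      field_simp; ring
  · filter_upwards [hI, hP, hreg.eventually_nhds, hdoms] with q h1 h2 h3 h4
    have e2 := h1.eq_A2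
    have e1 := h1.eq_A1
    rw [Regular.X_xx h3, hE'.1 _ h4.2] at e1
    have hT := h2.1.T_t
    refine Prod.ext ?_ ?_
    · change E'.A1 _ = (pdx X q * E.A1 q - _) / _ + _
      field_simp
      linear_combination e1
    · change E'.A2 _ = _ * E.A2 q
      field_simp
      linear_combination e2

/-! ## The heat potential -/

section HeatPotential

set_option linter.unusedSectionVars false

open MeasureTheory ProbabilityTheory

/-- The product of the Lebesgue measure on the positive half-line and the Gaussian measure of
variance `2`. -/
def heatMeasure : Measure (ℝ × ℝ) := (volume.restrict (Set.Ioi 0)).prod (gaussianReal 0 2)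

/-- The parabolic scaling. -/
def heatShift (w : ℝ × ℝ) : Base := (w.1, √w.1 * w.2)

lemma continuous_heatShift : Continuous heatShift := by
  unfold heatShift
  exact continuous_fst.prodMk ((Real.continuous_sqrt.comp continuous_fst).mul continuous_snd)

variable {W : Type} [NormedAddCommGroup W] [NormedSpace ℝ W]

/-- The heat potential with density `F`. -/
def heatPot (F : Base → W) (p : Base) : W := ∫ w, F (p - heatShift w) ∂heatMeasure

/-- The slab of the integration variables that matter for times before `a`. -/
def heatBound (M a : ℝ) : ℝ × ℝ → ℝ := Set.indicator (Set.Ioc 0 a ×ˢ Set.univ) fun _ => M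

lemma ae_heatMeasure_pos : ∀ᵐ w ∂heatMeasure, 0 < w.1 := by
  have : heatMeasure = (heatMeasure).restrict (Set.Ioi 0 ×ˢ Set.univ) := by
    unfold heatMeasure
    rw [← Measure.prod_restrict, Measure.restrict_restrict measurableSet_Ioi, Set.inter_self,
      Measure.restrict_univ]
  rw [this]
  filter_upwards [ae_restrict_mem (measurableSet_Ioi.prod MeasurableSet.univ)] with w hw
  exact hw.1

lemma heatMeasure_slab (a : ℝ) :
    heatMeasure (Set.Ioc 0 a ×ˢ Set.univ) = ENNReal.ofReal a := by
  unfold heatMeasure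
  rw [Measure.prod_prod, measure_univ, mul_one, Measure.restrict_apply measurableSet_Ioc,
    Set.inter_eq_left.2 fun x hx => hx.1, Real.volume_Ioc, sub_zero]

lemma integrable_heatBound (M a : ℝ) : Integrable (heatBound M a) heatMeasure := by
  refine (integrable_indicator_iff (measurableSet_Ioc.prod MeasurableSet.univ)).2 ?_
  refine integrableOn_const ?_
  rw [heatMeasure_slab]; exact ENNReal.ofReal_ne_top

variable {F : Base → W} {R M : ℝ}

/-- A density that vanishes for `|t| > R` is seen at time `p.1` only through delays `s ≤ p.1 + R`.
These fill a slab of finite measure, which gives a dominating function uniform in `p` with `p.1 + R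
≤ a`. -/
lemma norm_le_heatBound (hR : ∀ p, F p ≠ 0 → |p.1| ≤ R) (hM : ∀ p, ‖F p‖ ≤ M) {p : Base} {a : ℝ}
    (hp : p.1 + R ≤ a) {w : ℝ × ℝ} (hw : 0 < w.1) : ‖F (p - heatShift w)‖ ≤ heatBound M a w := by
  have hM0 : 0 ≤ M := (norm_nonneg _).trans (hM 0)
  by_cases h0 : F (p - heatShift w) = 0
  · rw [h0, norm_zero]
    exact Set.indicator_nonneg (fun _ _ => hM0) w
  · have h1 := abs_le.1 (hR _ h0)
    have h2 : (p - heatShift w).1 = p.1 - w.1 := rfl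
    rw [h2] at h1
    unfold heatBound
    rw [Set.indicator_of_mem (show w ∈ Set.Ioc 0 a ×ˢ Set.univ from ⟨⟨hw, by linarith⟩, trivial⟩)]
    exact hM _

lemma aestronglyMeasurable_heat (hc : Continuous F) (p : Base) :
    AEStronglyMeasurable (fun w => F (p - heatShift w)) heatMeasure :=
  (hc.comp (continuous_const.sub continuous_heatShift)).aestronglyMeasurable

lemma integrable_heat (hc : Continuous F) (hR : ∀ p, F p ≠ 0 → |p.1| ≤ R)
    (hM : ∀ p, ‖F p‖ ≤ M) (p : Base) :
    Integrable (fun w => F (p - heatShift w)) heatMeasure := by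
  refine (integrable_heatBound M (p.1 + R)).mono' (aestronglyMeasurable_heat hc p) ?_
  filter_upwards [ae_heatMeasure_pos] with w hw using norm_le_heatBound hR hM le_rfl hw

/-- Time bound of the support. -/
lemma exists_time_bound (hF : HasCompactSupport F) : ∃ R, ∀ p, F p ≠ 0 → |p.1| ≤ R := by
  obtain ⟨R, hR⟩ := hF.isCompact.isBounded.exists_norm_le
  exact ⟨R, fun p hp => (norm_fst_le p).trans (hR p (subset_tsupport F hp))⟩

/-- In the scaled variables the shift does not depend on `p`, so differentiation falls on the
density and the singularity of the heat kernel never appears. -/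
lemma hasFDerivAt_heatPot (hs : ContDiff ℝ ∞ F) (hF : HasCompactSupport F) (p : Base) :
    HasFDerivAt (heatPot F) (heatPot (fderiv ℝ F) p) p := by
  obtain ⟨R, hR⟩ := exists_time_bound hF
  have hF' : HasCompactSupport (fderiv ℝ F) := hF.fderiv ℝ
  obtain ⟨R', hR'⟩ := exists_time_bound hF'
  have hs' : Continuous (fderiv ℝ F) := hs.continuous_fderiv (by simp)
  obtain ⟨M, hM⟩ := hF.exists_bound_of_continuous hs.continuous
  obtain ⟨M', hM'⟩ := hF'.exists_bound_of_continuous hs'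
  refine hasFDerivAt_integral_of_dominated_of_fderiv_le
    (F' := fun q w => fderiv ℝ F (q - heatShift w)) (Metric.ball_mem_nhds p one_pos)
    (Filter.Eventually.of_forall fun q => aestronglyMeasurable_heat hs.continuous q)
    (integrable_heat hs.continuous hR hM p) (aestronglyMeasurable_heat hs' p)
    (bound := heatBound M' (p.1 + 1 + R')) ?_ (integrable_heatBound _ _) ?_
  · filter_upwards [ae_heatMeasure_pos] with w hw q hq
    refine norm_le_heatBound hR' hM' ?_ hw
    have h1 : |q.1 - p.1| < 1 := (norm_fst_le (q - p)).trans_lt (mem_ball_iff_norm.1 hq)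
    linarith [(abs_lt.1 h1).2]
  · refine Filter.Eventually.of_forall fun w q _ => ?_
    have h1 : HasFDerivAt F (fderiv ℝ F (q - heatShift w)) (q - heatShift w) :=
      (hs.differentiable (by simp) _).hasFDerivAt
    have := h1.comp q ((hasFDerivAt_id q).sub_const (heatShift w))
    exact this

lemma fderiv_heatPot (hs : ContDiff ℝ ∞ F) (hF : HasCompactSupport F) :
    fderiv ℝ (heatPot F) = heatPot (fderiv ℝ F) :=
  funext fun p => (hasFDerivAt_heatPot hs hF p).fderiv

end HeatPotential

/-- Induction on the order. The derivative of a heat potential is the heat potential of `fderiv ℝ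
F`, whose values lie in another normed space; hence the quantification over `W`. -/
lemma contDiff_heatPot_nat (n : ℕ) : ∀ {W : Type} [NormedAddCommGroup W] [NormedSpace ℝ W]
    {F : Base → W}, ContDiff ℝ ∞ F → HasCompactSupport F → ContDiff ℝ n (heatPot F) := by
  induction n with
  | zero =>
    intro W _ _ F hs hF
    exact contDiff_zero.2
      (continuous_iff_continuousAt.2 fun p => (hasFDerivAt_heatPot hs hF p).continuousAt)
  | succ n ih =>
    intro W _ _ F hs hF
    push_cast
    refine contDiff_succ_iff_fderiv.2
      ⟨fun p => (hasFDerivAt_heatPot hs hF p).differentiableAt, by simp, ?_⟩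
    rw [fderiv_heatPot hs hF]
    exact ih (hs.fderiv_right (by simp)) (hF.fderiv ℝ)

lemma contDiff_heatPot {F : Base → ℝ} (hs : ContDiff ℝ ∞ F) (hF : HasCompactSupport F) :
    ContDiff ℝ ∞ (heatPot F) :=
  contDiff_infty.2 fun n => contDiff_heatPot_nat n hs hF

lemma dir_heatPot {F : Base → ℝ} (hs : ContDiff ℝ ∞ F) (hF : HasCompactSupport F) (v : Base) :
    dir v (heatPot F) = heatPot (dir v F) := by
  funext p
  have hF' : HasCompactSupport (fderiv ℝ F) := hF.fderiv ℝ
  have hs' : Continuous (fderiv ℝ F) := hs.continuous_fderiv (by simp)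
  obtain ⟨R', hR'⟩ := exists_time_bound hF'
  obtain ⟨M', hM'⟩ := hF'.exists_bound_of_continuous hs'
  unfold dir
  rw [fderiv_heatPot hs hF]
  exact ContinuousLinearMap.integral_apply (integrable_heat hs' hR' hM' p) v

section HeatEquation

open MeasureTheory ProbabilityTheory

/-- Gaussian integration by parts. -/
lemma gaussian_integral_mul {h h' : ℝ → ℝ} {M : ℝ} (hd : ∀ z, HasDerivAt h (h' z) z)
    (hc : Continuous h') (hM : ∀ z, |h z| ≤ M) (hM' : ∀ z, |h' z| ≤ M) :
    ∫ z, h z * z ∂(gaussianReal 0 2) = 2 * ∫ z, h' z ∂(gaussianReal 0 2) := by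
  have hv : (2 : NNReal) ≠ 0 := two_ne_zero
  have hch : Continuous h := continuous_iff_continuousAt.2 fun z => (hd z).continuousAt
  set ρ := gaussianPDFReal 0 2 with hρ
  have hρd : ∀ z, HasDerivAt ρ (-(z / 2) * ρ z) z := by
    intro z
    have h1 : HasDerivAt (fun x : ℝ => -(x - 0) ^ 2 / (2 * ((2 : NNReal) : ℝ))) (-(z / 2)) z := by
      have := (((hasDerivAt_id z).sub_const 0).pow 2).neg.div_const (2 * ((2 : NNReal) : ℝ))
      refine this.congr_deriv ?_
      simp; ring
    have := (h1.exp).const_mul ((√(2 * Real.pi * ((2 : NNReal) : ℝ)))⁻¹)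
    refine this.congr_deriv ?_
    rw [hρ, gaussianPDFReal_def]
    ring
  have int1 : Integrable (fun z : ℝ => h z * z) (gaussianReal 0 2) := by
    have hid : Integrable (fun z : ℝ => z) (gaussianReal 0 2) :=
      (memLp_id_gaussianReal (μ := 0) (v := 2) 1).integrable (by simp)
    exact hid.bdd_mul hch.aestronglyMeasurable (Filter.Eventually.of_forall hM)
  have int2 : Integrable h' (gaussianReal 0 2) :=
    Integrable.of_bound hc.aestronglyMeasurable M (Filter.Eventually.of_forall hM')
  have int3 : Integrable h (gaussianReal 0 2) :=
    Integrable.of_bound hch.aestronglyMeasurable M (Filter.Eventually.of_forall hM)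
  have conv : ∀ {k : ℝ → ℝ}, Integrable k (gaussianReal 0 2) → Integrable (fun z => ρ z * k z) := by
    intro k hk
    rw [gaussianReal_of_var_ne_zero 0 hv] at hk
    have := (integrable_withDensity_iff_integrable_smul' (measurable_gaussianPDF 0 2)
      (Filter.Eventually.of_forall fun _ => gaussianPDF_lt_top)).1 hk
    simpa [toReal_gaussianPDF] using this
  -- For variance `2` the density satisfies `ρ' = -(z / 2) ρ`, and the integral of `(ρ h)'` over the
  -- line is zero.
  have key := integral_eq_zero_of_hasDerivAt_of_integrable (f := fun z => ρ z * h z)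
    (f' := fun z => ρ z * h' z - 1 / 2 * (ρ z * (h z * z)))
    (fun z => ((hρd z).mul (hd z)).congr_deriv (by ring))
    ((conv int2).sub ((conv int1).const_mul _)) (conv int3)
  rw [integral_sub (conv int2) ((conv int1).const_mul _), integral_const_mul] at key
  rw [integral_gaussianReal_eq_integral_smul hv, integral_gaussianReal_eq_integral_smul hv]
  simp only [smul_eq_mul]
  linarith

/-- The heat potential solves the heat equation. -/
lemma heatPot_heat {F : Base → ℝ} (hs : ContDiff ℝ ∞ F) (hF : HasCompactSupport F) (p : Base) :
    pdt (heatPot F) p - pdx (pdx (heatPot F)) p = F p := by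
  have sx : ContDiff ℝ ∞ (pdx F) := contDiff_iff_contDiffAt.2 fun q =>
    contDiffAt_dir hs.contDiffAt
  have st : ContDiff ℝ ∞ (pdt F) := contDiff_iff_contDiffAt.2 fun q =>
    contDiffAt_dir hs.contDiffAt
  have sxx : ContDiff ℝ ∞ (pdx (pdx F)) := contDiff_iff_contDiffAt.2 fun q =>
    contDiffAt_dir sx.contDiffAt
  have kd : ∀ {G : Base → ℝ} (v : Base), HasCompactSupport G → HasCompactSupport (dir v G) :=
    fun v hG => (hG.fderiv_apply ℝ v)
  have kx : HasCompactSupport (pdx F) := kd _ hF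
  have kt : HasCompactSupport (pdt F) := kd _ hF
  have kxx : HasCompactSupport (pdx (pdx F)) := kd _ kx
  have e1 : pdt (heatPot F) = heatPot (pdt F) := dir_heatPot hs hF (1, 0)
  have e2 : pdx (heatPot F) = heatPot (pdx F) := dir_heatPot hs hF (0, 1)
  have e3 : pdx (heatPot (pdx F)) = heatPot (pdx (pdx F)) := dir_heatPot sx kx (0, 1)
  obtain ⟨R, hR⟩ := exists_time_bound hF
  obtain ⟨Rt, hRt⟩ := exists_time_bound kt
  obtain ⟨Rx, hRx⟩ := exists_time_bound kxx
  obtain ⟨M, hM⟩ := hF.exists_bound_of_continuous hs.continuous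
  obtain ⟨Mx, hMx⟩ := kx.exists_bound_of_continuous sx.continuous
  obtain ⟨Mt, hMt⟩ := kt.exists_bound_of_continuous st.continuous
  obtain ⟨Mxx, hMxx⟩ := kxx.exists_bound_of_continuous sxx.continuous
  have it := integrable_heat st.continuous hRt hMt p
  have ixx := integrable_heat sxx.continuous hRx hMxx p
  rw [e1, e2, e3]
  unfold heatPot
  rw [← integral_sub it ixx]
  have isub : Integrable (fun w => pdt F (p - heatShift w) - pdx (pdx F) (p - heatShift w))
      heatMeasure := it.sub ixx
  unfold heatMeasure at isub ⊢
  rw [integral_prod _ isub]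
  set γ := gaussianReal 0 2 with hγ
  -- the evolution of `F` along the backward heat flow
  have cont : ∀ {G : Base → ℝ}, Continuous G → ∀ s : ℝ,
      Continuous fun z : ℝ => G (p - heatShift (s, z)) := fun hG s =>
    hG.comp (continuous_const.sub (continuous_heatShift.comp (continuous_const.prodMk
      continuous_id)))
  have ibd : ∀ {G : Base → ℝ} {B : ℝ}, Continuous G → (∀ q, ‖G q‖ ≤ B) → ∀ s : ℝ,
      Integrable (fun z : ℝ => G (p - heatShift (s, z))) γ := fun hG hB s =>
    Integrable.of_bound (cont hG s).aestronglyMeasurable _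
      (Filter.Eventually.of_forall fun z => hB _)
  -- `m s` is the expectation of `F(t - s, x - √s Z)` with `Z` Gaussian of variance `2`. Its
  -- derivative is minus the expectation of `F_t - F_xx`, so the integral over `s > 0` telescopes to
  -- `m 0 - m ∞ = F p`.
  set m : ℝ → ℝ := fun s => ∫ z, F (p - heatShift (s, z)) ∂γ with hm
  have hcontm : Continuous m := by
    refine continuous_of_dominated (fun s => (cont hs.continuous s).aestronglyMeasurable)
      (fun s => Filter.Eventually.of_forall fun z => hM _) (integrable_const M)
      (Filter.Eventually.of_forall fun z => ?_)
    exact hs.continuous.comp (continuous_const.sub (continuous_heatShift.comp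
      (continuous_id.prodMk continuous_const)))
  have hderiv : ∀ s ∈ Set.Ioi (0 : ℝ), HasDerivAt m
      (-∫ z, (pdt F (p - heatShift (s, z)) - pdx (pdx F) (p - heatShift (s, z))) ∂γ) s := by
    intro s hs0
    have hs0 : 0 < s := hs0
    have hsq : 0 < √s := Real.sqrt_pos.2 hs0
    -- pointwise derivative
    have hpt : ∀ z : ℝ, ∀ r : ℝ, 0 < r → HasDerivAt (fun r => F (p - heatShift (r, z)))
        (-pdt F (p - heatShift (r, z)) - pdx F (p - heatShift (r, z)) * (z / (2 * √r))) r := by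
      intro z r hr
      have h1 : HasDerivAt (fun r : ℝ => p - heatShift (r, z))
          ((-1, -(z / (2 * √r))) : Base) r := by
        have a1 : HasDerivAt (fun r : ℝ => p.1 - r) (-1) r := (hasDerivAt_id r).const_sub p.1
        have a2 : HasDerivAt (fun r : ℝ => p.2 - √r * z) (-(z / (2 * √r))) r :=
          (((Real.hasDerivAt_sqrt hr.ne').mul_const z).const_sub p.2).congr_deriv (by ring)
        exact a1.prodMk a2
      have h2 : HasFDerivAt F (fderiv ℝ F (p - heatShift (r, z))) (p - heatShift (r, z)) :=
        (hs.differentiable (by simp) _).hasFDerivAt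
      have := h2.comp_hasDerivAt r h1
      refine this.congr_deriv ?_
      have e : ((-1, -(z / (2 * √r))) : Base)
          = (-1 : ℝ) • ((1, 0) : Base) + (-(z / (2 * √r))) • ((0, 1) : Base) := by
        ext <;> simp
      rw [e, map_add, map_smul, map_smul]
      simp only [pdt, pdx, smul_eq_mul]; ring
    -- The derivative of `√r` is bounded only away from `r = 0`; above `s / 2` a uniform majorant
    -- exists.
    have hball : Set.Ioi (s / 2) ∈ 𝓝 s := Ioi_mem_nhds (by linarith)
    have hidγ : Integrable (fun z : ℝ => |z|) γ :=
      ((memLp_id_gaussianReal (μ := 0) (v := 2) 1).integrable (by simp)).abs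
    have ibound : Integrable (fun z : ℝ => Mt + Mx * (|z| / (2 * √(s / 2)))) γ :=
      (integrable_const _).add ((hidγ.div_const _).const_mul _)
    have hMx0 : 0 ≤ Mx := (norm_nonneg _).trans (hMx 0)
    obtain ⟨-, hD⟩ := hasDerivAt_integral_of_dominated_loc_of_deriv_le (μ := γ)
      (F := fun r z => F (p - heatShift (r, z)))
      (F' := fun r z => -pdt F (p - heatShift (r, z))
        - pdx F (p - heatShift (r, z)) * (z / (2 * √r))) hball
      (Filter.Eventually.of_forall fun r => (cont hs.continuous r).aestronglyMeasurable)
      (ibd hs.continuous hM s)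
      (((cont st.continuous s).neg.sub ((cont sx.continuous s).mul
        (continuous_id.div_const _))).aestronglyMeasurable)
      (Filter.Eventually.of_forall fun z r hr => by
        have hr : s / 2 < r := hr
        have b1 := hMt (p - heatShift (r, z))
        have b2 := hMx (p - heatShift (r, z))
        refine (norm_sub_le _ _).trans (add_le_add (by rwa [norm_neg]) ?_)
        rw [norm_mul]
        refine mul_le_mul b2 ?_ (norm_nonneg _) hMx0
        rw [Real.norm_eq_abs, abs_div, abs_of_nonneg (by positivity : (0 : ℝ) ≤ 2 * √r)]
        have : √(s / 2) ≤ √r := Real.sqrt_le_sqrt hr.le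
        have : 0 < √(s / 2) := Real.sqrt_pos.2 (by linarith)
        gcongr)
      ibound
      (Filter.Eventually.of_forall fun z r hr => hpt z r (by
        have hr : s / 2 < r := hr
        linarith))
    refine hD.congr_deriv ?_
    have igx := ibd sxx.continuous hMxx s
    have igt := ibd st.continuous hMt s
    have ibp := gaussian_integral_mul (h := fun z => pdx F (p - heatShift (s, z)))
      (h' := fun z => pdx (pdx F) (p - heatShift (s, z)) * (-√s)) (M := max Mx (Mxx * √s))
      (fun z => by
        have h1 : HasDerivAt (fun z : ℝ => p - heatShift (s, z)) ((0, -√s) : Base) z := by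
          have a1 : HasDerivAt (fun _ : ℝ => p.1 - s) 0 z := hasDerivAt_const _ _
          have a2 : HasDerivAt (fun z : ℝ => p.2 - √s * z) (-√s) z :=
            (((hasDerivAt_id z).const_mul (√s)).const_sub p.2).congr_deriv (by ring)
          exact a1.prodMk a2
        have h2 : HasFDerivAt (pdx F) (fderiv ℝ (pdx F) (p - heatShift (s, z)))
            (p - heatShift (s, z)) := (sx.differentiable (by simp) _).hasFDerivAt
        refine (h2.comp_hasDerivAt z h1).congr_deriv ?_
        have e : ((0, -√s) : Base) = (-√s) • ((0, 1) : Base) := by ext <;> simp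
        rw [e, map_smul]
        change _ * pdx (pdx F) _ = _
        ring)
      ((cont sxx.continuous s).mul continuous_const)
      (fun z => (hMx _).trans (le_max_left _ _))
      (fun z => by
        rw [abs_mul, abs_neg, abs_of_pos hsq]
        exact (mul_le_mul_of_nonneg_right (hMxx _) hsq.le).trans (le_max_right _ _))
    have ig3 : Integrable (fun z => pdx F (p - heatShift (s, z)) * (z / (2 * √s))) γ := by
      have hid : Integrable (fun z : ℝ => z / (2 * √s)) γ :=
        ((memLp_id_gaussianReal (μ := 0) (v := 2) 1).integrable (by simp)).div_const _
      exact hid.bdd_mul (cont sx.continuous s).aestronglyMeasurable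
        (Filter.Eventually.of_forall fun z => hMx _)
    rw [integral_sub (f := fun z => -pdt F (p - heatShift (s, z))) igt.neg ig3,
      integral_sub igt igx]
    -- Integration by parts in `z` produces a factor `-√s` from the chain rule, which cancels the
    -- `√s` in the denominator and leaves `-F_xx`.
    have e4 : ∫ z, pdx F (p - heatShift (s, z)) * (z / (2 * √s)) ∂γ
        = - ∫ z, pdx (pdx F) (p - heatShift (s, z)) ∂γ := by
      have : (fun z => pdx F (p - heatShift (s, z)) * (z / (2 * √s)))
          = fun z => (pdx F (p - heatShift (s, z)) * z) * (2 * √s)⁻¹ := by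
        funext z; ring
      rw [this, integral_mul_const, ibp, integral_mul_const, ← hγ]
      field_simp
    rw [e4, show ∫ z, -pdt F (p - heatShift (s, z)) ∂γ
      = - ∫ z, pdt F (p - heatShift (s, z)) ∂γ from integral_neg _]
    ring
  have hlim : Filter.Tendsto m Filter.atTop (𝓝 0) := by
    refine tendsto_const_nhds.congr' ?_
    filter_upwards [Filter.eventually_gt_atTop (p.1 + R)] with s hs'
    have : ∀ z, F (p - heatShift (s, z)) = 0 := by
      intro z
      by_contra h0
      have := (abs_le.1 (hR _ h0)).1
      have h2 : (p - heatShift (s, z)).1 = p.1 - s := rfl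
      rw [h2] at this
      linarith
    simp only [hm, this, integral_zero]
  have hfin := integral_Ioi_of_hasDerivAt_of_tendsto hcontm.continuousWithinAt hderiv
    (isub.integral_prod_left.neg) hlim
  rw [integral_neg] at hfin
  have hm0 : m 0 = F p := by
    simp only [hm]
    have : ∀ z : ℝ, p - heatShift (0, z) = p := by
      intro z
      simp [heatShift]
    simp [this, hγ]
  rw [hm0] at hfin
  linarith

end HeatEquation

/-! ### Weighted estimates and the Volterra equation -/

section Volterra

set_option linter.unusedSectionVars false

open MeasureTheory ProbabilityTheory

/-- With the weight `exp (μ t)`, integration over the delays gains the factor `∫ exp (-μ s) ds = 1 /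
μ`. A large `μ` therefore makes the Volterra operator a contraction without any smallness of `c`. -/
lemma heatMeasure_exp {μ : ℝ} (hμ : 0 < μ) (K a : ℝ) :
    Integrable (fun w : ℝ × ℝ => K * Real.exp (μ * (a - w.1))) heatMeasure ∧
      ∫ w, K * Real.exp (μ * (a - w.1)) ∂heatMeasure = K / μ * Real.exp (μ * a) := by
  have h1 : IntegrableOn (fun s : ℝ => Real.exp (-μ * s)) (Set.Ioi 0) :=
    integrableOn_exp_mul_Ioi (by linarith) 0
  have e : (fun w : ℝ × ℝ => K * Real.exp (μ * (a - w.1)))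
      = fun w => (K * Real.exp (μ * a)) * (Real.exp (-μ * w.1) * 1) := by
    funext w
    rw [mul_one, mul_assoc, ← Real.exp_add]
    ring_nf
  have h2 : Integrable (fun w : ℝ × ℝ => Real.exp (-μ * w.1) * 1) heatMeasure :=
    Integrable.mul_prod (f := fun s : ℝ => Real.exp (-μ * s)) (g := fun _ => (1 : ℝ)) h1
      (integrable_const _)
  rw [e]
  refine ⟨h2.const_mul _, ?_⟩
  rw [integral_const_mul]
  unfold heatMeasure
  rw [integral_prod_mul (fun s : ℝ => Real.exp (-μ * s)) (fun _ => (1 : ℝ)),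
    integral_exp_mul_Ioi (by linarith)]
  simp
  field_simp

variable {W : Type} [NormedAddCommGroup W] [NormedSpace ℝ W]

lemma integral_norm_heat_le {F : Base → W} {K μ : ℝ} (hμ : 0 < μ)
    (hK : ∀ q, ‖F q‖ ≤ K * Real.exp (μ * q.1)) (p : Base) :
    ∫ w, ‖F (p - heatShift w)‖ ∂heatMeasure ≤ K / μ * Real.exp (μ * p.1) := by
  rw [← (heatMeasure_exp hμ K p.1).2]
  exact integral_mono_of_nonneg (Filter.Eventually.of_forall fun w => norm_nonneg _)
    (heatMeasure_exp hμ K p.1).1 (Filter.Eventually.of_forall fun w => hK _)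

lemma norm_heatPot_le {F : Base → W} {K μ : ℝ} (hμ : 0 < μ)
    (hK : ∀ q, ‖F q‖ ≤ K * Real.exp (μ * q.1)) (p : Base) :
    ‖heatPot F p‖ ≤ K / μ * Real.exp (μ * p.1) :=
  (norm_integral_le_integral_norm _).trans (integral_norm_heat_le hμ hK p)

end Volterra

/-- Derivatives commute with the heat potential, so the gain `1 / μ` is the same at every order. -/
lemma norm_iteratedFDeriv_heatPot_le (n : ℕ) {K μ : ℝ} (hμ : 0 < μ) :
    ∀ {W : Type} [NormedAddCommGroup W] [NormedSpace ℝ W] {F : Base → W}, ContDiff ℝ ∞ F →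
      HasCompactSupport F → (∀ q, ‖iteratedFDeriv ℝ n F q‖ ≤ K * Real.exp (μ * q.1)) →
      ∀ p, ‖iteratedFDeriv ℝ n (heatPot F) p‖ ≤ K / μ * Real.exp (μ * p.1) := by
  induction n with
  | zero =>
    intro W _ _ F _ _ hK p
    simp only [norm_iteratedFDeriv_zero] at hK ⊢
    exact norm_heatPot_le hμ hK p
  | succ n ih =>
    intro W _ _ F hs hF hK p
    rw [← norm_iteratedFDeriv_fderiv, fderiv_heatPot hs hF]
    refine ih (hs.fderiv_right (by simp)) (hF.fderiv ℝ) (fun q => ?_) p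
    rw [norm_iteratedFDeriv_fderiv]
    exact hK q

/-- The iterates of the Volterra operator with kernel `c`. -/
def volterraIter (c : Base → ℝ) : ℕ → Base → ℝ
  | 0 => c
  | n + 1 => fun p => c p * heatPot (volterraIter c n) p

section Volterra

open MeasureTheory

variable {c : Base → ℝ}

lemma volterraIter_support (c : Base → ℝ) (n : ℕ) {p : Base} (h : volterraIter c n p ≠ 0) :
    c p ≠ 0 := by
  cases n with
  | zero => exact h
  | succ n => exact left_ne_zero_of_mul h

lemma volterraIter_hasCompactSupport (hc : HasCompactSupport c) (n : ℕ) :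
    HasCompactSupport (volterraIter c n) :=
  hc.mono fun _ h => volterraIter_support c n h

lemma contDiff_volterraIter (hs : ContDiff ℝ ∞ c) (hc : HasCompactSupport c) (n : ℕ) :
    ContDiff ℝ ∞ (volterraIter c n) := by
  induction n with
  | zero => exact hs
  | succ n ih => exact hs.mul (contDiff_heatPot ih (volterraIter_hasCompactSupport hc n))

/-- The Leibniz rule costs the sum of binomial coefficients, at most `2 ^ k`, and a factor `M`; the
potential gains `1 / μ`. By the choice of `μ` each iteration contributes at most `1 / 2`. -/
lemma norm_iteratedFDeriv_volterraIter_le (hs : ContDiff ℝ ∞ c) (hc : HasCompactSupport c)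
    {k : ℕ} {K M μ : ℝ} (hμ : 0 < μ) (hM : ∀ i ≤ k, ∀ q, ‖iteratedFDeriv ℝ i c q‖ ≤ M)
    (hK : ∀ i ≤ k, ∀ q, ‖iteratedFDeriv ℝ i c q‖ ≤ K * Real.exp (μ * q.1))
    (hμM : 2 ^ k * M * 2 ≤ μ) (n : ℕ) :
    ∀ i ≤ k, ∀ q, ‖iteratedFDeriv ℝ i (volterraIter c n) q‖
      ≤ K * (1 / 2) ^ n * Real.exp (μ * q.1) := by
  have hM0 : 0 ≤ M := (norm_nonneg _).trans (hM 0 (Nat.zero_le _) 0)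
  have hK0 : 0 ≤ K := by
    have := (norm_nonneg _).trans (hK 0 (Nat.zero_le _) 0)
    simpa using this
  induction n with
  | zero => simpa [volterraIter] using hK
  | succ n ih =>
    intro i hi q
    have s1 := contDiff_volterraIter hs hc n
    have s2 := volterraIter_hasCompactSupport hc n
    have h1 := norm_iteratedFDeriv_mul_le (n := i) (N := ∞) hs (contDiff_heatPot s1 s2) q
      (mod_cast le_top)
    refine h1.trans ?_
    have h2 : ∀ j ∈ Finset.range (i + 1), (i.choose j : ℝ) * ‖iteratedFDeriv ℝ j c q‖ *
        ‖iteratedFDeriv ℝ (i - j) (heatPot (volterraIter c n)) q‖ ≤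
        (i.choose j : ℝ) * (M * (K * (1 / 2) ^ n / μ * Real.exp (μ * q.1))) := by
      intro j hj
      have hj := Finset.mem_range.1 hj
      rw [mul_assoc]
      refine mul_le_mul_of_nonneg_left ?_ (Nat.cast_nonneg _)
      exact mul_le_mul (hM j (by omega) q)
        (norm_iteratedFDeriv_heatPot_le (i - j) hμ s1 s2 (ih (i - j) (by omega)) q)
        (norm_nonneg _) hM0
    refine (Finset.sum_le_sum h2).trans ?_
    rw [← Finset.sum_mul, ← Nat.cast_sum, Nat.sum_range_choose]
    have h3 : ((2 ^ i : ℕ) : ℝ) ≤ 2 ^ k := by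
      push_cast
      exact pow_le_pow_right₀ one_le_two hi
    have hX : 0 ≤ K * (1 / 2) ^ n * Real.exp (μ * q.1) := by positivity
    have h4 : 2 ^ k * M / μ ≤ 1 / 2 := by
      rw [div_le_iff₀ hμ]; linarith
    calc ((2 ^ i : ℕ) : ℝ) * (M * (K * (1 / 2) ^ n / μ * Real.exp (μ * q.1)))
        = (((2 ^ i : ℕ) : ℝ) * M / μ) * (K * (1 / 2) ^ n * Real.exp (μ * q.1)) := by ring
      _ ≤ (1 / 2) * (K * (1 / 2) ^ n * Real.exp (μ * q.1)) := by
          refine mul_le_mul_of_nonneg_right (le_trans ?_ h4) hX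
          gcongr
      _ = _ := by ring

/-- The linear Volterra equation `F = c + c * heatPot F`. -/
lemma exists_volterra (hs : ContDiff ℝ ∞ c) (hc : HasCompactSupport c) {K M μ : ℝ} (hμ : 0 < μ)
    (hM : ∀ q, |c q| ≤ M) (hK : ∀ q, |c q| ≤ K * Real.exp (μ * q.1)) (hμM : M * 2 ≤ μ) :
    ∃ F : Base → ℝ, ContDiff ℝ ∞ F ∧ HasCompactSupport F ∧
      (∀ q, F q = c q + c q * heatPot F q) ∧ ∀ q, |F q| ≤ 2 * K * Real.exp (μ * q.1) := by
  obtain ⟨R, hR⟩ := exists_time_bound hc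
  have cs : ∀ i, HasCompactSupport (iteratedFDeriv ℝ i c) := fun i =>  hc.iteratedFDeriv i
  -- Each order `k` has its own weight `ν`. As all iterates live on the compact support of `c`,
  -- where the weight is bounded above and below, a geometric majorant of the sup norms results.
  have bd : ∀ k : ℕ, ∃ v : ℕ → ℝ, Summable v ∧ ∀ n q,
      ‖iteratedFDeriv ℝ k (volterraIter c n) q‖ ≤ v n := by
    intro k
    have : ∃ M, ∀ i ≤ k, ∀ q, ‖iteratedFDeriv ℝ i c q‖ ≤ M := by
      choose B hB using fun i => (cs i).exists_bound_of_continuous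
        (hs.continuous_iteratedFDeriv (m := i) (mod_cast le_top))
      refine ⟨∑ i ∈ Finset.range (k + 1), |B i|, fun i hi q => ((hB i q).trans (le_abs_self _)).trans
        (Finset.single_le_sum (f := fun i => |B i|) (fun _ _ => abs_nonneg _)
          (Finset.mem_range.2 (by omega)))⟩
    obtain ⟨M', hM'⟩ := this
    have hM0 : 0 ≤ M' := (norm_nonneg _).trans (hM' 0 (Nat.zero_le _) 0)
    set ν := 2 ^ k * M' * 2 + 1 with hν
    have hν0 : 0 < ν := by positivity
    obtain ⟨R', hR'⟩ := hc.isCompact.isBounded.exists_norm_le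
    have vanish : ∀ n q, q ∉ tsupport c → ∀ i, iteratedFDeriv ℝ i (volterraIter c n) q = 0 := by
      intro n q hq i
      refine Function.notMem_support.1 fun h => hq ?_
      have := support_iteratedFDeriv_subset (𝕜 := ℝ) i h
      exact closure_mono (fun _ h => volterraIter_support c n h) this
    have key := norm_iteratedFDeriv_volterraIter_le hs hc (k := k) (K := M' * Real.exp (ν * R'))
      hν0 hM' (fun i hi q => by
        by_cases hq : q ∈ tsupport c
        · have h1 := (abs_le.1 ((norm_fst_le q).trans (hR' q hq))).1
          refine (hM' i hi q).trans ?_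
          rw [mul_assoc, ← Real.exp_add]
          refine le_mul_of_one_le_right hM0 (Real.one_le_exp ?_)
          have : 0 ≤ ν * (R' + q.1) := mul_nonneg hν0.le (by linarith)
          linarith
        · rw [show iteratedFDeriv ℝ i c q = 0 from vanish 0 q hq i, norm_zero]
          positivity) (by linarith)
    refine ⟨fun n => M' * Real.exp (ν * R') * (1 / 2) ^ n * Real.exp (ν * R'), ?_, fun n q => ?_⟩
    · exact ((summable_geometric_of_lt_one (by norm_num) (by norm_num)).mul_left _).mul_right _
    · by_cases hq : q ∈ tsupport c
      · refine (key n k le_rfl q).trans ?_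
        have h1 := (abs_le.1 ((norm_fst_le q).trans (hR' q hq))).2
        refine mul_le_mul_of_nonneg_left (Real.exp_le_exp.2 ?_) (by positivity)
        exact mul_le_mul_of_nonneg_left h1 hν0.le
      · rw [vanish n q hq k, norm_zero]
        positivity
  choose v hv hbd using bd
  -- The explicit bound with the prescribed `μ` and `K` is needed at order zero only. It will keep
  -- the heat solution away from zero.
  have h0 := norm_iteratedFDeriv_volterraIter_le hs hc (k := 0) (K := K) (M := M) hμ
    (fun i hi q => by
      obtain rfl : i = 0 := by omega
      simpa using hM q)
    (fun i hi q => by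
      obtain rfl : i = 0 := by omega
      simpa using hK q) (by linarith)
  have h0' : ∀ n q, |volterraIter c n q| ≤ K * (1 / 2) ^ n * Real.exp (μ * q.1) := fun n q => by
    simpa using h0 n 0 le_rfl q
  have hK0 : 0 ≤ K := by
    have := (abs_nonneg _).trans (hK 0)
    simpa using this
  have geo : Summable fun n : ℕ => (1 / 2 : ℝ) ^ n :=
    summable_geometric_of_lt_one (by norm_num) (by norm_num)
  have hsum : ∀ q, Summable fun n => volterraIter c n q := fun q =>
    Summable.of_norm_bounded ((geo.mul_left K).mul_right (Real.exp (μ * q.1))) fun n => h0' n q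
  have it : ∀ n p, Integrable (fun w => volterraIter c n (p - heatShift w)) heatMeasure := by
    intro n p
    have s1 := contDiff_volterraIter hs hc n
    have s2 := volterraIter_hasCompactSupport hc n
    obtain ⟨R1, hR1⟩ := exists_time_bound s2
    obtain ⟨M1, hM1⟩ := s2.exists_bound_of_continuous s1.continuous
    exact integrable_heat s1.continuous hR1 hM1 p
  refine ⟨fun q => ∑' n, volterraIter c n q, ?_, ?_, fun p => ?_, fun q => ?_⟩
  · exact contDiff_tsum (N := ⊤) (fun n => contDiff_volterraIter hs hc n) (fun k _ => hv k)
      (fun k n q _ => hbd k n q)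
  · refine hc.mono fun q hq hq0 => hq ?_
    have : ∀ n, volterraIter c n q = 0 := fun n => by
      by_contra h
      exact volterraIter_support c n h hq0
    simp [this]
  · have hint : HasSum (fun n => heatPot (volterraIter c n) p)
        (heatPot (fun q => ∑' n, volterraIter c n q) p) := by
      refine hasSum_integral_of_summable_integral_norm (fun n => it n p) ?_
      refine Summable.of_nonneg_of_le (fun n => integral_nonneg fun _ => norm_nonneg _)
        (fun n => integral_norm_heat_le hμ (h0' n) p) ?_
      exact ((geo.mul_left K).div_const μ).mul_right _
    refine ((hsum p).tsum_eq_zero_add).trans ?_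
    congr 1
    rw [← hint.tsum_eq, ← tsum_mul_left]
    rfl
  · have h1 : HasSum (fun n : ℕ => K * (1 / 2 : ℝ) ^ n * Real.exp (μ * q.1))
        (K * 2 * Real.exp (μ * q.1)) := by
      have := (hasSum_geometric_two.mul_left K).mul_right (Real.exp (μ * q.1))
      exact this
    rw [mul_comm 2 K]
    exact tsum_of_norm_bounded (f := fun n => volterraIter c n q) h1 (fun n => h0' n q)

/-- Local solvability of the linear heat equation with a potential. -/
lemma exists_heat_solution {c : Base → ℝ} {U : Set Base} (hU : IsOpen U)
    (hc : ContDiffOn ℝ ∞ c U) {p : Base} (hp : p ∈ U) :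
    ∃ V : Base → ℝ, ContDiff ℝ ∞ V ∧ V p ≠ 0 ∧
      ∀ᶠ q in 𝓝 p, pdt V q = pdx (pdx V) q + c q * V q := by
  have hcont : ContinuousAt c p := (hc.contDiffAt (hU.mem_nhds hp)).continuousAt
  set M := |c p| + 1 with hMdef
  have hM0 : 0 < M := by positivity
  have hnear : ∀ᶠ q in 𝓝 p, q ∈ U ∧ |c q| < M := by
    filter_upwards [hU.mem_nhds hp, hcont.abs.eventually_lt_const
      (show |c p| < M by linarith)] with q h1 h2 using ⟨h1, h2⟩
  obtain ⟨r₀, hr₀, hball⟩ := Metric.eventually_nhds_iff_ball.1 hnear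
  -- The second bound gives `4 M r ≤ 1 / 2`, where `4 M` is the exponent of the weight used below.
  set r := min (r₀ / 2) (1 / (8 * M)) with hr
  have hr_pos : 0 < r := by positivity
  have hrr : r < r₀ := (min_le_left _ _).trans_lt (by linarith)
  have hrM : 4 * M * r ≤ 1 / 2 := by
    have : r ≤ 1 / (8 * M) := min_le_right _ _
    rw [le_div_iff₀ (by positivity)] at this
    linarith
  -- A cut-off, equal to `1` near `p`, turns `c` into the globally smooth, compactly supported
  -- potential `d`.
  let b : ContDiffBump p := ⟨r / 2, r, by linarith, by linarith⟩
  have hin : ∀ q ∈ tsupport b, q ∈ Metric.ball p r₀ := by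
    intro q hq
    rw [b.tsupport_eq] at hq
    exact Metric.closedBall_subset_ball hrr hq
  set d : Base → ℝ := fun q => b q * c q with hd
  have hds : ContDiff ℝ ∞ d := by
    refine contDiff_iff_contDiffAt.2 fun q => ?_
    by_cases hq : q ∈ tsupport b
    · exact b.contDiffAt.mul (hc.contDiffAt (hU.mem_nhds (hball q (hin q hq)).1))
    · have : d =ᶠ[𝓝 q] fun _ => 0 := by
        filter_upwards [notMem_tsupport_iff_eventuallyEq.1 hq] with y hy
        simp [hd, hy]
      exact contDiffAt_const.congr_of_eventuallyEq this
  have hdc : HasCompactSupport d := b.hasCompactSupport.mul_right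
  have hdM : ∀ q, |d q| ≤ M := by
    intro q
    by_cases hq : q ∈ tsupport b
    · rw [hd, abs_mul, abs_of_nonneg b.nonneg]
      calc b q * |c q| ≤ 1 * M := mul_le_mul b.le_one (hball q (hin q hq)).2.le (abs_nonneg _)
            zero_le_one
        _ = M := one_mul M
    · simp only [hd, image_eq_zero_of_notMem_tsupport hq]
      simpa using hM0.le
  have hdK : ∀ q, |d q| ≤ M * Real.exp (-(4 * M) * (p.1 - r)) * Real.exp (4 * M * q.1) := by
    intro q
    by_cases hq : q ∈ tsupport b
    · refine (hdM q).trans ?_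
      rw [mul_assoc, ← Real.exp_add]
      refine le_mul_of_one_le_right hM0.le (Real.one_le_exp ?_)
      rw [b.tsupport_eq] at hq
      have h1 := (abs_le.1 ((norm_fst_le (q - p)).trans (mem_closedBall_iff_norm.1 hq))).1
      have h1 : -r ≤ q.1 - p.1 := h1
      have : 0 ≤ 4 * M * (q.1 - p.1 + r) := by
        have : 0 ≤ q.1 - p.1 + r := by linarith
        positivity
      linarith
    · simp only [hd, image_eq_zero_of_notMem_tsupport hq]
      simp only [zero_mul, abs_zero]
      positivity
  -- With `V = 1 + heatPot F`, the Volterra equation says `F = d V`, and `V_t - V_xx = F`.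
  obtain ⟨F, Fs, Fc, hF, hFb⟩ := exists_volterra hds hdc (μ := 4 * M) (by positivity) hdM hdK
    (by linarith)
  have hps := contDiff_heatPot Fs Fc
  refine ⟨fun q => 1 + heatPot F q, contDiff_const.add hps, ?_, ?_⟩
  -- At `p` the potential is at most `exp (4 M r) / 2 ≤ exp (1 / 2) / 2 < 1`, so `V p` is positive.
  · have h1 := norm_heatPot_le (F := F) (by positivity) hFb p
    have h2 : 2 * (M * Real.exp (-(4 * M) * (p.1 - r))) / (4 * M) * Real.exp (4 * M * p.1)
        = 1 / 2 * Real.exp (4 * M * r) := by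
      rw [show 4 * M * r = -(4 * M) * (p.1 - r) + 4 * M * p.1 by ring, Real.exp_add]
      field_simp
      ring
    rw [h2] at h1
    have h3 : Real.exp (4 * M * r) < 2 := by
      have h4 : Real.exp (4 * M * r) ≤ Real.exp (1 / 2) := Real.exp_le_exp.2 hrM
      have h5 : Real.exp (1 / 2) ^ 2 = Real.exp 1 := by
        rw [← Real.exp_nat_mul]; norm_num
      nlinarith [Real.exp_one_lt_d9, Real.exp_pos (1 / 2)]
    have h6 := (abs_le.1 h1).1
    intro h7
    linarith
  · have hone : ∀ᶠ q in 𝓝 p, b q = 1 := b.eventuallyEq_one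
    filter_upwards [hone] with q hq
    have e : ∀ (v : Base), dir v (fun q => 1 + heatPot F q) = dir v (heatPot F) := by
      intro v
      funext y
      simp only [dir]
      rw [fderiv_const_add]
    have e1 : pdt (fun q => 1 + heatPot F q) = pdt (heatPot F) := e _
    have e2 : pdx (fun q => 1 + heatPot F q) = pdx (heatPot F) := e _
    rw [e1, e2]
    have h1 := heatPot_heat Fs Fc q
    have h2 := hF q
    simp only [hd, hq, one_mul] at h2
    linear_combination h1 + h2

end Volterra

/-! ### Primitives depending smoothly on parameters -/

section Primitive

open MeasureTheory

/-- Smooth dependence of an integral on parameters. -/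
lemma contDiffAt_integral_param {P : Type*} [NormedAddCommGroup P] [NormedSpace ℝ P]
    {h : P × ℝ → ℝ} {W : Set (P × ℝ)} (hW : IsOpen W) (hh : ContDiffOn ℝ ∞ h W) {q₀ : P}
    (hq : ∀ θ ∈ Set.Icc (0 : ℝ) 1, (q₀, θ) ∈ W) :
    ContDiffAt ℝ ∞ (fun q => ∫ θ in (0 : ℝ)..1, h (q, θ)) q₀ := by
  obtain ⟨u, v, hu, hv, hqu, hIv, huv⟩ := generalized_tube_lemma (isCompact_singleton (x := q₀))
    (isCompact_Icc (a := (0 : ℝ)) (b := 1)) hW (by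
      rintro ⟨q, θ⟩ ⟨rfl, h2⟩
      exact hq θ h2)
  have hqu : q₀ ∈ u := hqu rfl
  obtain ⟨δ, hδ, hδv⟩ := isCompact_Icc.exists_thickening_subset_open hv hIv
  let b : ContDiffBump (1 / 2 : ℝ) := ⟨1 / 2, 1 / 2 + δ / 2, by norm_num, by linarith⟩
  have hb1 : ∀ θ ∈ Set.Icc (0 : ℝ) 1, b θ = 1 := by
    intro θ hθ
    refine b.one_of_mem_closedBall ?_
    rw [Metric.mem_closedBall, Real.dist_eq, abs_le]
    constructor <;> linarith [hθ.1, hθ.2]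
  have hbv : ∀ θ ∈ tsupport b, θ ∈ v := by
    intro θ hθ
    rw [b.tsupport_eq, Metric.mem_closedBall, Real.dist_eq, abs_le] at hθ
    have h1 : -(1 / 2 + δ / 2) ≤ θ - 1 / 2 := hθ.1
    have h2 : θ - 1 / 2 ≤ 1 / 2 + δ / 2 := hθ.2
    refine hδv (Metric.mem_thickening_iff.2 ?_)
    rcases lt_or_ge θ 0 with h0 | h0
    · refine ⟨0, by simp, ?_⟩
      rw [Real.dist_eq, abs_lt]; constructor <;> linarith
    rcases lt_or_ge 1 θ with h3 | h3
    · refine ⟨1, by simp, ?_⟩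
      rw [Real.dist_eq, abs_lt]; constructor <;> linarith
    · exact ⟨θ, ⟨h0, h3⟩, by simpa using hδ⟩
  -- The integral is the value at `0` of the convolution of the indicator `f` of the unit interval
  -- with `g q`. The reflected argument makes `g q (0 - θ)` equal to `h (q, θ)` there.
  let g : P → ℝ → ℝ := fun q s => b (-s) * h (q, -s)
  have hgs : ContDiffOn ℝ ∞ (Function.uncurry g) (u ×ˢ Set.univ) := by
    rintro ⟨q, s⟩ ⟨hqu, -⟩
    refine ContDiffAt.contDiffWithinAt ?_
    have hneg : ContDiffAt ℝ ∞ (fun w : P × ℝ => -w.2) (q, s) := contDiffAt_snd.neg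
    by_cases hs : -s ∈ tsupport b
    · have h1 : ContDiffAt ℝ ∞ (fun w : P × ℝ => b (-w.2)) (q, s) :=
        ContDiffAt.comp (g := b) (q, s) b.contDiffAt hneg
      have h2 : ContDiffAt ℝ ∞ (fun w : P × ℝ => h (w.1, -w.2)) (q, s) :=
        (hh.contDiffAt (hW.mem_nhds (huv ⟨hqu, hbv _ hs⟩) : W ∈ 𝓝 (q, -s))).comp (q, s)
          (contDiffAt_fst.prodMk hneg)
      exact h1.mul h2
    · have h1 : ∀ᶠ w : P × ℝ in 𝓝 (q, s), b (-w.2) = 0 :=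
        (hneg.continuousAt (x := (q, s))).eventually (notMem_tsupport_iff_eventuallyEq.1 hs)
      refine (contDiffAt_const (c := (0 : ℝ))).congr_of_eventuallyEq ?_
      filter_upwards [h1] with w hw
      change b (-w.2) * h (w.1, -w.2) = 0
      rw [hw, zero_mul]
  let f : ℝ → ℝ := Set.indicator (Set.Ioc 0 1) fun _ => 1
  have hf : LocallyIntegrable f volume :=
    ((integrable_indicator_iff measurableSet_Ioc).2 (by simp)).locallyIntegrable
  have key := contDiffOn_convolution_right_with_param (μ := volume) (n := ⊤)
    (ContinuousLinearMap.lsmul ℝ ℝ) (f := f) (g := g)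
    (k := Metric.closedBall (-(1 / 2)) (1 / 2 + δ / 2)) hu (isCompact_closedBall _ _)
    (fun q s _ hs => by
      have : -s ∉ tsupport b := by
        rw [b.tsupport_eq]
        intro h
        refine hs ?_
        rw [Metric.mem_closedBall, Real.dist_eq] at h ⊢
        rw [abs_sub_comm] at h
        have e : s - -(1 / 2) = 1 / 2 - -s := by ring
        rw [e]; exact h
      change b (-s) * h (q, -s) = 0
      rw [image_eq_zero_of_notMem_tsupport this, zero_mul]) hf hgs
  have h2 := (key.contDiffAt ((hu.prod isOpen_univ).mem_nhds ⟨hqu, trivial⟩)).comp q₀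
    (contDiffAt_id.prodMk (contDiffAt_const (c := (0 : ℝ))))
  refine h2.congr_of_eventuallyEq (Filter.Eventually.of_forall fun q => ?_)
  change _ = ∫ t, f t • g q (0 - t)
  beta_reduce
  rw [intervalIntegral.integral_of_le zero_le_one, ← integral_indicator measurableSet_Ioc]
  congr 1
  funext t
  by_cases ht : t ∈ Set.Ioc (0 : ℝ) 1
  · rw [Set.indicator_of_mem ht]
    simp only [f, g, Set.indicator_of_mem ht, zero_sub, neg_neg, hb1 t ⟨ht.1.le, ht.2⟩, one_smul,
      one_mul]
  · simp only [f, Set.indicator_of_notMem ht, zero_smul]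

/-- The primitive in `x` with the initial points `x₀ t`. -/
def primX (f : Base → ℝ) (x₀ : ℝ → ℝ) (q : Base) : ℝ := ∫ s in x₀ q.1..q.2, f (q.1, s)

/-- The substitution `s = x₀ + (x - x₀) θ` moves the limits to `0` and `1`, after which only the
parameters vary. -/
lemma contDiffAt_primX {f : Base → ℝ} {U : Set Base} (hU : IsOpen U) (hf : ContDiffOn ℝ ∞ f U)
    {x₀ : ℝ → ℝ} {p : Base} (hx : ContDiffAt ℝ ∞ x₀ p.1)
    (hp : ∀ s ∈ Set.uIcc (x₀ p.1) p.2, (p.1, s) ∈ U) : ContDiffAt ℝ ∞ (primX f x₀) p := by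
  have hx' : ContDiffAt ℝ ∞ (fun q : Base => x₀ q.1) p := hx.comp p contDiffAt_fst
  have e : primX f x₀ = fun q : Base => (q.2 - x₀ q.1) *
      ∫ θ in (0 : ℝ)..1, f (q.1, x₀ q.1 + (q.2 - x₀ q.1) * θ) := by
    funext q
    have := intervalIntegral.smul_integral_comp_add_mul (f := fun s => f (q.1, s)) (a := 0) (b := 1)
      (q.2 - x₀ q.1) (x₀ q.1)
    rw [smul_eq_mul] at this
    rw [this]
    simp [primX]
  rw [e]
  refine (contDiffAt_snd.sub hx').mul ?_
  -- The initial point enters as an independent parameter and is specialized to `x₀ t` at the end.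
  let m : (Base × ℝ) × ℝ → Base := fun w => (w.1.1.1, w.1.2 + (w.1.1.2 - w.1.2) * w.2)
  have hm : ContDiff ℝ ∞ m := by fun_prop
  have h1 := contDiffAt_integral_param (h := fun w => f (m w)) (q₀ := (p, x₀ p.1))
    (hU.preimage hm.continuous) (hf.comp hm.contDiffOn fun _ h => h) (fun θ hθ => hp _ (by
      change x₀ p.1 + (p.2 - x₀ p.1) * θ ∈ _
      rw [← segment_eq_uIcc]
      refine ⟨1 - θ, θ, by linarith [hθ.2], hθ.1, by ring, ?_⟩
      simp only [smul_eq_mul]; ring))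
  exact h1.comp p (contDiffAt_id.prodMk hx')

lemma pdx_primX {f : Base → ℝ} {U : Set Base} (hU : IsOpen U) (hf : ContDiffOn ℝ ∞ f U)
    {x₀ : ℝ → ℝ} {p : Base} (hx : ContDiffAt ℝ ∞ x₀ p.1)
    (hp : ∀ s ∈ Set.uIcc (x₀ p.1) p.2, (p.1, s) ∈ U) : pdx (primX f x₀) p = f p := by
  have hd : HasFDerivAt (primX f x₀) (fderiv ℝ (primX f x₀) p) (p.1, p.2) :=
    (diffAt_of_smooth (contDiffAt_primX hU hf hx hp)).hasFDerivAt
  have h1 := hd.comp_hasDerivAt p.2 ((hasDerivAt_const p.2 p.1).prodMk (hasDerivAt_id p.2))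
  have hm : Continuous fun s : ℝ => (p.1, s) := by fun_prop
  have hc : ContinuousOn (fun s => f (p.1, s)) ((fun s : ℝ => (p.1, s)) ⁻¹' U) :=
    hf.continuousOn.comp hm.continuousOn fun _ h => h
  have ho := hU.preimage hm
  have hp2 : p.2 ∈ (fun s : ℝ => (p.1, s)) ⁻¹' U := hp p.2 Set.right_mem_uIcc
  have h2 := intervalIntegral.integral_hasDerivAt_right (f := fun s => f (p.1, s))
    ((hc.mono hp).intervalIntegrable) (hc.stronglyMeasurableAtFilter ho _ hp2)
    (hc.continuousAt (ho.mem_nhds hp2))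
  exact h1.unique h2

/-- Local primitives with respect to `x`. -/
lemma exists_primX {f : Base → ℝ} {p : Base} (hf : ∀ᶠ q in 𝓝 p, ContDiffAt ℝ ∞ f q) :
    ∃ F : Base → ℝ, ∀ᶠ q in 𝓝 p, ContDiffAt ℝ ∞ F q ∧ pdx F q = f q := by
  obtain ⟨r, hr, hball⟩ := exists_ball_of_eventually hf
  have hfo : ContDiffOn ℝ ∞ f (Metric.ball p r) := fun q hq => (hball q hq).contDiffWithinAt
  refine ⟨primX f fun _ => p.2, ?_⟩
  filter_upwards [Metric.ball_mem_nhds p hr] with q hq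
  have hq' : ∀ s ∈ Set.uIcc p.2 q.2, (q.1, s) ∈ Metric.ball p r := by
    intro s hs
    rw [Metric.mem_ball, Prod.dist_eq, max_lt_iff] at hq ⊢
    exact ⟨hq.1, lt_of_le_of_lt (by
      have := Real.dist_left_le_of_mem_uIcc hs
      rwa [dist_comm, dist_comm p.2] at this) hq.2⟩
  exact ⟨contDiffAt_primX Metric.isOpen_ball hfo contDiffAt_const hq',
    pdx_primX Metric.isOpen_ball hfo contDiffAt_const hq'⟩

/-- Primitives of functions of one variable. -/
lemma exists_prim {f : ℝ → ℝ} {t : ℝ} (hf : ∀ᶠ s in 𝓝 t, ContDiffAt ℝ ∞ f s) :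
    ∃ F : ℝ → ℝ, ∀ᶠ s in 𝓝 t, ContDiffAt ℝ ∞ F s ∧ deriv F s = f s := by
  have h2 : Filter.Tendsto (fun q : Base => q.2) (𝓝 ((0 : ℝ), t)) (𝓝 t) :=
    continuous_snd.continuousAt
  obtain ⟨F, hF⟩ := exists_primX (f := fun q => f q.2) (p := ((0 : ℝ), t))
    ((h2.eventually hf).mono fun q hq => hq.comp q contDiffAt_snd)
  have h3 : Filter.Tendsto (fun s : ℝ => ((0 : ℝ), s)) (𝓝 t) (𝓝 ((0 : ℝ), t)) :=
    (by fun_prop : Continuous fun s : ℝ => ((0 : ℝ), s)).continuousAt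
  refine ⟨fun s => F (0, s), (h3.eventually hF).mono fun s hs => ⟨?_, ?_⟩⟩
  · exact hs.1.comp s (by fun_prop)
  · have hd := (diffAt_of_smooth hs.1).hasFDerivAt.comp_hasDerivAt s
      ((hasDerivAt_const s (0 : ℝ)).prodMk (hasDerivAt_id s))
    exact hd.deriv.trans hs.2

end Primitive

/-! ### Linear evolution equations with smooth coefficients -/

lemma dir_dir_mul {V : Type*} [NormedAddCommGroup V] [NormedSpace ℝ V] {v : V} {f g : V → ℝ}
    {q : V} (hf : ContDiffAt ℝ ∞ f q) (hg : ContDiffAt ℝ ∞ g q) :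
    dir v (dir v (fun r => f r * g r)) q
      = dir v (dir v f) q * g q + 2 * dir v f q * dir v g q + f q * dir v (dir v g) q := by
  have h1 : dir v (fun r => f r * g r) =ᶠ[𝓝 q] fun r => dir v f r * g r + f r * dir v g r := by
    filter_upwards [eventually_diffAt hf, eventually_diffAt hg] with r h1 h2 using dir_mul h1 h2
  have df := diffAt_of_smooth hf
  have dg := diffAt_of_smooth hg
  have dvf := diffAt_of_smooth (contDiffAt_dir (v := v) hf)
  have dvg := diffAt_of_smooth (contDiffAt_dir (v := v) hg)
  rw [dir_congr h1, dir_add (dvf.fun_mul dg) (df.fun_mul dvg), dir_mul dvf dg, dir_mul df dvg]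
  ring

lemma dist_of_mem_ball {p : Base} {r : ℝ} {q : Base} (hq : q ∈ Metric.ball p r) :
    q.1 ∈ Metric.ball p.1 r ∧ q.2 ∈ Metric.ball p.2 r := by
  rw [← ball_prod_same] at hq
  exact hq

/-- A function with vanishing `x`-derivative depends on `t` only. -/
lemma eq_of_pdx_eq_zero {k : Base → ℝ} {p : Base}
    (h : ∀ᶠ q in 𝓝 p, DifferentiableAt ℝ k q ∧ pdx k q = 0) :
    ∀ᶠ q in 𝓝 p, k q = k (q.1, p.2) := by
  obtain ⟨r, hr, hball⟩ := exists_ball_of_eventually h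
  filter_upwards [Metric.ball_mem_nhds p hr] with q hq
  obtain ⟨h1, h2⟩ := dist_of_mem_ball hq
  have hd : ∀ s ∈ Metric.ball p.2 r, HasDerivAt (fun s => k (q.1, s)) 0 s := by
    intro s hs
    have hqs : (q.1, s) ∈ Metric.ball p r := by
      rw [← ball_prod_same]
      exact ⟨h1, hs⟩
    have := (hball _ hqs).1.hasFDerivAt.comp_hasDerivAt s
      ((hasDerivAt_const s q.1).prodMk (hasDerivAt_id s))
    exact this.congr_deriv (hball _ hqs).2
  exact Metric.isOpen_ball.is_const_of_deriv_eq_zero (convex_ball p.2 r).isPreconnected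
    (fun s hs => (hd s hs).differentiableAt.differentiableWithinAt)
    (fun s hs => (hd s hs).deriv) h2 (Metric.mem_ball_self hr)

/-- The Poincaré lemma in the plane. -/
lemma exists_potential {w v : Base → ℝ} {p : Base} (hw : ∀ᶠ q in 𝓝 p, ContDiffAt ℝ ∞ w q)
    (hv : ∀ᶠ q in 𝓝 p, ContDiffAt ℝ ∞ v q) (h : ∀ᶠ q in 𝓝 p, pdt w q = pdx v q) :
    ∃ Y : Base → ℝ, ∀ᶠ q in 𝓝 p, ContDiffAt ℝ ∞ Y q ∧ pdx Y q = w q ∧ pdt Y q = v q := by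
  obtain ⟨F, hF⟩ := exists_primX hw
  have hk : ∀ᶠ q in 𝓝 p, ContDiffAt ℝ ∞ (fun r => v r - pdt F r) q := by
    filter_upwards [hF, hv] with q h1 h2 using h2.sub (contDiffAt_dir h1.1)
  -- The closedness condition says that `v - F_t` depends on `t` only; its primitive `g` corrects
  -- `F`.
  have hconst := eq_of_pdx_eq_zero (k := fun r => v r - pdt F r) (p := p) (by
    filter_upwards [hF, hv, h, hk, hF.eventually_nhds] with q h1 h2 h3 h4 h5
    refine ⟨diffAt_of_smooth h4, ?_⟩
    change dir (0, 1) (fun r => v r - dir (1, 0) F r) q = 0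
    rw [dir_sub (diffAt_of_smooth h2) (diffAt_of_smooth (contDiffAt_dir h1.1)), dir_comm h1.1]
    have : dir (0, 1) F =ᶠ[𝓝 q] w := h5.mono fun _ h => h.2
    rw [dir_congr this]
    have h3 : dir (1, 0) w q = dir (0, 1) v q := h3
    rw [h3, sub_self])
  have hmk : ContinuousAt (fun s : ℝ => ((s, p.2) : Base)) p.1 :=
    (by fun_prop : Continuous fun s : ℝ => ((s, p.2) : Base)).continuousAt
  obtain ⟨g, hg⟩ := exists_prim (f := fun s => v (s, p.2) - pdt F (s, p.2)) (t := p.1)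
    ((hmk.eventually (p := fun q => ContDiffAt ℝ ∞ (fun r => v r - pdt F r) q) hk).mono
      fun s hs => ContDiffAt.comp (g := fun r => v r - pdt F r) (f := fun s : ℝ => ((s, p.2) : Base))
        s hs (by fun_prop))
  have hg' := (continuous_fst.continuousAt (x := p)).eventually hg
  refine ⟨fun q => F q + g q.1, ?_⟩
  filter_upwards [hF, hconst, hg'] with q h1 h2 h3
  have s2 : ContDiffAt ℝ ∞ (fun q : Base => g q.1) q := h3.1.comp q contDiffAt_fst
  have d1 := diffAt_of_smooth h1.1
  have d2 := diffAt_of_smooth s2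
  have dir_g : ∀ u : Base, dir u (fun q : Base => g q.1) q = deriv g q.1 * u.1 := by
    intro u
    rw [dir_comp_real (k := g) (f := fun q : Base => q.1) (diffAt_of_smooth h3.1)
      differentiableAt_fst, dir_fst_base]
  refine ⟨h1.1.add s2, ?_, ?_⟩
  · change dir (0, 1) (fun q => F q + g q.1) q = w q
    rw [dir_add d1 d2, dir_g, ← h1.2]
    simp [pdx_eq_dir]
  · change dir (1, 0) (fun q => F q + g q.1) q = v q
    rw [dir_add d1 d2, dir_g, h3.2, ← h2]
    simp [pdt_eq_dir]

/-- Local nonvanishing solutions of a second-order evolution equation in divergence form. -/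
lemma exists_divergence_solution {a b : Base → ℝ} {p : Base}
    (ha : ∀ᶠ q in 𝓝 p, ContDiffAt ℝ ∞ a q ∧ a q ≠ 0) (hb : ∀ᶠ q in 𝓝 p, ContDiffAt ℝ ∞ b q) :
    ∃ w : Base → ℝ, w p ≠ 0 ∧ ∀ᶠ q in 𝓝 p, ContDiffAt ℝ ∞ w q ∧
      pdt w q = pdx (fun r => a r * pdx w r + b r * w r) q := by
  -- `σ` is the sign of `a` near `p`. The new time `σ t` turns a backward equation into a forward
  -- one.
  obtain ⟨σ, hσ, hσa⟩ : ∃ σ : ℝ, σ ^ 2 = 1 ∧ ∀ᶠ q in 𝓝 p, 0 < σ * a q := by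
    have hc : ContinuousAt a p := ha.self_of_nhds.1.continuousAt
    rcases lt_or_gt_of_ne ha.self_of_nhds.2 with h | h
    · refine ⟨-1, by norm_num, (hc.eventually_lt_const h).mono fun q hq => by linarith⟩
    · exact ⟨1, by norm_num, (hc.eventually_const_lt h).mono fun q hq => by linarith⟩
  -- the space coordinate
  obtain ⟨X, hX⟩ := exists_primX (f := fun q => (√(σ * a q))⁻¹) (p := p) (by
    filter_upwards [ha, hσa] with q h1 h2
    exact ((contDiffAt_const.mul h1.1).sqrt h2.ne').inv (Real.sqrt_pos.2 h2).ne')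
  have hXx : ∀ᶠ q in 𝓝 p, pdx X q ≠ 0 ∧ σ * a q * pdx X q ^ 2 = 1 := by
    filter_upwards [hX, hσa] with q h1 h2
    rw [h1.2]
    refine ⟨inv_ne_zero (Real.sqrt_pos.2 h2).ne', ?_⟩
    rw [inv_pow, Real.sq_sqrt h2.le, mul_inv_cancel₀ h2.ne']
  -- the multiplier
  have sX : ∀ᶠ q in 𝓝 p, ContDiffAt ℝ ∞ X q := hX.mono fun _ h => h.1
  obtain ⟨Γ, hΓ⟩ := exists_primX (f := fun q => (pdt X q - a q * pdx (pdx X) q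
      - (pdx a q + b q) * pdx X q) / (2 * a q * pdx X q)) (p := p) (by
    filter_upwards [ha, hb, sX, hXx] with q h1 h2 h3 h4
    have x1 : ContDiffAt ℝ ∞ (pdx X) q := contDiffAt_dir h3
    have x2 : ContDiffAt ℝ ∞ (pdx (pdx X)) q := contDiffAt_dir x1
    have x3 : ContDiffAt ℝ ∞ (pdt X) q := contDiffAt_dir h3
    have a1 : ContDiffAt ℝ ∞ (pdx a) q := contDiffAt_dir h1.1
    exact ((x3.sub (h1.1.mul x2)).sub ((a1.add h2).mul x1)).div
      ((contDiffAt_const.mul h1.1).mul x1) (mul_ne_zero (mul_ne_zero two_ne_zero h1.2) h4.1))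
  set G : Base → ℝ := fun q => Real.exp (Γ q) with hG
  have sG : ∀ᶠ q in 𝓝 p, ContDiffAt ℝ ∞ G q := hΓ.mono fun q h => h.1.exp
  have hG0 : ∀ q, G q ≠ 0 := fun q => (Real.exp_pos _).ne'
  have hGx : ∀ᶠ q in 𝓝 p, pdx G q * (2 * a q * pdx X q)
      = (pdt X q - a q * pdx (pdx X) q - (pdx a q + b q) * pdx X q) * G q := by
    filter_upwards [hΓ, ha, hXx] with q h1 h2 h3
    have e : pdx G q = Real.exp (Γ q) * pdx Γ q := by
      change dir _ _ q = _ * dir _ _ q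
      rw [hG, dir_comp_real Real.differentiableAt_exp (diffAt_of_smooth h1.1), Real.deriv_exp]
    rw [e, h1.2]
    have := h2.2
    have := h3.1
    field_simp
    rw [hG]; ring
  -- the potential
  set c : Base → ℝ := fun q => σ * (a q * pdx (pdx G) q + (pdx a q + b q) * pdx G q
    + pdx b q * G q - pdt G q) / G q with hc
  have sc : ∀ᶠ q in 𝓝 p, ContDiffAt ℝ ∞ c q := by
    filter_upwards [ha, hb, sG] with q h1 h2 h3
    have g1 : ContDiffAt ℝ ∞ (pdx G) q := contDiffAt_dir h3
    have g2 : ContDiffAt ℝ ∞ (pdx (pdx G)) q := contDiffAt_dir g1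
    have g3 : ContDiffAt ℝ ∞ (pdt G) q := contDiffAt_dir h3
    have a1 : ContDiffAt ℝ ∞ (pdx a) q := contDiffAt_dir h1.1
    have b1 : ContDiffAt ℝ ∞ (pdx b) q := contDiffAt_dir h2
    exact (contDiffAt_const.mul ((((h1.1.mul g2).add ((a1.add h2).mul g1)).add
      (b1.mul h3)).sub g3)).div h3 (hG0 q)
  set T : Base → ℝ := fun q => σ * q.1 with hT
  have sT : ∀ q, ContDiffAt ℝ ∞ T q := fun q => contDiffAt_const.mul contDiffAt_fst
  have dT : ∀ v q, dir v T q = σ * v.1 := by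
    intro v q
    rw [hT, dir_const_mul σ differentiableAt_fst, dir_fst_base]
  have Tt : ∀ q, pdt T q = σ := fun q => by
    rw [pdt_eq_dir, dT, mul_one]
  have Tx : ∀ q, pdx T q = 0 := fun q => by
    rw [pdx_eq_dir, dT, mul_zero]
  have hσ0 : σ ≠ 0 := by
    intro h
    rw [h] at hσ
    norm_num at hσ
  obtain ⟨J, sJ, -, hJ, -⟩ := exists_smooth_inverse (T := T) (X := X) (q := p) (by
    filter_upwards [sX, hXx] with q h1 h2
    exact ⟨sT q, h1, Tx q, by rw [Tt]; exact hσ0, h2.1⟩)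
  have hBc : Filter.Tendsto (fun r => (T r, X r)) (𝓝 p) (𝓝 (T p, X p)) :=
    (sT p).continuousAt.prodMk sX.self_of_nhds.continuousAt
  have hcJ : ∀ᶠ r in 𝓝 (T p, X p), ContDiffAt ℝ ∞ (fun r => c (J r)) r := by
    have hJc : Filter.Tendsto J (𝓝 (T p, X p)) (𝓝 p) := by
      have h1 := sJ.self_of_nhds.continuousAt
      unfold ContinuousAt at h1
      rwa [hJ.self_of_nhds] at h1
    filter_upwards [sJ, hJc.eventually sc] with r h1 h2 using h2.comp r h1
  obtain ⟨ε, hε, hball⟩ := exists_ball_of_eventually hcJ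
  obtain ⟨V, sV, hV0, hV⟩ := exists_heat_solution Metric.isOpen_ball
    (fun r hr => (hball r hr).contDiffWithinAt) (Metric.mem_ball_self hε)
  have sB : ∀ᶠ q in 𝓝 p, ContDiffAt ℝ ∞ (fun r => V (T r, X r)) q :=
    sX.mono fun q h => contDiffAt_comp_base sV.contDiffAt (sT q) h
  -- In the coordinates `T`, `X` the leading coefficient is `1`, the factor `G` removes the
  -- first-order term, and what remains is the heat equation with potential `c`, solved by `V`.
  refine ⟨fun q => G q * V (T q, X q), mul_ne_zero (hG0 p) hV0, ?_⟩
  filter_upwards [ha, hb, sX, sG, sB, hXx, hGx, hJ, hBc.eventually hV] with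
    q a1 b1 x1 g1 v1 x2 g2 j1 v2
  have sw := g1.mul v1
  refine ⟨sw, ?_⟩
  rw [j1] at v2
  have swx : ContDiffAt ℝ ∞ (pdx fun q => G q * V (T q, X q)) q := contDiffAt_dir sw
  have e1 : pdt (fun q => G q * V (T q, X q)) q = pdt G q * V (T q, X q)
      + G q * (pdt V (T q, X q) * σ + pdx V (T q, X q) * pdt X q) := by
    have := dir_mul (v := ((1, 0) : Base)) (diffAt_of_smooth g1) (diffAt_of_smooth v1)
    refine this.trans ?_
    have h2 := pdt_comp_base (g := V) (diffAt_of_smooth sV.contDiffAt) (diffAt_of_smooth (sT q))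
      (diffAt_of_smooth x1)
    rw [Tt] at h2
    rw [← pdt_eq_dir, h2]
  have ex := pdx_comp_base (g := V) (diffAt_of_smooth sV.contDiffAt) (diffAt_of_smooth (sT q))
      (diffAt_of_smooth x1) (Tx q)
  have exx := pdx_pdx_comp_base (g := V) (two_of_smooth sV.contDiffAt) (sT q) x1 (Filter.Eventually.of_forall Tx)
  have e2 : pdx (fun q => G q * V (T q, X q)) q = pdx G q * V (T q, X q)
      + G q * (pdx V (T q, X q) * pdx X q) := by
    have := dir_mul (v := ((0, 1) : Base)) (diffAt_of_smooth g1) (diffAt_of_smooth v1)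
    refine this.trans ?_
    rw [← pdx_eq_dir, ex]
  have e3 : pdx (pdx fun q => G q * V (T q, X q)) q = pdx (pdx G) q * V (T q, X q)
      + 2 * pdx G q * (pdx V (T q, X q) * pdx X q)
      + G q * (pdx (pdx V) (T q, X q) * pdx X q ^ 2 + pdx V (T q, X q) * pdx (pdx X) q) := by
    have := dir_dir_mul (v := ((0, 1) : Base)) g1 v1
    refine this.trans ?_
    rw [← pdx_eq_dir, ex, exx]
  have e4 : pdx (fun r => a r * pdx (fun q => G q * V (T q, X q)) r
      + b r * (G r * V (T r, X r))) q
      = pdx a q * pdx (fun q => G q * V (T q, X q)) q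
        + a q * pdx (pdx fun q => G q * V (T q, X q)) q
        + (pdx b q * (G q * V (T q, X q)) + b q * pdx (fun q => G q * V (T q, X q)) q) := by
    have da := diffAt_of_smooth a1.1
    have db := diffAt_of_smooth b1
    have dw := diffAt_of_smooth sw
    have dwx := diffAt_of_smooth swx
    have := dir_add (v := ((0, 1) : Base)) (da.fun_mul dwx) (db.fun_mul dw)
    refine this.trans ?_
    rw [dir_mul da dwx, dir_mul db dw]
    rfl
  have hcG : c q * G q = σ * (a q * pdx (pdx G) q + (pdx a q + b q) * pdx G q
      + pdx b q * G q - pdt G q) := div_mul_cancel₀ _ (hG0 q)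
  rw [e4, e1, e2, e3, v2]
  linear_combination (σ * V (T q, X q)) * hcG - pdx V (T q, X q) * g2
    - G q * pdx (pdx V) (T q, X q) * σ * x2.2
    + (V (T q, X q) * (a q * pdx (pdx G) q + (pdx a q + b q) * pdx G q
      + pdx b q * G q - pdt G q) + a q * pdx X q ^ 2 * G q * pdx (pdx V) (T q, X q)) * hσ

/-- Local coordinates solving a linear second-order evolution equation. -/
lemma exists_evolution_coordinate {a b : Base → ℝ} {p : Base}
    (ha : ∀ᶠ q in 𝓝 p, ContDiffAt ℝ ∞ a q ∧ a q ≠ 0) (hb : ∀ᶠ q in 𝓝 p, ContDiffAt ℝ ∞ b q) :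
    ∃ Y : Base → ℝ, ∀ᶠ q in 𝓝 p, ContDiffAt ℝ ∞ Y q ∧ pdx Y q ≠ 0 ∧
      pdt Y q = a q * pdx (pdx Y) q + b q * pdx Y q := by
  -- The function `w` plays the role of `Y_x`. The divergence form of its equation is exactly the
  -- compatibility of `Y_x = w` with `Y_t = a w_x + b w`.
  obtain ⟨w, hw0, hw⟩ := exists_divergence_solution ha hb
  have sw : ∀ᶠ q in 𝓝 p, ContDiffAt ℝ ∞ w q := hw.mono fun _ h => h.1
  have sv : ∀ᶠ q in 𝓝 p, ContDiffAt ℝ ∞ (fun r => a r * pdx w r + b r * w r) q := by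
    filter_upwards [ha, hb, sw] with q h1 h2 h3
    have : ContDiffAt ℝ ∞ (pdx w) q := contDiffAt_dir h3
    exact (h1.1.mul this).add (h2.mul h3)
  obtain ⟨Y, hY⟩ := exists_potential sw sv (hw.mono fun _ h => h.2)
  refine ⟨Y, ?_⟩
  filter_upwards [hY, hY.eventually_nhds, sw.self_of_nhds.continuousAt.eventually_ne hw0] with
    q h1 h2 h3
  have e : pdx (pdx Y) q = pdx w q := pdx_congr (h2.mono fun _ h => h.2.1)
  exact ⟨h1.1, by rw [h1.2.1]; exact h3, by rw [e, h1.2.1]; exact h1.2.2⟩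

/-! ### Sections, global primitives and changes of the base coordinates -/

open scoped Manifold in
/-- A smooth section of an open set with interval slices. -/
lemma exists_section {N : Set Base} (hN : IsOpen N)
    (hs : ∀ t : ℝ, {x : ℝ | (t, x) ∈ N}.OrdConnected) :
    ∃ x₀ : ℝ → ℝ, ∀ t ∈ Prod.fst '' N, ContDiffAt ℝ ∞ x₀ t ∧ (t, x₀ t) ∈ N := by
  let I : TopologicalSpace.Opens ℝ := ⟨Prod.fst '' N, isOpenMap_fst N hN⟩
  have : LocallyCompactSpace I := I.isOpen.locallyCompactSpace
  -- Constants are local sections of an open set, and a partition of unity may average them because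
  -- the slices are convex.
  obtain ⟨g, hg⟩ := exists_contMDiffMap_forall_mem_convex_of_local_const (n := ⊤) (𝓘(ℝ, ℝ)) (M := I)
    (t := fun t => {x : ℝ | ((t : ℝ), x) ∈ N}) (fun t => (hs t).convex) (by
      rintro ⟨t, p, hp, rfl⟩
      refine ⟨p.2, ?_⟩
      have h1 : Continuous fun s : I => ((s : ℝ), p.2) := by fun_prop
      exact h1.continuousAt.eventually (hN.mem_nhds hp))
  classical
  refine ⟨fun t => if h : t ∈ Prod.fst '' N then g ⟨t, h⟩ else 0, fun t ht => ⟨?_, ?_⟩⟩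
  · have h1 := (contMDiffAt_subtype_iff (U := I) (x := ⟨t, ht⟩) (n := ∞) (I := 𝓘(ℝ, ℝ))
      (I' := 𝓘(ℝ, ℝ)) (f := fun t => if h : t ∈ Prod.fst '' N then g ⟨t, h⟩ else 0)).1 (by
        have h2 := g.contMDiff.contMDiffAt (x := ⟨t, ht⟩)
        refine h2.congr_of_eventuallyEq (Filter.Eventually.of_forall fun s => ?_)
        exact dif_pos s.2)
    exact h1.contDiffAt
  · beta_reduce
    rw [dif_pos ht]
    exact hg ⟨t, ht⟩

/-- Global primitives with respect to `x`. -/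
lemma exists_global_primX {N : Set Base} (hN : IsOpen N)
    (hs : ∀ t : ℝ, {x : ℝ | (t, x) ∈ N}.OrdConnected) {f : Base → ℝ} (hf : ContDiffOn ℝ ∞ f N) :
    ∃ X : Base → ℝ, ContDiffOn ℝ ∞ X N ∧ ∀ p ∈ N, pdx X p = f p := by
  obtain ⟨x₀, hx⟩ := exists_section hN hs
  have key : ∀ p ∈ N, ∀ s ∈ Set.uIcc (x₀ p.1) p.2, (p.1, s) ∈ N := fun p hp =>
    (hs p.1).uIcc_subset (hx p.1 ⟨p, hp, rfl⟩).2 hp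
  exact ⟨primX f x₀, fun p hp => (contDiffAt_primX hN hf (hx p.1 ⟨p, hp, rfl⟩).1
    (key p hp)).contDiffWithinAt, fun p hp => pdx_primX hN hf (hx p.1 ⟨p, hp, rfl⟩).1 (key p hp)⟩

/-- A diffeomorphism of the open set `N` of the `(t,x)`-plane, projectable to the `t`-axis. -/
structure IsBaseMap (N : Set Base) (T X : Base → ℝ) : Prop where
  isOpen : IsOpen N
  smooth_T : ∀ q ∈ N, ContDiffAt ℝ ∞ T q
  smooth_X : ∀ q ∈ N, ContDiffAt ℝ ∞ X q
  T_x : ∀ q ∈ N, pdx T q = 0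
  T_t : ∀ q ∈ N, pdt T q ≠ 0
  X_x : ∀ q ∈ N, pdx X q ≠ 0
  injOn : Set.InjOn (fun q => (T q, X q)) N

section

variable {N : Set Base} {T X : Base → ℝ}

/-- Injectivity forces the local inverses from the inverse function theorem to agree with the global
set-theoretic one, which is therefore smooth on an open image. -/
lemma IsBaseMap.exists_inverse (h : IsBaseMap N T X) :
    ∃ G : Base → Base, (∀ q ∈ N, G (T q, X q) = q) ∧
      IsOpen ((fun q => (T q, X q)) '' N) ∧ ContDiffOn ℝ ∞ G ((fun q => (T q, X q)) '' N) := by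
  have hl := h.injOn.leftInvOn_invFunOn
  refine ⟨Function.invFunOn (fun q => (T q, X q)) N, fun q hq => hl hq, ?_, ?_⟩
  · refine isOpen_iff_mem_nhds.2 ?_
    rintro _ ⟨q, hq, rfl⟩
    obtain ⟨G, hG, hGq, -, hr⟩ := exists_local_inverse (h.smooth_T q hq) (h.smooth_X q hq)
      (h.T_x q hq) (h.T_t q hq) (h.X_x q hq)
    have h1 := hG.continuousAt.eventually (by rw [hGq]; exact h.isOpen.mem_nhds hq)
    filter_upwards [h1, hr] with r h2 h3 using ⟨G r, h2, h3⟩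
  · rintro _ ⟨q, hq, rfl⟩
    refine ContDiffAt.contDiffWithinAt ?_
    obtain ⟨G, hG, hGq, -, hr⟩ := exists_local_inverse (h.smooth_T q hq) (h.smooth_X q hq)
      (h.T_x q hq) (h.T_t q hq) (h.X_x q hq)
    have h1 := hG.continuousAt.eventually (by rw [hGq]; exact h.isOpen.mem_nhds hq)
    refine hG.congr_of_eventuallyEq ?_
    filter_upwards [h1, hr] with r h2 h3
    have := hl h2
    beta_reduce at this
    rwa [h3] at this

lemma IsBaseMap.mono (h : IsBaseMap N T X) {N' : Set Base} (hN' : IsOpen N') (hs : N' ⊆ N) :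
    IsBaseMap N' T X :=
  ⟨hN', fun q hq => h.smooth_T q (hs hq), fun q hq => h.smooth_X q (hs hq),
    fun q hq => h.T_x q (hs hq), fun q hq => h.T_t q (hs hq), fun q hq => h.X_x q (hs hq),
    h.injOn.mono hs⟩

/-- The point transformation with identical `u`-component over a map of the `(t,x)`-plane. -/
lemma IsBaseMap.exists_transformation (h : IsBaseMap N T X) :
    ∃ φ : PointTransformation Space, φ.source = N ×ˢ Set.univ ∧
      φ.target = ((fun q => (T q, X q)) '' N) ×ˢ Set.univ ∧
      ∀ q ∈ N, ∀ u : ℝ, φ (q, u) = ((T q, X q), u) := by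
  obtain ⟨G, hG, ho, hs⟩ := h.exists_inverse
  have hBc : ContDiffOn ℝ ∞ (fun z : Space => (((T z.1, X z.1), z.2) : Space))
      (N ×ˢ Set.univ) := fun z hz => by
    have h1 := (h.smooth_T z.1 hz.1).comp z contDiffAt_fst
    have h2 := (h.smooth_X z.1 hz.1).comp z contDiffAt_fst
    exact ((h1.prodMk h2).prodMk contDiffAt_snd).contDiffWithinAt
  have hGc : ContDiffOn ℝ ∞ (fun z : Space => ((G z.1, z.2) : Space))
      (((fun q => (T q, X q)) '' N) ×ˢ Set.univ) := fun z hz => by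
    have h1 := (hs.contDiffAt (ho.mem_nhds hz.1)).comp z contDiffAt_fst
    exact (h1.prodMk contDiffAt_snd).contDiffWithinAt
  exact ⟨{
    toFun := fun z => ((T z.1, X z.1), z.2)
    invFun := fun z => (G z.1, z.2)
    source := N ×ˢ Set.univ
    target := ((fun q => (T q, X q)) '' N) ×ˢ Set.univ
    map_source' := fun z hz => ⟨⟨z.1, hz.1, rfl⟩, trivial⟩
    map_target' := by
      rintro ⟨_, u⟩ ⟨⟨q, hq, rfl⟩, -⟩
      refine ⟨?_, trivial⟩
      change G (T q, X q) ∈ N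
      rw [hG q hq]; exact hq
    left_inv' := fun z hz => by
      change (G (T z.1, X z.1), z.2) = z
      rw [hG z.1 hz.1]
    right_inv' := by
      rintro ⟨_, u⟩ ⟨⟨q, hq, rfl⟩, -⟩
      change ((T (G (T q, X q)), X (G (T q, X q))), u) = ((T q, X q), u)
      rw [hG q hq]
    open_source := h.isOpen.prod isOpen_univ
    open_target := ho.prod isOpen_univ
    continuousOn_toFun := hBc.continuousOn
    continuousOn_invFun := hGc.continuousOn
    smooth := hBc
    smooth_symm := hGc }, rfl, rfl, fun q _ u => rfl⟩

lemma IsBaseMap.relates (h : IsBaseMap N T X) {E E' : Eqn} (hE : N ⊆ E.dom)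
    (hE' : ∀ q ∈ N, (T q, X q) ∈ E'.dom)
    (hI : ∀ q ∈ N, Intertwines E E' T X (fun _ => 1) (fun _ => 0) q)
    {φ : PointTransformation Space} (hφs : φ.source = N ×ˢ Set.univ)
    (hφt : φ.target = ((fun q => (T q, X q)) '' N) ×ˢ Set.univ)
    (hφ : ∀ q ∈ N, ∀ u : ℝ, φ (q, u) = ((T q, X q), u)) : Relates φ E E' := by
  refine ⟨?_, ?_, fun z hz => ?_⟩
  · rw [hφs]; exact Set.prod_mono hE le_rfl
  · rw [hφt]
    rintro ⟨_, u⟩ ⟨⟨q, hq, rfl⟩, -⟩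
    exact ⟨hE' q hq, trivial⟩
  · rw [hφs] at hz
    refine (hI z.1 hz.1).carriesAt ?_
    filter_upwards [(h.isOpen.prod isOpen_univ).mem_nhds hz] with y hy
    unfold AffineForm
    rw [show φ y = _ from hφ y.1 hy.1 y.2]
    simp

/-- Local diffeomorphisms. -/
lemma exists_isBaseMap {q : Base}
    (h : ∀ᶠ r in 𝓝 q, ContDiffAt ℝ ∞ T r ∧ ContDiffAt ℝ ∞ X r ∧ pdx T r = 0 ∧ pdt T r ≠ 0 ∧
      pdx X r ≠ 0) : ∃ ρ > 0, IsBaseMap (Metric.ball q ρ) T X := by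
  obtain ⟨G, -, -, hl, -⟩ := exists_smooth_inverse h
  obtain ⟨ρ, hρ, hb⟩ := exists_ball_of_eventually (h.and hl)
  refine ⟨ρ, hρ, Metric.isOpen_ball, fun r hr => (hb r hr).1.1, fun r hr => (hb r hr).1.2.1,
    fun r hr => (hb r hr).1.2.2.1, fun r hr => (hb r hr).1.2.2.2.1,
    fun r hr => (hb r hr).1.2.2.2.2, fun r hr s hs e => ?_⟩
  rw [← (hb r hr).2, ← (hb s hs).2]
  exact congrArg G e

/-- Changes of `x` on a domain with interval slices are injective. -/
lemma isBaseMap_fst {X : Base → ℝ} (hN : IsOpen N)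
    (hs : ∀ t : ℝ, {x : ℝ | (t, x) ∈ N}.OrdConnected) (hX : ContDiffOn ℝ ∞ X N)
    (hXx : ∀ p ∈ N, pdx X p ≠ 0) : IsBaseMap N (fun q => q.1) X := by
  have sX : ∀ q ∈ N, ContDiffAt ℝ ∞ X q := fun q hq => hX.contDiffAt (hN.mem_nhds hq)
  have hd : ∀ q ∈ N, HasDerivAt (fun x => X (q.1, x)) (pdx X q) q.2 := fun q hq =>
    HasFDerivAt.comp_hasDerivAt (f := fun x : ℝ => ((q.1, x) : Base)) q.2
      (diffAt_of_smooth (sX q hq)).hasFDerivAt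
      ((hasDerivAt_const q.2 q.1).prodMk (hasDerivAt_id q.2))
  -- Rolle's theorem on a slice, which contains the segment between two of its points.
  have key : ∀ (t x y : ℝ), (t, x) ∈ N → (t, y) ∈ N → x < y → X (t, x) ≠ X (t, y) := by
    intro t x y hx hy hxy he
    have hsub : ∀ s ∈ Set.Icc x y, (t, s) ∈ N := fun s hs' => (hs t).out hx hy hs'
    obtain ⟨c, hc, hc0⟩ := exists_deriv_eq_zero (f := fun s => X (t, s)) hxy
      (fun s hs' => (hd _ (hsub s hs')).continuousAt.continuousWithinAt) he
    have := hsub c ⟨hc.1.le, hc.2.le⟩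
    exact hXx _ this ((hd _ this).deriv.symm.trans hc0)
  refine ⟨hN, fun q _ => contDiffAt_fst, sX, fun q _ => dir_fst_base _ q, fun q _ => ?_, hXx, ?_⟩
  · rw [pdt_eq_dir, dir_fst_base]; exact one_ne_zero
  · rintro ⟨t, x⟩ hx ⟨t', y⟩ hy he
    obtain ⟨rfl, h2⟩ := Prod.ext_iff.1 he
    rcases lt_trichotomy x y with h | rfl | h
    · exact absurd h2 (key _ x y hx hy h)
    · rfl
    · exact absurd h2.symm (key _ y x hy hx h)

/-- The image of an equation under a change of `x`. -/
lemma exists_image (E : Eqn) {X : Base → ℝ} (hX : ContDiffOn ℝ ∞ X E.dom)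
    (hXx : ∀ p ∈ E.dom, pdx X p ≠ 0) :
    ∃ (E' : Eqn) (φ : PointTransformation Space), E'.dom = (fun q => (q.1, X q)) '' E.dom ∧
      φ.source = E.dom ×ˢ Set.univ ∧ φ.target = E'.dom ×ˢ Set.univ ∧
      (∀ p ∈ E.dom, ∀ u : ℝ, φ (p, u) = ((p.1, X p), u)) ∧ Relates φ E E' := by
  have hB := isBaseMap_fst E.dom_open E.dom_slice hX hXx
  obtain ⟨G, hG, ho, hGs⟩ := hB.exists_inverse
  obtain ⟨φ, h1, h2, h3⟩ := hB.exists_transformation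
  have sX := hB.smooth_X
  have sX1 : ∀ q ∈ E.dom, ContDiffAt ℝ ∞ (pdx X) q := fun q hq => contDiffAt_dir (sX q hq)
  have sX2 : ∀ q ∈ E.dom, ContDiffAt ℝ ∞ (pdx (pdx X)) q := fun q hq => contDiffAt_dir (sX1 q hq)
  have sX3 : ∀ q ∈ E.dom, ContDiffAt ℝ ∞ (pdt X) q := fun q hq => contDiffAt_dir (sX q hq)
  have hcomp : ∀ {k : Base → ℝ}, (∀ q ∈ E.dom, ContDiffAt ℝ ∞ k q) →
      ContDiffOn ℝ ∞ (fun r => k (G r)) ((fun q => (q.1, X q)) '' E.dom) := by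
    rintro k hk _ ⟨q, hq, rfl⟩
    refine ContDiffAt.contDiffWithinAt (ContDiffAt.comp (g := k) _ ?_
      (hGs.contDiffAt (ho.mem_nhds ⟨q, hq, rfl⟩)))
    rw [hG q hq]; exact hk q hq
  -- The coefficients are read off from `Intertwines` with `T = t`, `U₁ = 1`, `U₀ = 0` and
  -- transported by the inverse `G`. Slices remain intervals as continuous images of intervals.
  let E' : Eqn := {
    dom := (fun q => (q.1, X q)) '' E.dom
    A2 := fun r => E.A2 (G r) * pdx X (G r) ^ 2
    A1 := fun r => pdx X (G r) * E.A1 (G r) + E.A2 (G r) * pdx (pdx X) (G r) - pdt X (G r)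
    C := fun r => E.C (G r) * pdx X (G r)
    dom_open := ho
    dom_nonempty := E.dom_nonempty.image _
    dom_time := by
      rw [Set.image_image]; exact E.dom_time
    dom_slice := fun t => by
      have e : {x : ℝ | (t, x) ∈ (fun q => (q.1, X q)) '' E.dom}
          = (fun x => X (t, x)) '' {x : ℝ | (t, x) ∈ E.dom} := by
        ext y
        constructor
        · rintro ⟨⟨t', x⟩, hq, he⟩
          obtain ⟨rfl, rfl⟩ := Prod.ext_iff.1 he
          exact ⟨x, hq, rfl⟩
        · rintro ⟨x, hq, rfl⟩
          exact ⟨(t, x), hq, rfl⟩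
      rw [e]
      refine ((E.dom_slice t).isPreconnected.image _ fun x hx => ?_).ordConnected
      refine ContinuousAt.continuousWithinAt ?_
      exact ContinuousAt.comp (f := fun x : ℝ => ((t, x) : Base)) (g := X)
        (sX _ hx).continuousAt (by fun_prop)
    smooth_A2 := hcomp (k := fun q => E.A2 q * pdx X q ^ 2) fun q hq =>
      (E.contDiffAt_A2 hq).mul ((sX1 q hq).pow 2)
    smooth_A1 := hcomp (k := fun q => pdx X q * E.A1 q + E.A2 q * pdx (pdx X) q - pdt X q)
      fun q hq => (((sX1 q hq).mul (E.contDiffAt_A1 hq)).add ((E.contDiffAt_A2 hq).mul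
        (sX2 q hq))).sub (sX3 q hq)
    smooth_C := hcomp (k := fun q => E.C q * pdx X q) fun q hq =>
      (E.contDiffAt_C hq).mul (sX1 q hq)
    A2_ne := by
      rintro _ ⟨q, hq, rfl⟩
      simp only [hG q hq]
      exact mul_ne_zero (E.A2_ne q hq) (pow_ne_zero 2 (hXx q hq))
    C_ne := by
      rintro _ ⟨q, hq, rfl⟩
      simp only [hG q hq]
      exact mul_ne_zero (E.C_ne q hq) (hXx q hq) }
  refine ⟨E', φ, rfl, h1, h2, h3, hB.relates le_rfl
    (fun q hq => Set.mem_image_of_mem (fun q : Base => (q.1, X q)) hq) (fun q hq => ?_)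
    h1 h2 h3⟩
  have Tt : ∀ q, pdt (fun q : Base => q.1) q = 1 := fun q => by
    rw [pdt_eq_dir, dir_fst_base]
  have c1 : ∀ v : Base, dir v (fun _ => (1 : ℝ)) = fun _ => 0 := fun v =>
    funext fun r => dir_const 1
  have c0 : ∀ v : Base, dir v (fun _ => (0 : ℝ)) = fun _ => 0 := fun v =>
    funext fun r => dir_const 0
  refine ⟨contDiffAt_fst, sX q hq, contDiffAt_const, contDiffAt_const,
    Filter.Eventually.of_forall fun r => dir_fst_base _ r,
    Filter.Eventually.of_forall fun r => dir_const _, by rw [Tt]; exact one_ne_zero, hXx q hq,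
    one_ne_zero, ?_, ?_, ?_, ?_, ?_⟩
  · simp only [E', hG q hq, Tt, mul_one]
  · simp only [E', hG q hq, Tt, mul_one, one_mul]
  · simp only [E', hG q hq, Tt]; ring
  · simp [pdt_eq_dir, pdx_eq_dir, c1, c0]
  · simp [pdt_eq_dir, pdx_eq_dir, c0]

end

/-! ### The family of transformations making `C` equal to one -/

section

variable {N : Set Base} {X : Base → ℝ} {E E' : Eqn} {φ : PointTransformation Space}

lemma dir_lift {k : Base → ℝ} {y : Space} (v : Base) (hk : DifferentiableAt ℝ k y.1) :
    dir ((v, 0) : Space) (fun w : Space => k w.1) y = dir v k y.1 := by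
  have := dir_affine (k₁ := fun _ => 0) (k₀ := k) (y := y) v (differentiableAt_const _) hk
  simp only [zero_mul, zero_add] at this
  rw [this, dir_const, zero_mul, zero_add]

/-- A point transformation changing only `x`, and relating two equations, intertwines them. -/
lemma Relates.intertwines_fst (hR : Relates φ E E') (hN : IsOpen N)
    (hX : ∀ p ∈ N, ContDiffAt ℝ ∞ X p) (hs : φ.source = N ×ˢ Set.univ)
    (hφ : ∀ p ∈ N, ∀ u : ℝ, φ (p, u) = ((p.1, X p), u)) {p : Base} (hp : p ∈ N) :
    Intertwines E E' (fun q => q.1) X (fun _ => 1) (fun _ => 0) p := by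
  have mem : ∀ u, (p, u) ∈ φ.source := fun u => by rw [hs]; exact ⟨hp, trivial⟩
  have near : ∀ u, ∀ᶠ y in 𝓝 ((p, u) : Space), y.1 ∈ N := fun u =>
    continuous_fst.continuousAt.eventually (hN.mem_nhds hp)
  have eT : ∀ u, φ.T =ᶠ[𝓝 ((p, u) : Space)] fun y => y.1.1 := fun u =>
    (near u).mono fun y hy => by
      have := congrArg (fun z : Space => z.1.1) (hφ y.1 hy y.2)
      exact this
  have eX : ∀ u, φ.X =ᶠ[𝓝 ((p, u) : Space)] fun y => X y.1 := fun u =>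
    (near u).mono fun y hy => by
      have := congrArg (fun z : Space => z.1.2) (hφ y.1 hy y.2)
      exact this
  have eU : ∀ u, φ.U =ᶠ[𝓝 ((p, u) : Space)] fun y => (1 : ℝ) * y.2 + 0 := fun u =>
    (near u).mono fun y hy => by
      have h := congrArg (fun z : Space => z.2) (hφ y.1 hy y.2)
      have : φ.U y = y.2 := h
      rw [this]; ring
  have sX := hX p hp
  have sX1 : ContDiffAt ℝ ∞ (pdx X) p := contDiffAt_dir sX
  have v1 : ∀ u, pt φ.T (p, u) = 1 := fun u => by
    have h1 := dir_congr (v := (((1, 0), 0) : Space)) (eT u)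
    have h2 := dir_lift (k := fun q : Base => q.1) (y := (p, u)) (1, 0) differentiableAt_fst
    exact (h1.trans h2).trans (dir_fst_base _ _)
  have v2 : ∀ u, px φ.X (p, u) = pdx X p := fun u =>
    (dir_congr (v := (((0, 1), 0) : Space)) (eX u)).trans
      (dir_lift (k := X) (y := (p, u)) (0, 1) (diffAt_of_smooth sX))
  have v3 : ∀ u, pt φ.X (p, u) = pdt X p := fun u =>
    (dir_congr (v := (((1, 0), 0) : Space)) (eX u)).trans
      (dir_lift (k := X) (y := (p, u)) (1, 0) (diffAt_of_smooth sX))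
  have v4 : ∀ u, px (px φ.X) (p, u) = pdx (pdx X) p := fun u => by
    have h1 : px φ.X =ᶠ[𝓝 ((p, u) : Space)] fun y => pdx X y.1 := by
      filter_upwards [(eX u).eventually_nhds, near u] with y hy hyN
      exact (dir_congr (v := (((0, 1), 0) : Space)) hy).trans
        (dir_lift (k := X) (y := y) (0, 1) (diffAt_of_smooth (hX _ hyN)))
    exact (dir_congr (v := (((0, 1), 0) : Space)) h1).trans
      (dir_lift (k := pdx X) (y := (p, u)) (0, 1) (diffAt_of_smooth sX1))
  have eUu : ∀ u, pu φ.U =ᶠ[𝓝 ((p, u) : Space)] fun y => 0 * y.2 + 1 := fun u =>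
    pu_affine_eventually (eU u) contDiffAt_const contDiffAt_const
  have v5 : ∀ u, pu φ.U (p, u) = 1 := fun u => by
    rw [(eUu u).self_of_nhds]; ring
  have v6 : ∀ u, px (pu φ.U) (p, u) = 0 := fun u => by
    have := (dir_affine_eventually (0, 1) (eUu u) contDiffAt_const contDiffAt_const).self_of_nhds
    refine this.trans ?_
    beta_reduce
    rw [dir_const, dir_const]; ring
  have v7 : ∀ u, φ (p, u) = ((p.1, X p), u) := hφ p hp
  have v8 : ∀ u, φ.U (p, u) = u := fun u => by rw [(eU u).self_of_nhds]; ring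
  have hA2 := hR.eq_A2 (mem 0)
  -- The relation is affine in `u`; its values at `u = 0` and `u = 1` give `eq_A1` and `eq_C`.
  have h0 := (hR.determining (mem 0)).2.1
  have h1 := (hR.determining (mem 1)).2.1
  simp only [v1, v2, v3, v4, v5, v6, v7, v8] at hA2 h0 h1
  have hXx := hR.X_x_ne (mem 0)
  rw [v2] at hXx
  have c1 : ∀ v : Base, dir v (fun _ => (1 : ℝ)) = fun _ => 0 := fun v =>
    funext fun r => dir_const 1
  have c0 : ∀ v : Base, dir v (fun _ => (0 : ℝ)) = fun _ => 0 := fun v =>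
    funext fun r => dir_const 0
  have Tt : pdt (fun q : Base => q.1) p = 1 := by rw [pdt_eq_dir, dir_fst_base]
  refine ⟨contDiffAt_fst, sX, contDiffAt_const, contDiffAt_const,
    Filter.Eventually.of_forall fun r => dir_fst_base _ r,
    Filter.Eventually.of_forall fun r => dir_const _, by rw [Tt]; exact one_ne_zero, hXx,
    one_ne_zero, ?_, ?_, ?_, ?_, ?_⟩
  · rw [Tt, hA2]
  · rw [Tt]; linear_combination h0 - h1
  · rw [Tt]; linear_combination -h0
  · simp [pdt_eq_dir, pdx_eq_dir, c1, c0]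
  · simp [pdt_eq_dir, pdx_eq_dir, c0]

lemma IsFImage.exists_map (h : IsFImage E E') :
    ∃ (X : Base → ℝ) (φ : PointTransformation Space), IsBaseMap E.dom (fun q => q.1) X ∧
      (∀ p ∈ E.dom, pdx X p = 1 / E.C p) ∧
      φ.source = E.dom ×ˢ Set.univ ∧ φ.target = E'.dom ×ˢ Set.univ ∧
      (∀ p ∈ E.dom, ∀ u : ℝ, φ (p, u) = ((p.1, X p), u)) ∧ Relates φ E E' ∧
      E'.dom = (fun q => (q.1, X q)) '' E.dom ∧
      ∀ p ∈ E.dom, Intertwines E E' (fun q => q.1) X (fun _ => 1) (fun _ => 0) p := by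
  obtain ⟨X, φ, hX, hXx, hs, ht, hφ, hR⟩ := h
  have hB := isBaseMap_fst E.dom_open E.dom_slice hX fun p hp => by
    rw [hXx p hp]; exact one_div_ne_zero (E.C_ne p hp)
  refine ⟨X, φ, hB, hXx, hs, ht, hφ, hR, ?_, fun p hp =>
    hR.intertwines_fst E.dom_open hB.smooth_X hs hφ hp⟩
  have h1 := φ.toOpenPartialHomeomorph.image_source_eq_target
  rw [hs, ht] at h1
  ext r
  constructor
  · intro hr
    have hr0 : ((r, 0) : Space) ∈ E'.dom ×ˢ (Set.univ : Set ℝ) := ⟨hr, trivial⟩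
    rw [← h1] at hr0
    obtain ⟨⟨q, u⟩, hq, he⟩ := hr0
    rw [hφ q hq.1 u] at he
    exact ⟨q, hq.1, congrArg Prod.fst he⟩
  · rintro ⟨q, hq, rfl⟩
    have : φ (q, 0) ∈ E'.dom ×ˢ (Set.univ : Set ℝ) := h1 ▸ ⟨(q, 0), ⟨hq, trivial⟩, rfl⟩
    rw [hφ q hq 0] at this
    exact this.1

lemma exists_isFImage (E : Eqn) : ∃ E', IsFImage E E' := by
  obtain ⟨X, hX, hXx⟩ := exists_global_primX E.dom_open E.dom_slice (f := fun p => 1 / E.C p)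
    (contDiffOn_const.div E.smooth_C E.C_ne)
  obtain ⟨E', φ, -, hs, ht, hφ, hR⟩ := exists_image E hX fun p hp => by
    rw [hXx p hp]; exact one_div_ne_zero (E.C_ne p hp)
  exact ⟨E', X, φ, hX, hXx, hs, ht, hφ, hR⟩

lemma IsFImage.mem_classLhat (h : IsFImage E E') : E' ∈ classLhat := by
  obtain ⟨X, φ, hB, hXx, hs, ht, hφ, hR, hd, hI⟩ := h.exists_map
  intro r hr
  rw [hd] at hr
  obtain ⟨q, hq, rfl⟩ := hr
  have h1 := (hI q hq).eq_C
  have Tt : pdt (fun q : Base => q.1) q = 1 := by rw [pdt_eq_dir, dir_fst_base]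
  rw [hXx q hq, mul_one_div_cancel (E.C_ne q hq), Tt] at h1
  linear_combination -h1

/-- The conditions singling out the regular subclasses correspond to each other. -/
lemma A1_xx_of_intertwines (hE : E ∈ classL) (hXx : ∀ p ∈ E.dom, pdx X p = 1 / E.C p)
    (hd : E'.dom = (fun q => (q.1, X q)) '' E.dom)
    (hI : ∀ p ∈ E.dom, Intertwines E E' (fun q => q.1) X (fun _ => 1) (fun _ => 0) p)
    {q : Base} (hq : q ∈ E.dom) :
    pdx (pdx E'.A1) (q.1, X q) = E.C q * splitting E q := by
  have ev : ∀ {q}, q ∈ E.dom → ∀ᶠ r in 𝓝 q, r ∈ E.dom := fun hq => E.dom_open.mem_nhds hq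
  have Tt : ∀ q, pdt (fun q : Base => q.1) q = 1 := fun q => by rw [pdt_eq_dir, dir_fst_base]
  have Tx : ∀ q, pdx (fun q : Base => q.1) q = 0 := fun q => by rw [pdx_eq_dir, dir_fst_base]
  have mem : ∀ q ∈ E.dom, ((q.1, X q) : Base) ∈ E'.dom := fun q hq => by
    rw [hd]; exact ⟨q, hq, rfl⟩
  have sD : ∀ q ∈ E.dom, ContDiffAt ℝ ∞ (fun r => E.A2 r * pdx E.C r / E.C r ^ 2) q := fun q hq =>
    ((E.contDiffAt_A2 hq).mul (contDiffAt_dir (E.contDiffAt_C hq))).div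
      ((E.contDiffAt_C hq).pow 2) (pow_ne_zero 2 (E.C_ne q hq))
  have hXx' : ∀ q ∈ E.dom, pdx X =ᶠ[𝓝 q] fun r => (E.C r)⁻¹ := fun q hq =>
    (ev hq).mono fun r hr => by rw [hXx r hr, one_div]
  -- the coefficient `A1` of the image
  have e1 : ∀ q ∈ E.dom, E'.A1 (q.1, X q)
      = - (E.A2 q * pdx E.C q / E.C q ^ 2) - pdt X q := fun q hq => by
    have h1 := (hI q hq).eq_A1
    have h2 : pdx (pdx X) q = - pdx E.C q / E.C q ^ 2 :=
      (pdx_congr (hXx' q hq)).trans (dir_inv (diffAt_of_smooth (E.contDiffAt_C hq)) (E.C_ne q hq))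
    rw [Tt, hE q hq, h2] at h1
    linear_combination h1
  -- The choice of the primitive `X` disappears here, because `X_tx = (1 / C)_t`. The result is the
  -- expression whose `x`-derivative is `splitting`.
  have e2 : ∀ q ∈ E.dom, pdx E'.A1 (q.1, X q)
      = pdt E.C q / E.C q - E.C q * pdx (fun r => E.A2 r * pdx E.C r / E.C r ^ 2) q := fun q hq => by
    have hC := E.C_ne q hq
    have h1 := pdx_comp_base (g := E'.A1) (T := fun q : Base => q.1) (X := X) (q := q)
      (diffAt_of_smooth (E'.contDiffAt_A1 (mem q hq))) differentiableAt_fst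
      (diffAt_of_smooth (hI q hq).smooth_X) (Tx q)
    have h2 : pdx (fun r => E'.A1 (r.1, X r)) q
        = pdx (fun r => - (E.A2 r * pdx E.C r / E.C r ^ 2) - pdt X r) q :=
      pdx_congr ((ev hq).mono fun r hr => e1 r hr)
    have h3 : pdx (fun r => - (E.A2 r * pdx E.C r / E.C r ^ 2) - pdt X r) q
        = - pdx (fun r => E.A2 r * pdx E.C r / E.C r ^ 2) q - pdx (pdt X) q := by
      have sXt : ContDiffAt ℝ ∞ (pdt X) q := contDiffAt_dir (hI q hq).smooth_X
      exact (dir_sub (diffAt_of_smooth (sD q hq).neg) (diffAt_of_smooth sXt)).trans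
        (congrArg (· - _) dir_neg)
    have h4 : pdx (pdt X) q = - pdt E.C q / E.C q ^ 2 := by
      have h5 : pdx (pdt X) q = pdt (pdx X) q := dir_comm (hI q hq).smooth_X
      rw [h5]
      exact (pdt_congr (hXx' q hq)).trans
        (dir_inv (diffAt_of_smooth (E.contDiffAt_C hq)) (E.C_ne q hq))
    rw [h2, h3, h4, hXx q hq] at h1
    field_simp at h1 ⊢
    linear_combination -h1
  have hC := E.C_ne q hq
  have h1 := pdx_comp_base (g := pdx E'.A1) (T := fun q : Base => q.1) (X := X) (q := q)
    (diffAt_of_smooth (contDiffAt_dir (E'.contDiffAt_A1 (mem q hq)))) differentiableAt_fst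
    (diffAt_of_smooth (hI q hq).smooth_X) (Tx q)
  have h2 : pdx (fun r => pdx E'.A1 (r.1, X r)) q = splitting E q :=
    pdx_congr ((ev hq).mono fun r hr => e2 r hr)
  rw [h2, hXx q hq] at h1
  rw [h1]
  field_simp

lemma IsFImage.mem_classL1_iff (hE : E ∈ classL) (h : IsFImage E E') :
    E ∈ classL1 ↔ E' ∈ classL1hat := by
  obtain ⟨X, φ, -, hXx, -, -, -, -, hd, hI⟩ := h.exists_map
  have hX := fun q (hq : q ∈ E.dom) => A1_xx_of_intertwines hE hXx hd hI hq
  constructor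
  · intro h1
    refine ⟨h.mem_classLhat, fun r hr => ?_⟩
    rw [hd] at hr
    obtain ⟨q, hq, rfl⟩ := hr
    beta_reduce
    rw [hX q hq]
    exact mul_ne_zero (E.C_ne q hq) (h1.2 q hq)
  · intro h1
    refine ⟨hE, fun q hq h0 => ?_⟩
    have := hX q hq
    rw [h0, mul_zero] at this
    exact h1.2 _ (by rw [hd]; exact ⟨q, hq, rfl⟩) this

/-- Equations with `C = 1` are locally images of equations with `A1 = 0`. -/
lemma exists_preimage (hE' : E' ∈ classLhat) {p : Base} (hp : p ∈ E'.dom) {V : Set Base}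
    (hV : V ∈ 𝓝 p) :
    ∃ E ∈ classL, ∃ (r : ℝ) (hr : 0 < r) (hsub : Metric.ball p r ⊆ E'.dom),
      Metric.ball p r ⊆ V ∧ IsFImage E (E'.restrictBall p r hr hsub) := by
  have ev : ∀ᶠ r in 𝓝 p, r ∈ E'.dom := E'.dom_open.mem_nhds hp
  -- Under the change `x' = Y` the new `A1` is `A2 Y_xx + A1 Y_x - Y_t`, so this equation for `Y` is
  -- precisely its vanishing.
  obtain ⟨Y, hY⟩ := exists_evolution_coordinate (a := E'.A2) (b := E'.A1) (p := p)
    (ev.mono fun q hq => ⟨E'.contDiffAt_A2 hq, E'.A2_ne q hq⟩)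
    (ev.mono fun q hq => E'.contDiffAt_A1 hq)
  obtain ⟨r, hr, hb⟩ := exists_ball_of_eventually (hY.and (ev.and
    (show ∀ᶠ q in 𝓝 p, q ∈ V from hV)))
  have hsub : Metric.ball p r ⊆ E'.dom := fun q hq => (hb q hq).2.1
  set F := E'.restrictBall p r hr hsub with hF
  have sY : ∀ q ∈ F.dom, ContDiffAt ℝ ∞ Y q := fun q hq => (hb q hq).1.1
  have hY0 : ∀ q ∈ F.dom, pdx Y q ≠ 0 := fun q hq => (hb q hq).1.2.1
  obtain ⟨E, φ, hd, hs, ht, hφ, hR⟩ := exists_image F (X := Y)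
    (fun q hq => (sY q hq).contDiffWithinAt) hY0
  have hI := fun q (hq : q ∈ F.dom) => hR.intertwines_fst F.dom_open sY hs hφ hq
  have Tt : ∀ q, pdt (fun q : Base => q.1) q = 1 := fun q => by rw [pdt_eq_dir, dir_fst_base]
  have Tx : ∀ q, pdx (fun q : Base => q.1) q = 0 := fun q => by rw [pdx_eq_dir, dir_fst_base]
  have hinv : ∀ q ∈ F.dom, ∀ u, φ.inv ((q.1, Y q), u) = (q, u) := fun q hq u => by
    rw [← hφ q hq u]
    exact φ.left_inv (by rw [hs]; exact ⟨hq, trivial⟩)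
  have sX : ContDiffOn ℝ ∞ (fun y : Base => (φ.inv (y, 0)).1.2) E.dom := by
    intro y hy
    have h1 : ContDiffAt ℝ ∞ φ.inv (y, 0) := PointTransformation.contDiffAt (φ := φ.inv)
      (by change (y, 0) ∈ φ.target; rw [ht]; exact ⟨hy, trivial⟩)
    exact (ContDiffAt.comp (g := φ.inv) (f := fun y : Base => ((y, 0) : Space)) y h1
      (contDiffAt_id.prodMk contDiffAt_const)).fst.snd.contDiffWithinAt
  refine ⟨E, ?_, r, hr, hsub, fun q hq => (hb q hq).2.2, fun y => (φ.inv (y, 0)).1.2, φ.inv, sX,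
    ?_, ht, hs, ?_, hR.symm⟩
  · intro y hy
    rw [hd] at hy
    obtain ⟨q, hq, rfl⟩ := hy
    have h1 := (hI q hq).eq_A1
    have h2 := (hb q hq).1.2.2
    rw [Tt] at h1
    change _ = pdx Y q * E'.A1 q + E'.A2 q * _ - _ + _ at h1
    linear_combination h1 - h2
  · intro y hy
    have hy' := hy
    rw [hd] at hy'
    obtain ⟨q, hq, rfl⟩ := hy'
    have h1 := (hI q hq).eq_C
    rw [Tt] at h1
    change E'.C q * _ = _ at h1
    rw [hE' q (hsub hq)] at h1
    -- The new `C` is `Y_x`, as the old one is `1`. The inverse change has the reciprocal derivative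
    -- `1 / C` and thus belongs to the family.
    have h2 := pdx_comp_base (g := fun y : Base => (φ.inv (y, 0)).1.2)
      (T := fun q : Base => q.1) (X := Y) (q := q)
      (diffAt_of_smooth (sX.contDiffAt (E.dom_open.mem_nhds hy))) differentiableAt_fst
      (diffAt_of_smooth (sY q hq)) (Tx q)
    have h3 : pdx (fun r => (φ.inv ((r.1, Y r), 0)).1.2) q = 1 := by
      have : (fun r => (φ.inv ((r.1, Y r), 0)).1.2) =ᶠ[𝓝 q] fun r : Base => r.2 := by
        filter_upwards [F.dom_open.mem_nhds hq] with r hr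
        rw [hinv r hr]
      rw [pdx_congr this]
      exact dir_snd_base _ _
    rw [h3] at h2
    have h4 : E.C (q.1, Y q) = pdx Y q := by linear_combination -h1
    beta_reduce
    rw [h4]
    exact eq_one_div_of_mul_eq_one_left h2.symm
  · intro y hy u
    rw [hd] at hy
    obtain ⟨q, hq, rfl⟩ := hy
    beta_reduce
    rw [hinv q hq, hinv q hq]

end

/-! ### Local relatedness and reduction of affine `A1` -/

/-- Somewhere over `V`, the equation `E` is related to `E'`. -/
def LocallyRelated (E : Eqn) (V : Set Base) (E' : Eqn) : Prop :=
  ∃ φ : PointTransformation Space, Relates φ E E' ∧ φ.source.Nonempty ∧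
    φ.source ⊆ V ×ˢ Set.univ

lemma groupoidEquivOn_iff {K : Set Eqn} {E E' : Eqn} {V : Set Base} :
    GroupoidEquivOn K E V E' ↔ E ∈ K ∧ E' ∈ K ∧ LocallyRelated E V E' :=
  ⟨fun ⟨φ, ⟨h1, h2, h3⟩, h4, h5⟩ => ⟨h1, h2, φ, h3, h4, h5⟩,
    fun ⟨h1, h2, φ, h3, h4, h5⟩ => ⟨φ, ⟨h1, h2, h3⟩, h4, h5⟩⟩

section

variable {E E' E₁ : Eqn} {V V₁ : Set Base} {φ : PointTransformation Space}

lemma LocallyRelated.symm (h : LocallyRelated E V E') : LocallyRelated E' Set.univ E := by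
  obtain ⟨φ, hR, ⟨z, hz⟩, -⟩ := h
  exact ⟨φ.inv, hR.symm, ⟨φ z, φ.map_source hz⟩, fun w _ => ⟨trivial, trivial⟩⟩

/-- The source of `φ` is all of `E'.dom ×ˢ Set.univ`, which keeps the composition from being empty.
-/
lemma LocallyRelated.postcomp (h : LocallyRelated E V E') (hφ : Relates φ E' E₁)
    (hs : φ.source = E'.dom ×ˢ Set.univ) : LocallyRelated E V E₁ := by
  obtain ⟨ψ, hR, ⟨z, hz⟩, hsub⟩ := h
  refine ⟨ψ.comp φ, hR.trans hφ, ⟨z, PointTransformation.mem_comp_source.2 ⟨hz, ?_⟩⟩,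
    fun w hw => hsub (PointTransformation.mem_comp_source.1 hw).1⟩
  rw [hs]
  exact hR.2.1 (ψ.map_source hz)

lemma LocallyRelated.precomp (h : LocallyRelated E V E') (hφ : Relates φ E E₁)
    (hs : φ.source = E.dom ×ˢ Set.univ) (hV : ∀ z ∈ φ.source, z.1 ∈ V → (φ z).1 ∈ V₁) :
    LocallyRelated E₁ V₁ E' := by
  obtain ⟨ψ, hR, ⟨z, hz⟩, hsub⟩ := h
  have hz' : z ∈ φ.source := by
    rw [hs]; exact hR.1 hz
  have hinv : φ.inv (φ z) = z := φ.left_inv hz'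
  refine ⟨φ.inv.comp ψ, hφ.symm.trans hR,
    ⟨φ z, PointTransformation.mem_comp_source.2 ⟨φ.map_source hz', ?_⟩⟩, fun w hw => ⟨?_, trivial⟩⟩
  · rw [hinv]; exact hz
  · obtain ⟨h1, h2⟩ := PointTransformation.mem_comp_source.1 hw
    have h3 : φ.inv w ∈ φ.source := φ.map_target h1
    have h4 : φ (φ.inv w) = w := φ.right_inv h1
    have := hV _ h3 (hsub h2).1
    rwa [h4] at this

/-- Equations with `C = 1` and `A1` affine in `x` are reduced to `A1 = 0`. -/
lemma exists_classL0p_of_A1_xx (hE : E ∈ classLhat) {p : Base} (hp : p ∈ E.dom)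
    (h : ∀ᶠ q in 𝓝 p, pdx (pdx E.A1) q = 0) :
    ∃ E' ∈ classL0p, ∃ T X : Base → ℝ, (T p, X p) ∈ E'.dom ∧
      ∀ᶠ q in 𝓝 p, Intertwines E E' T X (fun _ => 1) (fun _ => 0) q := by
  have ev : ∀ᶠ r in 𝓝 p, r ∈ E.dom := E.dom_open.mem_nhds hp
  have sA : ∀ᶠ r in 𝓝 p, ContDiffAt ℝ ∞ E.A1 r := ev.mono fun r hr => E.contDiffAt_A1 hr
  have hmk : ContinuousAt (fun s : ℝ => ((s, p.2) : Base)) p.1 :=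
    (by fun_prop : Continuous fun s : ℝ => ((s, p.2) : Base)).continuousAt
  have mk_smooth : ∀ s, ContDiffAt ℝ ∞ (fun s : ℝ => ((s, p.2) : Base)) s := fun s => by fun_prop
  have sα : ∀ᶠ s in 𝓝 p.1, ContDiffAt ℝ ∞ (fun s => pdx E.A1 (s, p.2)) s :=
    (hmk.eventually (p := fun r => ContDiffAt ℝ ∞ E.A1 r) sA).mono fun s hs =>
      ContDiffAt.comp (g := pdx E.A1) (f := fun s : ℝ => ((s, p.2) : Base)) s
        (contDiffAt_dir hs) (mk_smooth s)
  have sβ : ∀ᶠ s in 𝓝 p.1,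
      ContDiffAt ℝ ∞ (fun s => E.A1 (s, p.2) - pdx E.A1 (s, p.2) * p.2) s := by
    filter_upwards [sα, hmk.eventually (p := fun r => ContDiffAt ℝ ∞ E.A1 r) sA] with s h1 h2
    exact (ContDiffAt.comp (g := E.A1) (f := fun s : ℝ => ((s, p.2) : Base)) s h2
      (mk_smooth s)).sub (h1.mul contDiffAt_const)
  -- For `A1 = α(t) x + β(t)`, take `a' = α`, `T_t = exp a` and `X = exp a * x + χ` with `χ' = exp a
  -- * β`. Then `X_x = T_t` keeps `C = 1`, and `X_t = X_x A1` makes the new `A1` vanish.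
  obtain ⟨a, ha⟩ := exists_prim sα
  obtain ⟨τ, hτ⟩ := exists_prim (f := fun s => Real.exp (a s)) (ha.mono fun s hs => hs.1.exp)
  obtain ⟨χ, hχ⟩ := exists_prim (f := fun s => Real.exp (a s) * (E.A1 (s, p.2)
    - pdx E.A1 (s, p.2) * p.2)) ((ha.and sβ).mono fun s hs => hs.1.1.exp.mul hs.2)
  -- `A1` is affine in `x`
  have hα := eq_of_pdx_eq_zero (k := pdx E.A1) (p := p) (by
    filter_upwards [h, sA] with q h1 h2 using ⟨diffAt_of_smooth (contDiffAt_dir h2), h1⟩)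
  have hβ := eq_of_pdx_eq_zero (k := fun q => E.A1 q - pdx E.A1 q * q.2) (p := p) (by
    filter_upwards [h, sA] with q h1 h2
    have d1 := diffAt_of_smooth h2
    have d2 : DifferentiableAt ℝ (pdx E.A1) q := diffAt_of_smooth (contDiffAt_dir h2)
    refine ⟨d1.fun_sub (d2.fun_mul differentiableAt_snd), ?_⟩
    have e : dir (0, 1) (fun q : Base => E.A1 q - pdx E.A1 q * q.2) q
        = dir (0, 1) E.A1 q - (dir (0, 1) (pdx E.A1) q * q.2
          + pdx E.A1 q * dir (0, 1) (fun q : Base => q.2) q) := by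
      rw [dir_sub d1 (d2.fun_mul differentiableAt_snd), dir_mul d2 differentiableAt_snd]
    rw [dir_snd_base] at e
    refine e.trans ?_
    rw [← pdx_eq_dir, h1]
    ring)
  have ht : ContinuousAt (fun q : Base => q.1) p := continuous_fst.continuousAt
  have lift : ∀ {k : ℝ → ℝ} {q : Base}, ContDiffAt ℝ ∞ k q.1 →
      ContDiffAt ℝ ∞ (fun q : Base => k q.1) q ∧
      ∀ v : Base, dir v (fun q : Base => k q.1) q = deriv k q.1 * v.1 := fun {k q} hk =>
    ⟨hk.comp q contDiffAt_fst, fun v => by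
      rw [dir_comp_real (k := k) (f := fun q : Base => q.1) (diffAt_of_smooth hk)
        differentiableAt_fst, dir_fst_base]⟩
  set T : Base → ℝ := fun q => τ q.1 with hT
  set X : Base → ℝ := fun q => Real.exp (a q.1) * q.2 + χ q.1 with hX
  have main : ∀ᶠ q in 𝓝 p, (ContDiffAt ℝ ∞ T q ∧ ContDiffAt ℝ ∞ X q) ∧ pdx T q = 0 ∧
      pdt T q = Real.exp (a q.1) ∧ pdx X q = Real.exp (a q.1) ∧
      pdt X q = Real.exp (a q.1) * E.A1 q := by
    filter_upwards [ht.eventually ha, ht.eventually hτ, ht.eventually hχ, hα, hβ] with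
      q h1 h2 h3 h4 h5
    obtain ⟨l1, d1⟩ := lift h2.1
    obtain ⟨l2, d2⟩ := lift (k := fun s => Real.exp (a s)) h1.1.exp
    obtain ⟨l3, d3⟩ := lift h3.1
    have hd : deriv (fun s => Real.exp (a s)) q.1 = Real.exp (a q.1) * pdx E.A1 (q.1, p.2) := by
      rw [deriv_exp (diffAt_of_smooth h1.1), h1.2]
    have dX : ∀ v : Base, dir v X q = Real.exp (a q.1) * pdx E.A1 (q.1, p.2) * v.1 * q.2
        + Real.exp (a q.1) * v.2 + Real.exp (a q.1) * (E.A1 (q.1, p.2)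
    - pdx E.A1 (q.1, p.2) * p.2) * v.1 := fun v => by
      rw [hX, dir_add ((diffAt_of_smooth l2).fun_mul differentiableAt_snd) (diffAt_of_smooth l3),
        dir_mul (diffAt_of_smooth l2) differentiableAt_snd, d2, d3, dir_snd_base, hd, h3.2]
    refine ⟨⟨l1, (l2.mul contDiffAt_snd).add l3⟩, ?_, ?_, ?_, ?_⟩
    · rw [pdx_eq_dir, d1, mul_zero]
    · rw [pdt_eq_dir, d1, h2.2, mul_one]
    · rw [pdx_eq_dir, dX]; ring
    · rw [pdt_eq_dir, dX]
      linear_combination -Real.exp (a q.1) * (h5 + h4 * q.2)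
  have hreg : ∀ᶠ q in 𝓝 p, Regular T X (fun _ => 1) (fun _ => 0) q := by
    filter_upwards [main] with q h1
    refine ⟨h1.1.1, h1.1.2, contDiffAt_const, contDiffAt_const, h1.2.1, dir_const 1, ?_,
      one_ne_zero, ?_⟩
    · rw [h1.2.2.1]; exact (Real.exp_pos _).ne'
    · rw [h1.2.2.1, h1.2.2.2.1, mul_one]
  obtain ⟨E', hC', hp', hE', hall⟩ := Regular.exists_target hreg
    (a2 := fun q => pdx X q ^ 2 / pdt T q * E.A2 q) (a1 := fun _ => 0) (by
      filter_upwards [hreg, ev] with q h1 h2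
      have x1 : ContDiffAt ℝ ∞ (pdx X) q := contDiffAt_dir h1.smooth_X
      have t1 : ContDiffAt ℝ ∞ (pdt T) q := contDiffAt_dir h1.smooth_T
      refine ⟨((x1.pow 2).div t1 h1.T_t).mul (E.contDiffAt_A2 h2), mul_ne_zero (div_ne_zero
        (pow_ne_zero 2 ?_) h1.T_t) (E.A2_ne q h2)⟩
      rw [h1.X_x]
      exact mul_ne_zero h1.T_t one_ne_zero) (Filter.Eventually.of_forall fun _ => contDiffAt_const)
    (P := fun _ => True) (Filter.Eventually.of_forall fun _ => trivial)
  refine ⟨E', fun r' hr' => ⟨?_, hC' r'⟩, T, X, hp', ?_⟩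
  · obtain ⟨r, -, rfl, he⟩ := hall r' hr'
    exact he.self_of_nhds.2
  · filter_upwards [hreg.eventually_nhds, main, hE', ev] with q h1 h2 h3 h4
    have c1 : ∀ v : Base, dir v (fun _ => (1 : ℝ)) = fun _ => 0 := fun v =>
      funext fun r => dir_const 1
    have c0 : ∀ v : Base, dir v (fun _ => (0 : ℝ)) = fun _ => 0 := fun v =>
      funext fun r => dir_const 0
    refine Regular.intertwines h1 (hE q h4) (hC' _) ?_ ?_ h3.1 ?_
    · simp [pdt_eq_dir, pdx_eq_dir, c1, c0]
    · simp [pdt_eq_dir, pdx_eq_dir, c0]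
    · rw [h3.2, h2.2.2.2.1, h2.2.2.2.2]; ring

end

/-! ### Determining equations of Lie symmetries -/

/-- The components of a vector field. -/
def VField.τ (Q : VField) (z : Space) : ℝ := (Q z).1.1

/-- The components of a vector field. -/
def VField.ξ (Q : VField) (z : Space) : ℝ := (Q z).1.2

/-- The components of a vector field. -/
def VField.η (Q : VField) (z : Space) : ℝ := (Q z).2

section

variable {Q : VField} {E : Eqn}

lemma invAlgebra_smooth (hQ : Q ∈ invAlgebra E) {z : Space} (hz : z.1 ∈ E.dom) :
    ContDiffAt ℝ ∞ Q z :=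
  hQ.1.contDiffAt ((E.dom_open.prod isOpen_univ).mem_nhds ⟨hz, trivial⟩)

lemma smooth_τ {z : Space} (h : ContDiffAt ℝ ∞ Q z) : ContDiffAt ℝ ∞ Q.τ z := h.fst.fst

lemma smooth_ξ {z : Space} (h : ContDiffAt ℝ ∞ Q z) : ContDiffAt ℝ ∞ Q.ξ z := h.fst.snd

lemma smooth_η {z : Space} (h : ContDiffAt ℝ ∞ Q z) : ContDiffAt ℝ ∞ Q.η z := h.snd

/-- The left-hand side of the infinitesimal invariance criterion. -/
def crit (E : Eqn) (Q : VField) (f : Base → ℝ) (p : Base) : ℝ :=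
  prolong Q 1 0 f p
    + along Q E.C (p, f p) * f p * pdx f p
    + E.C p * (Q (p, f p)).2 * pdx f p
    + E.C p * f p * prolong Q 0 1 f p
    - along Q E.A2 (p, f p) * pdx (pdx f) p
    - E.A2 p * prolong Q 0 2 f p
    - along Q E.A1 (p, f p) * pdx f p
    - E.A1 p * prolong Q 0 1 f p

lemma mem_invAlgebra_iff : Q ∈ invAlgebra E ↔ ContDiffOn ℝ ∞ Q (E.dom ×ˢ Set.univ) ∧
    ∀ p ∈ E.dom, ∀ f : Base → ℝ, ContDiffAt ℝ ∞ f p → E.HoldsAt f p → crit E Q f p = 0 := Iff.rfl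

/-- The prolongation of a vector field on the graph of a quadratic polynomial. -/
lemma prolong_quad {p : Base} {u : ℝ} (hQ : ContDiffAt ℝ ∞ Q (p, u)) (a b c d e : ℝ) :
    prolong Q 1 0 (quad p u a b c d e) p
      = (pt Q.η (p, u) + pu Q.η (p, u) * a) - (pt Q.τ (p, u) + pu Q.τ (p, u) * a) * a
        - (pt Q.ξ (p, u) + pu Q.ξ (p, u) * a) * b ∧
    prolong Q 0 1 (quad p u a b c d e) p
      = (px Q.η (p, u) + pu Q.η (p, u) * b) - (px Q.τ (p, u) + pu Q.τ (p, u) * b) * a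
        - (px Q.ξ (p, u) + pu Q.ξ (p, u) * b) * b ∧
    prolong Q 0 2 (quad p u a b c d e) p
      = (px (px Q.η) (p, u) + 2 * px (pu Q.η) (p, u) * b + pu (pu Q.η) (p, u) * b ^ 2
          + pu Q.η (p, u) * e)
        - (px (px Q.τ) (p, u) + 2 * px (pu Q.τ) (p, u) * b + pu (pu Q.τ) (p, u) * b ^ 2
          + pu Q.τ (p, u) * e) * a - 2 * (px Q.τ (p, u) + pu Q.τ (p, u) * b) * d
        - (px (px Q.ξ) (p, u) + 2 * px (pu Q.ξ) (p, u) * b + pu (pu Q.ξ) (p, u) * b ^ 2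
          + pu Q.ξ (p, u) * e) * b - 2 * (px Q.ξ (p, u) + pu Q.ξ (p, u) * b) * e := by
  set f := quad p u a b c d e with hf
  have hfp : f p = u := quad_self p u a b c d e
  have sf : ∀ q, ContDiffAt ℝ ∞ f q := fun q => (contDiff_quad p u a b c d e).contDiffAt
  have ft : pdt f = lin p a c d := by
    rw [pdt_eq_dir, hf, dir_quad]; simp
  have fx : pdx f = lin p b d e := by
    rw [pdx_eq_dir, hf, dir_quad]; simp
  have sl : ∀ {k l m : ℝ} {q : Base}, ContDiffAt ℝ ∞ (lin p k l m) q := fun {k l m q} =>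
    (contDiff_lin p k l m).contDiffAt
  have dl : ∀ {k l m : ℝ} (v : Base), dir v (lin p k l m) = fun _ => l * v.1 + m * v.2 :=
    fun {k l m} v => funext fun q => dir_lin p k l m v q
  have lp : ∀ {k l m : ℝ}, lin p k l m p = k := fun {k l m} => by simp [lin]
  rw [← hfp] at hQ ⊢
  have gτ := contDiffAt_graph (smooth_τ hQ) (sf p)
  have gξ := contDiffAt_graph (smooth_ξ hQ) (sf p)
  have gη := contDiffAt_graph (smooth_η hQ) (sf p)
  have eχ : characteristic Q f = fun r => Q.η (r, f r) - Q.τ (r, f r) * lin p a c d r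
      - Q.ξ (r, f r) * lin p b d e r := by
    funext r
    rw [← ft, ← fx]; rfl
  have dχ : ∀ v : Base, dir v (characteristic Q f) p = dir v (fun r => Q.η (r, f r)) p
      - (dir v (fun r => Q.τ (r, f r)) p * a + Q.τ (p, f p) * (c * v.1 + d * v.2))
      - (dir v (fun r => Q.ξ (r, f r)) p * b + Q.ξ (p, f p) * (d * v.1 + e * v.2)) := fun v => by
    rw [eχ, dir_sub ((diffAt_of_smooth gη).fun_sub ((diffAt_of_smooth gτ).fun_mul
      (diffAt_of_smooth sl))) ((diffAt_of_smooth gξ).fun_mul (diffAt_of_smooth sl)),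
      dir_sub (diffAt_of_smooth gη) ((diffAt_of_smooth gτ).fun_mul (diffAt_of_smooth sl)),
      dir_mul (diffAt_of_smooth gτ) (diffAt_of_smooth sl),
      dir_mul (diffAt_of_smooth gξ) (diffAt_of_smooth sl), dl, dl, lp, lp]
  have ddχ : pdx (pdx (characteristic Q f)) p = pdx (pdx fun r => Q.η (r, f r)) p
      - (pdx (pdx fun r => Q.τ (r, f r)) p * a + 2 * pdx (fun r => Q.τ (r, f r)) p * d)
      - (pdx (pdx fun r => Q.ξ (r, f r)) p * b + 2 * pdx (fun r => Q.ξ (r, f r)) p * e) := by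
    have h2 := dir_dir_mul (v := ((0, 1) : Base)) gτ (sl (k := a) (l := c) (m := d))
    have h3 := dir_dir_mul (v := ((0, 1) : Base)) gξ (sl (k := b) (l := d) (m := e))
    rw [dl, dir_const, lp] at h2 h3
    rw [eχ, pdx_pdx_sub (gη.sub (gτ.mul sl)) (gξ.mul sl), pdx_pdx_sub gη (gτ.mul sl)]
    simp only [pdx_eq_dir] at h2 h3 ⊢
    rw [h2, h3]
    ring
  have gt : ∀ {H : Space → ℝ}, ContDiffAt ℝ ∞ H (p, f p) →
      pdt (fun r => H (r, f r)) p = pt H (p, f p) + pu H (p, f p) * a := fun hH => by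
    rw [pdt_graph (diffAt_of_smooth hH) (diffAt_of_smooth (sf p)), ft, lp]
  have gx : ∀ {H : Space → ℝ}, ContDiffAt ℝ ∞ H (p, f p) →
      pdx (fun r => H (r, f r)) p = px H (p, f p) + pu H (p, f p) * b := fun hH => by
    rw [pdx_graph (diffAt_of_smooth hH) (diffAt_of_smooth (sf p)), fx, lp]
  have gxx : ∀ {H : Space → ℝ}, ContDiffAt ℝ ∞ H (p, f p) →
      pdx (pdx fun r => H (r, f r)) p = px (px H) (p, f p) + 2 * px (pu H) (p, f p) * b
        + pu (pu H) (p, f p) * b ^ 2 + pu H (p, f p) * e := fun hH => by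
    rw [pdx_pdx_graph hH (sf p), fx, lp, pdx_eq_dir, dl]
    ring
  have hχt : pdt (characteristic Q f) p = _ := dχ (1, 0)
  have hχx : pdx (characteristic Q f) p = _ := dχ (0, 1)
  rw [← pdt_eq_dir, gt (smooth_τ hQ), gt (smooth_ξ hQ), gt (smooth_η hQ)] at hχt
  rw [← pdx_eq_dir, gx (smooth_τ hQ), gx (smooth_ξ hQ), gx (smooth_η hQ)] at hχx
  rw [gx (smooth_τ hQ), gx (smooth_ξ hQ), gxx (smooth_τ hQ), gxx (smooth_ξ hQ),
    gxx (smooth_η hQ)] at ddχ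
  have tt : pdt (pdt f) p = c := by rw [ft, pdt_eq_dir, dl]; ring
  have tx : pdt (pdx f) p = d := by rw [fx, pdt_eq_dir, dl]; ring
  have xx : pdx (pdx f) p = e := by rw [fx, pdx_eq_dir, dl]; ring
  have txx : pdt (pdx (pdx f)) p = 0 := by
    rw [fx, pdx_eq_dir, dl, pdt_eq_dir, dir_const]
  have xxx : pdx (pdx (pdx f)) p = 0 := by
    rw [fx, pdx_eq_dir, dl, dir_const]
  refine ⟨?_, ?_, ?_⟩
  · change pdt (characteristic Q f) p + Q.τ (p, f p) * pdt (pdt f) p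
      + Q.ξ (p, f p) * pdt (pdx f) p = _
    rw [hχt, tt, tx]; ring
  · change pdx (characteristic Q f) p + Q.τ (p, f p) * pdt (pdx f) p
      + Q.ξ (p, f p) * pdx (pdx f) p = _
    rw [hχx, tx, xx]; ring
  · change pdx (pdx (characteristic Q f)) p + Q.τ (p, f p) * pdt (pdx (pdx f)) p
      + Q.ξ (p, f p) * pdx (pdx (pdx f)) p = _
    rw [ddχ, txx, xxx]; ring

/-- The criterion as a polynomial in the jet variables. -/
lemma invAlgebra_jet (hQ : Q ∈ invAlgebra E) {p : Base} (hp : p ∈ E.dom) (u b d e : ℝ) {a : ℝ}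
    (ha : a = E.A2 p * e + E.A1 p * b - E.C p * u * b) :
    (pt Q.η (p, u) + pu Q.η (p, u) * a) - (pt Q.τ (p, u) + pu Q.τ (p, u) * a) * a
        - (pt Q.ξ (p, u) + pu Q.ξ (p, u) * a) * b
      + (Q.τ (p, u) * pdt E.C p + Q.ξ (p, u) * pdx E.C p) * u * b
      + E.C p * Q.η (p, u) * b
      + (E.C p * u - E.A1 p) * ((px Q.η (p, u) + pu Q.η (p, u) * b)
        - (px Q.τ (p, u) + pu Q.τ (p, u) * b) * a - (px Q.ξ (p, u) + pu Q.ξ (p, u) * b) * b)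
      - (Q.τ (p, u) * pdt E.A2 p + Q.ξ (p, u) * pdx E.A2 p) * e
      - E.A2 p * ((px (px Q.η) (p, u) + 2 * px (pu Q.η) (p, u) * b + pu (pu Q.η) (p, u) * b ^ 2
          + pu Q.η (p, u) * e)
        - (px (px Q.τ) (p, u) + 2 * px (pu Q.τ) (p, u) * b + pu (pu Q.τ) (p, u) * b ^ 2
          + pu Q.τ (p, u) * e) * a - 2 * (px Q.τ (p, u) + pu Q.τ (p, u) * b) * d
        - (px (px Q.ξ) (p, u) + 2 * px (pu Q.ξ) (p, u) * b + pu (pu Q.ξ) (p, u) * b ^ 2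
          + pu Q.ξ (p, u) * e) * b - 2 * (px Q.ξ (p, u) + pu Q.ξ (p, u) * b) * e)
      - (Q.τ (p, u) * pdt E.A1 p + Q.ξ (p, u) * pdx E.A1 p) * b = 0 := by
  obtain ⟨h1, h2, h3⟩ := prolong_quad (invAlgebra_smooth hQ (z := (p, u)) hp) a b 0 d e
  have h := hQ.2 p hp (quad p u a b 0 d e) (contDiff_quad p u a b 0 d e).contDiffAt
    ((E.holdsAt_quad p u a b 0 d e).2 (by rw [ha]; ring))
  rw [h1, h2, h3, quad_self, pdx_quad, pdx_pdx_quad] at h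
  have hal : ∀ k : Base → ℝ, along Q k (p, u)
      = Q.τ (p, u) * pdt k p + Q.ξ (p, u) * pdx k p := fun _ => rfl
  have hη : (Q (p, u)).2 = Q.η (p, u) := rfl
  rw [hal, hal, hal, hη] at h
  linear_combination h

/-- The determining equations for Lie symmetries. -/
lemma invAlgebra_determining (hQ : Q ∈ invAlgebra E) {p : Base} (hp : p ∈ E.dom) (u : ℝ) :
    px Q.τ (p, u) = 0 ∧ pu Q.τ (p, u) = 0 ∧ pu Q.ξ (p, u) = 0 ∧ pu (pu Q.η) (p, u) = 0 ∧
    Q.τ (p, u) * pdt E.A2 p + Q.ξ (p, u) * pdx E.A2 p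
      = (2 * px Q.ξ (p, u) - pt Q.τ (p, u)) * E.A2 p ∧
    (E.C p * u - E.A1 p) * (pt Q.τ (p, u) - px Q.ξ (p, u)) - pt Q.ξ (p, u)
      + (Q.τ (p, u) * pdt E.C p + Q.ξ (p, u) * pdx E.C p) * u + E.C p * Q.η (p, u)
      - E.A2 p * (2 * px (pu Q.η) (p, u) - px (px Q.ξ) (p, u))
      - (Q.τ (p, u) * pdt E.A1 p + Q.ξ (p, u) * pdx E.A1 p) = 0 ∧
    pt Q.η (p, u) + (E.C p * u - E.A1 p) * px Q.η (p, u) - E.A2 p * px (px Q.η) (p, u) = 0 := by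
  have hA := E.A2_ne p hp
  have hτ : ∀ q ∈ E.dom, ∀ s, px Q.τ (q, s) = 0 ∧ pu Q.τ (q, s) = 0 := by
    intro q hq s
    -- The coefficient of the free variable `d = u_tx`.
    have key : ∀ b, px Q.τ (q, s) + pu Q.τ (q, s) * b = 0 := fun b => by
      have h0 := invAlgebra_jet hQ hq s b 0 0 rfl
      have h1 := invAlgebra_jet hQ hq s b 1 0 rfl
      have : (2 * E.A2 q) * (px Q.τ (q, s) + pu Q.τ (q, s) * b) = 0 := by
        linear_combination h1 - h0
      exact (mul_eq_zero.1 this).resolve_left (mul_ne_zero two_ne_zero (E.A2_ne q hq))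
    have h0 := key 0
    have h1 := key 1
    constructor <;> linarith
  have near : ∀ s, ∀ᶠ y in 𝓝 ((p, s) : Space), y.1 ∈ E.dom := fun s =>
    continuous_fst.continuousAt.eventually (E.dom_open.mem_nhds hp)
  have hτxx : px (px Q.τ) (p, u) = 0 :=
    dir_vanish_of_eventually ((near u).mono fun y hy => (hτ y.1 hy y.2).1)
  have hτxu : px (pu Q.τ) (p, u) = 0 :=
    dir_vanish_of_eventually ((near u).mono fun y hy => (hτ y.1 hy y.2).2)
  have hτuu : pu (pu Q.τ) (p, u) = 0 :=
    dir_vanish_of_eventually ((near u).mono fun y hy => (hτ y.1 hy y.2).2)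
  -- The mixed difference in `u_x` and `u_xx` isolates the coefficient of `u_x u_xx`, namely `2 A2
  -- ξ_u`.
  have hξ : ∀ q ∈ E.dom, ∀ s, pu Q.ξ (q, s) = 0 := by
    intro q hq s
    have h00 := invAlgebra_jet hQ hq s 0 0 0 rfl
    have h10 := invAlgebra_jet hQ hq s 1 0 0 rfl
    have h01 := invAlgebra_jet hQ hq s 0 0 1 rfl
    have h11 := invAlgebra_jet hQ hq s 1 0 1 rfl
    obtain ⟨e1, e2⟩ := hτ q hq s
    have nearq : ∀ᶠ y in 𝓝 ((q, s) : Space), y.1 ∈ E.dom :=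
      continuous_fst.continuousAt.eventually (E.dom_open.mem_nhds hq)
    have e3 : px (px Q.τ) (q, s) = 0 :=
      dir_vanish_of_eventually (nearq.mono fun y hy => (hτ y.1 hy y.2).1)
    have e4 : px (pu Q.τ) (q, s) = 0 :=
      dir_vanish_of_eventually (nearq.mono fun y hy => (hτ y.1 hy y.2).2)
    have e5 : pu (pu Q.τ) (q, s) = 0 :=
      dir_vanish_of_eventually (nearq.mono fun y hy => (hτ y.1 hy y.2).2)
    rw [e1, e2, e3, e4, e5] at h00 h10 h01 h11
    have : (2 * E.A2 q) * pu Q.ξ (q, s) = 0 := by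
      linear_combination h11 - h10 - h01 + h00
    exact (mul_eq_zero.1 this).resolve_left (mul_ne_zero two_ne_zero (E.A2_ne q hq))
  have hξxu : px (pu Q.ξ) (p, u) = 0 :=
    dir_vanish_of_eventually ((near u).mono fun y hy => hξ y.1 hy y.2)
  have hξuu : pu (pu Q.ξ) (p, u) = 0 :=
    dir_vanish_of_eventually ((near u).mono fun y hy => hξ y.1 hy y.2)
  obtain ⟨e1, e2⟩ := hτ p hp u
  have e3 := hξ p hp u
  -- What remains is a quadratic polynomial in `u_x`, plus a term linear in `u_xx`. The values `u_x
  -- = 0, 1, -1` and `u_xx = 0, 1` separate its coefficients.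
  have h00 := invAlgebra_jet hQ hp u 0 0 0 rfl
  have h10 := invAlgebra_jet hQ hp u 1 0 0 rfl
  have hm0 := invAlgebra_jet hQ hp u (-1) 0 0 rfl
  have h01 := invAlgebra_jet hQ hp u 0 0 1 rfl
  rw [hτxx, hτxu, hτuu, e1, e2, hξxu, hξuu, e3] at h00 h10 hm0 h01
  have huu : (2 * E.A2 p) * pu (pu Q.η) (p, u) = 0 := by
    linear_combination 2 * h00 - h10 - hm0
  refine ⟨e1, e2, e3,
    (mul_eq_zero.1 huu).resolve_left (mul_ne_zero two_ne_zero hA), ?_, ?_, ?_⟩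
  · linear_combination h00 - h01
  · linear_combination (h10 - hm0) / 2
  · linear_combination h00

end

/-- The determining equations in terms of the coefficients of
`τ ∂_t + ξ ∂_x + (η₁ u + η₀) ∂_u`. -/
structure SymmetryCoeffs (E : Eqn) (τ ξ η₁ η₀ : Base → ℝ) : Prop where
  smooth_τ : ∀ p ∈ E.dom, ContDiffAt ℝ ∞ τ p
  smooth_ξ : ∀ p ∈ E.dom, ContDiffAt ℝ ∞ ξ p
  smooth_η₁ : ∀ p ∈ E.dom, ContDiffAt ℝ ∞ η₁ p
  smooth_η₀ : ∀ p ∈ E.dom, ContDiffAt ℝ ∞ η₀ p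
  τ_x : ∀ p ∈ E.dom, pdx τ p = 0
  η₁_x : ∀ p ∈ E.dom, pdx η₁ p = 0
  eq_A2 : ∀ p ∈ E.dom, τ p * pdt E.A2 p + ξ p * pdx E.A2 p = (2 * pdx ξ p - pdt τ p) * E.A2 p
  eq_C : ∀ p ∈ E.dom, E.C p * (pdt τ p - pdx ξ p) + τ p * pdt E.C p + ξ p * pdx E.C p
    + E.C p * η₁ p = 0
  eq_A1 : ∀ p ∈ E.dom, - E.A1 p * (pdt τ p - pdx ξ p) - pdt ξ p + E.C p * η₀ p
    + E.A2 p * pdx (pdx ξ) p - (τ p * pdt E.A1 p + ξ p * pdx E.A1 p) = 0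
  eq_η₁ : ∀ p ∈ E.dom, pdt η₁ p + E.C p * pdx η₀ p = 0
  eq_η₀ : ∀ p ∈ E.dom, pdt η₀ p = E.A2 p * pdx (pdx η₀) p + E.A1 p * pdx η₀ p

section

variable {Q : VField} {E : Eqn}

lemma eq_of_pu_zero {H : Space → ℝ} {q : Base} (hd : ∀ s, DifferentiableAt ℝ H (q, s))
    (h0 : ∀ s, pu H (q, s) = 0) (u : ℝ) : H (q, u) = H (q, 0) := by
  refine eq_of_pu_eq_zero (ε := |u| + 1) (by positivity) (fun s _ => hd s) (fun s _ => h0 s) u ?_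
  rw [mem_ball_zero_iff, Real.norm_eq_abs]
  linarith

/-- Lie symmetries are affine in `u`. -/
theorem invAlgebra_affine (hQ : Q ∈ invAlgebra E) :
    ∃ τ ξ η₁ η₀ : Base → ℝ, SymmetryCoeffs E τ ξ η₁ η₀ ∧
      ∀ p ∈ E.dom, ∀ u : ℝ, Q (p, u) = ((τ p, ξ p), η₁ p * u + η₀ p) := by
  have sQ : ∀ p ∈ E.dom, ∀ u, ContDiffAt ℝ ∞ Q (p, u) := fun p hp u =>
    invAlgebra_smooth hQ (z := (p, u)) hp
  have det := fun p (hp : p ∈ E.dom) u => invAlgebra_determining hQ hp u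
  set τ : Base → ℝ := fun q => Q.τ (q, 0) with hτ
  set ξ : Base → ℝ := fun q => Q.ξ (q, 0) with hξ
  set η₁ : Base → ℝ := fun q => pu Q.η (q, 0) with hη₁
  set η₀ : Base → ℝ := fun q => Q.η (q, 0) with hη₀
  have smk : ∀ q, ContDiffAt ℝ ∞ (fun q : Base => ((q, 0) : Space)) q := fun q =>
    contDiffAt_id.prodMk contDiffAt_const
  have sη' : ∀ p ∈ E.dom, ∀ u, ContDiffAt ℝ ∞ (pu Q.η) (p, u) := fun p hp u =>
    contDiffAt_dir (smooth_η (sQ p hp u))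
  have sτ : ∀ p ∈ E.dom, ContDiffAt ℝ ∞ τ p := fun p hp =>
    ContDiffAt.comp (g := Q.τ) (f := fun q : Base => ((q, 0) : Space)) p
      (smooth_τ (sQ p hp 0)) (smk p)
  have sξ : ∀ p ∈ E.dom, ContDiffAt ℝ ∞ ξ p := fun p hp =>
    ContDiffAt.comp (g := Q.ξ) (f := fun q : Base => ((q, 0) : Space)) p
      (smooth_ξ (sQ p hp 0)) (smk p)
  have sη₁ : ∀ p ∈ E.dom, ContDiffAt ℝ ∞ η₁ p := fun p hp =>
    ContDiffAt.comp (g := pu Q.η) (f := fun q : Base => ((q, 0) : Space)) p (sη' p hp 0) (smk p)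
  have sη₀ : ∀ p ∈ E.dom, ContDiffAt ℝ ∞ η₀ p := fun p hp =>
    ContDiffAt.comp (g := Q.η) (f := fun q : Base => ((q, 0) : Space)) p
      (smooth_η (sQ p hp 0)) (smk p)
  have fτ : ∀ p ∈ E.dom, ∀ u, Q.τ (p, u) = 0 * u + τ p := fun p hp u => by
    rw [zero_mul, zero_add]
    exact eq_of_pu_zero (fun s => diffAt_of_smooth (smooth_τ (sQ p hp s)))
      (fun s => (det p hp s).2.1) u
  have fξ : ∀ p ∈ E.dom, ∀ u, Q.ξ (p, u) = 0 * u + ξ p := fun p hp u => by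
    rw [zero_mul, zero_add]
    exact eq_of_pu_zero (fun s => diffAt_of_smooth (smooth_ξ (sQ p hp s)))
      (fun s => (det p hp s).2.2.1) u
  have fη' : ∀ p ∈ E.dom, ∀ u, pu Q.η (p, u) = η₁ p := fun p hp u =>
    eq_of_pu_zero (fun s => diffAt_of_smooth (sη' p hp s)) (fun s => (det p hp s).2.2.2.1) u
  have fη : ∀ p ∈ E.dom, ∀ u, Q.η (p, u) = η₁ p * u + η₀ p := fun p hp u => by
    have d1 : ∀ s : ℝ, DifferentiableAt ℝ (fun y : Space => η₁ p * y.2) (p, s) := fun s =>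
      differentiableAt_snd.const_mul _
    have := eq_of_pu_zero (H := fun y => Q.η y - η₁ p * y.2) (q := p)
      (fun s => (diffAt_of_smooth (smooth_η (sQ p hp s))).fun_sub (d1 s)) (fun s => by
        have e := pu_affine (k₁ := fun _ => η₁ p) (k₀ := fun _ => 0) (y := (p, s))
          (differentiableAt_const _) (differentiableAt_const _)
        simp only [add_zero] at e
        refine (dir_sub (diffAt_of_smooth (smooth_η (sQ p hp s))) (d1 s)).trans ?_
        change pu Q.η (p, s) - pu (fun y : Space => η₁ p * y.2) (p, s) = 0
        rw [e, fη' p hp s, sub_self]) u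
    simp only [mul_zero, sub_zero] at this
    linear_combination this
  have near : ∀ p ∈ E.dom, ∀ u, ∀ᶠ y in 𝓝 ((p, u) : Space), y.1 ∈ E.dom := fun p hp u =>
    continuous_fst.continuousAt.eventually (E.dom_open.mem_nhds hp)
  have cz : ∀ p : Base, ContDiffAt ℝ ∞ (fun _ : Base => (0 : ℝ)) p := fun p => contDiffAt_const
  -- the first derivatives
  have aff : ∀ {H : Space → ℝ} {k₁ k₀ : Base → ℝ}, (∀ p ∈ E.dom, ContDiffAt ℝ ∞ k₁ p) →
      (∀ p ∈ E.dom, ContDiffAt ℝ ∞ k₀ p) → (∀ p ∈ E.dom, ∀ u, H (p, u) = k₁ p * u + k₀ p) →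
      ∀ (v : Base), ∀ p ∈ E.dom, ∀ u, dir (v, 0) H (p, u) = dir v k₁ p * u + dir v k₀ p := by
    intro H k₁ k₀ h1 h0 hH v p hp u
    have : H =ᶠ[𝓝 ((p, u) : Space)] fun w => k₁ w.1 * w.2 + k₀ w.1 :=
      (near p hp u).mono fun y hy => hH y.1 hy y.2
    exact (dir_affine_eventually v this (h1 p hp) (h0 p hp)).self_of_nhds
  have s0 : ∀ p ∈ E.dom, ContDiffAt ℝ ∞ (fun _ : Base => (0 : ℝ)) p := fun p _ => cz p
  have dz : ∀ v p, dir v (fun _ : Base => (0 : ℝ)) p = 0 := fun v p => dir_const 0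
  have τt : ∀ p ∈ E.dom, ∀ u, pt Q.τ (p, u) = pdt τ p := fun p hp u => by
    refine (aff s0 sτ fτ (1, 0) p hp u).trans ?_
    rw [dz, zero_mul, zero_add]; rfl
  have τx : ∀ p ∈ E.dom, ∀ u, px Q.τ (p, u) = pdx τ p := fun p hp u => by
    refine (aff s0 sτ fτ (0, 1) p hp u).trans ?_
    rw [dz, zero_mul, zero_add]; rfl
  have ξt : ∀ p ∈ E.dom, ∀ u, pt Q.ξ (p, u) = pdt ξ p := fun p hp u => by
    refine (aff s0 sξ fξ (1, 0) p hp u).trans ?_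
    rw [dz, zero_mul, zero_add]; rfl
  have ξx : ∀ p ∈ E.dom, ∀ u, px Q.ξ (p, u) = 0 * u + pdx ξ p := fun p hp u => by
    refine (aff s0 sξ fξ (0, 1) p hp u).trans ?_
    rw [dz]; rfl
  have sξx : ∀ p ∈ E.dom, ContDiffAt ℝ ∞ (pdx ξ) p := fun p hp => contDiffAt_dir (sξ p hp)
  have ξxx : ∀ p ∈ E.dom, ∀ u, px (px Q.ξ) (p, u) = pdx (pdx ξ) p := fun p hp u => by
    refine (aff s0 sξx ξx (0, 1) p hp u).trans ?_
    rw [dz, zero_mul, zero_add]; rfl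
  have ηt : ∀ p ∈ E.dom, ∀ u, pt Q.η (p, u) = pdt η₁ p * u + pdt η₀ p := fun p hp u =>
    aff sη₁ sη₀ fη (1, 0) p hp u
  have ηx : ∀ p ∈ E.dom, ∀ u, px Q.η (p, u) = pdx η₁ p * u + pdx η₀ p := fun p hp u =>
    aff sη₁ sη₀ fη (0, 1) p hp u
  have ηxx : ∀ p ∈ E.dom, ∀ u, px (px Q.η) (p, u) = pdx (pdx η₁) p * u + pdx (pdx η₀) p :=
    fun p hp u => aff (fun p hp => contDiffAt_dir (sη₁ p hp))
      (fun p hp => contDiffAt_dir (sη₀ p hp)) ηx (0, 1) p hp u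
  have ηux : ∀ p ∈ E.dom, ∀ u, px (pu Q.η) (p, u) = pdx η₁ p := fun p hp u => by
    refine (aff s0 sη₁ (fun p hp u => by rw [fη' p hp u, zero_mul, zero_add]) (0, 1) p hp u).trans
      ?_
    rw [dz, zero_mul, zero_add]; rfl
  have eτx : ∀ p ∈ E.dom, pdx τ p = 0 := fun p hp => by
    rw [← τx p hp 0]; exact (det p hp 0).1
  have D3 : ∀ p ∈ E.dom, ∀ u, pdt η₁ p * u + pdt η₀ p + (E.C p * u - E.A1 p)
      * (pdx η₁ p * u + pdx η₀ p) - E.A2 p * (pdx (pdx η₁) p * u + pdx (pdx η₀) p) = 0 :=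
    fun p hp u => by
      have := (det p hp u).2.2.2.2.2.2
      rwa [ηt p hp, ηx p hp, ηxx p hp] at this
  -- `D3` is quadratic in `u` with leading coefficient `C η₁_x`, because of the nonlinear term of
  -- the equation.
  have eη₁x : ∀ p ∈ E.dom, pdx η₁ p = 0 := fun p hp => by
    have h0 := D3 p hp 0
    have h1 := D3 p hp 1
    have h2 := D3 p hp (-1)
    have : E.C p * pdx η₁ p = 0 := by linear_combination (h1 + h2) / 2 - h0
    exact (mul_eq_zero.1 this).resolve_left (E.C_ne p hp)
  have eη₁xx : ∀ p ∈ E.dom, pdx (pdx η₁) p = 0 := fun p hp =>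
    dir_vanish_of_eventually
      ((show ∀ᶠ q in 𝓝 p, q ∈ E.dom from E.dom_open.mem_nhds hp).mono eη₁x)
  have D2 : ∀ p ∈ E.dom, ∀ u, (E.C p * u - E.A1 p) * (pdt τ p - pdx ξ p) - pdt ξ p
      + (τ p * pdt E.C p + ξ p * pdx E.C p) * u + E.C p * (η₁ p * u + η₀ p)
      + E.A2 p * pdx (pdx ξ) p - (τ p * pdt E.A1 p + ξ p * pdx E.A1 p) = 0 := fun p hp u => by
    have h := (det p hp u).2.2.2.2.2.1
    rw [τt p hp, ξx p hp, ξt p hp, fη p hp, ηux p hp, ξxx p hp, fτ p hp, fξ p hp,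
      eη₁x p hp] at h
    linear_combination h
  refine ⟨τ, ξ, η₁, η₀, ⟨sτ, sξ, sη₁, sη₀, eτx, eη₁x, fun p hp => ?_, fun p hp => ?_,
    fun p hp => ?_, fun p hp => ?_, fun p hp => ?_⟩, fun p hp u => ?_⟩
  · have h := (det p hp 0).2.2.2.2.1
    rw [τt p hp, ξx p hp] at h
    linear_combination h
  · linear_combination D2 p hp 1 - D2 p hp 0
  · linear_combination D2 p hp 0
  · have h0 := D3 p hp 0
    have h1 := D3 p hp 1
    rw [eη₁x p hp, eη₁xx p hp] at h0 h1
    linear_combination h1 - h0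
  · have h0 := D3 p hp 0
    rw [eη₁x p hp, eη₁xx p hp] at h0
    linear_combination h0
  · refine Prod.ext (Prod.ext ?_ ?_) ?_
    · exact (fτ p hp u).trans (by ring)
    · exact (fξ p hp u).trans (by ring)
    · exact fη p hp u

end

/-! ### Vanishing of the kernel algebras -/

/-- The equation with the same domain as `E`, and `A2 = exp (m x + n t)`. -/
def Eqn.withExp (E : Eqn) (m n : ℝ) (A1 C : Base → ℝ) (h1 : ContDiff ℝ ∞ A1)
    (hC : ContDiff ℝ ∞ C) (hC0 : ∀ p, C p ≠ 0) : Eqn where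
  dom := E.dom
  A2 := fun q => Real.exp (m * q.2 + n * q.1)
  A1 := A1
  C := C
  dom_open := E.dom_open
  dom_nonempty := E.dom_nonempty
  dom_time := E.dom_time
  dom_slice := E.dom_slice
  smooth_A2 := by
    have : ContDiff ℝ ∞ fun q : Base => Real.exp (m * q.2 + n * q.1) := by fun_prop
    exact this.contDiffOn
  smooth_A1 := h1.contDiffOn
  smooth_C := hC.contDiffOn
  A2_ne := fun _ _ => Real.exp_ne_zero _
  C_ne := fun p _ => hC0 p

lemma dir_exp_linear (m n : ℝ) (v q : Base) :
    dir v (fun q : Base => Real.exp (m * q.2 + n * q.1)) q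
      = (m * v.2 + n * v.1) * Real.exp (m * q.2 + n * q.1) := by
  have d1 : DifferentiableAt ℝ (fun q : Base => m * q.2 + n * q.1) q := by fun_prop
  rw [dir_comp_real (k := Real.exp) Real.differentiableAt_exp d1, Real.deriv_exp,
    dir_add (by fun_prop) (by fun_prop), dir_const_mul m differentiableAt_snd,
    dir_const_mul n differentiableAt_fst, dir_fst_base, dir_snd_base]
  ring

/-- A common Lie symmetry of sufficiently many equations vanishes. -/
lemma vanish_of_withExp {E : Eqn} {Q : VField} {A1 C : Base → ℝ} {h1 : ContDiff ℝ ∞ A1}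
    {hC : ContDiff ℝ ∞ C} {hC0 : ∀ p, C p ≠ 0}
    (h : ∀ m n : ℝ, m = 2 ∨ m = 3 → Q ∈ invAlgebra (E.withExp m n A1 C h1 hC hC0)) :
    ∀ p ∈ E.dom, ∀ u, Q (p, u) = 0 := by
  obtain ⟨τ, ξ, η₁, η₀, hS, hQ⟩ := invAlgebra_affine (h 2 0 (Or.inl rfl))
  -- For `A2 = exp (m x + n t)`, the equation `eq_A2` divided by `A2` is affine in `(m, n)` with
  -- coefficients `ξ` and `τ`; varying `m` and `n` kills both. The values `2` and `3` avoid `m = 0`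
  -- and `m = 1`, which the test family for `classL1` must exclude.
  have key : ∀ m n : ℝ, m = 2 ∨ m = 3 → ∀ p ∈ E.dom,
      τ p * n + ξ p * m = 2 * pdx ξ p - pdt τ p := by
    intro m n hm p hp
    obtain ⟨τ', ξ', η₁', η₀', hS', hQ'⟩ := invAlgebra_affine (h m n hm)
    have e : ∀ q ∈ E.dom, τ' q = τ q ∧ ξ' q = ξ q := fun q hq => by
      have := (hQ' q hq 0).symm.trans (hQ q hq 0)
      exact ⟨congrArg (fun z : Space => z.1.1) this, congrArg (fun z : Space => z.1.2) this⟩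
    have ev : ∀ᶠ q in 𝓝 p, q ∈ E.dom := E.dom_open.mem_nhds hp
    have h2 := hS'.eq_A2 p hp
    rw [(e p hp).1, (e p hp).2, pdx_congr (ev.mono fun q hq => (e q hq).2),
      pdt_congr (ev.mono fun q hq => (e q hq).1)] at h2
    simp only [Eqn.withExp, pdt_eq_dir, pdx_eq_dir, dir_exp_linear] at h2 ⊢
    refine mul_right_cancel₀ (Real.exp_ne_zero (m * p.2 + n * p.1)) ?_
    linear_combination h2
  have hξ : ∀ p ∈ E.dom, ξ p = 0 := fun p hp => by
    linarith [key 2 0 (Or.inl rfl) p hp, key 3 0 (Or.inr rfl) p hp]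
  have hτ : ∀ p ∈ E.dom, τ p = 0 := fun p hp => by
    linarith [key 2 0 (Or.inl rfl) p hp, key 2 1 (Or.inl rfl) p hp]
  intro p hp u
  have ev : ∀ᶠ q in 𝓝 p, q ∈ E.dom := E.dom_open.mem_nhds hp
  have τt : pdt τ p = 0 := dir_vanish_of_eventually (ev.mono hτ)
  have ξt : pdt ξ p = 0 := dir_vanish_of_eventually (ev.mono hξ)
  have ξx : ∀ q ∈ E.dom, pdx ξ q = 0 := fun q hq => dir_vanish_of_eventually
    ((show ∀ᶠ q in 𝓝 q, q ∈ E.dom from E.dom_open.mem_nhds hq).mono hξ)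
  have ξxx : pdx (pdx ξ) p = 0 := dir_vanish_of_eventually (ev.mono ξx)
  -- Once `τ` and `ξ` vanish, `eq_C` and `eq_A1` reduce to `C η₁ = 0` and `C η₀ = 0`.
  have k1 := hS.eq_C p hp
  have k0 := hS.eq_A1 p hp
  rw [hξ p hp, hτ p hp, τt, ξx p hp] at k1 k0
  rw [ξt, ξxx] at k0
  have z1 : C p * η₁ p = 0 := by
    change C p * _ + _ + _ + C p * η₁ p = 0 at k1
    linear_combination k1
  have z0 : C p * η₀ p = 0 := by
    change _ - _ + C p * η₀ p + _ - _ = 0 at k0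
    linear_combination k0
  rw [hQ p hp u, hξ p hp, hτ p hp, (mul_eq_zero.1 z1).resolve_left (hC0 p),
    (mul_eq_zero.1 z0).resolve_left (hC0 p)]
  simp

/-- The equation admits a nonzero Lie symmetry. -/
def HasSymmetry (E : Eqn) : Prop := ∃ Q ∈ invAlgebra E, ∃ z : Space, z.1 ∈ E.dom ∧ Q z ≠ 0

/-- Vector fields are total functions whose values off the domain are immaterial. A field outside
the kernel must therefore be shown to be nonzero over the domain. -/
lemma mem_invAlgebra_of_vanish {E : Eqn} {Q : VField} (h : ∀ p ∈ E.dom, ∀ u, Q (p, u) = 0) :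
    Q ∈ invAlgebra E := by
  have hz : ∀ z ∈ E.dom ×ˢ (Set.univ : Set ℝ), Q z = (fun _ => 0 : VField) z := fun z hz =>
    h z.1 hz.1 z.2
  refine mem_invAlgebra_iff.2 ⟨contDiffOn_const.congr hz, fun p hp f _ _ => ?_⟩
  have ev : ∀ᶠ q in 𝓝 p, characteristic Q f q = 0 := by
    filter_upwards [E.dom_open.mem_nhds hp] with q hq
    unfold characteristic
    rw [h q hq]
    simp
  have c0 : pdt (characteristic Q f) p = 0 := dir_vanish_of_eventually ev
  have c1 : pdx (characteristic Q f) p = 0 := dir_vanish_of_eventually ev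
  have c2 : pdx (pdx (characteristic Q f)) p = 0 := dir_vanish_of_eventually
    (ev.eventually_nhds.mono fun q hq => dir_vanish_of_eventually hq)
  simp [crit, prolong, along, h p hp, c0, c1, c2]

/-- If the kernel algebras of a class vanish, extensions are nonzero Lie symmetries. -/
lemma isExtension_iff {K : Set Eqn}
    (h : ∀ E : Eqn, ∃ (A1 C : Base → ℝ) (h1 : ContDiff ℝ ∞ A1) (hC : ContDiff ℝ ∞ C)
      (hC0 : ∀ p, C p ≠ 0), ∀ m n : ℝ, m = 2 ∨ m = 3 → E.withExp m n A1 C h1 hC hC0 ∈ K)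
    {E : Eqn} : IsExtension K E ↔ E ∈ K ∧ HasSymmetry E := by
  refine and_congr_right fun hE => exists_congr fun Q => and_congr_right fun hQ => ?_
  constructor
  · intro hn
    by_contra! h0
    exact hn fun E' _ hd => mem_invAlgebra_of_vanish fun p hp u => h0 (p, u) (hd ▸ hp)
  · rintro ⟨z, hz, hne⟩ hk
    obtain ⟨A1, C, h1, hC, hC0, hm⟩ := h E
    exact hne (vanish_of_withExp (fun m n hmn => hk _ (hm m n hmn) rfl) z.1 hz z.2)

lemma isExtension_classL0p {E : Eqn} : IsExtension classL0p E ↔ E ∈ classL0p ∧ HasSymmetry E :=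
  isExtension_iff (K := classL0p) fun _ => ⟨fun _ => 0, fun _ => 1, contDiff_const,
    contDiff_const, fun _ => one_ne_zero, fun _ _ _ _ _ => ⟨rfl, rfl⟩⟩

lemma isExtension_classL {E : Eqn} : IsExtension classL E ↔ E ∈ classL ∧ HasSymmetry E :=
  isExtension_iff (K := classL) fun _ => ⟨fun _ => 0, fun _ => 1, contDiff_const,
    contDiff_const, fun _ => one_ne_zero, fun _ _ _ _ _ => rfl⟩

/-- The test equations have `A1 = x²`, so `A1_xx = 2`. -/
lemma isExtension_classL1hat {E : Eqn} :
    IsExtension classL1hat E ↔ E ∈ classL1hat ∧ HasSymmetry E := by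
  refine isExtension_iff (K := classL1hat) fun _ => ⟨fun q => q.2 * q.2, fun _ => 1, by fun_prop, contDiff_const,
    fun _ => one_ne_zero, fun m n _ => ⟨fun _ _ => rfl, fun p _ => ?_⟩⟩
  change pdx (pdx fun q : Base => q.2 * q.2) p ≠ 0
  have h2 := dir_dir_mul (v := ((0, 1) : Base)) (f := fun q : Base => q.2)
    (g := fun q : Base => q.2) (q := p) contDiffAt_snd contDiffAt_snd
  have h3 : dir ((0, 1) : Base) (fun q : Base => q.2) = fun _ => 1 :=
    funext fun q => dir_snd_base _ q
  rw [h3, dir_const] at h2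
  rw [pdx_eq_dir, h2]
  norm_num

/-- For `C = exp x` and `A2 = exp (m x + n t)` the splitting expression equals `-m (m - 1) exp (m x
+ n t)`, nonzero for `m = 2, 3`. -/
lemma isExtension_classL1 {E : Eqn} : IsExtension classL1 E ↔ E ∈ classL1 ∧ HasSymmetry E := by
  refine isExtension_iff (K := classL1) fun _ => ⟨fun _ => 0, fun q => Real.exp (1 * q.2 + 0 * q.1),
    contDiff_const, by fun_prop, fun _ => Real.exp_ne_zero _, fun m n hm =>
    ⟨fun _ _ => rfl, fun p _ => ?_⟩⟩
  have key : ∀ q, (pdt (fun q : Base => Real.exp (1 * q.2 + 0 * q.1)) q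
      / Real.exp (1 * q.2 + 0 * q.1)
      - Real.exp (1 * q.2 + 0 * q.1) * pdx (fun r => Real.exp (m * r.2 + n * r.1)
        * pdx (fun q : Base => Real.exp (1 * q.2 + 0 * q.1)) r
        / Real.exp (1 * r.2 + 0 * r.1) ^ 2) q)
      = -(m - 1) * Real.exp (m * q.2 + n * q.1) := by
    intro q
    have e : (fun r : Base => Real.exp (m * r.2 + n * r.1)
        * pdx (fun q : Base => Real.exp (1 * q.2 + 0 * q.1)) r
        / Real.exp (1 * r.2 + 0 * r.1) ^ 2) = fun r => Real.exp ((m - 1) * r.2 + n * r.1) := by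
      funext r
      rw [pdx_eq_dir, dir_exp_linear]
      rw [show (m - 1) * r.2 + n * r.1 = (m * r.2 + n * r.1) - (1 * r.2 + 0 * r.1) by ring,
        Real.exp_sub]
      have := Real.exp_ne_zero (1 * r.2 + 0 * r.1)
      field_simp
      ring
    have e3 : Real.exp (m * q.2 + n * q.1)
        = Real.exp ((m - 1) * q.2 + n * q.1) * Real.exp (1 * q.2 + 0 * q.1) := by
      rw [← Real.exp_add]
      ring_nf
    have := Real.exp_ne_zero (1 * q.2 + 0 * q.1)
    rw [e, e3, pdt_eq_dir, pdx_eq_dir, dir_exp_linear, dir_exp_linear]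
    simp only [mul_zero, mul_one, zero_mul, zero_div, add_zero]
    ring
  have e2 := congrArg (fun k : Base → ℝ => pdx k p) (funext key)
  refine ne_of_eq_of_ne e2 ?_
  change pdx (fun q : Base => -(m - 1) * Real.exp (m * q.2 + n * q.1)) p ≠ 0
  rw [pdx_eq_dir, dir_const_mul _ (by fun_prop), dir_exp_linear]
  have := Real.exp_ne_zero (m * p.2 + n * p.1)
  rcases hm with rfl | rfl <;> norm_num

/-! ### Unique continuation for Lie symmetries -/

open Asymptotics in
/-- Solutions of total linear differential systems vanish where they vanish at a point. -/
lemma eventually_eq_zero_of_isBigO {W : Type*} [NormedAddCommGroup W] [NormedSpace ℝ W]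
    {Y : Base → W} {p : Base} (hd : ∀ᶠ q in 𝓝 p, DifferentiableAt ℝ Y q)
    (ht : (fun q => fderiv ℝ Y q (1, 0)) =O[𝓝 p] Y) (hx : (fun q => fderiv ℝ Y q (0, 1)) =O[𝓝 p] Y)
    (h0 : Y p = 0) : ∀ᶠ q in 𝓝 p, Y q = 0 := by
  obtain ⟨K, hK⟩ := ht.bound
  obtain ⟨L, hL⟩ := hx.bound
  obtain ⟨r, hr, hball⟩ := exists_ball_of_eventually (hd.and (hK.and hL))
  filter_upwards [Metric.ball_mem_nhds p hr] with q hq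
  set g : ℝ → W := fun s => Y (p + s • (q - p)) with hg
  have hin : ∀ s ∈ Set.Icc (0 : ℝ) 1, p + s • (q - p) ∈ Metric.ball p r := by
    intro s hs
    rw [mem_ball_iff_norm, add_sub_cancel_left, norm_smul, Real.norm_eq_abs, abs_of_nonneg hs.1]
    have h1 : ‖q - p‖ < r := mem_ball_iff_norm.1 hq
    have := mul_le_mul_of_nonneg_right hs.2 (norm_nonneg (q - p))
    linarith
  have hder : ∀ s ∈ Set.Icc (0 : ℝ) 1,
      HasDerivAt g (fderiv ℝ Y (p + s • (q - p)) (q - p)) s := by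
    intro s hs
    have h1 : HasDerivAt (fun s : ℝ => p + s • (q - p)) (q - p) s := by
      simpa using ((hasDerivAt_id s).smul_const (q - p)).const_add p
    exact (hball _ (hin s hs)).1.hasFDerivAt.comp_hasDerivAt s h1
  -- Grönwall's inequality along the segment from `p` to `q`, on which the derivative of `Y` is
  -- bounded by a multiple of `Y`.
  have := eq_zero_of_abs_deriv_le_mul_abs_self_of_eq_zero_right (a := 0) (b := 1) (f := g)
    (K := ‖(q - p).1‖ * K + ‖(q - p).2‖ * L)
    (fun s hs => (hder s hs).continuousAt.continuousWithinAt)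
    (fun s hs => (hder s ⟨hs.1, hs.2.le⟩).hasDerivWithinAt) (by simp [hg, h0]) (by
      intro s hs
      obtain ⟨-, h1, h2⟩ := hball _ (hin s ⟨hs.1, hs.2.le⟩)
      have e : q - p = (q - p).1 • ((1, 0) : Base) + (q - p).2 • ((0, 1) : Base) := by
        ext <;> simp
      have e2 : fderiv ℝ Y (p + s • (q - p)) (q - p)
          = (q - p).1 • fderiv ℝ Y (p + s • (q - p)) (1, 0)
            + (q - p).2 • fderiv ℝ Y (p + s • (q - p)) (0, 1) := by
        rw [← map_smul, ← map_smul, ← map_add, ← e]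
      rw [e2]
      refine (norm_add_le _ _).trans ?_
      rw [norm_smul, norm_smul]
      have k1 := mul_le_mul_of_nonneg_left h1 (norm_nonneg (q - p).1)
      have k2 := mul_le_mul_of_nonneg_left h2 (norm_nonneg (q - p).2)
      refine (add_le_add k1 k2).trans (le_of_eq ?_)
      simp only [hg]
      ring) 1 ⟨zero_le_one, le_rfl⟩
  simpa [hg] using this

/-- The graph of a continuous section over the time interval is connected and meets every slice,
itself an interval. -/
lemma Eqn.isPreconnected_dom (E : Eqn) : IsPreconnected E.dom := by
  obtain ⟨x₀, hx₀⟩ := exists_section E.dom_open E.dom_slice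
  obtain ⟨p, hp⟩ := E.dom_nonempty
  set G : Set Base := (fun t => (t, x₀ t)) '' (Prod.fst '' E.dom)
  have hG : IsPreconnected G := E.dom_time.isPreconnected.image _ fun t ht =>
    (continuousAt_id.prodMk (hx₀ t ht).1.continuousAt).continuousWithinAt
  have hGs : G ⊆ E.dom := by
    rintro _ ⟨t, ht, rfl⟩
    exact (hx₀ t ht).2
  have hsl : ∀ t, IsPreconnected ((fun x : ℝ => ((t, x) : Base)) '' {x | (t, x) ∈ E.dom}) :=
    fun t => (E.dom_slice t).isPreconnected.image _ (by fun_prop)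
  have hmem : ∀ q ∈ E.dom, q.1 ∈ Prod.fst '' E.dom := fun q hq => ⟨q, hq, rfl⟩
  refine isPreconnected_of_forall (p.1, x₀ p.1) fun q hq =>
    ⟨G ∪ (fun x : ℝ => ((q.1, x) : Base)) '' {x | (q.1, x) ∈ E.dom}, ?_, ?_, ?_, ?_⟩
  · refine Set.union_subset hGs ?_
    rintro _ ⟨x, hx, rfl⟩
    exact hx
  · exact Or.inl ⟨p.1, hmem p hp, rfl⟩
  · exact Or.inr ⟨q.2, hq, rfl⟩
  · exact hG.union (q.1, x₀ q.1) ⟨q.1, hmem q hq, rfl⟩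
      ⟨x₀ q.1, (hx₀ q.1 (hmem q hq)).2, rfl⟩ (hsl q.1)

section

variable {E : Eqn} {τ ξ η₁ η₀ : Base → ℝ}

/-- The determining equations, solved for the derivatives. -/
lemma SymmetryCoeffs.total (h : SymmetryCoeffs E τ ξ η₁ η₀) :
    ∃ n m w e₁ e₂ f₁ f₂ : Base → ℝ, (∀ p ∈ E.dom, ContDiffAt ℝ ∞ n p ∧ ContDiffAt ℝ ∞ m p ∧
      ContDiffAt ℝ ∞ w p ∧ ContDiffAt ℝ ∞ e₁ p ∧ ContDiffAt ℝ ∞ e₂ p ∧ ContDiffAt ℝ ∞ f₁ p ∧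
      ContDiffAt ℝ ∞ f₂ p) ∧ ∀ p ∈ E.dom,
      pdx (pdt η₁) p = 0 ∧ pdx η₀ p = n p * pdt η₁ p ∧ pdt η₀ p = m p * pdt η₁ p ∧
      pdt (pdt η₁) p = w p * pdt η₁ p ∧
      pdx ξ p = e₁ p * τ p + e₂ p * ξ p - η₁ p ∧
      pdt τ p = f₁ p * τ p + f₂ p * ξ p - 2 * η₁ p ∧
      pdt ξ p = - E.A1 p * (pdt τ p - pdx ξ p) + E.C p * η₀ p
        + E.A2 p * (pdx e₁ p * τ p + (pdx e₂ p * ξ p + e₂ p * pdx ξ p))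
        - (pdt E.A1 p * τ p + pdx E.A1 p * ξ p) := by
  have nb : ∀ p ∈ E.dom, ∀ᶠ q in 𝓝 p, q ∈ E.dom := fun p hp => E.dom_open.mem_nhds hp
  have sC : ∀ p ∈ E.dom, ContDiffAt ℝ ∞ E.C p := fun p hp => E.smooth_C.contDiffAt (nb p hp)
  have sA2 : ∀ p ∈ E.dom, ContDiffAt ℝ ∞ E.A2 p := fun p hp => E.smooth_A2.contDiffAt (nb p hp)
  have sA1 : ∀ p ∈ E.dom, ContDiffAt ℝ ∞ E.A1 p := fun p hp => E.smooth_A1.contDiffAt (nb p hp)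
  -- The derivative `κ = η₁_t` serves as a fifth unknown. `eq_η₁` gives `η₀_x = n κ`, then `eq_η₀`
  -- gives `η₀_t = m κ`, and equating mixed derivatives of `η₀` gives `κ_t = w κ`, which closes the
  -- system.
  set n : Base → ℝ := fun q => - (E.C q)⁻¹ with hn
  set m : Base → ℝ := fun q => E.A2 q * pdx n q + E.A1 q * n q with hm
  set w : Base → ℝ := fun q => - E.C q * (pdx m q - pdt n q) with hw
  set e₁ : Base → ℝ := fun q => pdt E.A2 q / E.A2 q - pdt E.C q / E.C q with he₁
  set e₂ : Base → ℝ := fun q => pdx E.A2 q / E.A2 q - pdx E.C q / E.C q with he₂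
  set f₁ : Base → ℝ := fun q => pdt E.A2 q / E.A2 q - 2 * (pdt E.C q / E.C q) with hf₁
  set f₂ : Base → ℝ := fun q => pdx E.A2 q / E.A2 q - 2 * (pdx E.C q / E.C q) with hf₂
  have sn : ∀ p ∈ E.dom, ContDiffAt ℝ ∞ n p := fun p hp => ((sC p hp).inv (E.C_ne p hp)).neg
  have sm : ∀ p ∈ E.dom, ContDiffAt ℝ ∞ m p := fun p hp =>
    ((sA2 p hp).mul (contDiffAt_dir (sn p hp))).add ((sA1 p hp).mul (sn p hp))
  have sw : ∀ p ∈ E.dom, ContDiffAt ℝ ∞ w p := fun p hp =>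
    (sC p hp).neg.mul ((contDiffAt_dir (sm p hp)).sub (contDiffAt_dir (sn p hp)))
  have sa : ∀ v, ∀ p ∈ E.dom, ContDiffAt ℝ ∞ (fun q => dir v E.A2 q / E.A2 q) p := fun v p hp =>
    (contDiffAt_dir (sA2 p hp)).div (sA2 p hp) (E.A2_ne p hp)
  have sc : ∀ v, ∀ p ∈ E.dom, ContDiffAt ℝ ∞ (fun q => dir v E.C q / E.C q) p := fun v p hp =>
    (contDiffAt_dir (sC p hp)).div (sC p hp) (E.C_ne p hp)
  have se₁ : ∀ p ∈ E.dom, ContDiffAt ℝ ∞ e₁ p := fun p hp => (sa (1, 0) p hp).sub (sc (1, 0) p hp)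
  have se₂ : ∀ p ∈ E.dom, ContDiffAt ℝ ∞ e₂ p := fun p hp => (sa (0, 1) p hp).sub (sc (0, 1) p hp)
  have κx : ∀ p ∈ E.dom, pdx (pdt η₁) p = 0 := fun p hp =>
    (dir_comm (h.smooth_η₁ p hp)).trans (dir_vanish_of_eventually ((nb p hp).mono h.η₁_x))
  have η₀x : ∀ p ∈ E.dom, pdx η₀ p = n p * pdt η₁ p := fun p hp => by
    have h1 := h.eq_η₁ p hp
    have h2 := E.C_ne p hp
    simp only [hn]
    field_simp
    linear_combination h1
  have sκ : ∀ p ∈ E.dom, ContDiffAt ℝ ∞ (pdt η₁) p := fun p hp => contDiffAt_dir (h.smooth_η₁ p hp)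
  have dn : ∀ v, ∀ p ∈ E.dom, dir v (pdx η₀) p = dir v n p * pdt η₁ p + n p * dir v (pdt η₁) p :=
    fun v p hp => by
      rw [dir_congr ((nb p hp).mono η₀x : pdx η₀ =ᶠ[𝓝 p] fun q => n q * pdt η₁ q),
        dir_mul (diffAt_of_smooth (sn p hp)) (diffAt_of_smooth (sκ p hp))]
  have η₀t : ∀ p ∈ E.dom, pdt η₀ p = m p * pdt η₁ p := fun p hp => by
    have h1 := dn (0, 1) p hp
    rw [← pdx_eq_dir, κx p hp] at h1
    rw [h.eq_η₀ p hp, h1, η₀x p hp]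
    simp only [hm]
    ring
  have κt : ∀ p ∈ E.dom, pdt (pdt η₁) p = w p * pdt η₁ p := fun p hp => by
    have h1 := dn (1, 0) p hp
    have h2 : pdt (pdx η₀) p = pdx (pdt η₀) p := dir_comm (h.smooth_η₀ p hp)
    rw [pdx_congr ((nb p hp).mono η₀t : pdt η₀ =ᶠ[𝓝 p] fun q => m q * pdt η₁ q), pdx_eq_dir,
      dir_mul (diffAt_of_smooth (sm p hp)) (diffAt_of_smooth (sκ p hp)), ← pdx_eq_dir,
      κx p hp] at h2
    rw [← pdt_eq_dir, h2] at h1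
    have h3 : E.C p * n p = -1 := by
      simp only [hn]
      rw [mul_neg, mul_inv_cancel₀ (E.C_ne p hp)]
    simp only [hw]
    linear_combination E.C p * h1 + pdt (pdt η₁) p * h3
  -- `eq_C` and `eq_A2` are two independent linear equations for `τ_t` and `ξ_x`.
  have hxi : ∀ p ∈ E.dom, pdx ξ p = e₁ p * τ p + e₂ p * ξ p - η₁ p ∧
      pdt τ p = f₁ p * τ p + f₂ p * ξ p - 2 * η₁ p := fun p hp => by
    have h1 := h.eq_C p hp
    have h2 := h.eq_A2 p hp
    have hC := E.C_ne p hp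
    have hA := E.A2_ne p hp
    have k1 : pdt τ p - pdx ξ p + pdt E.C p / E.C p * τ p + pdx E.C p / E.C p * ξ p + η₁ p = 0 := by
      field_simp
      linear_combination h1
    have k2 : pdt E.A2 p / E.A2 p * τ p + pdx E.A2 p / E.A2 p * ξ p = 2 * pdx ξ p - pdt τ p := by
      field_simp
      linear_combination h2
    simp only [he₁, he₂, hf₁, hf₂]
    constructor
    · linear_combination k1 - k2
    · linear_combination 2 * k1 - k2
  refine ⟨n, m, w, e₁, e₂, f₁, f₂, fun p hp => ⟨sn p hp, sm p hp, sw p hp, se₁ p hp, se₂ p hp,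
    (sa (1, 0) p hp).sub (contDiffAt_const.mul (sc (1, 0) p hp)),
    (sa (0, 1) p hp).sub (contDiffAt_const.mul (sc (0, 1) p hp))⟩, fun p hp =>
    ⟨κx p hp, η₀x p hp, η₀t p hp, κt p hp, (hxi p hp).1, (hxi p hp).2, ?_⟩⟩
  have h1 := h.eq_A1 p hp
  have h2 : pdx (pdx ξ) p = pdx e₁ p * τ p + (pdx e₂ p * ξ p + e₂ p * pdx ξ p) := by
    have d1 := diffAt_of_smooth (se₁ p hp)
    have d2 := diffAt_of_smooth (se₂ p hp)
    have d3 := diffAt_of_smooth (h.smooth_τ p hp)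
    have d4 := diffAt_of_smooth (h.smooth_ξ p hp)
    rw [pdx_congr ((nb p hp).mono fun q hq => (hxi q hq).1 :
      pdx ξ =ᶠ[𝓝 p] fun q => e₁ q * τ q + e₂ q * ξ q - η₁ q), pdx_eq_dir,
      dir_sub ((d1.fun_mul d3).fun_add (d2.fun_mul d4)) (diffAt_of_smooth (h.smooth_η₁ p hp)),
      dir_add (d1.fun_mul d3) (d2.fun_mul d4), dir_mul d1 d3, dir_mul d2 d4]
    have z1 : dir (0, 1) τ p = 0 := h.τ_x p hp
    have z2 : dir (0, 1) η₁ p = 0 := h.η₁_x p hp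
    rw [z1, z2]
    ring
  rw [h2] at h1
  linear_combination - h1

open Asymptotics in
/-- The vector field and one more derivative vanish near a point as soon as they vanish at it. -/
lemma SymmetryCoeffs.eventually_eq_zero (h : SymmetryCoeffs E τ ξ η₁ η₀) {p : Base} (hp : p ∈ E.dom)
    (z1 : τ p = 0) (z2 : ξ p = 0) (z3 : η₁ p = 0) (z4 : η₀ p = 0) (z5 : pdt η₁ p = 0) :
    ∀ᶠ q in 𝓝 p, τ q = 0 ∧ ξ q = 0 ∧ η₁ q = 0 ∧ η₀ q = 0 := by
  obtain ⟨n, m, w, e₁, e₂, f₁, f₂, hs, heq⟩ := h.total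
  have nb : ∀ᶠ q in 𝓝 p, q ∈ E.dom := E.dom_open.mem_nhds hp
  -- By `total`, each first derivative of `Y` is a combination of its components with smooth, hence
  -- locally bounded, coefficients.
  set Y : Base → (Fin 5 → ℝ) := fun q => ![τ q, ξ q, η₁ q, η₀ q, pdt η₁ q] with hY
  have sY : ∀ q ∈ E.dom, ContDiffAt ℝ ∞ Y q := fun q hq => contDiffAt_pi.2 fun i => by
    fin_cases i
    exacts [h.smooth_τ q hq, h.smooth_ξ q hq, h.smooth_η₁ q hq, h.smooth_η₀ q hq,
      contDiffAt_dir (h.smooth_η₁ q hq)]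
  have dY : ∀ v, ∀ q ∈ E.dom, ∀ i, fderiv ℝ Y q v i = dir v (fun r => Y r i) q :=
    fun v q hq i => by
      have := hasFDerivAt_pi'.1 (diffAt_of_smooth (sY q hq)).hasFDerivAt i
      rw [dir, this.fderiv]
      rfl
  have oY : ∀ i, (fun q => Y q i) =O[𝓝 p] Y := isBigO_pi.1 (isBigO_refl Y _)
  have oτ : τ =O[𝓝 p] Y := oY 0
  have oξ : ξ =O[𝓝 p] Y := oY 1
  have oη₁ : η₁ =O[𝓝 p] Y := oY 2
  have oη₀ : η₀ =O[𝓝 p] Y := oY 3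
  have oκ : pdt η₁ =O[𝓝 p] Y := oY 4
  have om : ∀ {a k : Base → ℝ}, ContDiffAt ℝ ∞ a p → k =O[𝓝 p] Y →
      (fun q => a q * k q) =O[𝓝 p] Y := fun ha hk => by
    simpa using (ha.continuousAt.isBigO_one ℝ).mul hk.norm_right
  obtain ⟨sn, sm, sw, se₁, se₂, sf₁, sf₂⟩ := hs p hp
  have sC : ContDiffAt ℝ ∞ E.C p := E.smooth_C.contDiffAt nb
  have sA2 : ContDiffAt ℝ ∞ E.A2 p := E.smooth_A2.contDiffAt nb
  have sA1 : ContDiffAt ℝ ∞ E.A1 p := E.smooth_A1.contDiffAt nb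
  have oξx : pdx ξ =O[𝓝 p] Y := (((om se₁ oτ).add (om se₂ oξ)).sub oη₁).congr'
    (nb.mono fun q hq => ((heq q hq).2.2.2.2.1).symm) .rfl
  have oτt : pdt τ =O[𝓝 p] Y := (((om sf₁ oτ).add (om sf₂ oξ)).sub
    (om (a := fun _ => 2) contDiffAt_const oη₁)).congr'
    (nb.mono fun q hq => ((heq q hq).2.2.2.2.2.1).symm) .rfl
  have oξt : pdt ξ =O[𝓝 p] Y := ((((om sA1.neg (oτt.sub oξx)).add (om sC oη₀)).add
    (om sA2 ((om (contDiffAt_dir se₁) oτ).add ((om (contDiffAt_dir se₂) oξ).add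
      (om se₂ oξx))))).sub ((om (contDiffAt_dir sA1) oτ).add (om (contDiffAt_dir sA1) oξ))).congr'
    (nb.mono fun q hq => ((heq q hq).2.2.2.2.2.2).symm) .rfl
  have oη₀x : pdx η₀ =O[𝓝 p] Y := (om sn oκ).congr' (nb.mono fun q hq => ((heq q hq).2.1).symm) .rfl
  have oη₀t : pdt η₀ =O[𝓝 p] Y :=
    (om sm oκ).congr' (nb.mono fun q hq => ((heq q hq).2.2.1).symm) .rfl
  have oκt : pdt (pdt η₁) =O[𝓝 p] Y :=
    (om sw oκ).congr' (nb.mono fun q hq => ((heq q hq).2.2.2.1).symm) .rfl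
  have oz : ∀ {k : Base → ℝ}, (∀ q ∈ E.dom, k q = 0) → k =O[𝓝 p] Y := fun hk =>
    (isBigO_zero Y (𝓝 p)).congr' (nb.mono fun q hq => (hk q hq).symm) .rfl
  have hfin : ∀ v, (∀ i, dir v (fun r => Y r i) =O[𝓝 p] Y) →
      (fun q => fderiv ℝ Y q v) =O[𝓝 p] Y := fun v hv => isBigO_pi.2 fun i =>
    (hv i).congr' (nb.mono fun q hq => (dY v q hq i).symm) .rfl
  have key := eventually_eq_zero_of_isBigO (Y := Y) (p := p)
    (nb.mono fun q hq => diffAt_of_smooth (sY q hq))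
    (hfin _ fun i => by fin_cases i; exacts [oτt, oξt, oκ, oη₀t, oκt])
    (hfin _ fun i => by
      fin_cases i
      exacts [oz h.τ_x, oξx, oz h.η₁_x, oη₀x, oz fun q hq => (heq q hq).1])
    (funext fun i => by fin_cases i; exacts [z1, z2, z3, z4, z5])
  exact key.mono fun q hq => ⟨congrFun hq 0, congrFun hq 1, congrFun hq 2, congrFun hq 3⟩

end

/-- Lie symmetries have the unique continuation property. -/
theorem invAlgebra_unique_continuation {E : Eqn} {Q : VField} (hQ : Q ∈ invAlgebra E) {p : Base}
    (hp : p ∈ E.dom) (h0 : ∀ᶠ q in 𝓝 p, ∀ u, Q (q, u) = 0) : ∀ q ∈ E.dom, ∀ u, Q (q, u) = 0 := by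
  obtain ⟨τ, ξ, η₁, η₀, h, hf⟩ := invAlgebra_affine hQ
  have nb : ∀ p ∈ E.dom, ∀ᶠ q in 𝓝 p, q ∈ E.dom := fun p hp => E.dom_open.mem_nhds hp
  set y : Base → Base × Base := fun q => ((τ q, ξ q), (η₁ q, η₀ q)) with hy
  set U : Set Base := {q | ∀ᶠ r in 𝓝 q, y r = 0} with hU
  have hUo : IsOpen U := isOpen_iff_mem_nhds.2 fun q hq => hq.eventually_nhds
  have hyQ : ∀ q ∈ E.dom, (y q = 0 ↔ ∀ u, Q (q, u) = 0) := by
    intro q hq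
    constructor
    · intro h1 u
      simp only [hy, Prod.mk_eq_zero] at h1
      rw [hf q hq, h1.1.1, h1.1.2, h1.2.1, h1.2.2]
      simp
    · intro h1
      have k0 := (hf q hq 0).symm.trans (h1 0)
      have k1 := (hf q hq 1).symm.trans (h1 1)
      simp only [Prod.mk_eq_zero] at k0 k1
      simp only [hy, Prod.mk_eq_zero]
      refine ⟨k0.1, ?_, ?_⟩ <;> linarith [k0.2, k1.2]
  have sy : ∀ q ∈ E.dom, ContDiffAt ℝ ∞ y q := fun q hq =>
    ((h.smooth_τ q hq).prodMk (h.smooth_ξ q hq)).prodMk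
      ((h.smooth_η₁ q hq).prodMk (h.smooth_η₀ q hq))
  have hsub : E.dom ⊆ U := by
    refine E.isPreconnected_dom.subset_of_closure_inter_subset hUo
      ⟨p, hp, ((nb p hp).and h0).mono fun q hq => (hyQ q hq.1).2 hq.2⟩ ?_
    rintro q ⟨hqc, hq⟩
    -- At a limit point of `U` the five unknowns vanish by continuity, hence also nearby. So `U` is
    -- relatively closed as well as open.
    have hfr : ∃ᶠ r in 𝓝 q, r ∈ U := mem_closure_iff_frequently.1 hqc
    have zero_of : ∀ {W : Type} [TopologicalSpace W] [T1Space W] {k : Base → W} {c : W},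
        ContinuousAt k q → (∀ r ∈ U, k r = c) → k q = c := by
      intro W _ _ k c hk hr
      by_contra hne
      exact hfr ((hk.eventually (isOpen_ne.mem_nhds hne)).mono fun r h1 h2 => h1 (hr r h2))
    have hy0 := zero_of (sy q hq).continuousAt fun r (hr : ∀ᶠ s in 𝓝 r, y s = 0) => hr.self_of_nhds
    have hκ : pdt η₁ q = 0 := zero_of (contDiffAt_dir (h.smooth_η₁ q hq)).continuousAt
      fun r hr => dir_vanish_of_eventually (hr.mono fun s hs => congrArg (fun w => w.2.1) hs)
    simp only [hy, Prod.mk_eq_zero] at hy0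
    refine (h.eventually_eq_zero hq hy0.1.1 hy0.1.2 hy0.2.1 hy0.2.2 hκ).mono fun r hr => ?_
    simp only [hy, hr.1, hr.2.1, hr.2.2.1, hr.2.2.2]
    rfl
  exact fun q hq => (hyQ q hq).1 (show ∀ᶠ s in 𝓝 q, y s = 0 from hsub hq).self_of_nhds

lemma invAlgebra_restrictBall {E : Eqn} {Q : VField} (hQ : Q ∈ invAlgebra E) {p : Base} {r : ℝ}
    (hr : 0 < r) (hsub : Metric.ball p r ⊆ E.dom) : Q ∈ invAlgebra (E.restrictBall p r hr hsub) :=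
  ⟨hQ.1.mono (Set.prod_mono hsub subset_rfl), fun q hq => hQ.2 q (hsub hq)⟩

/-- A symmetry could be lost only by vanishing over the ball, which unique continuation excludes. -/
lemma HasSymmetry.restrictBall {E : Eqn} (h : HasSymmetry E) {p : Base} {r : ℝ} (hr : 0 < r)
    (hsub : Metric.ball p r ⊆ E.dom) : HasSymmetry (E.restrictBall p r hr hsub) := by
  obtain ⟨Q, hQ, z, hz, hne⟩ := h
  refine ⟨Q, invAlgebra_restrictBall hQ hr hsub, ?_⟩
  by_contra! h0
  exact hne (invAlgebra_unique_continuation hQ (hsub (Metric.mem_ball_self hr))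
    (Filter.mem_of_superset (Metric.ball_mem_nhds p hr) fun q hq u => h0 (q, u) hq) z.1 hz z.2)

/-! ### Transformation of the invariance criterion -/

section

variable {E E' : Eqn} {Q Q' : VField} {f g : Base → ℝ} {p : Base}

lemma contDiffAt_characteristic (hQ : ContDiffAt ℝ ∞ Q (p, f p)) (hf : ContDiffAt ℝ ∞ f p) :
    ContDiffAt ℝ ∞ (characteristic Q f) p :=
  ((contDiffAt_graph (smooth_η hQ) hf).sub
    ((contDiffAt_graph (smooth_τ hQ) hf).mul (contDiffAt_dir hf))).sub
    ((contDiffAt_graph (smooth_ξ hQ) hf).mul (contDiffAt_dir hf))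

lemma Eqn.contDiffAt_op (E : Eqn) (hp : p ∈ E.dom) (hf : ContDiffAt ℝ ∞ f p) :
    ContDiffAt ℝ ∞ (E.op f) p := by
  have ft : ContDiffAt ℝ ∞ (pdt f) p := contDiffAt_dir hf
  have fx : ContDiffAt ℝ ∞ (pdx f) p := contDiffAt_dir hf
  have fxx : ContDiffAt ℝ ∞ (pdx (pdx f)) p := contDiffAt_dir fx
  exact ((ft.add (((E.contDiffAt_C hp).mul hf).mul fx)).sub ((E.contDiffAt_A2 hp).mul fxx)).sub
    ((E.contDiffAt_A1 hp).mul fx)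

/-- The criterion in terms of the characteristic. -/
lemma crit_eq (hp : p ∈ E.dom) (hQ : ContDiffAt ℝ ∞ Q (p, f p)) (hf : ContDiffAt ℝ ∞ f p) :
    crit E Q f p = (E.op (fun r => f r + characteristic Q f r) p
      - E.op (fun r => f r - characteristic Q f r) p) / 2
      + (Q (p, f p)).1.1 * pdt (E.op f) p + (Q (p, f p)).1.2 * pdx (E.op f) p := by
  -- Since `E.op` is quadratic in its argument, half its central difference with step
  -- `characteristic Q f` is exactly its linearization. The criterion is this linearization plus the
  -- derivative of `E.op f` along `Q`.
  have hχ := contDiffAt_characteristic hQ hf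
  have ft : ContDiffAt ℝ ∞ (pdt f) p := contDiffAt_dir hf
  have fx : ContDiffAt ℝ ∞ (pdx f) p := contDiffAt_dir hf
  have fxx : ContDiffAt ℝ ∞ (pdx (pdx f)) p := contDiffAt_dir fx
  have dC := diffAt_of_smooth (E.contDiffAt_C hp)
  have d2 := diffAt_of_smooth (E.contDiffAt_A2 hp)
  have d1 := diffAt_of_smooth (E.contDiffAt_A1 hp)
  have df := diffAt_of_smooth hf
  have dt := diffAt_of_smooth ft
  have dx := diffAt_of_smooth fx
  have dxx := diffAt_of_smooth fxx
  have dop : ∀ v, dir v (E.op f) p = dir v (pdt f) p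
      + ((dir v E.C p * f p + E.C p * dir v f p) * pdx f p + E.C p * f p * dir v (pdx f) p)
      - (dir v E.A2 p * pdx (pdx f) p + E.A2 p * dir v (pdx (pdx f)) p)
      - (dir v E.A1 p * pdx f p + E.A1 p * dir v (pdx f) p) := fun v => by
    unfold Eqn.op
    rw [dir_sub ((dt.fun_add ((dC.fun_mul df).fun_mul dx)).fun_sub (d2.fun_mul dxx))
      (d1.fun_mul dx), dir_sub (dt.fun_add ((dC.fun_mul df).fun_mul dx)) (d2.fun_mul dxx),
      dir_add dt ((dC.fun_mul df).fun_mul dx), dir_mul (dC.fun_mul df) dx, dir_mul dC df,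
      dir_mul d2 dxx, dir_mul d1 dx]
  have et := dop (1, 0)
  have ex := dop (0, 1)
  rw [← pdt_eq_dir] at et
  rw [← pdx_eq_dir] at ex
  have hxt : pdx (pdt f) p = pdt (pdx f) p := dir_comm hf
  rw [hxt] at ex
  have a1 : ∀ v, dir v (fun r => f r + characteristic Q f r) p
      = dir v f p + dir v (characteristic Q f) p := fun v => dir_add df (diffAt_of_smooth hχ)
  have s1 : ∀ v, dir v (fun r => f r - characteristic Q f r) p
      = dir v f p - dir v (characteristic Q f) p := fun v => dir_sub df (diffAt_of_smooth hχ)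
  have a2 : pdx (pdx fun r => f r + characteristic Q f r) p
      = pdx (pdx f) p + pdx (pdx (characteristic Q f)) p := by
    have h := pdx_pdx_sub hf hχ.neg
    have e1 : (fun r => f r - -characteristic Q f r) = fun r => f r + characteristic Q f r :=
      funext fun r => sub_neg_eq_add _ _
    have e2 : pdx (pdx fun r => -characteristic Q f r) p = - pdx (pdx (characteristic Q f)) p := by
      have : pdx (fun r => -characteristic Q f r) = fun r => - pdx (characteristic Q f) r :=
        funext fun r => dir_neg
      rw [this]; exact dir_neg
    change pdx (pdx fun r => f r - -characteristic Q f r) p = _ at h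
    change _ = _ - pdx (pdx fun r => -characteristic Q f r) p at h
    rw [e1, e2] at h
    rw [h, sub_neg_eq_add]
  have s2 := pdx_pdx_sub hf hχ
  have hη : (Q (p, f p)).2 = characteristic Q f p + (Q (p, f p)).1.1 * pdt f p
      + (Q (p, f p)).1.2 * pdx f p := by
    unfold characteristic; ring
  have c0 : prolong Q 1 0 f p = pdt (characteristic Q f) p + (Q (p, f p)).1.1 * pdt (pdt f) p
      + (Q (p, f p)).1.2 * pdt (pdx f) p := rfl
  have c1 : prolong Q 0 1 f p = pdx (characteristic Q f) p + (Q (p, f p)).1.1 * pdt (pdx f) p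
      + (Q (p, f p)).1.2 * pdx (pdx f) p := rfl
  have c2 : prolong Q 0 2 f p = pdx (pdx (characteristic Q f)) p
      + (Q (p, f p)).1.1 * pdt (pdx (pdx f)) p
      + (Q (p, f p)).1.2 * pdx (pdx (pdx f)) p := rfl
  unfold crit
  rw [c0, c1, c2, hη, et, ex]
  simp only [Eqn.op, along]
  rw [a2, s2]
  simp only [pdt_eq_dir, pdx_eq_dir] at a1 s1 ⊢
  rw [a1, a1, s1, s1]
  ring

/-- The criterion is transformed along with the equation and the vector field. -/
lemma crit_transform {T X : Base → ℝ} (hp : p ∈ E.dom) (hp' : (T p, X p) ∈ E'.dom)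
    (hI : ∀ᶠ r in 𝓝 p, Intertwines E E' T X (fun _ => 1) (fun _ => 0) r)
    (hf : ContDiffAt ℝ ∞ f p) (hg : ContDiffAt ℝ ∞ g (T p, X p))
    (hfg : ∀ᶠ r in 𝓝 p, g (T r, X r) = f r) (hQ : ContDiffAt ℝ ∞ Q (p, f p))
    (hQ' : ContDiffAt ℝ ∞ Q' ((T p, X p), f p))
    (hQQ : ∀ᶠ r in 𝓝 p, Q' ((T r, X r), f r) = ((pdt T r * (Q (r, f r)).1.1,
      pdt X r * (Q (r, f r)).1.1 + pdx X r * (Q (r, f r)).1.2), (Q (r, f r)).2))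
    (h0 : E.op f p = 0) : crit E Q f p = pdt T p * crit E' Q' g (T p, X p) := by
  have hI0 := hI.self_of_nhds
  have hfg0 := hfg.self_of_nhds
  have one : ∀ (k l : Base → ℝ) {q : Base}, (∀ᶠ r in 𝓝 q, l (T r, X r) = k r) →
      (fun r => l (T r, X r)) =ᶠ[𝓝 q] fun r => (fun _ : Base => (1 : ℝ)) r * k r
        + (fun _ : Base => (0 : ℝ)) r := fun k l q h => h.mono fun r hr => by
    beta_reduce; rw [hr]; ring
  have hQ'' : ContDiffAt ℝ ∞ Q' ((T p, X p), g (T p, X p)) := by rw [hfg0]; exact hQ'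
  have hχ := contDiffAt_characteristic hQ hf
  have hχ' := contDiffAt_characteristic hQ'' hg
  have hder : ∀ᶠ r in 𝓝 p, pdt f r = pdt g (T r, X r) * pdt T r + pdx g (T r, X r) * pdt X r ∧
      pdx f r = pdx g (T r, X r) * pdx X r := by
    filter_upwards [hfg.eventually_nhds, hI, hI0.tendsto_base.eventually (eventually_diffAt hg)]
      with r h1 h2 h3
    have dT := diffAt_of_smooth h2.smooth_T
    have dX := diffAt_of_smooth h2.smooth_X
    have e : f =ᶠ[𝓝 r] fun s => g (T s, X s) := h1.mono fun s hs => hs.symm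
    exact ⟨(pdt_congr e).trans (pdt_comp_base h3 dT dX),
      (pdx_congr e).trans (pdx_comp_base h3 dT dX h2.T_x.self_of_nhds)⟩
  -- As `u' = u`, the characteristic is simply carried along by the change of `(t,x)`.
  have hχχ : ∀ᶠ r in 𝓝 p, characteristic Q' g (T r, X r) = characteristic Q f r := by
    filter_upwards [hder, hQQ, hfg] with r h1 h2 h3
    unfold characteristic
    rw [h3, h2, h1.1, h1.2]
    ring
  have o1 := hI0.op_eq (f := fun r => f r + characteristic Q f r)
    (g := fun r => g r + characteristic Q' g r) (two_of_smooth (hf.add hχ))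
    (two_of_smooth (hg.add hχ'))
    (one (fun r => f r + characteristic Q f r) (fun r => g r + characteristic Q' g r) (by
    filter_upwards [hχχ, hfg] with r h1 h2
    rw [h1, h2]))
  have o2 := hI0.op_eq (f := fun r => f r - characteristic Q f r)
    (g := fun r => g r - characteristic Q' g r) (two_of_smooth (hf.sub hχ))
    (two_of_smooth (hg.sub hχ'))
    (one (fun r => f r - characteristic Q f r) (fun r => g r - characteristic Q' g r) (by
    filter_upwards [hχχ, hfg] with r h1 h2
    rw [h1, h2]))
  have ho : E.op f =ᶠ[𝓝 p] fun r => pdt T r * E'.op g (T r, X r) := by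
    filter_upwards [hI, hfg.eventually_nhds, (two_of_smooth hf).eventually (by simp),
      hI0.tendsto_base.eventually ((two_of_smooth hg).eventually (by simp))] with r h1 h2 h3 h4
    have := h1.op_eq h3 h4 (one f g h2)
    linarith
  -- On solutions the term with the derivative of the factor `T_t` drops out, so the two criteria
  -- are proportional.
  have ho0 : E'.op g (T p, X p) = 0 := by
    have := ho.self_of_nhds
    rw [h0] at this
    exact (mul_eq_zero.1 this.symm).resolve_left hI0.T_t
  have sT : ContDiffAt ℝ ∞ (pdt T) p := contDiffAt_dir hI0.smooth_T
  have so := E'.contDiffAt_op hp' hg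
  have dT := diffAt_of_smooth hI0.smooth_T
  have dX := diffAt_of_smooth hI0.smooth_X
  have dop : ∀ v, dir v (E.op f) p = pdt T p * (pdt (E'.op g) (T p, X p) * dir v T p
      + pdx (E'.op g) (T p, X p) * dir v X p) := fun v => by
    rw [dir_congr ho, dir_mul (diffAt_of_smooth sT) (diffAt_of_smooth
      (contDiffAt_comp_base so hI0.smooth_T hI0.smooth_X)), ho0, mul_zero, zero_add,
      dir_comp_base (diffAt_of_smooth so) dT dX]
  have et : pdt (E.op f) p = _ := dop (1, 0)
  have ex : pdx (E.op f) p = _ := dop (0, 1)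
  rw [← pdx_eq_dir, hI0.T_x.self_of_nhds] at ex
  rw [← pdt_eq_dir] at et
  rw [crit_eq hp hQ hf, crit_eq hp' hQ'' hg, et, ex, hfg0, hQQ.self_of_nhds]
  change pdt T p * E'.op (fun r => g r + characteristic Q' g r) _
    = _ * E.op (fun r => f r + characteristic Q f r) p at o1
  change pdt T p * E'.op (fun r => g r - characteristic Q' g r) _
    = _ * E.op (fun r => f r - characteristic Q f r) p at o2
  linear_combination (o2 - o1) / 2

end

/-! ### Identification of the invariance algebras -/

section

variable {φ ψ : PointTransformation Space} {E E' E₁ : Eqn} {N : Set Base} {T X : Base → ℝ}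

lemma PointTransformation.fderiv_inv_fderiv {z : Space} (hz : z ∈ φ.source) (v : Space) :
    fderiv ℝ φ.inv (φ z) (fderiv ℝ φ z v) = v := by
  have hd := diffAt_of_smooth (contDiffAt hz)
  have hs : DifferentiableAt ℝ φ.inv (φ z) :=
    diffAt_of_smooth (contDiffAt (φ := φ.inv) (φ.map_source hz))
  have h1 := (hs.hasFDerivAt.comp z hd.hasFDerivAt).fderiv
  have h2 : (φ.inv ∘ φ) =ᶠ[𝓝 z] id := by
    filter_upwards [φ.open_source.mem_nhds hz] with w hw using φ.left_inv hw
  rw [h2.fderiv_eq, fderiv_id] at h1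
  exact (congrArg (fun L : Space →L[ℝ] Space => L v) h1).symm

lemma PointTransformation.fderiv_fderiv_inv {z : Space} (hz : z ∈ φ.source) (v : Space) :
    fderiv ℝ φ z (fderiv ℝ φ.inv (φ z) v) = v := by
  have h := fderiv_inv_fderiv (φ := φ.inv) (φ.map_source hz : φ z ∈ φ.inv.source) v
  have e : φ.inv (φ z) = z := φ.left_inv hz
  rw [e] at h
  exact h

lemma PointTransformation.contDiffAt_fderiv_apply {z : Space} (hz : z ∈ φ.source) {Q : VField}
    (hQ : ContDiffAt ℝ ∞ Q z) : ContDiffAt ℝ ∞ (fun w => fderiv ℝ φ w (Q w)) z :=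
  ((contDiffAt hz).fderiv_right (m := ∞) (by simp)).clm_apply hQ

/-- The point transformation `φ` identifies the maximal Lie invariance algebras. -/
def Conjugates (φ : PointTransformation Space) (E E' : Eqn) : Prop :=
  φ.source ⊆ E.dom ×ˢ Set.univ ∧ φ.target ⊆ E'.dom ×ˢ Set.univ ∧
    (∀ Q ∈ invAlgebra E, ∃ Q' ∈ invAlgebra E', ∀ z ∈ φ.source, fderiv ℝ φ z (Q z) = Q' (φ z)) ∧
    (∀ Q' ∈ invAlgebra E', ∃ Q ∈ invAlgebra E, ∀ z ∈ φ.source, fderiv ℝ φ z (Q z) = Q' (φ z))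

lemma Conjugates.symm (h : Conjugates φ E E') : Conjugates φ.inv E' E := by
  have key : ∀ {Q Q' : VField}, (∀ z ∈ φ.source, fderiv ℝ φ z (Q z) = Q' (φ z)) →
      ∀ w ∈ φ.inv.source, fderiv ℝ φ.inv w (Q' w) = Q (φ.inv w) := by
    intro Q Q' hQ w hw
    have hz : φ.inv w ∈ φ.source := φ.map_target hw
    have e : φ (φ.inv w) = w := φ.right_inv hw
    have := hQ _ hz
    rw [e] at this
    rw [← this]
    have h2 := PointTransformation.fderiv_inv_fderiv hz (Q (φ.inv w))
    rwa [e] at h2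
  exact ⟨h.2.1, h.1, fun Q' hQ' => (h.2.2.2 Q' hQ').imp fun Q hQ => ⟨hQ.1, key hQ.2⟩,
    fun Q hQ => (h.2.2.1 Q hQ).imp fun Q' hQ' => ⟨hQ'.1, key hQ'.2⟩⟩

lemma Conjugates.trans (h : Conjugates φ E E') (h' : Conjugates ψ E' E₁) :
    Conjugates (φ.comp ψ) E E₁ := by
  have key : ∀ {Q Q' Q₁ : VField}, (∀ z ∈ φ.source, fderiv ℝ φ z (Q z) = Q' (φ z)) →
      (∀ z ∈ ψ.source, fderiv ℝ ψ z (Q' z) = Q₁ (ψ z)) →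
      ∀ z ∈ (φ.comp ψ).source, fderiv ℝ (φ.comp ψ) z (Q z) = Q₁ (φ.comp ψ z) := by
    intro Q Q' Q₁ h1 h2 z hz
    obtain ⟨hz1, hz2⟩ := PointTransformation.mem_comp_source.1 hz
    have d1 := diffAt_of_smooth (PointTransformation.contDiffAt hz1)
    have d2 := diffAt_of_smooth (PointTransformation.contDiffAt hz2)
    have e : fderiv ℝ (φ.comp ψ) z = (fderiv ℝ ψ (φ z)).comp (fderiv ℝ φ z) :=
      (d2.hasFDerivAt.comp z d1.hasFDerivAt).fderiv
    rw [e, ContinuousLinearMap.comp_apply, h1 z hz1, h2 _ hz2]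
    rfl
  refine ⟨fun z hz => h.1 (PointTransformation.mem_comp_source.1 hz).1,
    fun z hz => h'.2.1 (PointTransformation.mem_comp_target.1 hz).1, fun Q hQ => ?_,
    fun Q₁ hQ₁ => ?_⟩
  · obtain ⟨Q', hQ', e1⟩ := h.2.2.1 Q hQ
    obtain ⟨Q₁, hQ₁, e2⟩ := h'.2.2.1 Q' hQ'
    exact ⟨Q₁, hQ₁, key e1 e2⟩
  · obtain ⟨Q', hQ', e2⟩ := h'.2.2.2 Q₁ hQ₁
    obtain ⟨Q, hQ, e1⟩ := h.2.2.2 Q' hQ'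
    exact ⟨Q, hQ, key e1 e2⟩

lemma Conjugates.hasSymmetry (h : Conjugates φ E E') (hs : φ.source = E.dom ×ˢ Set.univ)
    (hE : HasSymmetry E) : HasSymmetry E' := by
  obtain ⟨Q, hQ, z, hz, hne⟩ := hE
  obtain ⟨Q', hQ', e⟩ := h.2.2.1 Q hQ
  have hz' : z ∈ φ.source := by rw [hs]; exact ⟨hz, trivial⟩
  refine ⟨Q', hQ', φ z, (h.2.1 (φ.map_source hz')).1, fun h0 => hne ?_⟩
  rw [← PointTransformation.fderiv_inv_fderiv hz' (Q z), e z hz', h0, map_zero]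

/-- The differential of a transformation with identical `u`-component. -/
lemma IsBaseMap.fderiv_eq (h : IsBaseMap N T X) (hφ : ∀ q ∈ N, ∀ u : ℝ, φ (q, u) = ((T q, X q), u))
    {q : Base} (hq : q ∈ N) (u : ℝ) (w : Space) :
    fderiv ℝ φ (q, u) w
      = ((pdt T q * w.1.1, pdt X q * w.1.1 + pdx X q * w.1.2), w.2) := by
  have e : φ =ᶠ[𝓝 ((q, u) : Space)] fun z => ((T z.1, X z.1), z.2) := by
    filter_upwards [(h.isOpen.prod isOpen_univ).mem_nhds
      (⟨hq, trivial⟩ : ((q, u) : Space) ∈ N ×ˢ (Set.univ : Set ℝ))] with y hy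
      using hφ y.1 hy.1 y.2
  have d1 : HasFDerivAt (fun z : Space => z.1) (ContinuousLinearMap.fst ℝ Base ℝ) (q, u) :=
    hasFDerivAt_fst
  have dT := (diffAt_of_smooth (h.smooth_T q hq)).hasFDerivAt
  have dX := (diffAt_of_smooth (h.smooth_X q hq)).hasFDerivAt
  have d := ((dT.comp (q, u) d1).prodMk (dX.comp (q, u) d1)).prodMk
    (hasFDerivAt_snd (𝕜 := ℝ) (p := ((q, u) : Space)))
  have e2 : fderiv ℝ φ (q, u) = _ := e.fderiv_eq.trans d.fderiv
  rw [e2]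
  obtain ⟨⟨a, b⟩, c⟩ := w
  change ((fderiv ℝ T q (a, b), fderiv ℝ X q (a, b)), c) = _
  rw [fderiv_base_apply, fderiv_base_apply, h.T_x q hq]
  simp

/-- Lie symmetries are mapped to Lie symmetries. -/
lemma IsBaseMap.exists_push (h : IsBaseMap N T X) (hN : N ⊆ E.dom)
    (hd : E'.dom = (fun q => (T q, X q)) '' N)
    (hI : ∀ q ∈ N, Intertwines E E' T X (fun _ => 1) (fun _ => 0) q)
    (hs : φ.source = N ×ˢ Set.univ) (ht : φ.target = E'.dom ×ˢ Set.univ)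
    (hφ : ∀ q ∈ N, ∀ u : ℝ, φ (q, u) = ((T q, X q), u)) {Q : VField} (hQ : Q ∈ invAlgebra E) :
    ∃ Q' ∈ invAlgebra E', ∀ z ∈ φ.source, fderiv ℝ φ z (Q z) = Q' (φ z) := by
  have hQ' : ∀ z ∈ φ.source, fderiv ℝ φ (φ.inv (φ z)) (Q (φ.inv (φ z))) = fderiv ℝ φ z (Q z) :=
    fun z hz => by
      have e : φ.inv (φ z) = z := φ.left_inv hz
      rw [e]
  have hsm : ContDiffOn ℝ ∞ (fun w => fderiv ℝ φ (φ.inv w) (Q (φ.inv w)))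
      (E'.dom ×ˢ Set.univ) := by
    rw [← ht]
    intro w hw
    have hz : φ.inv w ∈ φ.source := φ.map_target hw
    have hz' := hz
    rw [hs] at hz'
    exact (ContDiffAt.comp (g := fun z => fderiv ℝ φ z (Q z)) w
      (PointTransformation.contDiffAt_fderiv_apply hz (invAlgebra_smooth hQ (hN hz'.1)))
      (PointTransformation.contDiffAt (φ := φ.inv) hw)).contDiffWithinAt
  refine ⟨_, mem_invAlgebra_iff.2 ⟨hsm, ?_⟩, fun z hz => (hQ' z hz).symm⟩
  intro p' hp' g hg hholds
  have hp'' := hp'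
  rw [hd] at hp'
  obtain ⟨p, hp, rfl⟩ := hp'
  have hIp := hI p hp
  have hf : ContDiffAt ℝ ∞ (fun r => g (T r, X r)) p :=
    contDiffAt_comp_base hg hIp.smooth_T hIp.smooth_X
  have hN' : ∀ᶠ r in 𝓝 p, r ∈ N := h.isOpen.mem_nhds hp
  have h0 : E.HoldsAt (fun r => g (T r, X r)) p :=
    (hIp.holds_iff hf hg (Filter.Eventually.of_forall fun r => by simp)).2 hholds
  have key := crit_transform (hN hp) hp'' (hN'.mono hI) hf hg
    (Filter.Eventually.of_forall fun _ => rfl) (invAlgebra_smooth hQ (hN hp))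
    (hsm.contDiffAt ((E'.dom_open.prod isOpen_univ).mem_nhds ⟨hp'', trivial⟩))
    (hN'.mono fun r hr => by
      have hz : ((r, g (T r, X r)) : Space) ∈ φ.source := by rw [hs]; exact ⟨hr, trivial⟩
      rw [← hφ r hr, hQ' _ hz, h.fderiv_eq hφ hr]) ((E.holdsAt_iff _ _).1 h0)
  rw [hQ.2 p (hN hp) _ hf h0 |> (show crit E Q _ p = 0 from ·)] at key
  exact (mul_eq_zero.1 key.symm).resolve_left hIp.T_t

/-- Lie symmetries are images of Lie symmetries. -/
lemma IsBaseMap.exists_pull (h : IsBaseMap E.dom T X)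
    (hd : E'.dom = (fun q => (T q, X q)) '' E.dom)
    (hI : ∀ q ∈ E.dom, Intertwines E E' T X (fun _ => 1) (fun _ => 0) q)
    (hs : φ.source = E.dom ×ˢ Set.univ) (ht : φ.target = E'.dom ×ˢ Set.univ)
    (hφ : ∀ q ∈ E.dom, ∀ u : ℝ, φ (q, u) = ((T q, X q), u)) {Q' : VField}
    (hQ' : Q' ∈ invAlgebra E') :
    ∃ Q ∈ invAlgebra E, ∀ z ∈ φ.source, fderiv ℝ φ z (Q z) = Q' (φ z) := by
  have hpush : ∀ z ∈ φ.source, fderiv ℝ φ z (fderiv ℝ φ.inv (φ z) (Q' (φ z))) = Q' (φ z) :=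
    fun z hz => PointTransformation.fderiv_fderiv_inv hz _
  have hsm : ContDiffOn ℝ ∞ (fun z => fderiv ℝ φ.inv (φ z) (Q' (φ z))) (E.dom ×ˢ Set.univ) := by
    rw [← hs]
    intro z hz
    have hw : φ z ∈ φ.target := φ.map_source hz
    have hw' := hw
    rw [ht] at hw'
    exact (ContDiffAt.comp (g := fun w => fderiv ℝ φ.inv w (Q' w)) z
      (PointTransformation.contDiffAt_fderiv_apply (φ := φ.inv) hw (invAlgebra_smooth hQ' hw'.1))
      (PointTransformation.contDiffAt hz)).contDiffWithinAt
  obtain ⟨G, hG, ho, hGs⟩ := h.exists_inverse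
  refine ⟨_, mem_invAlgebra_iff.2 ⟨hsm, ?_⟩, hpush⟩
  intro p hp f hf hholds
  have hIp := hI p hp
  have hp' : (T p, X p) ∈ (fun q => (T q, X q)) '' E.dom := ⟨p, hp, rfl⟩
  have hp'' := hp'
  rw [← hd] at hp''
  have hg : ContDiffAt ℝ ∞ (fun r => f (G r)) (T p, X p) :=
    ContDiffAt.comp (g := f) _ (by rw [hG p hp]; exact hf) (hGs.contDiffAt (ho.mem_nhds hp'))
  have hN' : ∀ᶠ r in 𝓝 p, r ∈ E.dom := h.isOpen.mem_nhds hp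
  have hfg : ∀ᶠ r in 𝓝 p, f (G (T r, X r)) = f r := hN'.mono fun r hr => by rw [hG r hr]
  have h0 : E'.HoldsAt (fun r => f (G r)) (T p, X p) :=
    (hIp.holds_iff hf hg (hfg.mono fun r hr => by simp [hr])).1 hholds
  have key := crit_transform hp hp'' (hN'.mono hI) hf hg hfg
    (hsm.contDiffAt ((E.dom_open.prod isOpen_univ).mem_nhds ⟨hp, trivial⟩))
    (invAlgebra_smooth hQ' hp'')
    (hN'.mono fun r hr => by
      have hz : ((r, f r) : Space) ∈ φ.source := by rw [hs]; exact ⟨hr, trivial⟩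
      rw [← hφ r hr]
      exact (hpush _ hz).symm.trans (h.fderiv_eq hφ hr _ _)) ((E.holdsAt_iff _ _).1 hholds)
  have h1 : crit E' Q' (fun r => f (G r)) (T p, X p) = 0 := hQ'.2 _ hp'' _ hg h0
  rwa [h1, mul_zero] at key

/-- The family `F` identifies the maximal Lie invariance algebras. -/
lemma IsFImage.exists_conjugates (h : IsFImage E E') :
    ∃ (X : Base → ℝ) (φ : PointTransformation Space), IsBaseMap E.dom (fun q => q.1) X ∧
      φ.source = E.dom ×ˢ Set.univ ∧ φ.target = E'.dom ×ˢ Set.univ ∧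
      (∀ p ∈ E.dom, ∀ u : ℝ, φ (p, u) = ((p.1, X p), u)) ∧ Relates φ E E' ∧
      Conjugates φ E E' := by
  obtain ⟨X, φ, hB, -, hs, ht, hφ, hR, hd, hI⟩ := h.exists_map
  exact ⟨X, φ, hB, hs, ht, hφ, hR, hs.le, ht.le,
    fun Q hQ => hB.exists_push le_rfl hd hI hs ht hφ hQ,
    fun Q' hQ' => hB.exists_pull hd hI hs ht hφ hQ'⟩

lemma IsFImage.hasSymmetry_iff (h : IsFImage E E') : HasSymmetry E ↔ HasSymmetry E' := by
  obtain ⟨X, φ, -, hs, ht, -, -, hC⟩ := h.exists_conjugates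
  exact ⟨hC.hasSymmetry hs, hC.symm.hasSymmetry ht⟩

/-- Lie symmetries survive on balls in the target of a map of the `(t,x)`-plane. -/
lemma exists_hasSymmetry_of_intertwines {p : Base} (hp : p ∈ E.dom) (hp' : (T p, X p) ∈ E'.dom)
    (hI : ∀ᶠ q in 𝓝 p, Intertwines E E' T X (fun _ => 1) (fun _ => 0) q) (hE : HasSymmetry E)
    {V : Set Base} (hV : V ∈ 𝓝 p) :
    ∃ (r : ℝ) (hr : 0 < r) (hsub : Metric.ball (T p, X p) r ⊆ E'.dom),
      HasSymmetry (E'.restrictBall (T p, X p) r hr hsub) ∧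
      ∃ φ : PointTransformation Space, Relates φ E (E'.restrictBall (T p, X p) r hr hsub) ∧
        φ.source ⊆ V ×ˢ Set.univ ∧ φ.target = Metric.ball (T p, X p) r ×ˢ Set.univ := by
  obtain ⟨ρ, hρ, hB⟩ := exists_isBaseMap (T := T) (X := X) (q := p) (by
    filter_upwards [hI] with r h1
    exact ⟨h1.smooth_T, h1.smooth_X, h1.T_x.self_of_nhds, h1.T_t, h1.X_x⟩)
  obtain ⟨ρ', hρ', hb⟩ := exists_ball_of_eventually (hI.and
    ((hI.self_of_nhds.tendsto_base.eventually (p := fun r => r ∈ E'.dom)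
      (E'.dom_open.mem_nhds hp')).and
      ((show ∀ᶠ q in 𝓝 p, q ∈ E.dom from E.dom_open.mem_nhds hp).and
        (show ∀ᶠ q in 𝓝 p, q ∈ V from hV))))
  have hB' := hB.mono (N' := Metric.ball p (min ρ ρ')) Metric.isOpen_ball
    (Metric.ball_subset_ball (min_le_left _ _))
  have hb' : ∀ q ∈ Metric.ball p (min ρ ρ'), _ := fun q hq =>
    hb q (Metric.ball_subset_ball (min_le_right _ _) hq)
  have hpB : p ∈ Metric.ball p (min ρ ρ') := Metric.mem_ball_self (lt_min hρ hρ')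
  obtain ⟨-, -, ho, -⟩ := hB'.exists_inverse
  obtain ⟨r, hr, hball⟩ := exists_ball_of_eventually (ho.mem_nhds
    (Set.mem_image_of_mem (fun q : Base => (T q, X q)) hpB))
  have hsub : Metric.ball (T p, X p) r ⊆ E'.dom := fun w hw => by
    obtain ⟨q, hq, rfl⟩ := hball w hw
    exact (hb' q hq).2.1
  -- Taking the whole preimage of the small ball makes the target of the transformation equal to the
  -- full domain of `F`.
  set N : Set Base := Metric.ball p (min ρ ρ') ∩ (fun q => (T q, X q)) ⁻¹' Metric.ball (T p, X p) r
    with hN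
  have hNo : IsOpen N := ContinuousOn.isOpen_inter_preimage (fun q hq =>
    ((hB'.smooth_T q hq).continuousAt.prodMk (hB'.smooth_X q hq).continuousAt).continuousWithinAt)
    Metric.isOpen_ball Metric.isOpen_ball
  have hBN := hB'.mono hNo Set.inter_subset_left
  have him : Metric.ball (T p, X p) r = (fun q => (T q, X q)) '' N := by
    refine Set.Subset.antisymm (fun w hw => ?_) ?_
    · obtain ⟨q, hq, rfl⟩ := hball w hw
      exact ⟨q, ⟨hq, hw⟩, rfl⟩
    · rintro _ ⟨q, hq, rfl⟩
      exact hq.2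
  have hpN : p ∈ N := ⟨hpB, Metric.mem_ball_self hr⟩
  have hNE : N ⊆ E.dom := fun q hq => (hb' q hq.1).2.2.1
  set F := E'.restrictBall (T p, X p) r hr hsub with hF
  have hIF : ∀ q ∈ N, Intertwines E F T X (fun _ => 1) (fun _ => 0) q := fun q hq => by
    have := (hb' q hq.1).1
    exact ⟨this.1, this.2, this.3, this.4, this.5, this.6, this.7, this.8, this.9, this.10,
      this.11, this.12, this.13, this.14⟩
  obtain ⟨φ, hs, ht, hφ⟩ := hBN.exists_transformation
  have ht' : φ.target = F.dom ×ˢ Set.univ := by rw [ht, ← him]; rfl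
  refine ⟨r, hr, hsub, ?_, φ, hBN.relates hNE (fun q hq => hq.2) hIF hs ht hφ,
    by rw [hs]; exact Set.prod_mono (fun q hq => (hb' q hq.1).2.2.2) le_rfl, ht'⟩
  obtain ⟨Q, hQ, z, hz, hne⟩ := hE
  obtain ⟨Q', hQ', e⟩ := hBN.exists_push (E' := F) hNE him hIF hs ht' hφ hQ
  -- If the pushed symmetry vanished, the original one would vanish near `p`, hence everywhere.
  by_contra hcon
  refine hne (invAlgebra_unique_continuation hQ hp ?_ z.1 hz z.2)
  filter_upwards [hNo.mem_nhds hpN] with q hq u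
  have hz' : ((q, u) : Space) ∈ φ.source := by rw [hs]; exact ⟨hq, trivial⟩
  have hmem : φ (q, u) ∈ F.dom ×ˢ (Set.univ : Set ℝ) := by rw [← ht']; exact φ.map_source hz'
  have h0 : Q' (φ (q, u)) = 0 := by
    by_contra hne'
    exact hcon ⟨Q', hQ', _, hmem.1, hne'⟩
  rw [← PointTransformation.fderiv_inv_fderiv hz' (Q (q, u)), e _ hz', h0, map_zero]

end

/-! ### Separation of the regular and singular subclasses -/

section

variable {E E' F : Eqn} {V : Set Base} {φ : PointTransformation Space}

lemma Relates.of_restrictBall_left {p : Base} {r : ℝ} {hr : 0 < r} {hsub : Metric.ball p r ⊆ E.dom}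
    (h : Relates φ (E.restrictBall p r hr hsub) E') : Relates φ E E' :=
  ⟨fun _ hz => ⟨hsub (h.1 hz).1, trivial⟩, h.2.1, fun z hz => h.2.2 z hz⟩

lemma LocallyRelated.of_restrictBall_left {p : Base} {r : ℝ} {hr : 0 < r}
    {hsub : Metric.ball p r ⊆ E.dom} (h : LocallyRelated (E.restrictBall p r hr hsub) V E') :
    LocallyRelated E V E' := by
  obtain ⟨φ, hR, h1, h2⟩ := h
  exact ⟨φ, hR.of_restrictBall_left, h1, h2⟩

lemma splitting_eq_zero (hE : E ∈ classL0p) {p : Base} (hp : p ∈ E.dom) : splitting E p = 0 := by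
  have hC : ∀ v, ∀ q ∈ E.dom, dir v E.C q = 0 := fun v q hq => by
    have : E.C =ᶠ[𝓝 q] fun _ => (1 : ℝ) := by
      filter_upwards [E.dom_open.mem_nhds hq] with r hr using (hE r hr).2
    rw [dir_congr this, dir_const]
  have hx : ∀ q ∈ E.dom, E.A2 q * pdx E.C q / E.C q ^ 2 = 0 := fun q hq => by
    have : pdx E.C q = 0 := hC _ q hq
    rw [this, mul_zero, zero_div]
  refine dir_vanish_of_eventually ?_
  filter_upwards [E.dom_open.mem_nhds hp] with q hq
  have h1 : pdt E.C q = 0 := hC _ q hq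
  have h2 : pdx (fun r => E.A2 r * pdx E.C r / E.C r ^ 2) q = 0 := by
    refine dir_vanish_of_eventually ?_
    filter_upwards [E.dom_open.mem_nhds hq] with r hr using hx r hr
  rw [h1, h2, zero_div, mul_zero, sub_zero]

lemma continuousAt_splitting {p : Base} (hp : p ∈ E.dom) : ContinuousAt (splitting E) p := by
  have sD : ∀ q ∈ E.dom, ContDiffAt ℝ ∞ (fun r => E.A2 r * pdx E.C r / E.C r ^ 2) q := fun q hq =>
    ((E.contDiffAt_A2 hq).mul (contDiffAt_dir (E.contDiffAt_C hq))).div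
      ((E.contDiffAt_C hq).pow 2) (pow_ne_zero 2 (E.C_ne q hq))
  have h1 : ContDiffAt ℝ ∞ (fun q => pdt E.C q / E.C q
      - E.C q * pdx (fun r => E.A2 r * pdx E.C r / E.C r ^ 2) q) p :=
    ((contDiffAt_dir (E.contDiffAt_C hp)).div (E.contDiffAt_C hp) (E.C_ne p hp)).sub
      ((E.contDiffAt_C hp).mul (contDiffAt_dir (sD p hp)))
  exact (contDiffAt_dir (v := ((0, 1) : Base)) h1).continuousAt

/-- Equations of the regular and singular subclasses are not related to each other. -/
lemma LocallyRelated.notMem_classL0p (h : LocallyRelated E V E') (hE : E ∈ classL1) :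
    E' ∉ classL0p := by
  intro hE'
  -- The image by `F` satisfies `A1_xx ≠ 0`, which transformations between equations with `C = 1`
  -- preserve, while `A1` vanishes in `classL0p`.
  obtain ⟨F, hF⟩ := exists_isFImage E
  obtain ⟨X, ψ, -, hs, -, -, hR, -⟩ := hF.exists_conjugates
  have hF1 := (hF.mem_classL1_iff hE.1).1 hE
  obtain ⟨φ, hφ, ⟨z, hz⟩, -⟩ := h.precomp hR hs (V₁ := Set.univ) fun _ _ _ => trivial
  refine hφ.A1_xx_ne hF1 (fun p hp => (hE' p hp).2) hz ?_
  have hz' := (hφ.2.1 (φ.map_source hz)).1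
  have h0 : ∀ q ∈ E'.dom, pdx E'.A1 q = 0 := fun q hq => dir_vanish_of_eventually (by
    filter_upwards [E'.dom_open.mem_nhds hq] with r hr using (hE' r hr).1)
  exact dir_vanish_of_eventually (by filter_upwards [E'.dom_open.mem_nhds hz'] with q hq using h0 q hq)

/-- Equations with Lie symmetries in the singular subclass of `classL` are reduced to equations
with Lie symmetries in `classL0p`. -/
lemma exists_classL0p_of_splitting (hE : E ∈ classL) (hsym : HasSymmetry E) {p : Base}
    (hp : p ∈ E.dom) (h : ∀ᶠ q in 𝓝 p, splitting E q = 0) (hV : V ∈ 𝓝 p) :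
    ∃ E' ∈ classL0p, HasSymmetry E' ∧ ∃ φ : PointTransformation Space, Relates φ E E' ∧
      φ.source ⊆ V ×ˢ Set.univ ∧ φ.target = E'.dom ×ˢ Set.univ := by
  obtain ⟨F, hF⟩ := exists_isFImage E
  obtain ⟨X, φ, hB, hXx, hs, ht, hφ, hR, hd, hI⟩ := hF.exists_map
  have hX := fun q (hq : q ∈ E.dom) => A1_xx_of_intertwines hE hXx hd hI hq
  obtain ⟨r, hr, hb⟩ := exists_ball_of_eventually (h.and ((show ∀ᶠ q in 𝓝 p, q ∈ E.dom from
    E.dom_open.mem_nhds hp).and (show ∀ᶠ q in 𝓝 p, q ∈ V from hV)))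
  obtain ⟨-, -, ho, -⟩ := (hB.mono Metric.isOpen_ball fun q hq => (hb q hq).2.1).exists_inverse
  have hp' : (p.1, X p) ∈ (fun q => (q.1, X q)) '' Metric.ball p r :=
    Set.mem_image_of_mem (fun q : Base => (q.1, X q)) (Metric.mem_ball_self hr)
  have hpF : (p.1, X p) ∈ F.dom := by
    rw [hd]; exact Set.mem_image_of_mem (fun q : Base => (q.1, X q)) hp
  -- In the image by `F`, `A1_xx` equals `C` times the splitting expression, so it vanishes near the
  -- image of `p`.
  obtain ⟨E', hE', T, Y, hTY, hI'⟩ := exists_classL0p_of_A1_xx hF.mem_classLhat hpF (by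
      filter_upwards [ho.mem_nhds hp']
      rintro _ ⟨q, hq, rfl⟩
      beta_reduce
      rw [hX q (hb q hq).2.1, (hb q hq).1, mul_zero])
  obtain ⟨r', hr', hsub, hsym', ψ, hψ, hψs, hψt⟩ := exists_hasSymmetry_of_intertwines hpF hTY hI'
    (hF.hasSymmetry_iff.1 hsym) (ho.mem_nhds hp')
  refine ⟨E'.restrictBall _ r' hr' hsub, fun q hq => hE' q (hsub hq), hsym', φ.comp ψ,
    hR.trans hψ, fun w hw => ⟨?_, trivial⟩, ?_⟩
  · obtain ⟨h1, h2⟩ := PointTransformation.mem_comp_source.1 hw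
    obtain ⟨q, hq, he⟩ := (hψs h2).1
    have hqE := (hb q hq).2.1
    rw [hs] at h1
    have h3 : φ (w.1, w.2) = ((w.1.1, X w.1), w.2) := hφ w.1 h1.1 w.2
    have : q = w.1 := hB.injOn hqE h1.1 (he.trans (congrArg Prod.fst h3))
    rw [← this]
    exact (hb q hq).2.2
  · ext w
    rw [PointTransformation.mem_comp_target, hψt, ht]
    refine ⟨fun h1 => h1.1, fun h1 => ⟨h1, ?_⟩⟩
    exact hψ.1 (ψ.map_target (by rw [hψt]; exact h1))

end

/-! ### Complete lists and their correspondence -/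

/-- The notion of a complete list in terms of nonvanishing Lie symmetries. -/
structure CompleteList {ι : Type*} (K : Set Eqn) (R : ι → Set Eqn) : Prop where
  nonempty : ∀ i, (R i).Nonempty
  extension : ∀ i, ∀ E ∈ R i, E ∈ K ∧ HasSymmetry E
  similar : ∀ i, ∀ E ∈ R i, ∀ E' ∈ R i, SimilarAlgebras E E'
  inequivalent : ∀ i j, i ≠ j → ∀ E ∈ R i, ∀ E' ∈ R j, ¬ LocallyRelated E Set.univ E'
  complete : ∀ E ∈ K, HasSymmetry E → ∀ V : Set Base, IsOpen V → (V ∩ E.dom).Nonempty →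
    ∃ i, ∃ E' ∈ R i, LocallyRelated E V E'

/-- The kernel algebras and the kind of equivalence, which vary with the class, are traded for
nonzero symmetries and local relatedness. Lists for different classes then become comparable. -/
lemma isCompleteList_iff {ι : Type*} {K : Set Eqn} {Equiv : Eqn → Set Base → Eqn → Prop}
    (hext : ∀ {E}, IsExtension K E ↔ E ∈ K ∧ HasSymmetry E)
    (hequiv : ∀ {E V E'}, IsOpen V →
      (Equiv E V E' ↔ E ∈ K ∧ E' ∈ K ∧ LocallyRelated E V E')) {R : ι → Set Eqn} :
    IsCompleteList K Equiv R ↔ CompleteList K R := by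
  constructor
  · intro h
    have hK : ∀ i, ∀ E ∈ R i, E ∈ K ∧ HasSymmetry E := fun i E hE => hext.1 (h.extension i E hE)
    refine ⟨h.nonempty, hK, h.similar, fun i j hij E hE E' hE' hr => ?_, fun E hE hs V hV hne => ?_⟩
    · exact h.inequivalent i j hij E hE E' hE'
        ((hequiv isOpen_univ).2 ⟨(hK i E hE).1, (hK j E' hE').1, hr⟩)
    · obtain ⟨i, E', hE', he⟩ := h.complete E (hext.2 ⟨hE, hs⟩) V hV hne
      exact ⟨i, E', hE', ((hequiv hV).1 he).2.2⟩
  · intro h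
    refine ⟨h.nonempty, fun i E hE => hext.2 (h.extension i E hE), h.similar,
      fun i j hij E hE E' hE' he => ?_, fun E hE V hV hne => ?_⟩
    · exact h.inequivalent i j hij E hE E' hE' ((hequiv isOpen_univ).1 he).2.2
    · obtain ⟨h1, h2⟩ := hext.1 hE
      obtain ⟨i, E', hE', hr⟩ := h.complete E h1 h2 V hV hne
      exact ⟨i, E', hE', (hequiv hV).2 ⟨h1, (h.extension i E' hE').1, hr⟩⟩

lemma isCompleteList_groupoid_iff {ι : Type*} {K : Set Eqn}
    (hext : ∀ {E}, IsExtension K E ↔ E ∈ K ∧ HasSymmetry E) {R : ι → Set Eqn} :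
    IsCompleteList K (GroupoidEquivOn K) R ↔ CompleteList K R :=
  isCompleteList_iff hext fun _ => groupoidEquivOn_iff

/-- Normalization enters here: it replaces an admissible transformation by an element of the
equivalence group. The converse uses that arbitrary elements determine the equation within the
class. -/
lemma isCompleteList_classL0p_iff {ι : Type*} {R : ι → Set Eqn} :
    IsCompleteList classL0p (GroupEquivOn classL0p arbL0p) R ↔ CompleteList classL0p R :=
  isCompleteList_iff isExtension_classL0p fun hV => by
    rw [← groupoidEquivOn_iff]
    exact ⟨fun h => h.groupoidEquivOn (fun E hE E' hE' p hp hp' he => ⟨he,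
        (hE p hp).1.trans (hE' p hp').1.symm, (hE p hp).2.trans (hE' p hp').2.symm⟩)
      (fun E _ p hp => (E.contDiffAt_A2 hp).continuousAt) hV,
      fun h => h.groupEquivOn isNormalized_classL0p⟩

lemma isCompleteList_classL1hat_iff {ι : Type*} {R : ι → Set Eqn} :
    IsCompleteList classL1hat (GroupEquivOn classL1hat arbL1hat) R ↔ CompleteList classL1hat R :=
  isCompleteList_iff isExtension_classL1hat fun hV => by
    rw [← groupoidEquivOn_iff]
    exact ⟨fun h => h.groupoidEquivOn (fun E hE E' hE' p hp hp' he => ⟨congrArg Prod.snd he,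
        congrArg Prod.fst he, (hE.1 p hp).trans (hE'.1 p hp').symm⟩)
      (fun E _ p hp => (E.contDiffAt_A1 hp).continuousAt.prodMk (E.contDiffAt_A2 hp).continuousAt)
      hV, fun h => h.groupEquivOn isNormalized_classL1hat⟩

/-- The lists for `classL` are disjoint unions of lists for `classL0p` and `classL1`. -/
lemma completeList_sum_iff {ι₀ ι₁ : Type*} {R₀ : ι₀ → Set Eqn} {R₁ : ι₁ → Set Eqn}
    (h₀ : ∀ i, R₀ i ⊆ classL0p) (h₁ : ∀ j, R₁ j ⊆ classL1) :
    CompleteList classL (Sum.elim R₀ R₁) ↔ CompleteList classL0p R₀ ∧ CompleteList classL1 R₁ := by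
  have hL0 : classL0p ⊆ classL := fun E hE p hp => (hE p hp).1
  constructor
  · intro h
    refine ⟨⟨fun i => h.nonempty (.inl i),
      fun i E hE => ⟨h₀ i hE, (h.extension (.inl i) E hE).2⟩, fun i => h.similar (.inl i),
      fun i j hij => h.inequivalent (.inl i) (.inl j) (by simpa using hij),
      fun E hE hs V hV hne => ?_⟩, ⟨fun i => h.nonempty (.inr i),
      fun i E hE => ⟨h₁ i hE, (h.extension (.inr i) E hE).2⟩, fun i => h.similar (.inr i),
      fun i j hij => h.inequivalent (.inr i) (.inr j) (by simpa using hij),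
      fun E hE hs V hV hne => ?_⟩⟩
    · obtain ⟨i | j, E', hE', hr⟩ := h.complete E (hL0 hE) hs V hV hne
      · exact ⟨i, E', hE', hr⟩
      · exact absurd hE (hr.symm.notMem_classL0p (h₁ j hE'))
    · obtain ⟨i | j, E', hE', hr⟩ := h.complete E hE.1 hs V hV hne
      · exact absurd (h₀ i hE') (hr.notMem_classL0p hE)
      · exact ⟨j, E', hE', hr⟩
  · rintro ⟨k₀, k₁⟩
    refine ⟨?_, ?_, ?_, ?_, fun E hE hs V hV hne => ?_⟩
    · rintro (i | j)
      exacts [k₀.nonempty i, k₁.nonempty j]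
    · rintro (i | j) E hE
      exacts [⟨hL0 (h₀ i hE), (k₀.extension i E hE).2⟩, ⟨(h₁ j hE).1, (k₁.extension j E hE).2⟩]
    · rintro (i | j)
      exacts [k₀.similar i, k₁.similar j]
    · rintro (i | j) (i' | j') hij E hE E' hE' hr
      · exact k₀.inequivalent i i' (fun e => hij (e ▸ rfl)) E hE E' hE' hr
      · exact hr.symm.notMem_classL0p (h₁ j' hE') (h₀ i hE)
      · exact hr.notMem_classL0p (h₁ j hE) (h₀ i' hE')
      · exact k₁.inequivalent j j' (fun e => hij (e ▸ rfl)) E hE E' hE' hr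
    -- Equivalence is needed only somewhere over `V`. A single regular point, with a ball around it,
    -- leads to `R₁`; in its absence every point of `V` is singular, which leads to `R₀`.
    · by_cases hsp : ∃ p ∈ V ∩ E.dom, splitting E p ≠ 0
      · obtain ⟨p, ⟨hpV, hp⟩, hne'⟩ := hsp
        obtain ⟨r, hr, hb⟩ := exists_ball_of_eventually
          (((continuousAt_splitting hp).eventually (isOpen_ne.mem_nhds hne')).and
          ((show ∀ᶠ q in 𝓝 p, q ∈ E.dom from E.dom_open.mem_nhds hp).and
            (show ∀ᶠ q in 𝓝 p, q ∈ V from hV.mem_nhds hpV)))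
        have hsub : Metric.ball p r ⊆ E.dom := fun q hq => (hb q hq).2.1
        obtain ⟨j, E', hE', hrel⟩ := k₁.complete (E.restrictBall p r hr hsub)
          ⟨fun q hq => hE q (hsub hq), fun q hq => (hb q hq).1⟩ (hs.restrictBall hr hsub) V hV
          ⟨p, hpV, Metric.mem_ball_self hr⟩
        exact ⟨.inr j, E', hE', hrel.of_restrictBall_left⟩
      · push Not at hsp
        obtain ⟨p, hpV, hp⟩ := hne
        obtain ⟨F, hF, hsF, φ, hR, hφs, hφt⟩ := exists_classL0p_of_splitting hE hs hp
          (Filter.mem_of_superset ((hV.inter E.dom_open).mem_nhds ⟨hpV, hp⟩) hsp)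
          (hV.mem_nhds hpV)
        obtain ⟨i, E', hE', hrel⟩ := k₀.complete F hF hsF Set.univ isOpen_univ
          (by rw [Set.univ_inter]; exact F.dom_nonempty)
        exact ⟨.inl i, E', hE', hrel.precomp hR.symm hφt fun z hz _ =>
          (hφs (φ.map_target hz)).1⟩

/-- Because `φ` reaches all of `E` and `ψ` starts from all of `E'`, the composition with the given
similarity stays nonempty. -/
lemma SimilarAlgebras.of_conjugates {E E' F F' : Eqn} {φ ψ : PointTransformation Space}
    (h : SimilarAlgebras E E') (hφ : Conjugates φ F E) (hφt : φ.target = E.dom ×ˢ Set.univ)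
    (hψ : Conjugates ψ E' F') (hψs : ψ.source = E'.dom ×ˢ Set.univ) : SimilarAlgebras F F' := by
  obtain ⟨χ, ⟨z, hz⟩, hχ⟩ := h
  have h1 : Conjugates ((φ.comp χ).comp ψ) F F' := (hφ.trans hχ).trans hψ
  have hz1 : z ∈ φ.target := by
    rw [hφt]; exact hχ.1 hz
  have hz2 : φ (φ.inv z) = z := φ.right_inv hz1
  refine ⟨(φ.comp χ).comp ψ, ⟨φ.inv z, PointTransformation.mem_comp_source.2
    ⟨PointTransformation.mem_comp_source.2 ⟨φ.map_target hz1, by rw [hz2]; exact hz⟩, ?_⟩⟩, h1⟩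
  change χ (φ (φ.inv z)) ∈ ψ.source
  rw [hz2, hψs]
  exact hχ.2.1 (χ.map_source hz)

section

variable {E E' F F' : Eqn} {V : Set Base}

lemma LocallyRelated.of_isFImage (h : LocallyRelated F Set.univ F') (hE : IsFImage E F)
    (hE' : IsFImage E' F') : LocallyRelated E Set.univ E' := by
  obtain ⟨-, φ, -, -, ht, -, hR, -⟩ := hE.exists_conjugates
  obtain ⟨-, φ', -, -, ht', -, hR', -⟩ := hE'.exists_conjugates
  exact (h.postcomp hR'.symm ht').precomp hR.symm ht fun _ _ _ => trivial

lemma LocallyRelated.isFImage (h : LocallyRelated E Set.univ E') (hE : IsFImage E F)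
    (hE' : IsFImage E' F') : LocallyRelated F Set.univ F' := by
  obtain ⟨-, φ, -, hs, -, -, hR, -⟩ := hE.exists_conjugates
  obtain ⟨-, φ', -, hs', -, -, hR', -⟩ := hE'.exists_conjugates
  exact (h.postcomp hR' hs').precomp hR hs fun _ _ _ => trivial

lemma SimilarAlgebras.isFImage (h : SimilarAlgebras E E') (hE : IsFImage E F)
    (hE' : IsFImage E' F') : SimilarAlgebras F F' := by
  obtain ⟨-, φ, -, hs, -, -, -, hC⟩ := hE.exists_conjugates
  obtain ⟨-, φ', -, hs', -, -, -, hC'⟩ := hE'.exists_conjugates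
  exact h.of_conjugates hC.symm hs hC' hs'

lemma SimilarAlgebras.of_isFImage (h : SimilarAlgebras F F') (hE : IsFImage E F)
    (hE' : IsFImage E' F') : SimilarAlgebras E E' := by
  obtain ⟨-, φ, -, -, ht, -, -, hC⟩ := hE.exists_conjugates
  obtain ⟨-, φ', -, -, ht', -, -, hC'⟩ := hE'.exists_conjugates
  exact h.of_conjugates hC ht hC'.symm ht'

end

/-- The complete lists for `classL1` and `classL1hat` correspond to each other. -/
lemma completeList_iff_of_isFPreimage {ι : Type*} {R R' : ι → Set Eqn} (hR : ∀ i, R i ⊆ classL1)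
    (hF : IsFPreimage R R') : CompleteList classL1 R ↔ CompleteList classL1hat R' := by
  constructor
  · intro h
    refine ⟨fun i => ?_, fun i E' hE' => ?_, fun i E₁' h₁ E₂' h₂ => ?_,
      fun i j hij E₁' h₁ E₂' h₂ hr => ?_, fun E' hE' hs V hV ⟨p, hpV, hp⟩ => ?_⟩
    · obtain ⟨E, hE⟩ := h.nonempty i
      obtain ⟨E', hE', -⟩ := (hF i).1 E hE
      exact ⟨E', hE'⟩
    · obtain ⟨E, hE, hEE'⟩ := (hF i).2 E' hE'
      exact ⟨(hEE'.mem_classL1_iff (hR i hE).1).1 (hR i hE),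
        hEE'.hasSymmetry_iff.1 (h.extension i E hE).2⟩
    · obtain ⟨E₁, k₁, e₁⟩ := (hF i).2 E₁' h₁
      obtain ⟨E₂, k₂, e₂⟩ := (hF i).2 E₂' h₂
      exact (h.similar i E₁ k₁ E₂ k₂).isFImage e₁ e₂
    · obtain ⟨E₁, k₁, e₁⟩ := (hF i).2 E₁' h₁
      obtain ⟨E₂, k₂, e₂⟩ := (hF j).2 E₂' h₂
      exact h.inequivalent i j hij E₁ k₁ E₂ k₂ (hr.of_isFImage e₁ e₂)
    -- Preimages exist only locally, so `E'` is first restricted to a ball inside `V`; its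
    -- symmetries survive the restriction.
    · obtain ⟨E, hE, r, hr, hsub, hball, hEE'⟩ := exists_preimage hE'.1 hp (hV.mem_nhds hpV)
      have hE1 : E ∈ classL1 := (hEE'.mem_classL1_iff hE).2
        ⟨fun q hq => hE'.1 q (hsub hq), fun q hq => hE'.2 q (hsub hq)⟩
      obtain ⟨i, E₁, k₁, hrel⟩ := h.complete E hE1
        (hEE'.hasSymmetry_iff.2 (hs.restrictBall hr hsub)) Set.univ isOpen_univ
        (by rw [Set.univ_inter]; exact E.dom_nonempty)
      obtain ⟨E₁', k₁', e₁⟩ := (hF i).1 E₁ k₁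
      obtain ⟨-, φ, -, hφs, hφt, -, hφ, -⟩ := hEE'.exists_conjugates
      obtain ⟨-, ψ, -, hψs, -, -, hψ, -⟩ := e₁.exists_conjugates
      refine ⟨i, E₁', k₁', ((hrel.postcomp hψ hψs).precomp (V₁ := V) hφ hφs
        fun z hz _ => hball ?_).of_restrictBall_left⟩
      have := φ.map_source hz
      rw [hφt] at this
      exact this.1
  · intro h
    refine ⟨fun i => ?_, fun i E hE => ?_, fun i E₁ k₁ E₂ k₂ => ?_,
      fun i j hij E₁ k₁ E₂ k₂ hr => ?_, fun E hE hs V hV ⟨p, hpV, hp⟩ => ?_⟩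
    · obtain ⟨E', hE'⟩ := h.nonempty i
      obtain ⟨E, hE, -⟩ := (hF i).2 E' hE'
      exact ⟨E, hE⟩
    · obtain ⟨E', hE', hEE'⟩ := (hF i).1 E hE
      exact ⟨hR i hE, hEE'.hasSymmetry_iff.2 (h.extension i E' hE').2⟩
    · obtain ⟨E₁', h₁, e₁⟩ := (hF i).1 E₁ k₁
      obtain ⟨E₂', h₂, e₂⟩ := (hF i).1 E₂ k₂
      exact (h.similar i E₁' h₁ E₂' h₂).of_isFImage e₁ e₂
    · obtain ⟨E₁', h₁, e₁⟩ := (hF i).1 E₁ k₁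
      obtain ⟨E₂', h₂, e₂⟩ := (hF j).1 E₂ k₂
      exact h.inequivalent i j hij E₁' h₁ E₂' h₂ (hr.isFImage e₁ e₂)
    · obtain ⟨E', hEE'⟩ := exists_isFImage E
      obtain ⟨X, φ, hB, hφs, hφt, hφ, hφR, -⟩ := hEE'.exists_conjugates
      have hBV := hB.mono (hV.inter E.dom_open) Set.inter_subset_right
      obtain ⟨-, -, ho, -⟩ := hBV.exists_inverse
      have himg : ∀ q ∈ E.dom, φ (q, 0) ∈ E'.dom ×ˢ (Set.univ : Set ℝ) := fun q hq => by
        rw [← hφt]; exact φ.map_source (by rw [hφs]; exact ⟨hq, trivial⟩)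
      -- Completeness is applied over the image of `V ∩ E.dom`, so that the pulled-back
      -- transformation has its source over `V`.
      obtain ⟨i, E₁', k₁', hrel⟩ := h.complete E' ((hEE'.mem_classL1_iff hE.1).1 hE)
        (hEE'.hasSymmetry_iff.1 hs) _ ho ⟨(p.1, X p), ⟨p, ⟨hpV, hp⟩, rfl⟩, by
          have := himg p hp
          rw [hφ p hp] at this
          exact this.1⟩
      obtain ⟨E₁, k₁, e₁⟩ := (hF i).2 E₁' k₁'
      obtain ⟨-, ψ, -, -, hψt, -, hψ, -⟩ := e₁.exists_conjugates
      refine ⟨i, E₁, k₁, (hrel.postcomp hψ.symm hψt).precomp hφR.symm hφt ?_⟩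
      rintro w hw ⟨q, hq, he⟩
      have e : w = φ (q, w.2) := by
        rw [hφ q hq.2]; exact Prod.ext he.symm rfl
      have h2 : φ.inv (φ (q, w.2)) = (q, w.2) := φ.left_inv (by rw [hφs]; exact ⟨hq.2, trivial⟩)
      rw [e, h2]
      exact hq.1

end VarBurgers

end

/-! ### The theorem -/

theorem mainTheorem3 :
    -- the classes up to whose equivalence groups the lists are given are normalized
    (IsNormalized classL0p arbL0p ∧ IsNormalized classL1hat arbL1hat) ∧
    -- the complete list for the whole class is the disjoint union of two complete lists
    (∀ {ι₀ : Type*} {ι₁ : Type*} (R₀ : ι₀ → Set Eqn) (R₁ : ι₁ → Set Eqn),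
      (∀ i, R₀ i ⊆ classL0p) → (∀ j, R₁ j ⊆ classL1) →
      ((∀ i j, Disjoint (R₀ i) (R₁ j)) ∧
        (IsCompleteList classL (GroupoidEquivOn classL) (Sum.elim R₀ R₁) ↔
          IsCompleteList classL0p (GroupEquivOn classL0p arbL0p) R₀ ∧
          IsCompleteList classL1 (GroupoidEquivOn classL1) R₁))) ∧
    -- the list for the regular subclass is necessarily the preimage of a complete list
    (∀ {ι : Type*} (R : ι → Set Eqn), IsCompleteList classL1 (GroupoidEquivOn classL1) R →
      ∃ R' : ι → Set Eqn, IsFPreimage R R' ∧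
        IsCompleteList classL1hat (GroupEquivOn classL1hat arbL1hat) R') ∧
    (∀ {ι : Type*} (R R' : ι → Set Eqn), (∀ i, R i ⊆ classL1) → IsFPreimage R R' →
      (IsCompleteList classL1 (GroupoidEquivOn classL1) R ↔
        IsCompleteList classL1hat (GroupEquivOn classL1hat arbL1hat) R')) ∧
    -- the family of point transformations maps the class onto the imaged class, and the regular
    -- subclass is the preimage of the imaged regular subclass
    (∀ E ∈ classL, (∃ E', IsFImage E E') ∧
      ∀ E', IsFImage E E' → E' ∈ classLhat ∧ (E ∈ classL1 ↔ E' ∈ classL1hat)) ∧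
    (∀ E' ∈ classLhat, ∀ p ∈ E'.dom, ∃ E ∈ classL, ∃ E'' : Eqn,
      E''.IsRestrictionOf E' ∧ p ∈ E''.dom ∧ IsFImage E E'') := by
  refine ⟨⟨isNormalized_classL0p, isNormalized_classL1hat⟩, fun R₀ R₁ h₀ h₁ => ⟨fun i j => ?_, ?_⟩,
    fun R hR => ?_, fun R R' hR hF => ?_, fun E hE => ⟨exists_isFImage E, fun E' h =>
      ⟨h.mem_classLhat, h.mem_classL1_iff hE⟩⟩, fun E' hE' p hp => ?_⟩
  · refine Set.disjoint_left.2 fun E hE hE' => ?_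
    obtain ⟨p, hp⟩ := E.dom_nonempty
    exact (h₁ j hE').2 p hp (splitting_eq_zero (h₀ i hE) hp)
  · rw [isCompleteList_groupoid_iff isExtension_classL, isCompleteList_classL0p_iff,
      isCompleteList_groupoid_iff isExtension_classL1]
    exact completeList_sum_iff h₀ h₁
  · rw [isCompleteList_groupoid_iff isExtension_classL1] at hR
    have hsub : ∀ i, R i ⊆ classL1 := fun i E hE => (hR.extension i E hE).1
    -- Each case of the new list consists of all images of the equations of the given case; this
    -- makes both halves of the preimage condition immediate.
    have hF : IsFPreimage R fun i => {E' | ∃ E ∈ R i, IsFImage E E'} := fun i =>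
      ⟨fun E hE => (exists_isFImage E).imp fun E' h => ⟨⟨E, hE, h⟩, h⟩, fun E' h => h⟩
    exact ⟨_, hF, isCompleteList_classL1hat_iff.2
      ((completeList_iff_of_isFPreimage hsub hF).1 hR)⟩
  · rw [isCompleteList_groupoid_iff isExtension_classL1, isCompleteList_classL1hat_iff]
    exact completeList_iff_of_isFPreimage hR hF
  · obtain ⟨E, hE, r, hr, hsub, -, h⟩ := exists_preimage hE' hp Filter.univ_mem
    exact ⟨E, hE, E'.restrictBall p r hr hsub, ⟨hsub, fun _ _ => rfl, fun _ _ => rfl, fun _ _ => rfl⟩,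
      Metric.mem_ball_self hr, h⟩
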